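/- Notation. Write vectors of $\mathbb R^{10}$ as $(a,x,y',c)$ with $a,c\in\mathbb R$, $x,y'\in\mathbb R^4$, and let $Spin(5,5)$ be the real spin group of the quadratic form $ac+x\cdot y'$, with covering map $\pi$ to $SO(5,5)$. Let $\Gamma=Spin(5,5,\mathbb Z)$ be the subgroup of elements $\gamma$ with $\pi(\gamma)\in GL(10,\mathbb Z)$, and $P=P_{\alpha_1}$ the maximal parabolic subgroup of those $p$ for which $\pi(p)$ has bottom row $(0,\dots,0,*)$. With $\omega_{\alpha_1}$ the fundamental weight of the vector node and $H$ the logarithm of the Iwasawa torus component, $e^{\omega_{\alpha_1}(H(g))}$ is the inverse of the Euclidean norm of the bottom row of $\pi(g)$. Put $$E^{Spin(5,5)}_{\alpha_1;s}(g)=\sum_{\gamma\in(P\cap\Gamma)\backslash\Gamma}e^{2s\,\omega_{\alpha_1}(H(\gamma g))}$$ for $\Re s$ large, and by meromorphic continuation for all $s\in\mathbb C$. Likewise $2\zeta(2s)E^{SL(2)}_s(\tau)=\sum_{(m,n)\in\mathbb Z^2\setminus 0}\tau_2^s|n\tau+m|^{-2s}$ for $\Re s>1$, continued meromorphically. Let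 $\xi(s)=\pi^{-s/2}\Gamma(s/2)\zeta(s)$ and $\sigma_a(n)=\sum_{d\mid n}d^a$. For $Q_1,Q_2\in\mathbb R^4$ let $u(Q_1,Q_2)\in Spin(5,5)$ be the element of the unipotent radical of $P$ whose image under $\pi$ has first row $(1,Q_1,Q_2,-Q_1\cdot Q_2)$, last column $(-Q_1\cdot Q_2,-Q_2,-Q_1,1)^t$, and is otherwise the identity matrix. Let $y_6>0$, let $e_4$ be a real $4\times4$ matrix with $\det e_4>0$, let $B$ be a real antisymmetric $4\times 4$ matrix, and let $h\in Spin(5,5)$ be an element with $\pi(h)=\mathrm{diag}\big(y_6^{-1/2},h_4,y_6^{1/2}\big)$, where $h_4=\begin{pmatrix}I&B\\0&I\end{pmatrix}\begin{pmatrix}e_4&0\\0&(e_4^t)^{-1}\end{pmatrix}$. For row vectors $M,N\in\mathbb Z^4$ with $N\neq0$ put $N_1=\begin{bmatrix}M\\N\end{bmatrix}$, $\gcd(N_1)$ the gcd of its eight entries, $$F_s(N_1)=\int_{[0,1]^8}E^{Spin(5,5)}_{\alpha_1;s}\big(u(Q_1,Q_2)h\big)\,e^{-2\pi i(M\cdot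 Q_1+N\cdot Q_2)}\,dQ_1\,dQ_2 ,$$ and, with $G_4=e_4e_4^t$, $\sqrt2\,p_L=(M+N(B-G_4))(e_4^t)^{-1}$ and $\sqrt2\,p_R=(M+N(B+G_4))(e_4^t)^{-1}$. Theorem. The series for $E^{Spin(5,5)}_{\alpha_1;s}(u(Q_1,Q_2)h)$ converge absolutely for $\Re s>5$, they and $E^{SL(2)}_s$ continue meromorphically to $\mathbb C$, and the following holds. (a) As an identity of meromorphic functions of $s$ (for all $s$ outside a closed discrete set, which contains neither $3/2$ nor any $s$ with $\Re s>5$, and outside which both Eisenstein series involved are holomorphic and all integrals converge absolutely), $$F_s(N_1)=\frac{1}{\xi(2s)\,y_6^{1/2}}\sum_{p\mid\gcd(N_1)}\int_0^\infty d\tau_2\;e^{-\pi\frac{p^2}{\tau_2y_6}-\pi\frac{\tau_2}{p^2}(p_L^2+p_R^2)}\int_{-1/2}^{1/2}d\tau_1\;E^{SL(2)}_{s-\frac32}(\tau_1+i\tau_2)\,e^{i\pi\tau_1\frac{p_L^2-p_R^2}{p^2}} .$$ (b) At $s=3/2$ the coefficient $F_{3/2}(N_1)$ is nonzero if and only if $p_L^2=p_R^2$,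 and $$2\zeta(3)\,F_{3/2}(N_1)=\frac{4\sqrt2\,\pi\,\sigma_2(\gcd(N_1))}{y_6\sqrt{p_L^2}}\,K_1\!\big(2\pi y_6^{-1/2}\sqrt{2p_L^2}\big)\,\delta_{p_L^2=p_R^2}.$$ (c) If $p_L^2\neq p_R^2$, then $$\lim_{s\to5/2}\zeta(5)\,F_s(N_1)=\frac{16\pi}{y_6}\sum_{p\mid\gcd(N_1)}p^2\,\sigma_{-1}\!\Big(\frac{|p_L^2-p_R^2|}{2p^2}\Big)\,\frac{K_1\big(2\pi y_6^{-1/2}\sqrt{p_L^2+p_R^2+|p_L^2-p_R^2|}\big)}{\sqrt{p_L^2+p_R^2+|p_L^2-p_R^2|}} .$$ -/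

import Mathlib

open scoped Matrix

noncomputable section

/-! ### Meromorphic continuation -/

/-- `F` is the meromorphic continuation to `ℂ` of the function `f`, given on the half plane
`σ < Re s`.  Normal form means: `F` takes its analytic value wherever its singularity is removable,
and the value `0` at its poles; so there is at most one such `F`. -/
def IsMeroCont (f : ℂ → ℂ) (σ : ℝ) (F : ℂ → ℂ) : Prop :=
  MeromorphicNFOn F Set.univ ∧ ∀ s : ℂ, σ < s.re → F s = f s

open scoped Classical in
/-- The meromorphic continuation of `f` from the half plane `σ < Re s` (`0` if there is none). -/
def meroCont (f : ℂ → ℂ) (σ : ℝ) : ℂ → ℂ :=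
  if h : ∃ F, IsMeroCont f σ F then h.choose else 0

/-! ### The `SL(2)` Eisenstein series and special functions -/

/-- `E^{SL(2)}_s(z)` for `Re s > 1`, from
`2 ζ(2s) E_s(z) = ∑_{(m,n) ≠ (0,0)} (Im z)^s / |n z + m|^{2s}`. -/
def eisSL2Series (s z : ℂ) : ℂ :=
  (2 * riemannZeta (2 * s))⁻¹ *
    ∑' p : {p : ℤ × ℤ // p ≠ 0},
      ((z.im : ℝ) : ℂ) ^ s / ((‖(p.1.2 : ℂ) * z + (p.1.1 : ℂ)‖ : ℝ) : ℂ) ^ (2 * s)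

/-- The non-holomorphic Eisenstein series `E^{SL(2)}_s(z)`, continued to all `s`. -/
def eisSL2 (s z : ℂ) : ℂ := meroCont (fun w => eisSL2Series w z) 1 s

/-- The modified Bessel function of the second kind, `K_ν(x) = ∫_0^∞ e^{-x cosh t} cosh(ν t) dt`. -/
def besselK (ν x : ℝ) : ℝ :=
  ∫ t in Set.Ioi (0 : ℝ), Real.exp (-x * Real.cosh t) * Real.cosh (ν * t)

/-- The divisor sum `σ_a(n) = ∑_{d ∣ n} d^a`. -/
def divisorSum (a : ℤ) (n : ℕ) : ℝ := ∑ d ∈ n.divisors, (d : ℝ) ^ a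

/-! ### The group `Spin(5,5)` -/

/-- Index set of the coordinates `(a, x, y, c)` of `ℝ^{10} = ℝ ⊕ ℝ^4 ⊕ ℝ^4 ⊕ ℝ`. -/
abbrev Ix : Type := Unit ⊕ ((Fin 4 ⊕ Fin 4) ⊕ Unit)

/-- The vectors of `ℝ^{10}`. -/
abbrev V10 : Type := Ix → ℝ

/-- the index of the coordinate `a` -/
abbrev ixA : Ix := Sum.inl ()
/-- the index of the coordinate `x i` -/
abbrev ixX (i : Fin 4) : Ix := Sum.inr (Sum.inl (Sum.inl i))
/-- the index of the coordinate `y i` -/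
abbrev ixY (i : Fin 4) : Ix := Sum.inr (Sum.inl (Sum.inr i))
/-- the index of the coordinate `c` -/
abbrev ixC : Ix := Sum.inr (Sum.inr ())

/-- The split quadratic form `a c + x ⬝ y` of signature `(5,5)`. -/
def Q55 : QuadraticForm ℝ V10 :=
  QuadraticMap.proj ixA ixC + ∑ i : Fin 4, QuadraticMap.proj (ixX i) (ixY i)

/-- The Clifford algebra of the split form. -/
abbrev Cl55 : Type := CliffordAlgebra Q55

/-- The real group `Spin(5,5)`. -/
abbrev Spin55 : Type := spinGroup Q55

/-- The canonical map from vectors to the Clifford algebra. -/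
abbrev cl : V10 →ₗ[ℝ] Cl55 := CliffordAlgebra.ι Q55

/-- A linear left inverse of `cl`, the vector part of an element of the Clifford algebra. -/
def clInv : Cl55 →ₗ[ℝ] V10 :=
  ExteriorAlgebra.ιInv ∘ₗ (CliffordAlgebra.equivExterior Q55).toLinearMap

lemma clInv_cl (v : V10) : clInv (cl v) = v := by
  have : (CliffordAlgebra.equivExterior Q55) (cl v) = ExteriorAlgebra.ι ℝ v := by
    simp [CliffordAlgebra.equivExterior, CliffordAlgebra.changeFormEquiv, ExteriorAlgebra.ι]
  simp only [clInv, LinearMap.comp_apply, LinearEquiv.coe_coe, this]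
  exact ExteriorAlgebra.ι_leftInverse v

/-- The action `v ↦ g v g⁻¹` of `Spin(5,5)` on vectors. -/
def vecAct (g : Spin55) : V10 →ₗ[ℝ] V10 :=
  clInv ∘ₗ LinearMap.mulLeft ℝ (g : Cl55) ∘ₗ
    LinearMap.mulRight ℝ ((g⁻¹ : Spin55) : Cl55) ∘ₗ cl

lemma cl_vecAct (g : Spin55) (v : V10) :
    cl (vecAct g v) = (g : Cl55) * cl v * ((g⁻¹ : Spin55) : Cl55) := by
  have h := spinGroup.conjAct_smul_ι_mem_range_ι (Q := Q55) (x := spinGroup.toUnits g)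
    (by simp) v
  obtain ⟨w, hw⟩ := h
  rw [ConjAct.units_smul_def, ConjAct.ofConjAct_toConjAct] at hw
  have hw' : cl w = (g : Cl55) * cl v * ((g⁻¹ : Spin55) : Cl55) := hw
  have : vecAct g v = w := by
    simp only [vecAct, LinearMap.comp_apply, LinearMap.mulLeft_apply, LinearMap.mulRight_apply]
    rw [← mul_assoc, ← hw', clInv_cl]
  rw [this, hw']

/-- The vector representation (covering map) `π : Spin(5,5) → SO(5,5)`, as matrices. -/
def vecRep : Spin55 →* Matrix Ix Ix ℝ where
  toFun g := LinearMap.toMatrix' (vecAct g)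
  map_one' := by
    have : vecAct 1 = LinearMap.id := by
      ext1 v
      apply LinearMap.ext
      intro x
      have h := cl_vecAct 1 (Pi.single v x)
      have h2 := congrArg clInv h
      simpa [clInv_cl] using h2
    rw [this, LinearMap.toMatrix'_id]
  map_mul' g k := by
    have : vecAct (g * k) = vecAct g ∘ₗ vecAct k := by
      apply LinearMap.ext
      intro v
      have h : cl (vecAct (g * k) v) = cl (vecAct g (vecAct k v)) := by
        rw [cl_vecAct, cl_vecAct, cl_vecAct, mul_inv_rev]
        simp only [Submonoid.coe_mul, mul_assoc]
      simpa [clInv_cl] using congrArg clInv h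
    rw [this, LinearMap.toMatrix'_comp]

/-- The integral points `Spin(5,5,ℤ)`: those elements which act on vectors by elements of
`GL(10,ℤ)`, that is, which preserve the lattice `ℤ^{10}`. -/
def spinInt : Subgroup Spin55 :=
  (Units.map ((Int.castRingHom ℝ).mapMatrix (m := Ix)).toMonoidHom).range.comap
    vecRep.toHomUnits

/-- The maximal parabolic `P_{α₁}`: the stabilizer, for the action on row vectors, of the isotropic
line spanned by the last basis row vector, i.e. bottom row `(0, …, 0, *)`. -/
def parabolic : Subgroup Spin55 where
  carrier := {p | ∀ j, j ≠ ixC → vecRep p ixC j = 0}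
  one_mem' := fun j hj => by simp [Matrix.one_apply_ne hj.symm]
  mul_mem' := by
    intro p q hp hq j hj
    rw [map_mul, Matrix.mul_apply]
    refine Finset.sum_eq_zero fun k _ => ?_
    by_cases hk : k = ixC
    · rw [hk, hq j hj, mul_zero]
    · rw [hp k hk, zero_mul]
  inv_mem' := by
    intro p hp j hj
    have key : ∀ l, vecRep p ixC ixC * vecRep p⁻¹ ixC l = (1 : Matrix Ix Ix ℝ) ixC l := by
      intro l
      have h : vecRep p * vecRep p⁻¹ = 1 := by rw [← map_mul, mul_inv_cancel, map_one]
      rw [← h, Matrix.mul_apply]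
      symm
      refine Finset.sum_eq_single ixC (fun k _ hk => ?_) (by simp)
      rw [hp k hk, zero_mul]
    have h0 : vecRep p ixC ixC ≠ 0 := by
      intro h
      have := key ixC
      simp [h] at this
    have := key j
    rw [Matrix.one_apply_ne hj.symm] at this
    exact (mul_eq_zero.mp this).resolve_left h0

/-- The Euclidean norm of the bottom row of a matrix. -/
def bottomNorm (A : Matrix Ix Ix ℝ) : ℝ := √(∑ j, A ixC j ^ 2)

/-- For an Iwasawa product `n a k` the bottom row has norm the last entry of the torus element `a`;
this is `e^{-ω(H(nak))}` for the fundamental weight `ω` of the vector node. -/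
lemma bottomNorm_iwasawa (n a k : Matrix Ix Ix ℝ) (t : Ix → ℝ) (hn : n ixC = Pi.single ixC 1)
    (ha : a = Matrix.diagonal t) (ht : 0 < t ixC) (hk : k * kᵀ = 1) :
    bottomNorm (n * a * k) = t ixC := by
  have hrow : ∀ j, (n * a * k) ixC j = t ixC * k ixC j := by
    intro j
    rw [Matrix.mul_assoc, Matrix.mul_apply, hn, ha]
    simp [Matrix.diagonal_mul, Pi.single_apply]
  have hk1 : ∑ j, k ixC j ^ 2 = 1 := by
    have := congrFun (congrFun hk ixC) ixC
    rw [Matrix.mul_apply, Matrix.one_apply_eq] at this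
    simpa [sq, Matrix.transpose_apply] using this
  simp only [bottomNorm, hrow, mul_pow, ← Finset.mul_sum, hk1, mul_one]
  exact Real.sqrt_sq ht.le

/-- `e^{ω(H(g))}`, with `H` the logarithm of the Iwasawa torus component and `ω` the fundamental
weight of the vector node `α₁`: the inverse of the norm of the bottom row. -/
def height (g : Spin55) : ℝ := (bottomNorm (vecRep g))⁻¹

/-- The coset space `(P ∩ Γ) \ Γ` for `Γ = Spin(5,5,ℤ)`. -/
abbrev EisCosets : Type := Quotient (QuotientGroup.rightRel (parabolic.subgroupOf spinInt))

/-- The summand `e^{2 s ω(H(γ g))}` attached to a coset. -/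
def eisTerm (s : ℂ) (g : Spin55) (q : EisCosets) : ℂ :=
  ((height ((q.out : spinInt) * g) : ℝ) : ℂ) ^ (2 * s)

/-- The Eisenstein series `E^{Spin(5,5)}_{α₁;s}(g)`: the sum of `e^{2 s ω(H(γ g))}` over
`(P ∩ Γ) \ Γ` for large `Re s`, meromorphically continued to all `s`. -/
def eisSpin (s : ℂ) (g : Spin55) : ℂ := meroCont (fun w => ∑' q, eisTerm w g q) 5 s

/-! ### The unipotent radical of `P_{α₁}` -/

/-- The vector with coordinates `a = c = 0`, `x = Q₂`, `y = Q₁`, where `q = (Q₁, Q₂)`. -/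
def radVec (q : Fin 4 ⊕ Fin 4 → ℝ) : V10 :=
  Sum.elim 0 (Sum.elim (Sum.elim (fun i => q (Sum.inr i)) (fun i => q (Sum.inl i))) 0)

/-- The isotropic basis vector of the coordinate `a`. -/
def vecA : V10 := Pi.single ixA 1

lemma cl_mul_cl_mem_spin (a b : V10) (h : Q55 a * Q55 b = 1) :
    cl a * cl b ∈ spinGroup Q55 := by
  have unitOf : ∀ v : V10, Q55 v ≠ 0 →
      ∃ u : Cl55ˣ, (u : Cl55) = cl v ∧ u ∈ lipschitzGroup Q55 := by
    intro v hv
    have h1 : cl v * ((Q55 v)⁻¹ • cl v) = 1 := by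
      rw [mul_smul_comm, CliffordAlgebra.ι_sq_scalar, Algebra.algebraMap_eq_smul_one, smul_smul,
        inv_mul_cancel₀ hv, one_smul]
    have h2 : ((Q55 v)⁻¹ • cl v) * cl v = 1 := by
      rw [smul_mul_assoc, CliffordAlgebra.ι_sq_scalar, Algebra.algebraMap_eq_smul_one, smul_smul,
        inv_mul_cancel₀ hv, one_smul]
    exact ⟨⟨cl v, _, h1, h2⟩, rfl, Subgroup.subset_closure ⟨v, rfl⟩⟩
  have ha : Q55 a ≠ 0 := left_ne_zero_of_mul_eq_one h
  have hb : Q55 b ≠ 0 := right_ne_zero_of_mul_eq_one h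
  obtain ⟨u, hu, hu'⟩ := unitOf a ha
  obtain ⟨w, hw, hw'⟩ := unitOf b hb
  refine ⟨⟨⟨u * w, mul_mem hu' hw', by simp [hu, hw]⟩, ?_⟩, ?_⟩
  · refine Unitary.mem_iff.mpr ?_
    have e1 : ∀ v : V10, star (cl v) = -cl v := fun v => CliffordAlgebra.star_ι v
    constructor
    · rw [star_mul, e1, e1, neg_mul_neg, mul_assoc, ← mul_assoc (cl a), CliffordAlgebra.ι_sq_scalar,
        ← mul_assoc, ← Algebra.commutes, mul_assoc, CliffordAlgebra.ι_sq_scalar, ← map_mul, h,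
        map_one]
    · rw [star_mul, e1, e1, neg_mul_neg, mul_assoc, ← mul_assoc (cl b), CliffordAlgebra.ι_sq_scalar,
        ← mul_assoc, ← Algebra.commutes, mul_assoc, CliffordAlgebra.ι_sq_scalar, ← map_mul,
        mul_comm, h, map_one]
  · exact CliffordAlgebra.ι_mul_ι_mem_evenOdd_zero Q55 a b

lemma Q55_apply (v : V10) :
    Q55 v = v ixA * v ixC + ∑ i : Fin 4, v (ixX i) * v (ixY i) := by
  simp [Q55]

lemma Q55_vecA_add (t : ℝ) (q : Fin 4 ⊕ Fin 4 → ℝ) :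
    Q55 (vecA + t • radVec q) = t ^ 2 * Q55 (radVec q) := by
  simp only [Q55_apply, vecA, radVec, Pi.add_apply, Pi.smul_apply, smul_eq_mul]
  simp [Finset.mul_sum]
  exact Finset.sum_congr rfl fun i _ => by ring

lemma vecA_sq : cl vecA * cl vecA = 0 := by
  rw [CliffordAlgebra.ι_sq_scalar]
  simp [Q55_apply, vecA]

lemma vecA_rad_anticomm (q : Fin 4 ⊕ Fin 4 → ℝ) :
    cl (radVec q) * cl vecA = -(cl vecA * cl (radVec q)) := by
  apply CliffordAlgebra.ι_mul_ι_comm_of_isOrtho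
  rw [QuadraticMap.isOrtho_def]
  have h := Q55_vecA_add 1 q
  have h0 : Q55 vecA = 0 := by simp [Q55_apply, vecA]
  rw [one_smul, one_pow, one_mul, add_comm] at h
  rw [h, h0, add_zero]

/-- The lift to the Clifford algebra of a unipotent element lies in `Spin(5,5)`. -/
lemma unip_mem (q : Fin 4 ⊕ Fin 4 → ℝ) :
    1 + cl vecA * cl (radVec q) ∈ spinGroup Q55 := by
  have main : ∀ p : Fin 4 ⊕ Fin 4 → ℝ, Q55 (radVec p) ≠ 0 →
      1 + cl vecA * cl (radVec p) ∈ spinGroup Q55 := by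
    intro p hp
    have h : Q55 (vecA + (Q55 (radVec p))⁻¹ • radVec p) * Q55 (radVec p) = 1 := by
      rw [Q55_vecA_add]; field_simp
    have := cl_mul_cl_mem_spin _ _ h
    rwa [map_add, map_smul, add_mul, smul_mul_assoc, CliffordAlgebra.ι_sq_scalar,
      Algebra.algebraMap_eq_smul_one, smul_smul, inv_mul_cancel₀ hp, one_smul, add_comm] at this
  have radQ : ∀ p, Q55 (radVec p) = ∑ i : Fin 4, p (Sum.inr i) * p (Sum.inl i) := by
    intro p; simp [Q55_apply, radVec]
  -- split `q` as a sum of two vectors on which the form does not vanish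
  set c : Fin 4 ⊕ Fin 4 → ℝ := Pi.single (Sum.inl 0) 1 + Pi.single (Sum.inr 0) 1 with hc
  set t : ℝ := 1 + |q (Sum.inl 0) + q (Sum.inr 0)| + |Q55 (radVec q)| with ht
  have h1 : Q55 (radVec (t • c)) ≠ 0 := by
    rw [radQ]
    have : t ≠ 0 := by positivity
    simp [hc, Fin.sum_univ_four, this]
  have h2 : Q55 (radVec (q - t • c)) ≠ 0 := by
    have hq := radQ q
    have : Q55 (radVec (q - t • c))
        = Q55 (radVec q) - t * (q (Sum.inl 0) + q (Sum.inr 0)) + t ^ 2 := by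
      rw [radQ, radQ]
      simp [hc, Fin.sum_univ_four]
      ring
    rw [this]
    have a1 := abs_nonneg (q (Sum.inl 0) + q (Sum.inr 0))
    have a2 := abs_nonneg (Q55 (radVec q))
    have a3 := le_abs_self (q (Sum.inl 0) + q (Sum.inr 0))
    have a4 := neg_abs_le (Q55 (radVec q))
    have ht1 : 1 ≤ t := by rw [ht]; linarith
    have : 0 < Q55 (radVec q) + t * (t - (q (Sum.inl 0) + q (Sum.inr 0))) := by
      have : 1 + |Q55 (radVec q)| ≤ t - (q (Sum.inl 0) + q (Sum.inr 0)) := by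
        rw [ht]; linarith
      nlinarith
    intro h0
    nlinarith
  have hsum : radVec q = radVec (t • c) + radVec (q - t • c) := by
    ext j
    rcases j with j | (j | j) | j <;> simp [radVec]
  have hmul := mul_mem (main _ h1) (main _ h2)
  have h0 : cl vecA * cl (radVec (t • c)) * (cl vecA * cl (radVec (q - t • c))) = 0 := by
    rw [mul_assoc, ← mul_assoc (cl (radVec (t • c))), vecA_rad_anticomm, neg_mul, mul_neg,
      mul_assoc, ← mul_assoc (cl vecA) (cl vecA), vecA_sq, zero_mul, neg_zero]
  rw [hsum, map_add, mul_add]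
  rw [add_mul, one_mul, mul_add, mul_one, h0, add_zero] at hmul
  convert hmul using 1
  abel

/-- The element `u(Q₁, Q₂)` of the unipotent radical, lifted to `Spin(5,5)`. -/
def unip (q : Fin 4 ⊕ Fin 4 → ℝ) : Spin55 := ⟨1 + cl vecA * cl (radVec q), unip_mem q⟩

/-- The action of `u(Q₁, Q₂)` on vectors, in the coordinates `(a, x, y, c)`. -/
lemma vecAct_unip (q : Fin 4 ⊕ Fin 4 → ℝ) (v : V10) :
    vecAct (unip q) v =
      v + (QuadraticMap.polar Q55 (radVec q) v - v ixC * Q55 (radVec q)) • vecA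
        - v ixC • radVec q := by
  set e := cl vecA with he
  set r := cl (radVec q) with hr
  have hg : ((unip q : Spin55) : Cl55) = 1 + e * r := rfl
  have hre : r * e = -(e * r) := vecA_rad_anticomm q
  have hee : e * e = 0 := vecA_sq
  have hrr : r * r = algebraMap ℝ Cl55 (Q55 (radVec q)) := CliffordAlgebra.ι_sq_scalar _ _
  have hginv : (((unip q)⁻¹ : Spin55) : Cl55) = 1 - e * r := by
    have : (((unip q)⁻¹ : Spin55) : Cl55) = star (1 + e * r) := rfl
    rw [this, star_add, star_one, star_mul, he, hr, CliffordAlgebra.star_ι,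
      CliffordAlgebra.star_ι, neg_mul_neg, ← he, ← hr, hre, sub_eq_add_neg]
  have hE : QuadraticMap.polar Q55 vecA v = v ixC := by
    simp only [QuadraticMap.polar, Q55_apply, vecA, Pi.add_apply]
    simp
    ring
  set P := QuadraticMap.polar Q55 (radVec q) v with hP
  set w := cl v with hw
  have hrw : r * w = algebraMap ℝ Cl55 P - w * r := CliffordAlgebra.ι_mul_ι_comm _ _
  have hew : e * w = algebraMap ℝ Cl55 (v ixC) - w * e := by
    rw [← hE]; exact CliffordAlgebra.ι_mul_ι_comm _ _
  have herw : e * r * w = P • e - v ixC • r + w * e * r := by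
    rw [mul_assoc, hrw, mul_sub, ← mul_assoc e w, hew, sub_mul, ← Algebra.commutes,
      ← Algebra.smul_def, ← Algebra.smul_def]
    abel
  have hrer : r * (e * r) = -(Q55 (radVec q) • e) := by
    rw [← mul_assoc, hre, neg_mul, mul_assoc, hrr, ← Algebra.commutes, ← Algebra.smul_def]
  have heer : e * (e * r) = 0 := by rw [← mul_assoc, hee, zero_mul]
  have herer : e * r * (e * r) = 0 := by
    rw [mul_assoc, hrer, mul_neg, mul_smul_comm, hee, smul_zero, neg_zero]
  have hfin : cl (vecAct (unip q) v) =
      cl (v + (P - v ixC * Q55 (radVec q)) • vecA - v ixC • radVec q) := by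
    rw [cl_vecAct, hg, hginv, map_sub, map_add, map_smul, map_smul, ← hw, ← he, ← hr,
      add_mul, one_mul, herw, mul_sub, mul_one, add_mul, add_mul, sub_mul, smul_mul_assoc,
      smul_mul_assoc, heer, hrer, mul_assoc w e r, mul_assoc w (e * r), herer]
    simp only [smul_zero, mul_zero, sub_smul, smul_neg, smul_smul]
    abel
  simpa [clInv_cl] using congrArg clInv hfin

/-- `u(Q₁, Q₂)` as a matrix. -/
lemma vecRep_unip (q : Fin 4 ⊕ Fin 4 → ℝ) :
    vecRep (unip q) =
      Matrix.of fun j k => match j, k with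
        | Sum.inl _, Sum.inl _ => 1
        | Sum.inl _, Sum.inr (Sum.inl i) => q i
        | Sum.inl _, Sum.inr (Sum.inr _) => -∑ i : Fin 4, q (Sum.inl i) * q (Sum.inr i)
        | Sum.inr (Sum.inl i), Sum.inr (Sum.inl l) => if i = l then 1 else 0
        | Sum.inr (Sum.inl i), Sum.inr (Sum.inr _) => -q i.swap
        | Sum.inr (Sum.inr _), Sum.inr (Sum.inr _) => 1
        | _, _ => 0 := by
  ext j k
  have h : vecRep (unip q) j k = vecAct (unip q) (Pi.single k 1) j := by
    change LinearMap.toMatrix' (vecAct (unip q)) j k = _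
    rw [LinearMap.toMatrix'_apply]
  rw [h, vecAct_unip]
  simp only [QuadraticMap.polar, Q55_apply, vecA, radVec, Pi.add_apply, Pi.sub_apply,
    Pi.smul_apply, smul_eq_mul, Matrix.of_apply]
  rcases j with j | (j | j) | j <;> rcases k with k | (k | k) | k <;>
    simp [Pi.single_apply, Finset.sum_add_distrib, add_mul, mul_add, mul_comm, eq_comm]

/-! ### The Levi component, the charges and the Fourier coefficient -/

/-- The element `h_4 = (1 B; 0 1) · diag(e, (eᵗ)⁻¹)` of `SO(4,4)`, in the coordinates `(x, y)`. -/
def so44 (e B : Matrix (Fin 4) (Fin 4) ℝ) : Matrix (Fin 4 ⊕ Fin 4) (Fin 4 ⊕ Fin 4) ℝ :=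
  Matrix.fromBlocks 1 B 0 1 * Matrix.fromBlocks e 0 0 (eᵀ)⁻¹

/-- The Levi element `diag(t, h_4, t⁻¹)` of `P_{α₁}`. -/
def levi (t : ℝ) (h4 : Matrix (Fin 4 ⊕ Fin 4) (Fin 4 ⊕ Fin 4) ℝ) : Matrix Ix Ix ℝ :=
  Matrix.fromBlocks (Matrix.of fun _ _ => t) 0 0
    (Matrix.fromBlocks h4 0 0 (Matrix.of fun _ _ => t⁻¹))

/-- `p_L = (M + N (B - G)) (eᵗ)⁻¹ / √2`, with `G = e eᵗ`. -/
def pL (e B : Matrix (Fin 4) (Fin 4) ℝ) (M N : Fin 4 → ℤ) : Fin 4 → ℝ :=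
  (√2)⁻¹ • (((fun i => (M i : ℝ)) + (fun i => (N i : ℝ)) ᵥ* (B - e * eᵀ)) ᵥ* (eᵀ)⁻¹)

/-- `p_R = (M + N (B + G)) (eᵗ)⁻¹ / √2`, with `G = e eᵗ`. -/
def pR (e B : Matrix (Fin 4) (Fin 4) ℝ) (M N : Fin 4 → ℤ) : Fin 4 → ℝ :=
  (√2)⁻¹ • (((fun i => (M i : ℝ)) + (fun i => (N i : ℝ)) ᵥ* (B + e * eᵀ)) ᵥ* (eᵀ)⁻¹)

/-- `p_L²` -/
def pL2 (e B : Matrix (Fin 4) (Fin 4) ℝ) (M N : Fin 4 → ℤ) : ℝ := pL e B M N ⬝ᵥ pL e B M N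

/-- `p_R²` -/
def pR2 (e B : Matrix (Fin 4) (Fin 4) ℝ) (M N : Fin 4 → ℤ) : ℝ := pR e B M N ⬝ᵥ pR e B M N

/-- The greatest common divisor of the eight entries of `M` and `N`. -/
def gcdModes (M N : Fin 4 → ℤ) : ℕ :=
  Finset.univ.gcd fun i : Fin 4 ⊕ Fin 4 => (Sum.elim M N i).natAbs

/-- The unit cube `[0,1]^8` in the coordinates `(Q₁, Q₂)` of the unipotent radical. -/
abbrev cube : Set (Fin 4 ⊕ Fin 4 → ℝ) := Set.Icc 0 1

/-- The integrand `E_s(u(Q₁,Q₂) h) e^{-2πi (M ⬝ Q₁ + N ⬝ Q₂)}`. -/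
def modeIntegrand (s : ℂ) (h : Spin55) (M N : Fin 4 → ℤ) (q : Fin 4 ⊕ Fin 4 → ℝ) : ℂ :=
  eisSpin s (unip q * h) *
    Complex.exp (-(2 * Real.pi * Complex.I) *
      ∑ i : Fin 4, ((M i : ℂ) * (q (Sum.inl i) : ℂ) + (N i : ℂ) * (q (Sum.inr i) : ℂ)))

/-- The Fourier coefficient `F^{Spin(5,5) α₁}_{α₁;s}([M; N])` at `h`. -/
def fourierMode (s : ℂ) (h : Spin55) (M N : Fin 4 → ℤ) : ℂ :=
  ∫ q in cube, modeIntegrand s h M N q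

/-- The Gaussian weight
`e^{-π p²/(τ₂ y) - π (τ₂/p²) (p_L² + p_R²)}`, with `X = p_L² + p_R²`. -/
def gaussWeight (y X : ℝ) (p : ℕ) (τ₂ : ℝ) : ℂ :=
  (Real.exp (-Real.pi * (p : ℝ) ^ 2 / (τ₂ * y) - Real.pi * (τ₂ / (p : ℝ) ^ 2) * X) : ℝ)

/-- `E^{SL(2)}_s(τ₁ + i τ₂) e^{i π τ₁ D/p²}`, with `D = p_L² - p_R²`. -/
def sl2Weight (s : ℂ) (D : ℝ) (p : ℕ) (τ₂ τ₁ : ℝ) : ℂ :=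
  eisSL2 s ((τ₁ : ℂ) + (τ₂ : ℂ) * Complex.I) *
    Complex.exp (Complex.I * Real.pi * (τ₁ : ℂ) * ((D / (p : ℝ) ^ 2 : ℝ) : ℂ))

end

section

open scoped UpperHalfPlane MatrixGroups
open MeasureTheory Filter Topology

/-! ### Summation over lattices and Poisson summation -/

/-! Eisenstein series as a theta integral. Every nonzero integral null vector of the split lattice
of rank ten is, in exactly one way, a nonzero integer times the bottom row of a coset
representative, by a Euclidean algorithm inside `spinInt`. Hence `2 ζ(2s)` times the series is the
sum of `|v g|^{-2s}` over the nonzero null vectors `v` (`summable_eisTerm`). Nullity is imposed by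
averaging `e^{-2πi τ₁ q(v)}` over a period, so `2 ξ(2s)` times the series is the integral of
`τ₂^{s-3/2} (Θ - τ₂^{5/2})` over the strip `|τ₁| ≤ 1/2` for the invariant measure, where `Θ` is the
Siegel–Narain theta function (`integral_thetaPrime`). Poisson summation in five coordinates brings
`Θ` to a form in which `SL(2,ℤ)` only permutes the summands, so `Θ` is invariant
(`narainTheta_modular`).

Continuation. Rankin–Selberg unfolding of this integral against an `SL(2)` Eisenstein series is
obstructed by the growth `τ₂^{5/2}` of `Θ` at the cusp. That term is an eigenfunction of the Hecke
operator at 2. Subtracting the eigenvalue leaves an invariant, exponentially decaying function, and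
the Mellin transform is merely multiplied by an explicit entire factor (`integral_heckeTheta`).
Unfolding now gives a quotient of entire functions whose denominator does not depend on the
unipotent variable (`isMeroCont_eisSpin`). The `SL(2)` series is a quotient of the same kind, by the
functional equation of the Epstein theta function (`isMeroCont_eisSL2`).

Fourier modes. After Poisson summation in the last coordinate alone, `Θ` is a sum over winding pairs
`(a,b)`, which `SL(2,ℤ)` permutes. Every nonzero pair is in the orbit of some `(0,p)` with `p > 0`.
In the sector `(0,p)` each term depends on `(Q₁,Q₂)` through a character, so the mode `(M,N)` keeps
at most one Gaussian, and keeps it exactly when `p ∣ gcd(M,N)`. The mode of `Θ` is therefore a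
finite sum of Poincaré series (`narainTheta_mode_eq`). Unfolding them replaces `τ₂^{s-3/2}` by
`E_{s-3/2}` and gives the formula for `Re s > 5`. The Gaussians decay both at the cusp and at the
real axis, so the resulting integrals need no regularization, and the identity theorem extends the
formula to the complement of the zeros of one entire function, `exceptional` (`fourierMode_eq`).

Special values, with `w = s - 3/2`. At `w = 0` the `SL(2)` series is the constant 1. The `τ₁`
integral is then a Kronecker delta on `p_L² = p_R²` and the `τ₂` integral is a `K₁`
(`fourierMode_three_halves`). At `w = 1` the `SL(2)` series has a pole whose residue is constant in
`τ`. A nontrivial character of `τ₁` does not see it, and what remains is the nonzero Fourier mode of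
the entire part of the completed Epstein zeta function, an exponential times `σ₋₁`
(`integral_epsteinEntire_mode`). The exponential merges with the Gaussian weight and produces the
shifted argument of `K₁` (`tendsto_fourierMode`). -/

theorem summable_pi_prod {ι : Type*} [Fintype ι] {f : ℤ → ℝ} (h0 : ∀ k, 0 ≤ f k)
    (hf : Summable f) : Summable fun v : ι → ℤ => ∏ i, f (v i) := by
  have key : ∀ n : ℕ, Summable fun v : Fin n → ℤ => ∏ i, f (v i) := by
    intro n
    induction n with
    | zero => exact Summable.of_finite
    | succ n ih =>
      rw [← (Fin.consEquiv fun _ : Fin (n + 1) => ℤ).summable_iff]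
      have := hf.mul_of_nonneg ih h0 fun v => Finset.prod_nonneg fun i _ => h0 _
      refine this.congr fun x => ?_
      simp [Fin.prod_univ_succ, Fin.consEquiv]
  let e := Fintype.equivFin ι
  rw [← (Equiv.arrowCongr e (Equiv.refl ℤ)).symm.summable_iff]
  refine (key (Fintype.card ι)).congr fun v => ?_
  simp [Equiv.arrowCongr, Function.comp_def]
  exact (Equiv.prod_comp e (fun i => f (v i))).symm

theorem summable_exp_neg_mul_int_sq {c : ℝ} (hc : 0 < c) :
    Summable fun k : ℤ => Real.exp (-c * (k : ℝ) ^ 2) := by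
  have h := (summable_pow_mul_jacobiTheta₂_term_bound 0 (T := c / Real.pi)
    (div_pos hc Real.pi_pos) 0)
  refine h.congr fun k => ?_
  simp
  field_simp

theorem summable_gaussian_pi {ι : Type*} [Fintype ι] {c : ℝ} (hc : 0 < c) :
    Summable fun v : ι → ℤ => Real.exp (-c * ∑ i, (v i : ℝ) ^ 2) := by
  refine (summable_pi_prod (ι := ι) (fun k => (Real.exp_pos _).le)
    (summable_exp_neg_mul_int_sq hc)).congr fun v => ?_
  rw [← Real.exp_sum, Finset.mul_sum]

theorem summable_int_one_add_sq_rpow {r : ℝ} (hr : r < -(1 / 2)) :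
    Summable fun k : ℤ => (1 + (k : ℝ) ^ 2) ^ r := by
  have h : Summable fun k : ℤ => |(k : ℝ)| ^ (2 * r) := by
    have h1 := (Real.summable_nat_rpow (p := 2 * r)).2 (by linarith)
    refine Summable.of_nat_of_neg ?_ ?_ <;> simpa using h1
  refine Summable.of_norm_bounded_eventually h ?_
  rw [Int.cofinite_eq]
  have : ∀ k : ℤ, k ≠ 0 → ‖(1 + (k : ℝ) ^ 2) ^ r‖ ≤ |(k : ℝ)| ^ (2 * r) := by
    intro k hk
    have hk' : (0 : ℝ) < |(k : ℝ)| := by positivity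
    rw [Real.norm_of_nonneg (by positivity), Real.rpow_mul hk'.le, Real.rpow_two, sq_abs]
    exact Real.rpow_le_rpow_of_nonpos (by positivity) (by linarith) (by linarith)
  rw [eventually_sup]
  exact ⟨(eventually_lt_atBot 0).mono fun k hk => this k hk.ne,
    (eventually_gt_atTop 0).mono fun k hk => this k hk.ne'⟩

/-- With `n` coordinates, `∏ (1 + vᵢ²) ≤ (1 + ∑ vᵢ²)^n`. Since the exponent is negative, the summand
is at most a product of one-dimensional summands with exponent `r / n < -1/2`. -/
theorem summable_pi_one_add_sq_rpow {ι : Type*} [Fintype ι] {r : ℝ}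
    (hr : 2 * r < -(Fintype.card ι : ℝ)) (hι : 0 < Fintype.card ι) :
    Summable fun v : ι → ℤ => (1 + ∑ i, (v i : ℝ) ^ 2) ^ r := by
  have hn : (0 : ℝ) < Fintype.card ι := by exact_mod_cast hι
  have h := summable_pi_prod (ι := ι) (f := fun k : ℤ => (1 + (k : ℝ) ^ 2) ^ (r / Fintype.card ι))
    (fun k => by positivity) (summable_int_one_add_sq_rpow (by
      rw [div_lt_iff₀ hn]; linarith))
  refine h.of_nonneg_of_le (fun v => by positivity) fun v => ?_
  have hr0 : r < 0 := by linarith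
  rw [Real.finsetProd_rpow _ _ (fun i _ => by positivity)]
  have h1 : ∏ i, (1 + (v i : ℝ) ^ 2) ≤ (1 + ∑ i, (v i : ℝ) ^ 2) ^ (Fintype.card ι : ℝ) := by
    rw [Real.rpow_natCast]
    calc ∏ i, (1 + (v i : ℝ) ^ 2) ≤ ∏ _i : ι, (1 + ∑ i, (v i : ℝ) ^ 2) := by
          refine Finset.prod_le_prod (fun i _ => by positivity) fun i _ => ?_
          have := Finset.single_le_sum (f := fun i => (v i : ℝ) ^ 2) (fun i _ => sq_nonneg _)
            (Finset.mem_univ i)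
          linarith
      _ = _ := by simp
  have h2 := Real.rpow_le_rpow_of_nonpos (z := r / Fintype.card ι)
    (Finset.prod_pos fun i _ => by positivity) h1 (div_nonpos_of_nonpos_of_nonneg hr0.le hn.le)
  rwa [← Real.rpow_mul (by positivity), mul_div_cancel₀ _ hn.ne'] at h2

/-- A positive quadratic form depending continuously on a parameter in a compact set is bounded
below by a multiple of the square of the norm. -/
theorem exists_quadratic_lower_bound {X E : Type*} [TopologicalSpace X] [NormedAddCommGroup E]
    [NormedSpace ℝ E] [FiniteDimensional ℝ E] {s : Set X} (hs : IsCompact s) (f : X → E → ℝ)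
    (hf : Continuous fun p : X × E => f p.1 p.2)
    (hom : ∀ x (r : ℝ) v, f x (r • v) = r ^ 2 * f x v) (hpos : ∀ x ∈ s, ∀ v, v ≠ 0 → 0 < f x v) :
    ∃ c : ℝ, 0 < c ∧ ∀ x ∈ s, ∀ v, c * ‖v‖ ^ 2 ≤ f x v := by
  have : ProperSpace E := FiniteDimensional.proper ℝ E
  have hK : IsCompact (s ×ˢ Metric.sphere (0 : E) 1) := hs.prod (isCompact_sphere _ _)
  obtain ⟨c, hc, hcK⟩ : ∃ c : ℝ, 0 < c ∧ ∀ p ∈ s ×ˢ Metric.sphere (0 : E) 1, c ≤ f p.1 p.2 := by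
    -- The product is empty when `s` is empty or `E` is trivial; any positive constant then serves.
    by_cases hne : (s ×ˢ Metric.sphere (0 : E) 1).Nonempty
    · obtain ⟨p, hp, hmin⟩ := hK.exists_isMinOn hne hf.continuousOn
      refine ⟨f p.1 p.2, hpos _ hp.1 _ ?_, fun q hq => hmin hq⟩
      rintro h
      have := hp.2
      simp [h] at this
    · exact ⟨1, one_pos, fun p hp => (hne ⟨p, hp⟩).elim⟩
  refine ⟨c, hc, fun x hx v => ?_⟩
  by_cases hv : v = 0
  · have := hom x 0 v
    simp_all
  · have hv' : 0 < ‖v‖ := norm_pos_iff.2 hv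
    have h1 := hcK (x, ‖v‖⁻¹ • v) ⟨hx, by simp [norm_smul, hv'.ne']⟩
    have h2 := hom x ‖v‖ (‖v‖⁻¹ • v)
    rw [smul_smul, mul_inv_cancel₀ hv'.ne', one_smul] at h2
    rw [h2, mul_comm]
    gcongr

/-- The Fourier transform of a function on `ℝ^ι` at a frequency. -/
noncomputable def fourierPi {ι : Type*} [Fintype ι] (g : (ι → ℝ) → ℂ) (n : ι → ℝ) : ℂ :=
  ∫ x : ι → ℝ, Complex.exp (-(2 * Real.pi * Complex.I) * ∑ i, (n i : ℂ) * (x i : ℂ)) * g x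

section Poisson

variable {ι : Type*} [Fintype ι]

/-- The unit cube with corner `k`. -/
def unitCubeAt (k : ι → ℤ) : Set (ι → ℝ) := {x | ∀ i, x i ∈ Set.Ioc (k i : ℝ) (k i + 1)}

theorem measurableSet_unitCubeAt (k : ι → ℤ) : MeasurableSet (unitCubeAt k) := by
  have : unitCubeAt k = Set.univ.pi fun i => Set.Ioc (k i : ℝ) (k i + 1) := by
    ext; simp [unitCubeAt]
  rw [this]
  exact MeasurableSet.univ_pi fun i => measurableSet_Ioc

/-- The half-open cubes with integral corners tile the space disjointly, and each is translated back
to the origin. They are open on the left, which is why the corner of the cube containing a point is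
`⌈x⌉ - 1`. -/
theorem hasSum_integral_unitCubeAt {g : (ι → ℝ) → ℂ} (hg : Integrable g) :
    HasSum (fun k : ι → ℤ => ∫ x in unitCubeAt (0 : ι → ℤ), g (fun i => x i + k i))
      (∫ x, g x) := by
  have h := hasSum_integral_iUnion (μ := volume) (f := g) (s := fun k : ι → ℤ => unitCubeAt k)
    measurableSet_unitCubeAt ?_ hg.integrableOn
  · have hU : (⋃ k : ι → ℤ, unitCubeAt k) = Set.univ := by
      refine Set.eq_univ_of_forall fun x => Set.mem_iUnion.2 ⟨fun i => ⌈x i⌉ - 1, fun i => ?_⟩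
      have h1 := Int.ceil_lt_add_one (x i)
      have h2 := Int.le_ceil (x i)
      constructor <;> push_cast <;> linarith
    rw [hU, setIntegral_univ] at h
    refine h.congr_fun fun k => ?_
    have mp := measurePreserving_add_right (volume : Measure (ι → ℝ)) (fun i => (k i : ℝ))
    have := mp.setIntegral_preimage_emb (measurableEmbedding_addRight _) g (unitCubeAt k)
    rw [← this]
    have hpre : (fun x : ι → ℝ => x + fun i => (k i : ℝ)) ⁻¹' unitCubeAt k
        = unitCubeAt (0 : ι → ℤ) := by
      ext x
      simp only [unitCubeAt, Set.mem_preimage, Set.mem_ofPred_eq, Pi.add_apply, Set.mem_Ioc,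
        Pi.zero_apply, Int.cast_zero]
      refine forall_congr' fun i => ?_
      constructor <;> rintro ⟨h1, h2⟩ <;> constructor <;> linarith
    rw [hpre]
    rfl
  · intro k l hkl
    rw [Function.onFun, Set.disjoint_left]
    intro x hk hl
    refine hkl (funext fun i => ?_)
    have h1 := hk i
    have h2 := hl i
    have a1 : (k i : ℝ) < l i + 1 := by linarith [h1.1, h2.2]
    have a2 : (l i : ℝ) < k i + 1 := by linarith [h1.2, h2.1]
    have b1 : k i < l i + 1 := by exact_mod_cast a1
    have b2 : l i < k i + 1 := by exact_mod_cast a2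
    omega

end Poisson

section Poisson

variable {ι : Type*} [Fintype ι]

/-- Poisson summation on `ℤ^ι`. -/
theorem tsum_eq_tsum_fourierPi {g : (ι → ℝ) → ℂ} (hc : Continuous g) (hi : Integrable g)
    (hb : ∀ R : ℝ, ∃ u : (ι → ℤ) → ℝ, Summable u ∧
      ∀ k (x : ι → ℝ), ‖x‖ ≤ R → ‖g (fun i => x i + k i)‖ ≤ u k)
    (hs : Summable fun n : ι → ℤ => fourierPi g fun i => (n i : ℝ)) (x : ι → ℝ) :
    ∑' k : ι → ℤ, g (fun i => x i + k i) =
      ∑' n : ι → ℤ, fourierPi g (fun i => (n i : ℝ)) *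
        Complex.exp (2 * Real.pi * Complex.I * ∑ i, (n i : ℂ) * (x i : ℂ)) := by
  set P : (ι → ℝ) → ℂ := fun x => ∑' k : ι → ℤ, g (fun i => x i + k i) with hP
  have hPper : ∀ x (k : ι → ℤ), P (fun i => x i + k i) = P x := by
    intro x k
    simp only [hP]
    rw [← (Equiv.addLeft k).tsum_eq fun l : ι → ℤ => g (fun i => x i + l i)]
    simp [add_assoc]
  have hPc : Continuous P := by
    rw [continuous_iff_continuousAt]
    intro x0
    obtain ⟨u, hu, hub⟩ := hb (‖x0‖ + 1)
    have : ContinuousOn P (Metric.closedBall 0 (‖x0‖ + 1)) := by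
      refine continuousOn_tsum (fun k => ?_) hu fun k x hx => hub k x (by simpa using hx)
      exact (hc.comp (by fun_prop)).continuousOn
    exact this.continuousAt (Metric.closedBall_mem_nhds_of_mem (by simp))
  -- The periodization descends along the open quotient map to a continuous function on the torus.
  -- Its Fourier coefficients will be the values of the Fourier transform at integral frequencies,
  -- and their summability makes the Fourier series converge pointwise.
  let π' : (ι → ℝ) → UnitAddTorus ι := fun x i => (x i : UnitAddCircle)
  have hπ : IsOpenQuotientMap π' :=
    IsOpenQuotientMap.piMap fun _ => QuotientAddGroup.isOpenQuotientMap_mk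
  have hfac : ∀ x x', π' x = π' x' → P x = P x' := by
    intro x x' h
    have : ∀ i, ∃ k : ℤ, x i = x' i + k := by
      intro i
      have := congrFun h i
      obtain ⟨k, hk⟩ := AddSubgroup.mem_zmultiples_iff.1 (QuotientAddGroup.eq.1 this)
      exact ⟨-k, by simp at hk ⊢; linarith⟩
    choose k hk using this
    rw [← hPper x' k]
    exact congrArg P (funext hk)
  let F0 : UnitAddTorus ι → ℂ := fun θ => P (hπ.surjective θ).choose
  have hF0 : ∀ x, F0 (π' x) = P x := fun x => hfac _ _ (hπ.surjective (π' x)).choose_spec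
  let F : C(UnitAddTorus ι, ℂ) := ⟨F0, by
    rw [hπ.isQuotientMap.continuous_iff]
    convert hPc using 1
    exact funext hF0⟩
  have hmF : ∀ (n : ι → ℤ) (x : ι → ℝ), UnitAddTorus.mFourier n (π' x) =
      Complex.exp (2 * Real.pi * Complex.I * ∑ i, (n i : ℂ) * (x i : ℂ)) := by
    intro n x
    simp only [UnitAddTorus.mFourier, ContinuousMap.coe_mk, π', fourier_coe_apply]
    rw [← Complex.exp_sum, Finset.mul_sum]
    refine congrArg _ (Finset.sum_congr rfl fun i _ => ?_)
    push_cast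
    ring
  have hcoef : ∀ n, UnitAddTorus.mFourierCoeff F n = fourierPi g fun i => (n i : ℝ) := by
    intro n
    rw [UnitAddTorus.mFourierCoeff_eq_integral F n 0]
    set χ : (ι → ℝ) → ℂ := fun x =>
      Complex.exp (-(2 * Real.pi * Complex.I) * ∑ i, (n i : ℂ) * (x i : ℂ)) with hχ
    have hχn : ∀ x, ‖χ x‖ = 1 := by
      intro x
      have : -(2 * Real.pi * Complex.I) * ∑ i, (n i : ℂ) * (x i : ℂ)
          = ((-(2 * Real.pi) * ∑ i, (n i : ℝ) * x i : ℝ) : ℂ) * Complex.I := by push_cast; ring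
      simp only [hχ, this, Complex.norm_exp_ofReal_mul_I]
    have hχc : Continuous χ := by simp only [hχ]; fun_prop
    have hχper : ∀ x (k : ι → ℤ), χ (fun i => x i + k i) = χ x := by
      intro x k
      simp only [hχ]
      rw [Complex.exp_eq_exp_iff_exists_int]
      refine ⟨-∑ i, n i * k i, ?_⟩
      push_cast
      simp only [mul_add, Finset.sum_add_distrib]
      ring
    have hint : Integrable fun x => χ x * g x :=
      hi.bdd_mul (c := 1) hχc.aestronglyMeasurable (Eventually.of_forall fun x => (hχn x).le)
    -- The integral over the whole space is folded onto one unit cube, where the character is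
    -- periodic and the integrand sums to the periodization.
    have h1 := (hasSum_integral_unitCubeAt hint).tsum_eq
    rw [fourierPi]
    simp only [Complex.ofReal_intCast]
    rw [← h1]
    have hset : {x : ι → ℝ | ∀ i, x i ∈ Set.Ioc ((0 : ι → ℝ) i) ((0 : ι → ℝ) i + 1)}
        = unitCubeAt (0 : ι → ℤ) := by ext x; simp [unitCubeAt]
    rw [hset]
    have hnorm : ∀ x ∈ unitCubeAt (0 : ι → ℤ), ‖x‖ ≤ 1 := by
      intro x hx
      rw [pi_norm_le_iff_of_nonneg zero_le_one]
      intro i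
      have := hx i
      simp only [Pi.zero_apply, Int.cast_zero, zero_add] at this
      rw [Real.norm_of_nonneg this.1.le]
      exact this.2
    obtain ⟨u, hu, hub⟩ := hb 1
    have hfin : IsFiniteMeasure (volume.restrict (unitCubeAt (0 : ι → ℤ))) := by
      constructor
      rw [Measure.restrict_apply_univ]
      refine (measure_mono (t := Metric.closedBall 0 1) fun x hx => ?_).trans_lt
        measure_closedBall_lt_top
      simpa using hnorm x hx
    calc ∫ x in unitCubeAt (0 : ι → ℤ), UnitAddTorus.mFourier (-n) (π' x) • F (π' x)
        = ∫ x in unitCubeAt (0 : ι → ℤ), ∑' k : ι → ℤ, χ x * g (fun i => x i + k i) := by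
          refine integral_congr_ae (Eventually.of_forall fun x => ?_)
          change UnitAddTorus.mFourier (-n) (π' x) • F0 (π' x) = _
          change _ = ∑' k : ι → ℤ, χ x * g (fun i => x i + k i)
          rw [hmF, hF0, smul_eq_mul, tsum_mul_left]
          simp only [hP, hχ, Pi.neg_apply]
          congr 2
          push_cast
          simp
      _ = ∑' k : ι → ℤ, ∫ x in unitCubeAt (0 : ι → ℤ), χ x * g (fun i => x i + k i) := by
          refine (hasSum_integral_of_dominated_convergence (fun k _ => u k)
            (fun k => ?_) (fun k => ?_) ?_ ?_ ?_).tsum_eq.symm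
          · exact (hχc.mul (hc.comp (by fun_prop))).aestronglyMeasurable
          · refine (ae_restrict_iff' (measurableSet_unitCubeAt _)).2 (Eventually.of_forall
              fun x hx => ?_)
            rw [norm_mul, hχn, one_mul]
            exact hub k x (hnorm x hx)
          · exact Eventually.of_forall fun _ => hu
          · exact integrable_const _
          · refine (ae_restrict_iff' (measurableSet_unitCubeAt _)).2 (Eventually.of_forall
              fun x hx => ?_)
            refine (Summable.of_norm_bounded hu fun k => ?_).hasSum
            rw [norm_mul, hχn, one_mul]
            exact hub k x (hnorm x hx)
      _ = ∑' k : ι → ℤ, ∫ x in unitCubeAt (0 : ι → ℤ),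
            χ (fun i => x i + k i) * g (fun i => x i + k i) := by simp only [hχper]
  have hsum : Summable (UnitAddTorus.mFourierCoeff F) := by
    rw [funext hcoef]; exact hs
  have := (UnitAddTorus.hasSum_mFourier_series_apply_of_summable hsum (π' x)).tsum_eq
  change _ = F0 (π' x) at this
  rw [hF0] at this
  change P x = _
  rw [← this]
  refine tsum_congr fun n => ?_
  rw [hcoef, hmF, smul_eq_mul]

theorem exists_quadratic_lower_bound_pi {X : Type*} [TopologicalSpace X] {s : Set X}
    (hs : IsCompact s) (f : X → (ι → ℝ) → ℝ) (hf : Continuous fun p : X × (ι → ℝ) => f p.1 p.2)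
    (hom : ∀ x (r : ℝ) v, f x (r • v) = r ^ 2 * f x v) (hpos : ∀ x ∈ s, ∀ v, v ≠ 0 → 0 < f x v) :
    ∃ c : ℝ, 0 < c ∧ ∀ x ∈ s, ∀ v, c * ∑ i, v i ^ 2 ≤ f x v := by
  obtain ⟨c, hc, h⟩ := exists_quadratic_lower_bound hs f hf hom hpos
  refine ⟨c / (Fintype.card ι + 1), by positivity, fun x hx v => le_trans ?_ (h x hx v)⟩
  have : ∑ i, v i ^ 2 ≤ (Fintype.card ι + 1) * ‖v‖ ^ 2 := by
    calc ∑ i, v i ^ 2 ≤ ∑ _i : ι, ‖v‖ ^ 2 := by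
          refine Finset.sum_le_sum fun i _ => ?_
          rw [← sq_abs]
          gcongr
          exact norm_le_pi_norm v i
      _ ≤ _ := by simp; nlinarith [sq_nonneg ‖v‖]
  rw [div_mul_eq_mul_div, div_le_iff₀ (by positivity)]
  nlinarith

/-- The sum of the squares of the entries of a vector. -/
def sqNorm (v : ι → ℝ) : ℝ := ∑ i, v i ^ 2

theorem sqNorm_nonneg (v : ι → ℝ) : 0 ≤ sqNorm v := Finset.sum_nonneg fun _ _ => sq_nonneg _

theorem sqNorm_smul (r : ℝ) (v : ι → ℝ) : sqNorm (r • v) = r ^ 2 * sqNorm v := by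
  simp [sqNorm, mul_pow, Finset.mul_sum]

theorem sqNorm_pos {v : ι → ℝ} (hv : v ≠ 0) : 0 < sqNorm v := by
  obtain ⟨i, hi⟩ := Function.ne_iff.1 hv
  exact Finset.sum_pos' (fun _ _ => sq_nonneg _) ⟨i, Finset.mem_univ _, by
    have : v i ≠ 0 := hi
    positivity⟩

theorem continuous_sqNorm : Continuous (sqNorm : (ι → ℝ) → ℝ) := by
  unfold sqNorm; fun_prop

/-- Coordinatewise this is `(2x + k)² ≥ 0`. It makes Gaussian bounds on a shifted lattice uniform
for shifts in a bounded set. -/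
theorem sqNorm_add_ge (x k : ι → ℝ) : sqNorm k / 2 - sqNorm x ≤ sqNorm (x + k) := by
  simp only [sqNorm, Finset.sum_div, ← Finset.sum_sub_distrib, Pi.add_apply]
  exact Finset.sum_le_sum fun i _ => by nlinarith [sq_nonneg (2 * x i + k i)]

theorem exists_sqNorm_vecMul_ge [DecidableEq ι] {A : Matrix ι ι ℝ} (hA : A.det ≠ 0) :
    ∃ c : ℝ, 0 < c ∧ ∀ v, c * sqNorm v ≤ sqNorm (v ᵥ* A) := by
  obtain ⟨c, hc, h⟩ := exists_quadratic_lower_bound_pi (X := Unit) (s := Set.univ) isCompact_univ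
    (fun _ v => sqNorm (v ᵥ* A))
    (continuous_sqNorm.comp (continuous_snd.matrix_vecMul continuous_const))
    (fun _ r v => by rw [Matrix.smul_vecMul, sqNorm_smul])
    (fun _ _ v hv => sqNorm_pos fun h0 => hv (Matrix.eq_zero_of_vecMul_eq_zero hA h0))
  exact ⟨c, hc, h () trivial⟩

theorem integrable_exp_neg_sqNorm {c : ℝ} (hc : 0 < c) :
    Integrable fun x : ι → ℝ => Real.exp (-c * sqNorm x) := by
  have := GaussianFourier.integrable_cexp_neg_mul_sum_add (ι := ι) (b := c) (by simpa) 0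
  refine this.norm.congr (Eventually.of_forall fun x => ?_)
  have h : -(c : ℂ) * ∑ i, (x i : ℂ) ^ 2 + ∑ i, (0 : ι → ℂ) i * (x i : ℂ)
      = ((-c * sqNorm x : ℝ) : ℂ) := by simp [sqNorm]
  simp only [h, Complex.norm_exp_ofReal]

/-- Poisson summation for Gaussians. -/
theorem tsum_gaussian_poisson [DecidableEq ι] {e : Matrix ι ι ℝ} (he : e.det ≠ 0) {t : ℝ}
    (ht : 0 < t) (u v : ι → ℝ) :
    ∑' k : ι → ℤ, Complex.exp (((-Real.pi * t * sqNorm ((fun i => u i + k i) ᵥ* (eᵀ)⁻¹) : ℝ) : ℂ) +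
        2 * Real.pi * Complex.I * ((∑ i, k i * v i : ℝ) : ℂ)) =
      |e.det| * ((t⁻¹ : ℝ) : ℂ) ^ (Fintype.card ι / 2 : ℂ) *
        ∑' l : ι → ℤ, Complex.exp (((-Real.pi / t * sqNorm ((fun i => l i - v i) ᵥ* e) : ℝ) : ℂ) +
          2 * Real.pi * Complex.I * ((∑ i, (l i - v i) * u i : ℝ) : ℂ)) := by
  have heT : ((eᵀ)⁻¹).det ≠ 0 := by
    rw [Matrix.det_nonsing_inv, Matrix.det_transpose]
    simpa using he
  set E := (eᵀ)⁻¹ with hE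
  set g : (ι → ℝ) → ℂ := fun x => Complex.exp (((-Real.pi * t * sqNorm (x ᵥ* E) : ℝ) : ℂ) +
        2 * Real.pi * Complex.I * ((∑ i, x i * v i : ℝ) : ℂ)) with hg
  obtain ⟨c, hc, hcE⟩ := exists_sqNorm_vecMul_ge heT
  have hpt : 0 < Real.pi * t := mul_pos Real.pi_pos ht
  have hgn : ∀ x, ‖g x‖ ≤ Real.exp (-(Real.pi * t * c) * sqNorm x) := by
    intro x
    rw [hg, Complex.norm_exp]
    refine Real.exp_le_exp.2 ?_
    simp only [Complex.add_re, Complex.ofReal_re]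
    have : (2 * Real.pi * Complex.I * ((∑ i, x i * v i : ℝ) : ℂ)).re = 0 := by
      simp [-Complex.ofReal_sum]
    rw [this]
    nlinarith [mul_le_mul_of_nonneg_left (hcE x) hpt.le]
  have hgc : Continuous g := by
    have : Continuous fun x : ι → ℝ => sqNorm (x ᵥ* E) :=
      continuous_sqNorm.comp (continuous_id.matrix_vecMul continuous_const)
    simp only [hg]
    fun_prop
  have hgi : Integrable g := (integrable_exp_neg_sqNorm (by positivity)).mono'
    hgc.aestronglyMeasurable (Eventually.of_forall hgn)
  have hfour : ∀ n : ι → ℤ, fourierPi g (fun i => (n i : ℝ)) = |e.det| *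
      ((t⁻¹ : ℝ) : ℂ) ^ (Fintype.card ι / 2 : ℂ) *
      Complex.exp ((-Real.pi / t * sqNorm ((fun i => n i - v i) ᵥ* e) : ℝ) : ℂ) := by
    intro n
    have hmap := Real.map_matrix_volume_pi_eq_smul_volume_pi he
    have hemb : MeasurableEmbedding (Matrix.toLin' e) :=
      (((Matrix.toLin' e).equivOfDetNeZero (by simpa using he)).toContinuousLinearEquiv
        |>.toHomeomorph).measurableEmbedding
    -- The substitution `x = e z` diagonalizes the Gaussian, because `(e z) (eᵀ)⁻¹ = z` as row
    -- vectors; it costs the factor `|det e|`.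
    have hcov : ∀ F : (ι → ℝ) → ℂ, ∫ x, F x = |e.det| * ∫ z, F (e *ᵥ z) := by
      intro F
      have h1 := hemb.integral_map (μ := volume) F
      rw [hmap, integral_smul_measure, ENNReal.toReal_ofReal (abs_nonneg _)] at h1
      simp only [Matrix.toLin'_apply] at h1
      rw [← h1, Complex.real_smul, ← mul_assoc, ← Complex.ofReal_mul, abs_inv,
        mul_inv_cancel₀ (abs_ne_zero.2 he), Complex.ofReal_one, one_mul]
    rw [fourierPi, hcov]
    have hz : ∀ z, (e *ᵥ z) ᵥ* E = z := by
      intro z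
      rw [← Matrix.vecMul_transpose, Matrix.vecMul_vecMul, hE, Matrix.mul_nonsing_inv _
        (by simpa using he), Matrix.vecMul_one]
    set w : ι → ℝ := (fun i => n i - v i) ᵥ* e with hw
    have hlin : ∀ z : ι → ℝ, ∑ i, (e *ᵥ z) i * (n i - v i) = ∑ j, w j * z j := by
      intro z
      have := Matrix.dotProduct_mulVec (fun i => (n i : ℝ) - v i) e z
      simpa [dotProduct, mul_comm] using this
    have hb := GaussianFourier.integral_cexp_neg_mul_sum_add (ι := ι)
      (b := ((Real.pi * t : ℝ) : ℂ)) (by simpa using hpt)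
      (fun j => -(2 * Real.pi * Complex.I) * (w j : ℂ))
    rw [mul_assoc ((|e.det| : ℝ) : ℂ)]
    refine congrArg _ ?_
    rw [show (Real.pi : ℂ) / ((Real.pi * t : ℝ) : ℂ) = ((t⁻¹ : ℝ) : ℂ) by
      push_cast; field_simp] at hb
    have hexp : (∑ j, (-(2 * Real.pi * Complex.I) * (w j : ℂ)) ^ 2) /
        (4 * ((Real.pi * t : ℝ) : ℂ)) = ((-Real.pi / t * sqNorm w : ℝ) : ℂ) := by
      have htc : (t : ℂ) ≠ 0 := by exact_mod_cast ht.ne'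
      have hpc : (Real.pi : ℂ) ≠ 0 := by exact_mod_cast Real.pi_ne_zero
      simp only [mul_pow, ← Finset.mul_sum, neg_sq, Complex.I_sq, sqNorm]
      push_cast
      field_simp
      ring
    rw [hexp] at hb
    rw [← hb]
    refine integral_congr_ae (Eventually.of_forall fun z => ?_)
    simp only [hg, hz]
    rw [← Complex.exp_add]
    congr 1
    have h2 : ∑ i, (n i : ℂ) * ((e *ᵥ z) i : ℂ) - ∑ i, ((e *ᵥ z) i : ℂ) * (v i : ℂ)
        = ∑ j, (w j : ℂ) * (z j : ℂ) := by
      rw [← Finset.sum_sub_distrib]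
      have := congrArg (fun r : ℝ => (r : ℂ)) (hlin z)
      push_cast at this
      rw [← this]
      exact Finset.sum_congr rfl fun i _ => by ring
    simp only [mul_assoc, ← Finset.mul_sum]
    rw [← h2]
    simp only [sqNorm]
    push_cast
    ring
  have hpoi := tsum_eq_tsum_fourierPi hgc hgi ?_ ?_ u
  -- Poisson summation is applied to a function of `u + k`, whereas the phase on the left involves
  -- `k` alone; the discrepancy is the constant `e^{-2πi u·v}`.
  · have hl : ∀ k : ι → ℤ, Complex.exp (((-Real.pi * t *
        sqNorm ((fun i => u i + k i) ᵥ* E) : ℝ) : ℂ) +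
        2 * Real.pi * Complex.I * ((∑ i, k i * v i : ℝ) : ℂ)) =
        Complex.exp (-(2 * Real.pi * Complex.I * ((∑ i, u i * v i : ℝ) : ℂ))) *
          g (fun i => u i + k i) := by
      intro k
      rw [hg, ← Complex.exp_add]
      congr 1
      push_cast
      simp only [add_mul, Finset.sum_add_distrib]
      ring
    simp only [hl]
    rw [tsum_mul_left, hpoi, ← tsum_mul_left, ← tsum_mul_left]
    refine tsum_congr fun n => ?_
    rw [hfour, mul_left_comm, ← Complex.exp_add, mul_assoc _ (Complex.exp _), ← Complex.exp_add]
    congr 2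
    push_cast
    simp only [sub_mul, Finset.sum_sub_distrib, mul_comm (v _ : ℂ)]
    ring
  · intro R
    refine ⟨fun k => Real.exp (Real.pi * t * c * (Fintype.card ι * R ^ 2)) *
      Real.exp (-(Real.pi * t * c / 2) * ∑ i, (k i : ℝ) ^ 2),
      (summable_gaussian_pi (by positivity)).mul_left _, fun k x hx => (hgn _).trans ?_⟩
    beta_reduce
    rw [← Real.exp_add]
    refine Real.exp_le_exp.2 ?_
    have h1 := sqNorm_add_ge x (fun i => (k i : ℝ))
    have h2 : sqNorm x ≤ Fintype.card ι * R ^ 2 := by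
      calc sqNorm x ≤ ∑ _i : ι, R ^ 2 := by
            refine Finset.sum_le_sum fun i _ => ?_
            rw [← sq_abs]
            gcongr
            exact (norm_le_pi_norm x i).trans hx
        _ = _ := by simp
    have h3 : sqNorm (fun i => (k i : ℝ)) = ∑ i, (k i : ℝ) ^ 2 := rfl
    change -(Real.pi * t * c) * sqNorm (x + fun i => (k i : ℝ)) ≤ _
    rw [← h3]
    have : 0 < Real.pi * t * c := by positivity
    nlinarith
  · simp only [hfour]
    refine Summable.mul_left _ ?_
    obtain ⟨c', hc', hcE'⟩ := exists_sqNorm_vecMul_ge he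
    refine Summable.of_norm_bounded ((summable_gaussian_pi (ι := ι)
      (c := Real.pi / t * c' / 2) (by positivity)).mul_left
        (Real.exp (Real.pi / t * c' * sqNorm v))) fun n => ?_
    rw [Complex.norm_exp_ofReal, ← Real.exp_add]
    refine Real.exp_le_exp.2 ?_
    have h1 := sqNorm_add_ge (-v) (fun i => (n i : ℝ))
    have h2 := hcE' (fun i => n i - v i)
    have h3 : sqNorm (fun i => (n i : ℝ)) = ∑ i, (n i : ℝ) ^ 2 := rfl
    have h4 : (-v + fun i => (n i : ℝ)) = fun i => n i - v i := by ext i; simp; ring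
    have h5 : sqNorm (-v) = sqNorm v := by simp [sqNorm]
    rw [h4, h5] at h1
    rw [← h3]
    have h6 : 0 < Real.pi / t := by positivity
    have h7 : -Real.pi / t = -(Real.pi / t) := by ring
    rw [h7]
    nlinarith [mul_le_mul_of_nonneg_left h2 h6.le, mul_le_mul_of_nonneg_left h1
      (mul_pos h6 hc').le]

end Poisson

/-! ### Holomorphic dependence on parameters and meromorphic continuation -/

/-- For holomorphic integrands a dominating function for the values suffices: Cauchy's estimate on a
circle of radius one dominates the derivative by the same function. The margin 2 in the radius is
one for the ball around the point and one for the circle. -/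
theorem differentiable_integral_of_locally_bounded {α : Type*} [MeasurableSpace α] {μ : Measure α}
    {F : ℂ → α → ℂ} (hm : ∀ s, AEStronglyMeasurable (F s) μ)
    (hd : ∀ᵐ a ∂μ, Differentiable ℂ fun s => F s a)
    (hb : ∀ r : ℝ, ∃ bound : α → ℝ, Integrable bound μ ∧
      ∀ᵐ a ∂μ, ∀ s, ‖s‖ ≤ r → ‖F s a‖ ≤ bound a) :
    Differentiable ℂ fun s => ∫ a, F s a ∂μ := by
  intro s0
  obtain ⟨bound, hbi, hbb⟩ := hb (‖s0‖ + 2)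
  -- Measurability of the derivative is not assumed; it is a limit of difference quotients along the
  -- steps `1 / (n + 1)`.
  have hder : AEStronglyMeasurable (fun a => deriv (fun s => F s a) s0) μ := by
    refine aestronglyMeasurable_of_tendsto_ae atTop
      (f := fun (n : ℕ) a => ((n : ℂ) + 1) * (F (s0 + 1 / ((n : ℂ) + 1)) a - F s0 a))
      (fun n => ((hm _).sub (hm _)).const_mul _) ?_
    filter_upwards [hd] with a ha
    have h1 := (ha s0).hasDerivAt.tendsto_slope
    have h2 : Tendsto (fun n : ℕ => s0 + 1 / ((n : ℂ) + 1)) atTop (𝓝[≠] s0) := by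
      refine tendsto_nhdsWithin_iff.2 ⟨?_, Eventually.of_forall fun n => ?_⟩
      · have := (tendsto_one_div_add_atTop_nhds_zero_nat (𝕜 := ℂ)).const_add s0
        simpa using this
      · have : (n : ℂ) + 1 ≠ 0 := by exact_mod_cast n.succ_ne_zero
        simp [this]
    refine (h1.comp h2).congr fun n => ?_
    simp [slope_def_field]
    ring
  refine (hasDerivAt_integral_of_dominated_loc_of_deriv_le (s := Metric.ball s0 1)
    (F' := fun s a => deriv (fun s => F s a) s) (bound := bound)
    (Metric.ball_mem_nhds s0 one_pos) (Eventually.of_forall hm) ?_ hder ?_ hbi ?_).2.differentiableAt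
  · refine hbi.mono' (hm s0) ?_
    filter_upwards [hbb] with a ha using ha s0 (by linarith)
  · filter_upwards [hbb, hd] with a ha hda s hs
    have := Complex.norm_deriv_le_of_forall_mem_sphere_norm_le (f := fun s => F s a) (c := s)
      (R := 1) (C := bound a) one_pos hda.diffContOnCl fun z hz => ha z ?_
    · simpa using this
    · rw [mem_sphere_iff_norm] at hz
      rw [Metric.mem_ball, dist_eq_norm] at hs
      have : z = (z - s) + (s - s0) + s0 := by ring
      rw [this]
      refine (norm_add_le _ _).trans ?_
      have := norm_add_le (z - s) (s - s0)
      linarith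
  · filter_upwards [hd] with a ha s _ using (ha s).hasDerivAt

/-- The difference vanishes on a half plane, so its order is infinite at one point and then, by
connectedness, at every point. Two functions in normal form which agree near a point, except
possibly at it, agree there too. -/
theorem isMeroCont_unique {f : ℂ → ℂ} {σ : ℝ} {F G : ℂ → ℂ} (hF : IsMeroCont f σ F)
    (hG : IsMeroCont f σ G) : F = G := by
  have hFm : MeromorphicOn F Set.univ := hF.1.meromorphicOn
  have hGm : MeromorphicOn G Set.univ := hG.1.meromorphicOn
  have hsub : MeromorphicOn (F - G) Set.univ := hFm.sub hGm
  have htop : ∀ s : ℂ, meromorphicOrderAt (F - G) s = ⊤ := by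
    by_contra hne
    push Not at hne
    obtain ⟨s, hs⟩ := hne
    have := hsub.meromorphicOrderAt_ne_top_of_isPreconnected (x := s) (y := ((σ + 1 : ℝ) : ℂ))
      isPreconnected_univ trivial trivial hs
    apply this
    rw [meromorphicOrderAt_eq_top_iff]
    refine Filter.Eventually.filter_mono nhdsWithin_le_nhds ?_
    have : {z : ℂ | σ < z.re} ∈ 𝓝 ((σ + 1 : ℝ) : ℂ) :=
      (isOpen_lt continuous_const Complex.continuous_re).mem_nhds (by simp)
    filter_upwards [this] with z hz
    rw [Pi.sub_apply, hF.2 z hz, hG.2 z hz, sub_self]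
  funext s
  have h1 : F =ᶠ[𝓝[≠] s] G := by
    have := meromorphicOrderAt_eq_top_iff.1 (htop s)
    filter_upwards [this] with z hz
    exact sub_eq_zero.1 hz
  exact ((MeromorphicNFAt.eventuallyEq_nhdsNE_iff_eventuallyEq_nhds (hF.1 trivial)
    (hG.1 trivial)).1 h1).self_of_nhds

/-- The meromorphic continuation of a quotient of entire functions. -/
theorem meroCont_quotient {f : ℂ → ℂ} {σ : ℝ} {A D : ℂ → ℂ} (hA : Differentiable ℂ A)
    (hD : Differentiable ℂ D) (hf : ∀ s : ℂ, σ < s.re → D s ≠ 0 ∧ f s = A s / D s) :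
    IsMeroCont f σ (meroCont f σ) ∧
      ∀ s, D s ≠ 0 → AnalyticAt ℂ (meroCont f σ) s ∧ meroCont f σ s = A s / D s := by
  set G : ℂ → ℂ := fun s => A s / D s with hG
  have hGm : MeromorphicOn G Set.univ := fun s _ =>
    (hA.analyticAt s).meromorphicAt.div (hD.analyticAt s).meromorphicAt
  have hGan : ∀ s, D s ≠ 0 → AnalyticAt ℂ G s := fun s hs =>
    (hA.analyticAt s).div (hD.analyticAt s) hs
  -- Passing to the normal form can change the quotient only at zeros of `D`, where division by zero
  -- gave an arbitrary value.
  set F := toMeromorphicNFOn G Set.univ with hF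
  have hFG : ∀ s, D s ≠ 0 → F s = G s := by
    intro s hs
    rw [hF, toMeromorphicNFOn_eq_toMeromorphicNFAt hGm trivial,
      toMeromorphicNFAt_eq_self.2 (hGan s hs).meromorphicNFAt]
  have hcont : IsMeroCont f σ F :=
    ⟨meromorphicNFOn_toMeromorphicNFOn G Set.univ, fun s hs => by
      rw [hFG s (hf s hs).1, (hf s hs).2]⟩
  have hex : ∃ F, IsMeroCont f σ F := ⟨F, hcont⟩
  have hmc : IsMeroCont f σ (meroCont f σ) := by
    rw [meroCont, dif_pos hex]
    exact hex.choose_spec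
  have heq := isMeroCont_unique hmc hcont
  refine ⟨hmc, fun s hs => ?_⟩
  rw [heq]
  refine ⟨(hGan s hs).congr ?_, hFG s hs⟩
  filter_upwards [(hD.continuous.isOpen_preimage _ isOpen_compl_singleton).mem_nhds hs] with z hz
  exact (hFG z hz).symm

/-- Zero sets of entire functions which do not vanish identically. -/
theorem compl_zeros_mem_codiscrete {D : ℂ → ℂ} (hD : Differentiable ℂ D) {s₀ : ℂ} (h : D s₀ ≠ 0) :
    {s | D s = 0}ᶜ ∈ Filter.codiscrete ℂ := by
  have han : AnalyticOnNhd ℂ D Set.univ := fun s _ => hD.analyticAt s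
  have := han.preimage_zero_mem_codiscrete (x := s₀) h
  exact this

/-- The zeros of a nontrivial entire function form a discrete, hence countable, set, and the
complement of a countable set in a real vector space of dimension two is connected. The identity
theorem therefore carries an equality from a half plane to the whole complement. -/
theorem eq_of_differentiableOn_compl_zeros {D : ℂ → ℂ} (hD : Differentiable ℂ D) {f g : ℂ → ℂ}
    (hf : ∀ s, D s ≠ 0 → DifferentiableAt ℂ f s) (hg : ∀ s, D s ≠ 0 → DifferentiableAt ℂ g s)
    {σ : ℝ} (h0 : ∀ s : ℂ, σ < s.re → D s ≠ 0) (h : ∀ s : ℂ, σ < s.re → f s = g s) (s : ℂ)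
    (hs : D s ≠ 0) : f s = g s := by
  have hz := compl_zeros_mem_codiscrete hD hs
  have hcount : {s | D s = 0}.Countable := by
    have h1 : IsDiscrete {s | D s = 0} := by simpa using (mem_codiscrete'.mp hz).2
    exact (HereditarilyLindelofSpace.isLindelof _).countable_of_isDiscrete h1
  have hconn := hcount.isConnected_compl_of_one_lt_rank (by simp [Complex.rank_real_complex])
  have hopen : IsOpen {s | D s = 0}ᶜ := by
    have : IsClosed {s | D s = 0} := isClosed_eq hD.continuous continuous_const
    exact this.isOpen_compl
  have hfa : AnalyticOnNhd ℂ f {s | D s = 0}ᶜ :=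
    DifferentiableOn.analyticOnNhd (fun z hz => (hf z hz).differentiableWithinAt) hopen
  have hga : AnalyticOnNhd ℂ g {s | D s = 0}ᶜ :=
    DifferentiableOn.analyticOnNhd (fun z hz => (hg z hz).differentiableWithinAt) hopen
  refine hfa.eqOn_of_preconnected_of_eventuallyEq hga hconn.isPreconnected
    (z₀ := ((σ + 1 : ℝ) : ℂ)) (h0 _ (by simp)) ?_ hs
  have : {z : ℂ | σ < z.re} ∈ 𝓝 ((σ + 1 : ℝ) : ℂ) :=
    (isOpen_lt continuous_const Complex.continuous_re).mem_nhds (by simp)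
  filter_upwards [this] with z hz using h z hz

/-! ### Measurability of sums of series. -/

theorem measurable_tsum_of_summable {α ι E : Type*} [MeasurableSpace α] [Countable ι]
    [NormedAddCommGroup E] [MeasurableSpace E] [BorelSpace E] [SecondCountableTopology E]
    {f : ι → α → E} (hf : ∀ i, Measurable (f i)) (hs : ∀ a, Summable fun i => f i a) :
    Measurable fun a => ∑' i, f i a := by
  refine measurable_of_tendsto_metrizable' (atTop : Filter (Finset ι))
    (f := fun (s : Finset ι) a => ∑ i ∈ s, f i a)
    (fun s => Finset.measurable_fun_sum s fun i _ => hf i) ?_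
  rw [tendsto_pi_nhds]
  exact fun a => (hs a).hasSum

theorem measurable_indicator_tsum {α ι E : Type*} [MeasurableSpace α] [Countable ι]
    [NormedAddCommGroup E] [MeasurableSpace E] [BorelSpace E] [SecondCountableTopology E]
    {f : ι → α → E} {S : Set α} (hS : MeasurableSet S) (hf : ∀ i, Measurable (f i))
    (hs : ∀ a ∈ S, Summable fun i => f i a) :
    Measurable (S.indicator fun a => ∑' i, f i a) := by
  have := measurable_tsum_of_summable (f := fun i => S.indicator (f i))
    (fun i => (hf i).indicator hS) fun a => by
      by_cases ha : a ∈ S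
      · simpa [ha] using hs a ha
      · simp [ha]
  convert this using 1
  funext a
  by_cases ha : a ∈ S <;> simp [ha]

/-- One-dimensional Poisson summation for Gaussians. -/
theorem tsum_int_gaussian_poisson {t : ℝ} (ht : 0 < t) (u v : ℝ) :
    ∑' k : ℤ, Complex.exp (((-Real.pi * t * (k + u) ^ 2 : ℝ) : ℂ) +
        2 * Real.pi * Complex.I * ((k * v : ℝ) : ℂ)) =
      (((√t)⁻¹ : ℝ) : ℂ) * ∑' l : ℤ, Complex.exp (((-Real.pi / t * (l - v) ^ 2 : ℝ) : ℂ) +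
          2 * Real.pi * Complex.I * (((l - v) * u : ℝ) : ℂ)) := by
  have h := Complex.tsum_exp_neg_quadratic (a := t) (by simpa using ht) (-(t * u) + Complex.I * v)
  have htc : (t : ℂ) ≠ 0 := by exact_mod_cast ht.ne'
  have hsq : (((√t)⁻¹ : ℝ) : ℂ) = 1 / (t : ℂ) ^ (1 / 2 : ℂ) := by
    rw [Real.sqrt_eq_rpow, Complex.ofReal_inv, Complex.ofReal_cpow ht.le]
    simp
  have hl : ∀ k : ℤ, Complex.exp (((-Real.pi * t * (k + u) ^ 2 : ℝ) : ℂ) +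
        2 * Real.pi * Complex.I * ((k * v : ℝ) : ℂ)) = Complex.exp (-Real.pi * t * u ^ 2) *
      Complex.exp (-Real.pi * t * (k : ℂ) ^ 2 +
        2 * Real.pi * (-(t * u) + Complex.I * v) * (k : ℂ)) := by
    intro k
    rw [← Complex.exp_add]
    congr 1
    push_cast
    ring
  simp only [hl]
  rw [tsum_mul_left, h, hsq, ← tsum_mul_left, ← tsum_mul_left, ← tsum_mul_left]
  refine tsum_congr fun l => ?_
  rw [mul_left_comm, ← Complex.exp_add]
  congr 2
  have hb : Complex.I * (-((t : ℂ) * u) + Complex.I * v) = -v - Complex.I * (t * u) := by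
    linear_combination v * Complex.I_sq
  rw [hb]
  push_cast
  field_simp
  linear_combination (-(t : ℂ) ^ 2 * u ^ 2) * Complex.I_sq

theorem norm_cexp_add_two_pi_I (a b : ℝ) :
    ‖Complex.exp ((a : ℂ) + 2 * Real.pi * Complex.I * (b : ℂ))‖ = Real.exp a := by
  have : (2 * Real.pi * Complex.I * (b : ℂ)).re = 0 := by simp
  rw [Complex.norm_exp, Complex.add_re, Complex.ofReal_re, this, add_zero]

/-! ### The Epstein theta function and the continuation of the `SL(2)` Eisenstein series -/

/-- The binary quadratic form attached to a point of the upper half plane. -/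
noncomputable def epsteinQ (τ : ℍ) (p : ℤ × ℤ) : ℝ := ‖(p.2 : ℂ) * τ + (p.1 : ℂ)‖ ^ 2 / τ.im

theorem epsteinQ_eq (τ : ℍ) (p : ℤ × ℤ) :
    epsteinQ τ p = ((p.1 + p.2 * τ.re) ^ 2 + (p.2 * τ.im) ^ 2) / τ.im := by
  rw [epsteinQ, ← Complex.normSq_eq_norm_sq, Complex.normSq_apply]
  simp
  ring

/-- A lower bound for the smallest eigenvalue of the form `epsteinQ τ`. -/
noncomputable def epsteinMin (τ : ℍ) : ℝ := τ.im / (2 * τ.im ^ 2 + 2 * τ.re ^ 2 + 1)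

theorem epsteinMin_pos (τ : ℍ) : 0 < epsteinMin τ := by
  have := τ.im_pos
  unfold epsteinMin; positivity

theorem epsteinQ_ge (τ : ℍ) (p : ℤ × ℤ) :
    epsteinMin τ * ((p.1 : ℝ) ^ 2 + (p.2 : ℝ) ^ 2) ≤ epsteinQ τ p := by
  have hv := τ.im_pos
  rw [epsteinQ_eq, epsteinMin, div_mul_eq_mul_div, div_le_div_iff₀ (by positivity) hv]
  set a : ℝ := (p.1 : ℝ)
  set b : ℝ := (p.2 : ℝ)
  set u := τ.re
  set v := τ.im
  have h1 : a ^ 2 ≤ 2 * (a + b * u) ^ 2 + 2 * (b * u) ^ 2 := by nlinarith [sq_nonneg (a + 2 * (b * u))]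
  have h2 := mul_le_mul_of_nonneg_left h1 (sq_nonneg v)
  nlinarith [sq_nonneg ((a + b * u) * u), sq_nonneg (b * v * v), sq_nonneg (a + b * u)]

theorem epsteinQ_nonneg (τ : ℍ) (p : ℤ × ℤ) : 0 ≤ epsteinQ τ p := by
  have := τ.im_pos
  unfold epsteinQ; positivity

theorem one_le_sq_add_sq {p : ℤ × ℤ} (hp : p ≠ 0) : (1 : ℝ) ≤ (p.1 : ℝ) ^ 2 + (p.2 : ℝ) ^ 2 := by
  have : 1 ≤ p.1 ^ 2 + p.2 ^ 2 := by
    by_contra h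
    have h1 := sq_nonneg p.1
    have h2 := sq_nonneg p.2
    exact hp (Prod.ext (pow_eq_zero_iff two_ne_zero |>.1 (by omega))
      (pow_eq_zero_iff two_ne_zero |>.1 (by omega)))
  exact_mod_cast this

theorem epsteinQ_pos (τ : ℍ) {p : ℤ × ℤ} (hp : p ≠ 0) : 0 < epsteinQ τ p :=
  lt_of_lt_of_le (mul_pos (epsteinMin_pos τ) (by linarith [one_le_sq_add_sq hp]))
    (epsteinQ_ge τ p)

theorem summable_exp_neg_epstein (τ : ℍ) {x : ℝ} (hx : 0 < x) :
    Summable fun p : ℤ × ℤ => Real.exp (-Real.pi * epsteinQ τ p * x) := by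
  have hc : 0 < Real.pi * epsteinMin τ * x :=
    mul_pos (mul_pos Real.pi_pos (epsteinMin_pos τ)) hx
  have h := (summable_exp_neg_mul_int_sq hc).mul_of_nonneg (summable_exp_neg_mul_int_sq hc)
    (fun k => (Real.exp_pos _).le) (fun k => (Real.exp_pos _).le)
  refine h.of_nonneg_of_le (fun p => (Real.exp_pos _).le) fun p => ?_
  rw [← Real.exp_add]
  refine Real.exp_le_exp.2 ?_
  have := mul_le_mul_of_nonneg_left (epsteinQ_ge τ p) (mul_pos Real.pi_pos hx).le
  nlinarith

/-- The theta function `∑ exp (-π x |n τ + m|² / Im τ)`. -/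
noncomputable def epsteinTheta (τ : ℍ) (x : ℝ) : ℝ :=
  ∑' p : ℤ × ℤ, Real.exp (-Real.pi * epsteinQ τ p * x)

theorem hasSum_epsteinTheta_sub_one (τ : ℍ) {x : ℝ} (hx : 0 < x) :
    HasSum (fun p : {p : ℤ × ℤ // p ≠ 0} => Real.exp (-Real.pi * epsteinQ τ p * x))
      (epsteinTheta τ x - 1) := by
  have h := (summable_exp_neg_epstein τ hx).hasSum
  have h1 := (hasSum_ite_eq (0 : ℤ × ℤ) (1 : ℝ))
  have h2 := h.sub h1
  rw [← hasSum_subtype_iff_of_support_subset (s := {p : ℤ × ℤ | p ≠ 0})] at h2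
  · refine h2.congr_fun fun p => ?_
    have : (p : ℤ × ℤ) ≠ 0 := p.2
    simp [this]
  · intro p hp hp0
    subst hp0
    simp [epsteinQ] at hp

theorem summable_int_prod_one_add_rpow {r : ℝ} (hr : r < -1) :
    Summable fun p : ℤ × ℤ => (1 + ((p.1 : ℝ) ^ 2 + (p.2 : ℝ) ^ 2)) ^ r := by
  have h := summable_pi_one_add_sq_rpow (ι := Fin 2) (r := r) (by simp; linarith) (by simp)
  rw [← (finTwoArrowEquiv ℤ).symm.summable_iff] at h
  simpa [Function.comp_def, Fin.sum_univ_two] using h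

/-- The inequality `e^{-t} ≤ k! / t^k` turns each Gaussian into a power of the norm of the pair,
summable over `ℤ²` once `k ≥ 2`. What matters later is that `τ` enters only through a power of
`(epsteinMin τ)⁻¹`, which grows polynomially towards the cusps. -/
theorem exists_epsteinTheta_sub_one_le (k : ℕ) (hk : 2 ≤ k) :
    ∃ C : ℝ, 0 ≤ C ∧ ∀ τ x, 0 < x → |epsteinTheta τ x - 1| ≤ C * (epsteinMin τ)⁻¹ ^ k * (x ^ k)⁻¹ := by
  set S := ∑' p : ℤ × ℤ, (1 + ((p.1 : ℝ) ^ 2 + (p.2 : ℝ) ^ 2)) ^ (-(k : ℝ)) with hS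
  have hk' : (2 : ℝ) ≤ k := by exact_mod_cast hk
  have hsum := summable_int_prod_one_add_rpow (r := -(k : ℝ)) (by linarith)
  have hS0 : 0 ≤ S := tsum_nonneg fun p => by positivity
  refine ⟨k.factorial * 2 ^ k * S, by positivity, fun τ x hx => ?_⟩
  have h := hasSum_epsteinTheta_sub_one τ hx
  have hnn : 0 ≤ epsteinTheta τ x - 1 := h.nonneg fun p => (Real.exp_pos _).le
  rw [abs_of_nonneg hnn]
  have hm := epsteinMin_pos τ
  have hterm : ∀ p : {p : ℤ × ℤ // p ≠ 0}, Real.exp (-Real.pi * epsteinQ τ p * x) ≤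
      (k.factorial * 2 ^ k * (epsteinMin τ)⁻¹ ^ k * (x ^ k)⁻¹) *
        (1 + ((p.1.1 : ℝ) ^ 2 + (p.1.2 : ℝ) ^ 2)) ^ (-(k : ℝ)) := by
    intro p
    set n : ℝ := (p.1.1 : ℝ) ^ 2 + (p.1.2 : ℝ) ^ 2 with hn
    have hn1 : 1 ≤ n := one_le_sq_add_sq p.2
    have hQ := epsteinQ_ge τ p.1
    have hpi : (1 : ℝ) ≤ Real.pi := by linarith [Real.pi_gt_three]
    set t := epsteinMin τ * x * n with ht
    have ht0 : 0 < t := by positivity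
    have h1 : Real.exp (-Real.pi * epsteinQ τ p * x) ≤ Real.exp (-t) := by
      refine Real.exp_le_exp.2 ?_
      have hQ0 := epsteinQ_nonneg τ p.1
      have h3 : t ≤ epsteinQ τ p.1 * x := by nlinarith
      nlinarith [mul_nonneg hQ0 hx.le]
    have h2 := Real.pow_div_factorial_le_exp t ht0.le k
    have hf : (0 : ℝ) < k.factorial := by exact_mod_cast k.factorial_pos
    calc Real.exp (-Real.pi * epsteinQ τ p * x) ≤ Real.exp (-t) := h1
      _ ≤ k.factorial / t ^ k := by
          rw [Real.exp_neg, inv_le_comm₀ (Real.exp_pos _) (by positivity), inv_div]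
          exact h2
      _ = k.factorial * ((epsteinMin τ)⁻¹ ^ k * (x ^ k)⁻¹) * (n ^ k)⁻¹ := by
          rw [ht, mul_pow, mul_pow, inv_pow]; field_simp
      _ ≤ k.factorial * ((epsteinMin τ)⁻¹ ^ k * (x ^ k)⁻¹) * (2 ^ k * ((1 + n) ^ k)⁻¹) := by
          gcongr
          rw [← div_eq_mul_inv, le_div_iff₀ (by positivity), ← inv_pow, ← mul_pow]
          gcongr
          rw [inv_mul_le_iff₀ (by linarith)]; linarith
      _ = _ := by rw [Real.rpow_neg (by positivity), Real.rpow_natCast]; ring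
  calc epsteinTheta τ x - 1
      = ∑' p : {p : ℤ × ℤ // p ≠ 0}, Real.exp (-Real.pi * epsteinQ τ p * x) := h.tsum_eq.symm
    _ ≤ ∑' p : {p : ℤ × ℤ // p ≠ 0}, (k.factorial * 2 ^ k * (epsteinMin τ)⁻¹ ^ k * (x ^ k)⁻¹) *
        (1 + ((p.1.1 : ℝ) ^ 2 + (p.1.2 : ℝ) ^ 2)) ^ (-(k : ℝ)) :=
        h.summable.tsum_le_tsum hterm ((hsum.subtype _).mul_left _)
    _ ≤ (k.factorial * 2 ^ k * (epsteinMin τ)⁻¹ ^ k * (x ^ k)⁻¹) * S := by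
        rw [tsum_mul_left]
        gcongr
        exact hsum.tsum_subtype_le _ _ (fun p => by positivity)
    _ = _ := by ring

/-- The theta function after Poisson summation in one of the two variables. -/
theorem epsteinTheta_eq_poisson (τ : ℍ) {x : ℝ} (hx : 0 < x) :
    (epsteinTheta τ x : ℂ) = (√(τ.im / x) : ℝ) * ∑' p : ℤ × ℤ,
      Complex.exp (((-Real.pi * τ.im * (x * p.1 ^ 2 + p.2 ^ 2 / x) : ℝ) : ℂ) +
        2 * Real.pi * Complex.I * ((p.1 * p.2 * τ.re : ℝ) : ℂ)) := by
  have hv := τ.im_pos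
  have hs := summable_exp_neg_epstein τ hx
  have hsc : Summable fun p : ℤ × ℤ => ((Real.exp (-Real.pi * epsteinQ τ p * x) : ℝ) : ℂ) := by
    exact_mod_cast hs
  have hs2 : Summable fun p : ℤ × ℤ =>
      Complex.exp (((-Real.pi * τ.im * (x * p.1 ^ 2 + p.2 ^ 2 / x) : ℝ) : ℂ) +
        2 * Real.pi * Complex.I * ((p.1 * p.2 * τ.re : ℝ) : ℂ)) := by
    have h := (summable_exp_neg_mul_int_sq (c := Real.pi * τ.im * x) (by positivity)).mul_of_nonneg
      (summable_exp_neg_mul_int_sq (c := Real.pi * τ.im / x) (by positivity))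
      (fun k => (Real.exp_pos _).le) (fun k => (Real.exp_pos _).le)
    refine Summable.of_norm_bounded h fun p => ?_
    rw [norm_cexp_add_two_pi_I, ← Real.exp_add]
    exact Real.exp_le_exp.2 (le_of_eq (by ring))
  rw [epsteinTheta, Complex.ofReal_tsum, hs2.tsum_prod, hsc.tsum_prod, ← tsum_mul_left]
  rw [← hsc.tsum_prod, ← (Equiv.prodComm ℤ ℤ).tsum_eq, Summable.tsum_prod]
  · refine tsum_congr fun b => ?_
    have h := tsum_int_gaussian_poisson (t := x / τ.im) (by positivity) (b * τ.re) 0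
    have hl : ∀ k : ℤ, ((Real.exp (-Real.pi * epsteinQ τ (Equiv.prodComm ℤ ℤ (b, k)) * x) : ℝ) : ℂ)
        = Complex.exp ((-Real.pi * x * τ.im * b ^ 2 : ℝ) : ℂ) *
          Complex.exp (((-Real.pi * (x / τ.im) * (k + b * τ.re) ^ 2 : ℝ) : ℂ) +
        2 * Real.pi * Complex.I * ((k * 0 : ℝ) : ℂ)) := by
      intro k
      rw [Complex.ofReal_exp, ← Complex.exp_add, epsteinQ_eq]
      congr 1
      have : (τ.im : ℂ) ≠ 0 := by exact_mod_cast hv.ne'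
      simp
      field_simp
      ring
    simp only [hl]
    rw [tsum_mul_left, h, ← tsum_mul_left, ← tsum_mul_left, ← tsum_mul_left]
    refine tsum_congr fun k => ?_
    rw [mul_left_comm, ← Complex.exp_add, ← Real.sqrt_inv, inv_div]
    congr 2
    have hx' : (x : ℂ) ≠ 0 := by exact_mod_cast hx.ne'
    push_cast
    field_simp
    ring
  · exact (Equiv.prodComm ℤ ℤ).summable_iff.2 hsc

/-- After Poisson summation in one variable the double sum is symmetric under `x ↦ 1/x` together
with the exchange of its two indices; only the factor `√(τ.im / x)` changes. -/
theorem epsteinTheta_one_div (τ : ℍ) {x : ℝ} (hx : 0 < x) :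
    epsteinTheta τ (1 / x) = x * epsteinTheta τ x := by
  have h1 := epsteinTheta_eq_poisson τ (one_div_pos.2 hx)
  have h2 := epsteinTheta_eq_poisson τ hx
  have hv := τ.im_pos
  have : ((epsteinTheta τ (1 / x) : ℝ) : ℂ) = ((x * epsteinTheta τ x : ℝ) : ℂ) := by
    rw [Complex.ofReal_mul, h1, h2, ← mul_assoc, ← Complex.ofReal_mul]
    congr 1
    · congr 1
      rw [div_div_eq_mul_div, div_one, show τ.im * x = x ^ 2 * (τ.im / x) by field_simp,
        Real.sqrt_mul (sq_nonneg x), Real.sqrt_sq hx.le]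
    · rw [← (Equiv.prodComm ℤ ℤ).tsum_eq]
      refine tsum_congr fun p => ?_
      congr 1
      have hx' : (x : ℂ) ≠ 0 := by exact_mod_cast hx.ne'
      simp
      field_simp
      ring
  exact_mod_cast this

theorem continuousOn_epsteinTheta (τ : ℍ) : ContinuousOn (epsteinTheta τ) (Set.Ioi 0) := by
  intro x hx
  have hx' : 0 < x := hx
  have : ContinuousOn (epsteinTheta τ) (Set.Ioi (x / 2)) := by
    refine continuousOn_tsum (fun p => by fun_prop)
      (summable_exp_neg_epstein τ (half_pos hx')) fun p y hy => ?_
    rw [Real.norm_of_nonneg (Real.exp_pos _).le]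
    refine Real.exp_le_exp.2 ?_
    have := mul_le_mul_of_nonneg_left (le_of_lt (show x / 2 < y from hy))
      (mul_nonneg Real.pi_pos.le (epsteinQ_nonneg τ p))
    linarith
  exact (this.continuousAt (Ioi_mem_nhds (half_lt_self hx'))).continuousWithinAt

theorem isBigO_epsteinTheta_sub_one (τ : ℍ) (r : ℝ) :
    (fun x => (epsteinTheta τ x : ℂ) - 1) =O[atTop] (fun x : ℝ => x ^ r) := by
  obtain ⟨k, hk⟩ := exists_nat_ge (max 2 (-r))
  obtain ⟨C, hC, h⟩ := exists_epsteinTheta_sub_one_le k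
    (by exact_mod_cast (le_max_left _ _).trans hk)
  refine Asymptotics.IsBigO.of_bound (C * (epsteinMin τ)⁻¹ ^ k) ?_
  filter_upwards [eventually_ge_atTop 1] with x hx
  have hx0 : 0 < x := by linarith
  rw [← Complex.ofReal_one, ← Complex.ofReal_sub, Complex.norm_real, Real.norm_eq_abs,
    Real.norm_of_nonneg (by positivity)]
  refine (h τ x hx0).trans ?_
  gcongr
  · have := epsteinMin_pos τ; positivity
  · rw [← Real.rpow_natCast, ← Real.rpow_neg hx0.le]
    exact Real.rpow_le_rpow_of_exponent_le hx (by linarith [(le_max_right _ _).trans hk])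

/-- The functional equation data of the Epstein theta function. -/
noncomputable def epsteinPair (τ : ℍ) : WeakFEPair ℂ where
  f x := (epsteinTheta τ x : ℂ)
  g x := (epsteinTheta τ x : ℂ)
  k := 1
  ε := 1
  f₀ := 1
  g₀ := 1
  hf_int := (Complex.continuous_ofReal.comp_continuousOn
    (continuousOn_epsteinTheta τ)).locallyIntegrableOn measurableSet_Ioi
  hg_int := (Complex.continuous_ofReal.comp_continuousOn
    (continuousOn_epsteinTheta τ)).locallyIntegrableOn measurableSet_Ioi
  hk := one_pos
  hε := one_ne_zero
  h_feq x hx := by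
    rw [epsteinTheta_one_div τ hx]; simp
  hf_top := isBigO_epsteinTheta_sub_one τ
  hg_top := isBigO_epsteinTheta_sub_one τ

/-- The entire part of the completed Epstein zeta function. -/
noncomputable def epsteinEntire (w : ℂ) (τ : ℍ) : ℂ := (epsteinPair τ).Λ₀ w

/-- The function whose Mellin transform is the entire part of the completed Epstein zeta
function. -/
noncomputable def epsteinKernel (τ : ℍ) (x : ℝ) : ℂ :=
  (Set.Ioi 1).indicator (fun x => (epsteinTheta τ x : ℂ) - 1) x +
    (Set.Ioo 0 1).indicator (fun x => (epsteinTheta τ x : ℂ) - (x : ℂ)⁻¹) x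

theorem epsteinEntire_eq (w : ℂ) (τ : ℍ) :
    epsteinEntire w τ = ∫ x in Set.Ioi (0 : ℝ), (x : ℂ) ^ (w - 1) * epsteinKernel τ x := by
  rw [epsteinEntire, WeakFEPair.Λ₀, mellin]
  refine setIntegral_congr_fun measurableSet_Ioi fun x hx => ?_
  simp only [smul_eq_mul, WeakFEPair.f_modif, epsteinPair, epsteinKernel, Pi.add_apply, one_mul,
    mul_one]
  simp [Real.rpow_neg_one]

/-- Near zero the functional equation rewrites `θ(x) - x⁻¹` as `x⁻¹ (θ(1/x) - 1)`, so decay of order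
`k` at infinity becomes vanishing of order `k - 1` at zero. -/
theorem exists_norm_epsteinKernel_le (k : ℕ) (hk : 2 ≤ k) :
    ∃ C : ℝ, 0 ≤ C ∧ ∀ τ x, 0 < x → ‖epsteinKernel τ x‖ ≤ C * (epsteinMin τ)⁻¹ ^ k *
      ((Set.Ioi 1).indicator (fun x => (x ^ k)⁻¹) x +
        (Set.Ioo 0 1).indicator (fun x => x ^ (k - 1)) x) := by
  obtain ⟨C, hC, h⟩ := exists_epsteinTheta_sub_one_le k hk
  refine ⟨C, hC, fun τ x hx => ?_⟩
  by_cases h1 : 1 < x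
  · rw [epsteinKernel, Set.indicator_of_mem (Set.mem_Ioi.2 h1), Set.indicator_of_notMem (by simp [h1.le]),
      Set.indicator_of_mem (Set.mem_Ioi.2 h1), Set.indicator_of_notMem (by simp [h1.le]), add_zero, add_zero,
      ← Complex.ofReal_one, ← Complex.ofReal_sub, Complex.norm_real]
    exact h τ x hx
  · rcases (not_lt.1 h1).lt_or_eq with h2 | rfl
    · have hm : x ∈ Set.Ioo (0 : ℝ) 1 := ⟨hx, h2⟩
      rw [epsteinKernel, Set.indicator_of_notMem (by simp [h2.le]), Set.indicator_of_mem hm,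
        Set.indicator_of_notMem (by simp [h2.le]), Set.indicator_of_mem hm, zero_add, zero_add,
        ← Complex.ofReal_inv, ← Complex.ofReal_sub, Complex.norm_real]
      have h3 := epsteinTheta_one_div τ (one_div_pos.2 hx)
      rw [one_div_one_div] at h3
      have h4 : epsteinTheta τ x - x⁻¹ = x⁻¹ * (epsteinTheta τ (1 / x) - 1) := by
        rw [h3]; ring
      rw [h4, Real.norm_eq_abs, abs_mul, abs_of_pos (inv_pos.2 hx)]
      calc x⁻¹ * |epsteinTheta τ (1 / x) - 1|
          ≤ x⁻¹ * (C * (epsteinMin τ)⁻¹ ^ k * ((1 / x) ^ k)⁻¹) := by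
            gcongr; exact h τ _ (one_div_pos.2 hx)
        _ = C * (epsteinMin τ)⁻¹ ^ k * (x⁻¹ * x ^ k) := by rw [one_div, inv_pow x, inv_inv]; ring
        _ = _ := by
            obtain ⟨j, rfl⟩ : ∃ j, k = j + 1 := ⟨k - 1, by omega⟩
            rw [pow_succ' x, inv_mul_cancel_left₀ hx.ne', Nat.add_sub_cancel]
    · simp [epsteinKernel]

theorem integrableOn_epstein_bound {r : ℝ} {k : ℕ} (hk : r + 2 ≤ k) (hr : 0 ≤ r) :
    IntegrableOn (fun x : ℝ => (x ^ (r + 1) + x ^ (-r - 1)) *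
      ((Set.Ioi 1).indicator (fun x => (x ^ (k + 2))⁻¹) x +
        (Set.Ioo 0 1).indicator (fun x => x ^ (k + 2 - 1)) x)) (Set.Ioi 0) := by
  have h1 : IntegrableOn (fun x : ℝ => (2 : ℝ) * x ^ (-2 : ℝ)) (Set.Ioi 1) :=
    (integrableOn_Ioi_rpow_of_lt (by norm_num) one_pos).const_mul 2
  have h2 : IntegrableOn (fun _ : ℝ => (2 : ℝ)) (Set.Ioo 0 1) := by simp
  refine (((h1.integrable_indicator measurableSet_Ioi).add
    (h2.integrable_indicator measurableSet_Ioo)).integrableOn (s := Set.Ioi 0)).mono' ?_ ?_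
  · refine Measurable.aestronglyMeasurable ?_
    refine Measurable.mul (by fun_prop) ((Measurable.indicator (by fun_prop)
      measurableSet_Ioi).add (Measurable.indicator (by fun_prop) measurableSet_Ioo))
  · refine (ae_restrict_iff' measurableSet_Ioi).2 (Eventually.of_forall fun x hx => ?_)
    have hx0 : 0 < x := hx
    simp only [Pi.add_apply]
    by_cases h1 : 1 < x
    · rw [Set.indicator_of_mem (Set.mem_Ioi.2 h1), Set.indicator_of_notMem (by simp [h1.le]),
        Set.indicator_of_mem (Set.mem_Ioi.2 h1), Set.indicator_of_notMem (by simp [h1.le]), add_zero,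
        add_zero, Real.norm_of_nonneg (by positivity), ← Real.rpow_natCast, ← Real.rpow_neg hx0.le,
        add_mul, ← Real.rpow_add hx0, ← Real.rpow_add hx0, two_mul]
      push_cast
      gcongr <;> linarith
    · rcases (not_lt.1 h1).lt_or_eq with h2 | rfl
      · have hm : x ∈ Set.Ioo (0 : ℝ) 1 := ⟨hx0, h2⟩
        rw [Set.indicator_of_notMem (by simp [h2.le]), Set.indicator_of_mem hm,
          Set.indicator_of_notMem (by simp [h2.le]), Set.indicator_of_mem hm, zero_add, zero_add,
          Real.norm_of_nonneg (by positivity), ← Real.rpow_natCast,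
          add_mul, ← Real.rpow_add hx0, ← Real.rpow_add hx0]
        have e : ((k + 2 - 1 : ℕ) : ℝ) = k + 1 := by
          rw [show k + 2 - 1 = k + 1 by omega]; push_cast; ring
        rw [e]
        have a1 : x ^ (r + 1 + (k + 1)) ≤ 1 :=
          Real.rpow_le_one hx0.le h2.le (by linarith)
        have a2 : x ^ (-r - 1 + (k + 1)) ≤ 1 :=
          Real.rpow_le_one hx0.le h2.le (by linarith)
        linarith
      · simp

theorem norm_cpow_sub_one_le {r : ℝ} {w : ℂ} (hw : ‖w‖ ≤ r) {x : ℝ} (hx : 0 < x) :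
    ‖(x : ℂ) ^ (w - 1)‖ ≤ x ^ (r + 1) + x ^ (-r - 1) := by
  have hre := (Complex.abs_re_le_norm w).trans hw
  rw [abs_le] at hre
  rw [Complex.norm_cpow_eq_rpow_re_of_pos hx, Complex.sub_re, Complex.one_re]
  rcases le_total 1 x with h | h
  · have : x ^ (w.re - 1) ≤ x ^ (r + 1) := Real.rpow_le_rpow_of_exponent_le h (by linarith)
    have : 0 ≤ x ^ (-r - 1) := by positivity
    linarith
  · have : x ^ (w.re - 1) ≤ x ^ (-r - 1) :=
      Real.rpow_le_rpow_of_exponent_ge hx h (by linarith)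
    have : 0 ≤ x ^ (r + 1) := by positivity
    linarith

/-- The bound is uniform in `w` and factors into a function of `τ` and an integrable function of
`x`. It controls the entire part on the strip and also justifies Fubini for the Fourier modes in the
real part of `τ`. -/
theorem exists_norm_cpow_mul_epsteinKernel_le (r : ℝ) :
    ∃ (k : ℕ) (B : ℝ → ℝ), IntegrableOn B (Set.Ioi 0) ∧ (∀ x, 0 < x → 0 ≤ B x) ∧
      ∀ (τ : ℍ) (w : ℂ) (x : ℝ), ‖w‖ ≤ r → 0 < x →
        ‖(x : ℂ) ^ (w - 1) * epsteinKernel τ x‖ ≤ (epsteinMin τ)⁻¹ ^ k * B x := by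
  obtain ⟨k, hk⟩ := exists_nat_ge (max r 0 + 2)
  obtain ⟨C, hC, h⟩ := exists_norm_epsteinKernel_le (k + 2) (by omega)
  have hi := (integrableOn_epstein_bound hk (le_max_right r 0)).const_mul C
  refine ⟨k + 2, _, hi, fun x hx => ?_, fun τ w x hw hx => ?_⟩
  · refine mul_nonneg hC (mul_nonneg (by positivity) (add_nonneg ?_ ?_))
    · exact Set.indicator_nonneg (fun y (hy : 1 < y) => by positivity) x
    · exact Set.indicator_nonneg (fun y hy => pow_nonneg hy.1.le _) x
  · rw [norm_mul]
    have a1 := norm_cpow_sub_one_le (hw.trans (le_max_left r 0)) hx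
    have a2 := h τ x hx
    calc _ ≤ _ := mul_le_mul a1 a2 (norm_nonneg _) (by positivity)
      _ = _ := by ring

theorem exists_norm_epsteinEntire_le (r : ℝ) : ∃ (k : ℕ) (C : ℝ), 0 ≤ C ∧
    ∀ τ w, ‖w‖ ≤ r → ‖epsteinEntire w τ‖ ≤ C * (epsteinMin τ)⁻¹ ^ k := by
  obtain ⟨k, B, hB, hB0, h⟩ := exists_norm_cpow_mul_epsteinKernel_le r
  refine ⟨k, ∫ x in Set.Ioi 0, B x, setIntegral_nonneg measurableSet_Ioi hB0, fun τ w hw => ?_⟩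
  rw [epsteinEntire_eq, mul_comm, ← integral_const_mul]
  refine norm_integral_le_of_norm_le (hB.const_mul _) ?_
  exact (ae_restrict_iff' measurableSet_Ioi).2 (Eventually.of_forall fun x hx => h τ w x hw hx)

theorem differentiable_epsteinEntire (τ : ℍ) : Differentiable ℂ fun w => epsteinEntire w τ :=
  (epsteinPair τ).differentiable_Λ₀

theorem continuous_epsteinQ (p : ℤ × ℤ) : Continuous fun τ : ℍ => epsteinQ τ p := by
  unfold epsteinQ
  refine Continuous.div ?_ UpperHalfPlane.continuous_im fun τ => τ.im_pos.ne'
  have := UpperHalfPlane.continuous_coe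
  fun_prop

theorem measurable_epsteinTheta :
    Measurable ({p : ℍ × ℝ | 0 < p.2}.indicator fun p => epsteinTheta p.1 p.2) := by
  refine measurable_indicator_tsum (measurableSet_lt measurable_const measurable_snd)
    (fun p => ?_) fun a ha => summable_exp_neg_epstein a.1 ha
  have : Continuous fun a : ℍ × ℝ => epsteinQ a.1 p := (continuous_epsteinQ p).comp continuous_fst
  exact Continuous.measurable (Real.continuous_exp.comp
    ((continuous_const.mul this).mul continuous_snd))

theorem measurable_epsteinKernel : Measurable fun p : ℍ × ℝ => epsteinKernel p.1 p.2 := by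
  have h := Complex.measurable_ofReal.comp measurable_epsteinTheta
  have h1 : Measurable fun p : ℍ × ℝ => {p : ℍ × ℝ | 1 < p.2}.indicator
      (fun p => ((({p : ℍ × ℝ | 0 < p.2}.indicator fun p => epsteinTheta p.1 p.2) p : ℝ) : ℂ) - 1) p
      + {p : ℍ × ℝ | 0 < p.2 ∧ p.2 < 1}.indicator
      (fun p => ((({p : ℍ × ℝ | 0 < p.2}.indicator fun p => epsteinTheta p.1 p.2) p : ℝ) : ℂ)
        - (p.2 : ℂ)⁻¹) p := by
    refine Measurable.add (Measurable.indicator (h.sub_const 1)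
      (measurableSet_lt measurable_const measurable_snd)) (Measurable.indicator (h.sub ?_)
      ((measurableSet_lt measurable_const measurable_snd).inter
        (measurableSet_lt measurable_snd measurable_const)))
    fun_prop
  convert h1 using 1
  funext p
  rw [epsteinKernel]
  congr 1
  · by_cases hp : 1 < p.2
    · have : 0 < p.2 := by linarith
      simp [Set.indicator, hp, this]
    · simp [Set.indicator, hp]
  · by_cases hp : 0 < p.2 ∧ p.2 < 1 <;> simp [Set.indicator, hp]

theorem measurable_epsteinEntire (w : ℂ) : Measurable fun τ : ℍ => epsteinEntire w τ := by
  simp only [epsteinEntire_eq]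
  have h : Measurable fun p : ℍ × ℝ => (p.2 : ℂ) ^ (w - 1) * epsteinKernel p.1 p.2 :=
    Measurable.mul (by fun_prop) measurable_epsteinKernel
  exact (h.stronglyMeasurable.integral_prod_right (ν := volume.restrict (Set.Ioi 0))).measurable

/-- The entire function `w (w - 1) ξ(w)`. -/
noncomputable def xiEntire (w : ℂ) : ℂ := w * (w - 1) * completedRiemannZeta₀ w + 1

theorem differentiable_xiEntire : Differentiable ℂ xiEntire := by
  have := differentiable_completedZeta₀
  unfold xiEntire
  fun_prop

theorem xiEntire_eq {w : ℂ} (h0 : w ≠ 0) (h1 : w ≠ 1) :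
    xiEntire w = w * (w - 1) * completedRiemannZeta w := by
  rw [xiEntire, completedRiemannZeta_eq]
  have : 1 - w ≠ 0 := sub_ne_zero.2 h1.symm
  field_simp
  ring

theorem completedRiemannZeta_ne_zero_of_one_lt_re {w : ℂ} (h : 1 < w.re) :
    completedRiemannZeta w ≠ 0 := by
  have h0 : w ≠ 0 := by rintro rfl; norm_num at h
  have h1 := riemannZeta_ne_zero_of_one_le_re h.le
  rw [riemannZeta_def_of_ne_zero h0] at h1
  exact (div_ne_zero_iff.1 h1).1

theorem xiEntire_ne_zero_of_one_lt_re {w : ℂ} (h : 1 < w.re) : xiEntire w ≠ 0 := by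
  have h0 : w ≠ 0 := by rintro rfl; norm_num at h
  have h1 : w ≠ 1 := by rintro rfl; norm_num at h
  rw [xiEntire_eq h0 h1]
  exact mul_ne_zero (mul_ne_zero h0 (sub_ne_zero.2 h1)) (completedRiemannZeta_ne_zero_of_one_lt_re h)

/-- Numerator of the continuation of the `SL(2)` Eisenstein series. -/
noncomputable def eisNum (w : ℂ) (τ : ℍ) : ℂ :=
  (1 - w) * (w * (2 * w - 1) * epsteinEntire w τ - (2 * w - 1)) - w * (2 * w - 1)

/-- Denominator of the continuation of the `SL(2)` Eisenstein series. -/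
noncomputable def eisDen (w : ℂ) : ℂ := (1 - w) * xiEntire (2 * w)

theorem differentiable_eisNum (τ : ℍ) : Differentiable ℂ fun w => eisNum w τ := by
  have := differentiable_epsteinEntire τ
  unfold eisNum
  fun_prop

theorem differentiable_eisDen : Differentiable ℂ eisDen := by
  have := differentiable_xiEntire
  unfold eisDen
  fun_prop

theorem eisNum_zero (τ : ℍ) : eisNum 0 τ = 1 := by simp [eisNum]

theorem eisDen_zero : eisDen 0 = 1 := by simp [eisDen, xiEntire]

theorem eisDen_ne_zero_of_one_lt_re {w : ℂ} (h : 1 < w.re) : eisDen w ≠ 0 := by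
  refine mul_ne_zero ?_ (xiEntire_ne_zero_of_one_lt_re (by simp; linarith))
  rintro h0
  rw [sub_eq_zero] at h0
  rw [← h0] at h
  norm_num at h

theorem summable_epsteinQ_rpow (τ : ℍ) {r : ℝ} (hr : 1 < r) :
    Summable fun p : {p : ℤ × ℤ // p ≠ 0} => epsteinQ τ p ^ (-r) := by
  have hm := epsteinMin_pos τ
  refine (((summable_int_prod_one_add_rpow (r := -r) (by linarith)).mul_left
    ((epsteinMin τ / 2) ^ (-r))).subtype _).of_nonneg_of_le
    (fun p => Real.rpow_nonneg (epsteinQ_nonneg τ p) _) fun p => ?_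
  have h1 := one_le_sq_add_sq p.2
  have h2 := epsteinQ_ge τ p
  simp only [Function.comp_apply]
  rw [← Real.mul_rpow (by positivity) (by positivity)]
  refine Real.rpow_le_rpow_of_nonpos (by positivity) ?_ (by linarith)
  nlinarith

theorem eisSL2_summand_eq (τ : ℍ) (w : ℂ) {p : ℤ × ℤ} (hp : p ≠ 0) :
    ((τ.im : ℝ) : ℂ) ^ w / ((‖(p.2 : ℂ) * τ + (p.1 : ℂ)‖ : ℝ) : ℂ) ^ (2 * w) =
      1 / (epsteinQ τ p : ℂ) ^ w := by
  have hv := τ.im_pos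
  have hQ := epsteinQ_pos τ hp
  have hn : 0 < ‖(p.2 : ℂ) * τ + (p.1 : ℂ)‖ := by
    refine lt_of_le_of_ne (norm_nonneg _) fun h => ?_
    rw [epsteinQ, ← h] at hQ
    simp at hQ
  have h2 : ((‖(p.2 : ℂ) * τ + (p.1 : ℂ)‖ : ℝ) : ℂ) ^ (2 * w) =
      ((‖(p.2 : ℂ) * τ + (p.1 : ℂ)‖ ^ 2 : ℝ) : ℂ) ^ w := by
    rw [sq, Complex.ofReal_mul, Complex.mul_cpow_ofReal_nonneg hn.le hn.le,
      ← Complex.cpow_add _ _ (by exact_mod_cast hn.ne'), two_mul]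
  rw [h2, epsteinQ, Complex.ofReal_div, Complex.div_cpow_ofReal_nonneg (by positivity) hv.le,
    one_div_div]

/-- The Mellin transform is taken term by term: `∫ x^{w-1} e^{-π Q x} dx = π^{-w} Γ(w) Q^{-w}`. -/
theorem hasSum_epsteinQ_cpow (τ : ℍ) {w : ℂ} (hw : 1 < w.re) :
    HasSum (fun p : {p : ℤ × ℤ // p ≠ 0} => (Real.pi : ℂ) ^ (-w) * Complex.Gamma w *
      1 / (epsteinQ τ p : ℂ) ^ w) ((epsteinPair τ).Λ w) := by
  have hP : (epsteinPair τ).k < w.re := hw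
  have hm := ((epsteinPair τ).hasMellin hP).2
  have h := hasSum_mellin_pi_mul (ι := {p : ℤ × ℤ // p ≠ 0}) (a := fun _ => 1)
    (q := fun p => epsteinQ τ p) (F := fun x => (epsteinPair τ).f x - (epsteinPair τ).f₀) (s := w)
    (fun p => Or.inr (epsteinQ_pos τ p.2)) (by linarith) (fun t ht => ?_) ?_
  · rwa [hm] at h
  · have := hasSum_epsteinTheta_sub_one τ ht
    have h2 := Complex.hasSum_ofReal.2 this
    simpa [epsteinPair] using h2
  · refine (summable_epsteinQ_rpow τ hw).congr fun p => ?_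
    rw [norm_one, Real.rpow_neg (epsteinQ_nonneg τ p), one_div]

/-- Let `Λ` be the completed Epstein zeta function. Since `π^{-w} Γ(w) ζ(2w) = ξ(2w)`, the series
equals `Λ(w) / (2 ξ(2w))`. Multiplying numerator and denominator by `w (1 - w) (2w - 1)` clears the
poles of `Λ` at 0 and 1 and those of `ξ(2w)` at 0 and 1/2, which yields two entire functions. -/
theorem eisSL2Series_eq (τ : ℍ) {w : ℂ} (hw : 1 < w.re) :
    eisSL2Series w τ = eisNum w τ / eisDen w := by
  have h := (hasSum_epsteinQ_cpow τ hw).tsum_eq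
  have h0 : w ≠ 0 := by rintro rfl; norm_num at hw
  have h1 : 1 - w ≠ 0 := by
    rw [sub_ne_zero]; rintro rfl; norm_num at hw
  have h20 : 2 * w ≠ 0 := by simpa using h0
  have h21 : 2 * w - 1 ≠ 0 := by
    intro h
    have := congrArg Complex.re h
    simp at this
    linarith
  have h2w : 1 < (2 * w).re := by simp; linarith
  have hG : (Real.pi : ℂ) ^ (-w) * Complex.Gamma w ≠ 0 := by
    refine mul_ne_zero ?_ (Complex.Gamma_ne_zero_of_re_pos (by linarith))
    rw [Ne, Complex.cpow_eq_zero_iff]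
    simp [Real.pi_ne_zero]
  have hGR : Complex.Gammaℝ (2 * w) = (Real.pi : ℂ) ^ (-w) * Complex.Gamma w := by
    rw [Complex.Gammaℝ_def]
    congr 2 <;> ring_nf
  have hsum : eisSL2Series w τ = (2 * riemannZeta (2 * w))⁻¹ *
      ∑' p : {p : ℤ × ℤ // p ≠ 0}, 1 / (epsteinQ τ p : ℂ) ^ w := by
    rw [eisSL2Series]
    congr 1
    exact tsum_congr fun p => eisSL2_summand_eq τ w p.2
  simp only [mul_div_assoc] at h
  rw [tsum_mul_left] at h
  have hxi := completedRiemannZeta_ne_zero_of_one_lt_re h2w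
  rw [hsum, riemannZeta_def_of_ne_zero h20, hGR, eisDen, xiEntire_eq h20 (sub_ne_zero.1 h21)]
  have hL : (epsteinPair τ).Λ w = epsteinEntire w τ - 1 / w - 1 / (1 - w) := by
    rw [WeakFEPair.Λ, epsteinEntire]
    simp [epsteinPair]
  have hsum2 : ∑' p : {p : ℤ × ℤ // p ≠ 0}, 1 / (epsteinQ τ p : ℂ) ^ w =
      (epsteinEntire w τ - 1 / w - 1 / (1 - w)) / ((Real.pi : ℂ) ^ (-w) * Complex.Gamma w) := by
    rw [eq_div_iff hG, mul_comm, h, hL]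
  rw [hsum2, eisNum]
  set G := (Real.pi : ℂ) ^ (-w) * Complex.Gamma w
  field_simp

/-- The denominator `eisDen` does not involve `z`, so the points to be avoided are the same for the
whole upper half plane. -/
theorem isMeroCont_eisSL2 {z : ℂ} (hz : 0 < z.im) :
    IsMeroCont (fun s => eisSL2Series s z) 1 (fun s => eisSL2 s z) ∧
      ∀ s, eisDen s ≠ 0 → AnalyticAt ℂ (fun w => eisSL2 w z) s ∧
        eisSL2 s z = eisNum s ⟨z, hz⟩ / eisDen s :=
  meroCont_quotient (differentiable_eisNum ⟨z, hz⟩) differentiable_eisDen fun _ hs =>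
    ⟨eisDen_ne_zero_of_one_lt_re hs, eisSL2Series_eq ⟨z, hz⟩ hs⟩

/-- A bound for the numerator of the `SL(2)` Eisenstein series, locally uniform in `w`. -/
theorem exists_norm_eisNum_le (r : ℝ) : ∃ (k : ℕ) (C : ℝ), 0 ≤ C ∧
    ∀ τ w, ‖w‖ ≤ r → ‖eisNum w τ‖ ≤ C * (1 + (epsteinMin τ)⁻¹ ^ k) := by
  obtain ⟨k, C, hC, h⟩ := exists_norm_epsteinEntire_le r
  refine ⟨k, (1 + |r|) * (|r| * (2 * |r| + 1) * C + (2 * |r| + 1)) + |r| * (2 * |r| + 1),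
    by positivity, fun τ w hw => ?_⟩
  have hw' : ‖w‖ ≤ |r| := hw.trans (le_abs_self r)
  have hE := h τ w hw
  have hm : 0 ≤ (epsteinMin τ)⁻¹ ^ k := by have := epsteinMin_pos τ; positivity
  set M := (epsteinMin τ)⁻¹ ^ k
  have e1 : ‖1 - w‖ ≤ 1 + |r| := (norm_sub_le _ _).trans (by simpa using hw')
  have e2 : ‖2 * w - 1‖ ≤ 2 * |r| + 1 := (norm_sub_le _ _).trans (by simpa using hw')
  have e3 : ‖w * (2 * w - 1) * epsteinEntire w τ - (2 * w - 1)‖ ≤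
      |r| * (2 * |r| + 1) * (C * M) + (2 * |r| + 1) := by
    refine (norm_sub_le _ _).trans (add_le_add ?_ e2)
    rw [norm_mul, norm_mul]
    gcongr
  calc ‖eisNum w τ‖ ≤ (1 + |r|) * (|r| * (2 * |r| + 1) * (C * M) + (2 * |r| + 1)) +
        |r| * (2 * |r| + 1) := by
        refine (norm_sub_le _ _).trans (add_le_add ?_ ?_) <;> rw [norm_mul] <;> gcongr
    _ ≤ _ := by
        have a1 : 0 ≤ (1 + |r|) * (|r| * (2 * |r| + 1) * C) := by positivity
        have a2 : 0 ≤ (1 + |r|) * (2 * |r| + 1) * M := by positivity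
        have a3 : 0 ≤ |r| * (2 * |r| + 1) * M := by positivity
        nlinarith

theorem measurable_eisNum (w : ℂ) : Measurable fun τ : ℍ => eisNum w τ := by
  have := measurable_epsteinEntire w
  unfold eisNum
  fun_prop

/-! ### Unfolding over `SL(2, ℤ)` -/

instance smulInvariantMeasure_SL2Z : SMulInvariantMeasure SL(2, ℤ) ℍ volume where
  measure_preimage_smul γ s hs := by
    have := measure_preimage_smul (volume : Measure ℍ) (γ : GL (Fin 2) ℝ) s
    exact this

instance measurableConstSMul_SL2Z : MeasurableConstSMul SL(2, ℤ) ℍ where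
  measurable_const_smul γ := (continuous_const_smul (γ : GL (Fin 2) ℝ) (T := ℍ)).measurable

instance countable_SL2Z : Countable SL(2, ℤ) :=
  Function.Injective.countable (f := fun (γ : SL(2, ℤ)) (i j : Fin 2) => γ i j) fun γ γ' h => by
    ext i j
    exact congrFun (congrFun h i) j

/-- Folding and unfolding in one step: by invariance of the measure each `γ` is moved from `F` to
`φ`, and the sum over the group is reindexed by inversion. No fundamental domain enters. -/
theorem integral_mul_tsum_smul {φ F : ℍ → ℂ} (hφ : Measurable φ) (hF : Measurable F)
    (hfin : ∑' γ : SL(2, ℤ), ∫⁻ τ, ‖φ (γ • τ) * F τ‖ₑ ≠ ⊤) :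
    ∫ τ, φ τ * ∑' γ : SL(2, ℤ), F (γ • τ) = ∫ τ, (∑' γ : SL(2, ℤ), φ (γ • τ)) * F τ := by
  have hm : ∀ γ : SL(2, ℤ), Measurable fun τ : ℍ => γ • τ := fun γ => measurable_const_smul γ
  have key : ∀ γ : SL(2, ℤ), ∫⁻ τ, ‖φ τ * F (γ • τ)‖ₑ = ∫⁻ τ, ‖φ (γ⁻¹ • τ) * F τ‖ₑ := by
    intro γ
    have := (measurePreserving_smul γ (volume : Measure ℍ)).lintegral_comp
      (((hφ.comp (hm γ⁻¹)).mul hF).enorm)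
    simpa using this
  have hfin' : ∑' γ : SL(2, ℤ), ∫⁻ τ, ‖φ τ * F (γ • τ)‖ₑ ≠ ⊤ := by
    simp only [key]
    have := (Equiv.inv SL(2, ℤ)).tsum_eq fun γ => ∫⁻ τ, ‖φ (γ • τ) * F τ‖ₑ
    simp only [Equiv.inv_apply] at this
    rwa [this]
  calc ∫ τ, φ τ * ∑' γ : SL(2, ℤ), F (γ • τ)
      = ∑' γ : SL(2, ℤ), ∫ τ, φ τ * F (γ • τ) := by
        have := integral_tsum (μ := (volume : Measure ℍ))
          (f := fun (γ : SL(2, ℤ)) τ => φ τ * F (γ • τ))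
          (fun γ => (hφ.mul (hF.comp (hm γ))).aestronglyMeasurable) hfin'
        rw [← this]
        simp only [tsum_mul_left]
    _ = ∑' γ : SL(2, ℤ), ∫ τ, φ (γ⁻¹ • τ) * F τ := by
        refine tsum_congr fun γ => ?_
        have := integral_smul_eq_self (μ := (volume : Measure ℍ)) (fun τ => φ (γ⁻¹ • τ) * F τ) (g := γ)
        simpa using this
    _ = ∑' γ : SL(2, ℤ), ∫ τ, φ (γ • τ) * F τ :=
        (Equiv.inv SL(2, ℤ)).tsum_eq fun γ => ∫ τ, φ (γ • τ) * F τ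
    _ = ∫ τ, (∑' γ : SL(2, ℤ), φ (γ • τ)) * F τ := by
        have := integral_tsum (μ := (volume : Measure ℍ))
          (f := fun (γ : SL(2, ℤ)) τ => φ (γ • τ) * F τ)
          (fun γ => ((hφ.comp (hm γ)).mul hF).aestronglyMeasurable) hfin
        rw [← this]
        simp only [tsum_mul_right]

/-- A fundamental domain for the translations by integers. -/
def strip : Set ℍ := {τ | τ.re ∈ Set.Ioc (-(1 / 2) : ℝ) (1 / 2)}

theorem measurableSet_strip : MeasurableSet strip :=
  UpperHalfPlane.continuous_re.measurable measurableSet_Ioc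

/-- Coprime pairs of integers, in the order `(d, c)`. -/
abbrev CoprimePair : Type := {p : ℤ × ℤ // IsCoprime p.1 p.2}

/-- The bottom row of a unimodular matrix. -/
def bottomRow (γ : SL(2, ℤ)) : CoprimePair :=
  ⟨(γ 1 1, γ 1 0), by
    have := γ.det_coe
    rw [Matrix.det_fin_two] at this
    exact ⟨γ 0 0, -γ 0 1, by linarith⟩⟩

theorem exists_eq_T_zpow_mul {γ γ' : SL(2, ℤ)} (h : bottomRow γ = bottomRow γ') :
    ∃ k : ℤ, γ' = ModularGroup.T ^ k * γ := by
  have h1 : γ 1 1 = γ' 1 1 := congrArg (fun v : CoprimePair => v.1.1) h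
  have h0 : γ 1 0 = γ' 1 0 := congrArg (fun v : CoprimePair => v.1.2) h
  have hd := γ.det_coe
  have hd' := γ'.det_coe
  rw [Matrix.det_fin_two] at hd hd'
  -- If the bottom rows agree, `γ' γ⁻¹` has bottom row `(0, 1)` and is a translation; this is its
  -- upper right entry.
  refine ⟨γ 0 0 * γ' 0 1 - γ 0 1 * γ' 0 0, ?_⟩
  ext i j
  rw [Matrix.SpecialLinearGroup.coe_mul, ModularGroup.coe_T_zpow, Matrix.mul_apply]
  rw [← h1, ← h0] at hd'
  fin_cases i <;> fin_cases j <;> simp [Fin.sum_univ_two]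
  · linear_combination (-γ' 0 0) * hd + γ 0 0 * hd'
  · linear_combination (-γ' 0 1) * hd + γ 0 1 * hd'
  · exact h0.symm
  · exact h1.symm

theorem exists_bottomRow_eq (v : CoprimePair) : ∃ γ, bottomRow γ = v := by
  obtain ⟨γ, -, hγ⟩ := ModularGroup.bottom_row_surj (R := ℤ)
    (show ![v.1.2, v.1.1] ∈ {cd : Fin 2 → ℤ | IsCoprime (cd 0) (cd 1)} from v.2.symm)
  refine ⟨γ, Subtype.ext (Prod.ext ?_ ?_)⟩
  · exact congrFun hγ 1
  · exact congrFun hγ 0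

theorem exists_smul_mem_strip (v : CoprimePair) (τ : ℍ) :
    ∃ γ, bottomRow γ = v ∧ γ • τ ∈ strip := by
  obtain ⟨γ, hγ⟩ := exists_bottomRow_eq v
  set r := (γ • τ).re
  refine ⟨ModularGroup.T ^ (-(⌈r - 1 / 2⌉)) * γ, ?_, ?_⟩
  · rw [← hγ]
    refine Subtype.ext (Prod.ext ?_ ?_) <;>
    · simp only [bottomRow]
      rw [Matrix.SpecialLinearGroup.coe_mul, ModularGroup.coe_T_zpow, Matrix.mul_apply]
      simp [Fin.sum_univ_two]
  · rw [mul_smul, strip, Set.mem_ofPred_eq, ModularGroup.re_T_zpow_smul]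
    have h1 := Int.le_ceil (r - 1 / 2)
    have h2 := Int.ceil_lt_add_one (r - 1 / 2)
    constructor <;> push_cast <;> linarith

/-- The representative of a coset of translations which moves a point into the strip. -/
noncomputable def stripRep (τ : ℍ) (v : CoprimePair) : SL(2, ℤ) :=
  (exists_smul_mem_strip v τ).choose

theorem bottomRow_stripRep (τ : ℍ) (v : CoprimePair) : bottomRow (stripRep τ v) = v :=
  (exists_smul_mem_strip v τ).choose_spec.1

theorem stripRep_smul_mem (τ : ℍ) (v : CoprimePair) : stripRep τ v • τ ∈ strip :=
  (exists_smul_mem_strip v τ).choose_spec.2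

theorem stripRep_injective (τ : ℍ) : Function.Injective (stripRep τ) := fun v w h => by
  rw [← bottomRow_stripRep τ v, h, bottomRow_stripRep]

/-- Two matrices with the same bottom row differ by an integral translation, and a half-open strip
of width one allows only the trivial one. So the elements which move `τ` into the strip correspond
to coprime pairs, and a sum over the group of functions supported in the strip is a Poincaré sum in
which both signs of the bottom row occur. -/
theorem stripRep_bottomRow {τ : ℍ} {γ : SL(2, ℤ)} (h : γ • τ ∈ strip) :
    stripRep τ (bottomRow γ) = γ := by
  obtain ⟨k, hk⟩ := exists_eq_T_zpow_mul (bottomRow_stripRep τ (bottomRow γ)).symm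
  have h2 := stripRep_smul_mem τ (bottomRow γ)
  rw [hk, mul_smul, strip, Set.mem_ofPred_eq, ModularGroup.re_T_zpow_smul] at h2
  have h1 : (γ • τ).re ∈ Set.Ioc (-(1 / 2) : ℝ) (1 / 2) := h
  have a1 : (k : ℝ) < 1 := by linarith [h1.1, h2.2]
  have a2 : (-1 : ℝ) < k := by linarith [h1.2, h2.1]
  have b1 : k < 1 := by exact_mod_cast a1
  have b2 : -1 < k := by exact_mod_cast a2
  have : k = 0 := by omega
  rw [hk, this, zpow_zero, one_mul]

section StripSum

variable {E : Type*} [AddCommMonoid E]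

theorem support_strip_indicator_subset (F : ℍ → E) (τ : ℍ) :
    (Function.support fun γ : SL(2, ℤ) => strip.indicator F (γ • τ)) ⊆
      Set.range (stripRep τ) := fun γ hγ => by
  have : γ • τ ∈ strip := by
    by_contra h
    exact hγ (Set.indicator_of_notMem h _)
  exact ⟨bottomRow γ, stripRep_bottomRow this⟩

theorem tsum_strip_indicator [TopologicalSpace E] [T2Space E] (F : ℍ → E) (τ : ℍ) :
    ∑' γ : SL(2, ℤ), strip.indicator F (γ • τ) = ∑' v, F (stripRep τ v • τ) := by
  rw [← (stripRep_injective τ).tsum_eq (support_strip_indicator_subset F τ)]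
  exact tsum_congr fun v => Set.indicator_of_mem (stripRep_smul_mem τ v) _

theorem summable_strip_indicator_iff [TopologicalSpace E] (F : ℍ → E) (τ : ℍ) :
    (Summable fun γ : SL(2, ℤ) => strip.indicator F (γ • τ)) ↔
      Summable fun v => F (stripRep τ v • τ) := by
  rw [← (stripRep_injective τ).summable_iff fun γ hγ => by
    by_contra h
    exact hγ (support_strip_indicator_subset F τ h)]
  refine summable_congr fun v => ?_
  exact Set.indicator_of_mem (stripRep_smul_mem τ v) _

end StripSum

theorem im_smul_eq_one_div_epsteinQ (γ : SL(2, ℤ)) (τ : ℍ) :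
    (γ • τ).im = 1 / epsteinQ τ (bottomRow γ).1 := by
  rw [ModularGroup.im_smul_eq_div_normSq, epsteinQ, Complex.normSq_eq_norm_sq,
    UpperHalfPlane.denom, one_div_div]
  rfl

theorem coprimePair_ne_zero (v : CoprimePair) : v.1 ≠ 0 := fun h => by
  have := v.2
  rw [h] at this
  exact not_isCoprime_zero_zero this

/-- Nonzero pairs of integers are positive multiples of coprime pairs. -/
noncomputable def pairEquiv : ℕ+ × CoprimePair ≃ {p : ℤ × ℤ // p ≠ 0} :=
  Equiv.ofBijective
    (fun x => ⟨((x.1 : ℤ) * x.2.1.1, (x.1 : ℤ) * x.2.1.2), fun h => by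
      have h1 : (x.1 : ℤ) ≠ 0 := by exact_mod_cast x.1.ne_zero
      have h2 := Prod.ext_iff.1 h
      simp only [Prod.fst_zero, Prod.snd_zero, mul_eq_zero, h1, false_or] at h2
      exact coprimePair_ne_zero x.2 (Prod.ext h2.1 h2.2)⟩) (by
    constructor
    · rintro ⟨k, v⟩ ⟨l, w⟩ h
      simp only [Subtype.mk.injEq, Prod.mk.injEq] at h
      have hg : ∀ (k : ℕ+) (v : CoprimePair), Int.gcd ((k : ℤ) * v.1.1) ((k : ℤ) * v.1.2) = k := by
        intro k v
        rw [Int.gcd_mul_left, Int.isCoprime_iff_gcd_eq_one.1 v.2]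
        simp
      have hkl : k = l := by
        have := hg k v
        rw [h.1, h.2, hg l w] at this
        exact PNat.coe_injective this.symm
      subst hkl
      have h1 : (k : ℤ) ≠ 0 := by exact_mod_cast k.ne_zero
      rw [Prod.mk.injEq]
      exact ⟨rfl, Subtype.ext (Prod.ext (mul_left_cancel₀ h1 h.1) (mul_left_cancel₀ h1 h.2))⟩
    · rintro ⟨p, hp⟩
      have hg : 0 < Int.gcd p.1 p.2 := by
        rw [Int.gcd_pos_iff]
        by_contra h
        push Not at h
        exact hp (Prod.ext h.1 h.2)
      obtain ⟨a, b, hab, ha, hb⟩ := Int.exists_gcd_one hg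
      refine ⟨(⟨Int.gcd p.1 p.2, hg⟩, ⟨(a, b), Int.isCoprime_iff_gcd_eq_one.2 hab⟩), ?_⟩
      refine Subtype.ext (Prod.ext ?_ ?_)
      · simpa [mul_comm] using ha.symm
      · simpa [mul_comm] using hb.symm)

theorem pairEquiv_apply (x : ℕ+ × CoprimePair) :
    (pairEquiv x).1 = ((x.1 : ℤ) * x.2.1.1, (x.1 : ℤ) * x.2.1.2) := rfl

theorem epsteinQ_mul (τ : ℍ) (k : ℤ) (p : ℤ × ℤ) :
    epsteinQ τ (k * p.1, k * p.2) = (k : ℝ) ^ 2 * epsteinQ τ p := by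
  rw [epsteinQ_eq, epsteinQ_eq]
  push_cast
  ring

/-- Sorting the nonzero pairs by their gcd splits off `ζ(2w)`. The factor 2 appears because coprime
pairs are not taken modulo sign. -/
theorem tsum_coprimePair_epsteinQ (τ : ℍ) {w : ℂ} (hw : 1 < w.re) :
    ∑' v : CoprimePair, 1 / (epsteinQ τ v.1 : ℂ) ^ w = 2 * (eisNum w τ / eisDen w) := by
  have hz : riemannZeta (2 * w) ≠ 0 :=
    riemannZeta_ne_zero_of_one_le_re (by simp; linarith)
  have hw2 : 1 < (2 * w).re := by simp; linarith
  have hnorm : ∀ p : {p : ℤ × ℤ // p ≠ 0},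
      ‖1 / (epsteinQ τ p : ℂ) ^ w‖ = epsteinQ τ p ^ (-w.re) := fun p => by
    rw [norm_div, norm_one, Complex.norm_cpow_eq_rpow_re_of_pos (epsteinQ_pos τ p.2),
      Real.rpow_neg (epsteinQ_nonneg τ _), one_div]
  have hs : Summable fun p : {p : ℤ × ℤ // p ≠ 0} => 1 / (epsteinQ τ p : ℂ) ^ w :=
    .of_norm (by simp only [hnorm]; exact summable_epsteinQ_rpow τ hw)
  have hprod : ∀ x : ℕ+ × CoprimePair, 1 / (epsteinQ τ (pairEquiv x).1 : ℂ) ^ w =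
      1 / ((x.1 : ℕ) : ℂ) ^ (2 * w) * (1 / (epsteinQ τ x.2.1 : ℂ) ^ w) := fun x => by
    have hk : (0 : ℝ) < ((x.1 : ℕ) : ℝ) := by exact_mod_cast x.1.pos
    have := epsteinQ_mul τ x.1 x.2.1
    rw [pairEquiv_apply, this, Complex.ofReal_mul,
      Complex.mul_cpow_ofReal_nonneg (by positivity) (epsteinQ_nonneg τ _),
      one_div_mul_one_div]
    congr 2
    have hk0 : ((x.1 : ℕ) : ℂ) ≠ 0 := by exact_mod_cast x.1.ne_zero
    rw [two_mul w, Complex.cpow_add _ _ hk0, ← Complex.natCast_mul_natCast_cpow]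
    push_cast
    rw [sq]
  have hs' := (pairEquiv.summable_iff.2 hs)
  have h1 : ∑' p : {p : ℤ × ℤ // p ≠ 0}, 1 / (epsteinQ τ p : ℂ) ^ w =
      riemannZeta (2 * w) * ∑' v : CoprimePair, 1 / (epsteinQ τ v.1 : ℂ) ^ w := by
    rw [← pairEquiv.tsum_eq, tsum_congr hprod]
    have hsum : Summable fun x : ℕ+ × CoprimePair => 1 / ((x.1 : ℕ) : ℂ) ^ (2 * w) *
        (1 / (epsteinQ τ x.2.1 : ℂ) ^ w) := by
      refine hs'.congr fun x => ?_
      exact hprod x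
    rw [hsum.tsum_prod]
    simp only [tsum_mul_left, tsum_mul_right]
    rw [zeta_eq_tsum_one_div_nat_add_one_cpow hw2,
      tsum_pnat_eq_tsum_succ (f := fun n : ℕ => 1 / (n : ℂ) ^ (2 * w))]
    simp
  have h2 := eisSL2Series_eq τ hw
  rw [eisSL2Series] at h2
  erw [tsum_congr fun p : {p : ℤ × ℤ // p ≠ 0} => eisSL2_summand_eq τ w p.2] at h2
  rw [h1] at h2
  rw [← h2]
  field_simp

theorem exists_tsum_coprimePair_le {r : ℝ} (hr : 1 < r) : ∃ C : ℝ, 0 ≤ C ∧ ∀ τ : ℍ,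
    ∑' v : CoprimePair, ENNReal.ofReal (epsteinQ τ v.1 ^ (-r)) ≤
      ENNReal.ofReal (C * epsteinMin τ ^ (-r)) := by
  have hS := (summable_int_prod_one_add_rpow (r := -r) (by linarith)).subtype
    {p : ℤ × ℤ | IsCoprime p.1 p.2}
  refine ⟨(1 / 2) ^ (-r) * ∑' v : CoprimePair,
    (1 + ((v.1.1 : ℝ) ^ 2 + (v.1.2 : ℝ) ^ 2)) ^ (-r), ?_, fun τ => ?_⟩
  · exact mul_nonneg (by positivity) (tsum_nonneg fun v => by positivity)
  have hm := epsteinMin_pos τ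
  have hle : ∀ v : CoprimePair, epsteinQ τ v.1 ^ (-r) ≤
      (1 / 2) ^ (-r) * epsteinMin τ ^ (-r) *
        (1 + ((v.1.1 : ℝ) ^ 2 + (v.1.2 : ℝ) ^ 2)) ^ (-r) := fun v => by
    rw [← Real.mul_rpow (by positivity) hm.le, ← Real.mul_rpow (by positivity) (by positivity)]
    have h1 := one_le_sq_add_sq (coprimePair_ne_zero v)
    refine Real.rpow_le_rpow_of_nonpos (by positivity) ?_ (by linarith)
    refine le_trans ?_ (epsteinQ_ge τ v.1)
    nlinarith
  calc _ ≤ ∑' v : CoprimePair, ENNReal.ofReal ((1 / 2) ^ (-r) * epsteinMin τ ^ (-r) *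
        (1 + ((v.1.1 : ℝ) ^ 2 + (v.1.2 : ℝ) ^ 2)) ^ (-r)) :=
        ENNReal.tsum_le_tsum fun v => ENNReal.ofReal_le_ofReal (hle v)
    _ = ENNReal.ofReal (∑' v : CoprimePair, (1 / 2) ^ (-r) * epsteinMin τ ^ (-r) *
        (1 + ((v.1.1 : ℝ) ^ 2 + (v.1.2 : ℝ) ^ 2)) ^ (-r)) :=
        (ENNReal.ofReal_tsum_of_nonneg (fun v => (Real.rpow_nonneg (epsteinQ_nonneg τ _) _).trans
          (hle v)) (hS.mul_left _)).symm
    _ ≤ _ := by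
        rw [tsum_mul_left]
        refine ENNReal.ofReal_le_ofReal (le_of_eq ?_)
        ring

/-- Unfolding of a Poincaré series against an Eisenstein series. -/
theorem integral_strip_tsum_smul {F : ℍ → ℂ} (hF : Measurable F) {w : ℂ} (hw : 1 < w.re)
    (hint : Integrable fun τ => epsteinMin τ ^ (-w.re) * ‖F τ‖) :
    ∫ τ in strip, ((τ.im : ℝ) : ℂ) ^ w * ∑' γ : SL(2, ℤ), F (γ • τ) =
      ∫ τ, 2 * (eisNum w τ / eisDen w) * F τ := by
  have him : Measurable fun τ : ℍ => ((τ.im : ℝ) : ℂ) ^ w :=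
    (Complex.measurable_ofReal.comp UpperHalfPlane.continuous_im.measurable).pow_const w
  have hnorm : ∀ τ : ℍ, ‖((τ.im : ℝ) : ℂ) ^ w‖ = τ.im ^ w.re := fun τ =>
    Complex.norm_cpow_eq_rpow_re_of_pos τ.im_pos w
  -- The sum of the translates of this function over the group is the sum of `Q^{-w}` over coprime
  -- pairs, that is, twice the Eisenstein series.
  set φ : ℍ → ℂ := strip.indicator fun τ => ((τ.im : ℝ) : ℂ) ^ w with hφ
  have hφm : Measurable φ := him.indicator measurableSet_strip
  have hstrip : ∀ τ, ∑' γ : SL(2, ℤ), ‖φ (γ • τ)‖ₑ =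
      ∑' v : CoprimePair, ENNReal.ofReal (epsteinQ τ v.1 ^ (-w.re)) := fun τ => by
    have := tsum_strip_indicator (fun τ : ℍ => ‖((τ.im : ℝ) : ℂ) ^ w‖ₑ) τ
    simp only [hφ, enorm_indicator_eq_indicator_enorm]
    rw [this]
    refine tsum_congr fun v => ?_
    rw [← ofReal_norm, hnorm, im_smul_eq_one_div_epsteinQ, bottomRow_stripRep,
      one_div, Real.inv_rpow (epsteinQ_nonneg _ _), Real.rpow_neg (epsteinQ_nonneg _ _)]
  -- By Tonelli the sum over the group is taken first; the resulting series of absolute values is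
  -- bounded by a multiple of `epsteinMin τ ^ (-w.re)`, the weight in the integrability hypothesis.
  have hfin : ∑' γ : SL(2, ℤ), ∫⁻ τ, ‖φ (γ • τ) * F τ‖ₑ ≠ ⊤ := by
    rw [← lintegral_tsum fun γ => by
      exact ((hφm.comp (measurable_const_smul γ)).mul hF).enorm.aemeasurable]
    simp only [enorm_mul, ENNReal.tsum_mul_right, hstrip]
    obtain ⟨C, hC, h⟩ := exists_tsum_coprimePair_le hw
    refine ne_top_of_le_ne_top (hint.const_mul C).2.ne (lintegral_mono fun τ => ?_)
    simp only []
    rw [← mul_assoc, enorm_mul, enorm_norm, Real.enorm_of_nonneg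
      (mul_nonneg hC (Real.rpow_nonneg (epsteinMin_pos τ).le _))]
    gcongr
    exact h τ
  have h := integral_mul_tsum_smul hφm hF hfin
  rw [← integral_indicator measurableSet_strip]
  calc _ = ∫ τ, φ τ * ∑' γ : SL(2, ℤ), F (γ • τ) := by
        refine integral_congr_ae (.of_forall fun τ => ?_)
        by_cases hτ : τ ∈ strip <;> simp [hφ, hτ]
    _ = _ := by
        rw [h]
        refine integral_congr_ae (.of_forall fun τ => ?_)
        simp only []
        rw [hφ, tsum_strip_indicator, ← tsum_coprimePair_epsteinQ τ hw]
        congr 1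
        refine tsum_congr fun v => ?_
        rw [im_smul_eq_one_div_epsteinQ, bottomRow_stripRep]
        have := epsteinQ_pos τ (coprimePair_ne_zero v)
        rw [one_div, Complex.ofReal_inv, Complex.inv_cpow, one_div]
        rw [Complex.arg_ofReal_of_nonneg this.le]
        exact Real.pi_pos.ne

/-- The part of the strip above height `1 / 2`; its translates cover the upper half plane. -/
def cuspStrip : Set ℍ := strip ∩ {τ | 1 / 2 < τ.im}

theorem measurableSet_cuspStrip : MeasurableSet cuspStrip :=
  measurableSet_strip.inter (UpperHalfPlane.continuous_im.measurable measurableSet_Ioi)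

/-- The number of translates of a point in `cuspStrip`. -/
noncomputable def cuspWeight (τ : ℍ) : ℝ :=
  ∑' γ : SL(2, ℤ), cuspStrip.indicator (fun _ => (1 : ℝ)) (γ • τ)

theorem cuspStrip_indicator_eq (τ : ℍ) : cuspStrip.indicator (fun _ => (1 : ℝ)) τ =
    strip.indicator ({τ : ℍ | 1 / 2 < τ.im}.indicator fun _ => 1) τ := by
  rw [cuspStrip, Set.indicator_indicator]

/-- A translate above height `1/2` comes from a coprime pair with `Q < 2`, and then `1 ≤ 4 Q⁻²`, a
summable majorant. -/
theorem summable_cuspStrip_indicator (τ : ℍ) :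
    Summable fun γ : SL(2, ℤ) => cuspStrip.indicator (fun _ => (1 : ℝ)) (γ • τ) := by
  simp only [cuspStrip_indicator_eq]
  rw [summable_strip_indicator_iff]
  have h := (summable_epsteinQ_rpow τ (r := 2) (by norm_num)).comp_injective
    (i := fun v : CoprimePair => (⟨v.1, coprimePair_ne_zero v⟩ : {p : ℤ × ℤ // p ≠ 0}))
    (fun v w h => Subtype.ext (congrArg (fun p : {p : ℤ × ℤ // p ≠ 0} => p.1) h))
  refine (h.mul_left 4).of_nonneg_of_le (fun v => Set.indicator_nonneg (fun _ _ => zero_le_one) _)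
    fun v => ?_
  have hQ := epsteinQ_pos τ (coprimePair_ne_zero v)
  refine Set.indicator_le_indicator' (g := fun _ => 4 * epsteinQ τ v.1 ^ (-2 : ℝ)) ?_ |>.trans
    (Set.indicator_le_self' (fun _ _ => by positivity) _)
  intro hv
  rw [Set.mem_ofPred_eq, im_smul_eq_one_div_epsteinQ, bottomRow_stripRep,
    div_lt_div_iff₀ (by norm_num) hQ] at hv
  rw [Real.rpow_neg hQ.le, ← div_eq_mul_inv, le_div_iff₀ (by positivity)]
  norm_cast
  nlinarith

/-- A translate in the standard fundamental domain has squared height at least `3/4`, and moving it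
horizontally into the strip keeps the height. -/
theorem one_le_cuspWeight (τ : ℍ) : 1 ≤ cuspWeight τ := by
  obtain ⟨γ, hγ⟩ := ModularGroup.exists_smul_mem_fd τ
  have h1 := ModularGroup.three_le_four_mul_im_sq_of_mem_fd hγ
  have him : 1 / 2 < (γ • τ).im := by nlinarith [(γ • τ).im_pos]
  obtain ⟨γ', h⟩ : ∃ γ' : SL(2, ℤ), γ' • τ ∈ cuspStrip := by
    refine ⟨stripRep τ (bottomRow γ), stripRep_smul_mem _ _, ?_⟩
    rw [Set.mem_ofPred_eq, im_smul_eq_one_div_epsteinQ, bottomRow_stripRep,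
      ← im_smul_eq_one_div_epsteinQ]
    exact him
  calc (1 : ℝ) = cuspStrip.indicator (fun _ => (1 : ℝ)) (γ' • τ) :=
        by rw [Set.indicator_of_mem h]
    _ ≤ cuspWeight τ := (summable_cuspStrip_indicator τ).le_tsum γ'
        fun _ _ => Set.indicator_nonneg (fun _ _ => zero_le_one) _

theorem cuspWeight_pos (τ : ℍ) : 0 < cuspWeight τ := zero_lt_one.trans_le (one_le_cuspWeight τ)

theorem cuspWeight_smul (γ : SL(2, ℤ)) (τ : ℍ) : cuspWeight (γ • τ) = cuspWeight τ := by
  rw [cuspWeight, cuspWeight, ← (Equiv.mulRight γ).tsum_eq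
    fun γ' : SL(2, ℤ) => cuspStrip.indicator (fun _ => (1 : ℝ)) (γ' • τ)]
  simp only [Equiv.coe_mulRight, mul_smul]

theorem measurable_cuspWeight : Measurable cuspWeight :=
  measurable_tsum_of_summable
    (fun γ => (measurable_const.indicator measurableSet_cuspStrip).comp (measurable_const_smul γ))
    summable_cuspStrip_indicator

/-- A partition of unity takes the place of a fundamental domain: dividing by the number of visits
to `cuspStrip` exhibits an invariant function as the sum of the translates of a function supported
there. -/
theorem tsum_cuspStrip_indicator_div {Ψ : ℍ → ℂ} (hΨ : ∀ (γ : SL(2, ℤ)) τ, Ψ (γ • τ) = Ψ τ)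
    (τ : ℍ) :
    ∑' γ : SL(2, ℤ), cuspStrip.indicator (fun τ => Ψ τ / cuspWeight τ) (γ • τ) = Ψ τ := by
  have h : ∀ γ : SL(2, ℤ), cuspStrip.indicator (fun τ => Ψ τ / (cuspWeight τ : ℂ)) (γ • τ) =
      ((cuspStrip.indicator (fun _ => (1 : ℝ)) (γ • τ) : ℝ) : ℂ) * (Ψ τ / cuspWeight τ) := fun γ => by
    by_cases hγ : γ • τ ∈ cuspStrip
    · rw [Set.indicator_of_mem hγ, Set.indicator_of_mem hγ, hΨ, cuspWeight_smul]
      simp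
    · rw [Set.indicator_of_notMem hγ, Set.indicator_of_notMem hγ]
      simp
  rw [tsum_congr h, tsum_mul_right, ← Complex.ofReal_tsum, ← cuspWeight]
  have : (cuspWeight τ : ℂ) ≠ 0 := by exact_mod_cast (cuspWeight_pos τ).ne'
  field_simp

/-! ### Integrals over the upper half plane in Cartesian coordinates -/

/-- Real and imaginary part of a point of the upper half plane. -/
def halfPlaneCoord (τ : ℍ) : ℝ × ℝ := (τ.re, τ.im)

theorem measurableEmbedding_halfPlaneCoord : MeasurableEmbedding halfPlaneCoord :=
  Complex.measurableEquivRealProd.measurableEmbedding.comp UpperHalfPlane.measurableEmbedding_coe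

theorem measurePreserving_halfPlaneCoord :
    MeasurePreserving halfPlaneCoord ((volume : Measure ℂ).comap UpperHalfPlane.coe)
      (volume.restrict (Set.univ ×ˢ Set.Ioi 0)) := by
  have h1 : MeasurePreserving UpperHalfPlane.coe ((volume : Measure ℂ).comap UpperHalfPlane.coe)
      (volume.restrict (.range UpperHalfPlane.coe)) :=
    ⟨UpperHalfPlane.measurable_coe, by rw [UpperHalfPlane.measurableEmbedding_coe.map_comap]⟩
  have h2 := Complex.volume_preserving_equiv_real_prod.restrict_preimage
    (s := Set.univ ×ˢ Set.Ioi (0 : ℝ)) (MeasurableSet.univ.prod measurableSet_Ioi)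
  have h3 : (Set.range UpperHalfPlane.coe) =
      Complex.measurableEquivRealProd ⁻¹' (Set.univ ×ˢ Set.Ioi (0 : ℝ)) := by
    ext z
    simp only [Set.mem_range, Set.mem_preimage, Set.mem_prod, Set.mem_univ, true_and, Set.mem_Ioi]
    exact ⟨fun ⟨τ, h⟩ => h ▸ τ.im_pos, fun h => ⟨⟨z, h⟩, rfl⟩⟩
  rw [← h3] at h2
  exact h2.comp h1

theorem strip_indicator_eq {E : Type*} [Zero E] (f : ℝ × ℝ → E) (τ : ℍ) :
    strip.indicator (fun τ : ℍ => f (τ.re, τ.im)) τ =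
      (Set.Ioc (-(1 / 2)) (1 / 2) ×ˢ Set.univ).indicator f (τ.re, τ.im) := by
  by_cases h : τ ∈ strip
  · have h' : (τ.re, τ.im) ∈ (Set.Ioc (-(1 / 2)) (1 / 2) ×ˢ Set.univ : Set (ℝ × ℝ)) := ⟨h, trivial⟩
    rw [Set.indicator_of_mem h, Set.indicator_of_mem h']
  · rw [Set.indicator_of_notMem h, Set.indicator_of_notMem fun h' => h h'.1]

section

variable {E : Type*} [NormedAddCommGroup E] [NormedSpace ℝ E]

theorem measurable_halfPlane_density :
    Measurable fun τ : ℍ => (1 / NNReal.mk τ.im τ.im_pos.le) ^ 2 := by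
  have : Continuous fun τ : ℍ => NNReal.mk τ.im τ.im_pos.le :=
    UpperHalfPlane.continuous_im.subtype_mk _
  exact (measurable_const.div this.measurable).pow_const 2

theorem integral_halfPlane_eq (f : ℝ × ℝ → E) :
    ∫ τ : ℍ, f (τ.re, τ.im) = ∫ p in Set.univ ×ˢ Set.Ioi 0, (1 / p.2 ^ 2) • f p := by
  rw [UpperHalfPlane.volume_def, integral_withDensity_eq_integral_smul measurable_halfPlane_density,
    ← measurePreserving_halfPlaneCoord.integral_comp measurableEmbedding_halfPlaneCoord]
  refine integral_congr_ae (.of_forall fun τ => ?_)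
  simp only [halfPlaneCoord, NNReal.smul_def]
  congr 1
  push_cast
  simp

theorem integrable_halfPlane_iff (f : ℝ × ℝ → E) :
    Integrable (fun τ : ℍ => f (τ.re, τ.im)) ↔
      IntegrableOn (fun p => (1 / p.2 ^ 2) • f p) (Set.univ ×ˢ Set.Ioi 0) := by
  rw [UpperHalfPlane.volume_def, integrable_withDensity_iff_integrable_smul
    measurable_halfPlane_density, IntegrableOn,
    ← measurePreserving_halfPlaneCoord.integrable_comp_emb measurableEmbedding_halfPlaneCoord]
  refine integrable_congr (.of_forall fun τ => ?_)
  simp only [halfPlaneCoord, NNReal.smul_def, Function.comp]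
  congr 1
  push_cast
  simp

theorem stripSet_measurable :
    MeasurableSet (Set.Ioc (-(1 / 2)) (1 / 2) ×ˢ Set.univ : Set (ℝ × ℝ)) :=
  measurableSet_Ioc.prod .univ

theorem stripSet_inter : (Set.Ioc (-(1 / 2)) (1 / 2) ×ˢ Set.univ) ∩ (Set.univ ×ˢ Set.Ioi 0) =
    (Set.Ioc (-(1 / 2)) (1 / 2) ×ˢ Set.Ioi 0 : Set (ℝ × ℝ)) := by
  rw [Set.prod_inter_prod, Set.inter_univ, Set.univ_inter]

theorem integral_strip_eq (f : ℝ × ℝ → E) :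
    ∫ τ in strip, f (τ.re, τ.im) =
      ∫ p in Set.Ioc (-(1 / 2)) (1 / 2) ×ˢ Set.Ioi 0, (1 / p.2 ^ 2) • f p := by
  rw [← integral_indicator measurableSet_strip]
  simp only [strip_indicator_eq]
  rw [integral_halfPlane_eq, ← stripSet_inter, ← Measure.restrict_restrict stripSet_measurable,
    ← integral_indicator stripSet_measurable]
  refine integral_congr_ae (.of_forall fun p => ?_)
  by_cases h : p ∈ (Set.Ioc (-(1 / 2)) (1 / 2) ×ˢ Set.univ : Set (ℝ × ℝ)) <;>
    simp only [h, Set.indicator_of_mem, Set.indicator_of_notMem, smul_zero, not_false_eq_true]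

theorem integrableOn_strip_iff (f : ℝ × ℝ → E) :
    IntegrableOn (fun τ : ℍ => f (τ.re, τ.im)) strip ↔
      IntegrableOn (fun p => (1 / p.2 ^ 2) • f p) (Set.Ioc (-(1 / 2)) (1 / 2) ×ˢ Set.Ioi 0) := by
  rw [← integrable_indicator_iff measurableSet_strip, funext (strip_indicator_eq f),
    integrable_halfPlane_iff, ← stripSet_inter, IntegrableOn, IntegrableOn,
    ← Measure.restrict_restrict stripSet_measurable, ← IntegrableOn, ← IntegrableOn,
    ← integrable_indicator_iff stripSet_measurable, IntegrableOn]
  refine integrable_congr (.of_forall fun p => ?_)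
  by_cases h : p ∈ (Set.Ioc (-(1 / 2)) (1 / 2) ×ˢ Set.univ : Set (ℝ × ℝ)) <;>
    simp only [h, Set.indicator_of_mem, Set.indicator_of_notMem, smul_zero, not_false_eq_true]

end

theorem integrableOn_strip_of_im {g : ℝ → ℝ}
    (hg : IntegrableOn (fun t => 1 / t ^ 2 * g t) (Set.Ioi 0)) :
    IntegrableOn (fun τ : ℍ => g τ.im) strip := by
  rw [integrableOn_strip_iff (fun p => g p.2), IntegrableOn, Measure.volume_eq_prod,
    ← Measure.prod_restrict]
  have := (integrable_const (1 : ℝ) (μ := volume.restrict (Set.Ioc (-(1 / 2) : ℝ) (1 / 2)))).mul_prod hg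
  simpa using this

theorem integrableOn_cuspStrip_exp {c : ℝ} (hc : 0 < c) (k : ℕ) :
    IntegrableOn (fun τ : ℍ => τ.im ^ k * Real.exp (-c * τ.im)) cuspStrip := by
  -- Above height `1/2` the extra factor `4 t²` is at least one, and its `t²` cancels the density of
  -- the hyperbolic measure.
  have h := integrableOn_strip_of_im (g := fun t => 4 * t ^ (k + 2) * Real.exp (-c * t)) (by
    have := integrableOn_rpow_mul_exp_neg_mul_rpow (s := k) (p := 1) (b := c)
      (by have : (0 : ℝ) ≤ k := by positivity
          linarith) one_pos hc
    refine IntegrableOn.congr_fun (this.const_mul 4) (fun t ht => ?_) measurableSet_Ioi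
    have ht' : t ≠ 0 := (Set.mem_Ioi.1 ht).ne'
    simp only [Real.rpow_natCast, Real.rpow_one]
    field_simp
    ring)
  refine Integrable.mono' (h.mono_set Set.inter_subset_left) ?_ ?_
  · refine Measurable.aestronglyMeasurable ?_
    have := UpperHalfPlane.continuous_im.measurable
    fun_prop
  · refine (ae_restrict_mem measurableSet_cuspStrip).mono fun τ hτ => ?_
    have h1 : 1 / 2 < τ.im := hτ.2
    rw [Real.norm_of_nonneg (by positivity), pow_add]
    refine mul_le_mul_of_nonneg_right ?_ (Real.exp_pos _).le
    have : 0 ≤ τ.im ^ k := by positivity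
    have h2 : 1 ≤ 4 * τ.im ^ 2 := by nlinarith
    nlinarith

/-! ### The lattice sums: quadratic forms and their positivity -/

/-- Integral vectors, in the coordinates `((a, c), (x, y))`. -/
abbrev IntVec : Type := (ℤ × ℤ) × ((Fin 4 → ℤ) × (Fin 4 → ℤ))

/-- Vectors in the coordinates `(a, x, y, c)`. -/
def mkIx {R : Type*} (a c : R) (x y : Fin 4 → R) : Ix → R :=
  Sum.elim (fun _ => a) (Sum.elim (Sum.elim x y) (fun _ => c))

/-- The coordinates of an integral vector. -/
def latEquiv : IntVec ≃ (Ix → ℤ) where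
  toFun l := mkIx l.1.1 l.1.2 l.2.1 l.2.2
  invFun v := ((v ixA, v ixC), (fun i => v (ixX i), fun i => v (ixY i)))
  left_inv l := rfl
  right_inv v := by
    funext j
    rcases j with j | (j | j) | j <;> rfl

/-- The cast of an integral vector. -/
abbrev toReal (x : Fin 4 → ℤ) : Fin 4 → ℝ := fun i => (x i : ℝ)

theorem sum_Ix {R : Type*} [AddCommMonoid R] (f : Ix → R) :
    ∑ j, f j = f ixA + ((∑ i, f (ixX i) + ∑ i, f (ixY i)) + f ixC) := by
  simp [Fintype.sum_sum_type]

/-- The squared Euclidean norm of an integral vector. -/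
def latNorm (l : IntVec) : ℝ :=
  (l.1.1 : ℝ) ^ 2 + (l.1.2 : ℝ) ^ 2 + sqNorm (toReal l.2.1) + sqNorm (toReal l.2.2)

theorem latNorm_eq (l : IntVec) : latNorm l = ∑ j, (latEquiv l j : ℝ) ^ 2 := by
  rw [sum_Ix]
  simp only [latNorm, latEquiv, Equiv.coe_fn_mk, mkIx, sqNorm, Sum.elim_inl, Sum.elim_inr, toReal]
  ring

theorem latNorm_nonneg (l : IntVec) : 0 ≤ latNorm l := by
  rw [latNorm_eq]
  exact Finset.sum_nonneg fun _ _ => sq_nonneg _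

theorem one_le_latNorm {l : IntVec} (hl : l ≠ 0) : 1 ≤ latNorm l := by
  rw [latNorm_eq]
  have : latEquiv l ≠ 0 := fun h => hl (latEquiv.injective (by rw [h]; funext j; rcases j with j | (j | j) | j <;> rfl))
  obtain ⟨j, hj⟩ := Function.ne_iff.1 this
  have h1 : (1 : ℝ) ≤ (latEquiv l j : ℝ) ^ 2 := by
    have : 1 ≤ (latEquiv l j) ^ 2 := by have := sq_pos_of_ne_zero hj; omega
    exact_mod_cast this
  exact h1.trans (Finset.single_le_sum (f := fun j => (latEquiv l j : ℝ) ^ 2)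
    (fun _ _ => sq_nonneg _) (Finset.mem_univ j))

theorem summable_exp_latNorm {c : ℝ} (hc : 0 < c) :
    Summable fun l : IntVec => Real.exp (-c * latNorm l) := by
  simp only [latNorm_eq]
  exact latEquiv.summable_iff.2 (summable_gaussian_pi (ι := Ix) hc)

/-- The abscissa 5 is half the rank of the lattice. A nonzero vector has norm at least one, so its
norm is at least half of one plus the norm. -/
theorem summable_latNorm_rpow {r : ℝ} (hr : 5 < r) :
    Summable fun l : {l : IntVec // l ≠ 0} => latNorm l ^ (-r) := by
  have h1 := (latEquiv.summable_iff.2 (summable_pi_one_add_sq_rpow (ι := Ix) (r := -r)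
    (by simp [Ix]; linarith) (by simp [Ix]))).mul_left ((1 / 2) ^ (-r))
  refine (h1.subtype {l | l ≠ 0}).of_nonneg_of_le
    (fun l => Real.rpow_nonneg (latNorm_nonneg _) _) fun l => ?_
  have h2 := one_le_latNorm l.2
  simp only [Function.comp, ← latNorm_eq]
  rw [← Real.mul_rpow (by norm_num) (by linarith)]
  exact Real.rpow_le_rpow_of_nonpos (by linarith) (by linarith) (by linarith)

section Forms

variable (y : ℝ) (e B : Matrix (Fin 4) (Fin 4) ℝ) (q : Fin 4 ⊕ Fin 4 → ℝ)

/-- `x + a Q₁` -/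
def shiftX (a : ℝ) (x : Fin 4 → ℝ) : Fin 4 → ℝ := fun i => x i + a * q (Sum.inl i)

/-- `y + a Q₂` -/
def shiftY (a : ℝ) (x : Fin 4 → ℝ) : Fin 4 → ℝ := fun i => x i + a * q (Sum.inr i)

/-- The positive form `|(X, Y) h₄|²`. -/
noncomputable def narainForm (X Y : Fin 4 → ℝ) : ℝ :=
  sqNorm (X ᵥ* e) + sqNorm ((X ᵥ* B + Y) ᵥ* (eᵀ)⁻¹)

/-- `a Q₁ ⬝ Q₂ + x ⬝ Q₂ + y ⬝ Q₁` -/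
noncomputable def radPairing (a : ℝ) (x z : Fin 4 → ℝ) : ℝ :=
  ∑ i, (a * q (Sum.inl i) * q (Sum.inr i) + x i * q (Sum.inr i) + z i * q (Sum.inl i))

/-- The form `|r τ + s|² / Im τ`. -/
noncomputable def pairForm (τ : ℍ) (r s : ℝ) : ℝ := ((s + τ.re * r) ^ 2 + τ.im ^ 2 * r ^ 2) / τ.im

/-- The squared norm of the row vector `(a, x, z, c) u(Q) h`. -/
noncomputable def hamForm (a c : ℝ) (x z : Fin 4 → ℝ) : ℝ :=
  a ^ 2 / y + narainForm e B (shiftX q a x) (shiftY q a z) + y * (c - radPairing q a x z) ^ 2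

/-- The exponent after Poisson summation in the last coordinate. -/
noncomputable def midForm (τ : ℍ) (a b : ℝ) (x z : Fin 4 → ℝ) : ℝ :=
  pairForm τ a b / y + τ.im * narainForm e B (shiftX q a x) (shiftY q a z)

/-- The exponent after Poisson summation in five coordinates. -/
noncomputable def lagForm (τ : ℍ) (a b : ℝ) (x z : Fin 4 → ℝ) : ℝ :=
  pairForm τ a b / y + ∑ i, pairForm τ ((shiftX q a x ᵥ* e) i) ((shiftX q b z ᵥ* e) i)

variable {y e}

theorem narainForm_nonneg (X Y : Fin 4 → ℝ) : 0 ≤ narainForm e B X Y :=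
  add_nonneg (sqNorm_nonneg _) (sqNorm_nonneg _)

theorem vecMul_eq_zero_of_det_ne_zero (he : e.det ≠ 0) {v : Fin 4 → ℝ} (h : v ᵥ* e = 0) : v = 0 :=
  Matrix.eq_zero_of_vecMul_eq_zero he h

theorem det_transpose_inv_ne_zero (he : e.det ≠ 0) : (eᵀ)⁻¹.det ≠ 0 := by
  rw [Matrix.det_nonsing_inv, Matrix.det_transpose, Ring.inverse_eq_inv']
  exact inv_ne_zero he

theorem sqNorm_eq_zero {v : Fin 4 → ℝ} (h : sqNorm v = 0) : v = 0 := by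
  by_contra hv
  exact (sqNorm_pos hv).ne' h

theorem narainForm_pos (he : e.det ≠ 0) {X Y : Fin 4 → ℝ} (h : ¬ (X = 0 ∧ Y = 0)) :
    0 < narainForm e B X Y := by
  refine lt_of_le_of_ne (narainForm_nonneg B X Y) fun h0 => h ?_
  have h1 := sqNorm_nonneg (X ᵥ* e)
  have h2 := sqNorm_nonneg ((X ᵥ* B + Y) ᵥ* (eᵀ)⁻¹)
  rw [narainForm] at h0
  have hX : X = 0 := vecMul_eq_zero_of_det_ne_zero he (sqNorm_eq_zero (by linarith))
  refine ⟨hX, ?_⟩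
  have := vecMul_eq_zero_of_det_ne_zero (det_transpose_inv_ne_zero he)
    (sqNorm_eq_zero (v := (X ᵥ* B + Y) ᵥ* (eᵀ)⁻¹) (by linarith))
  simpa [hX] using this

theorem pairForm_nonneg (τ : ℍ) (r s : ℝ) : 0 ≤ pairForm τ r s := by
  have := τ.im_pos
  unfold pairForm; positivity

theorem pairForm_pos (τ : ℍ) {r s : ℝ} (h : ¬ (r = 0 ∧ s = 0)) : 0 < pairForm τ r s := by
  have hv := τ.im_pos
  refine lt_of_le_of_ne (pairForm_nonneg τ r s) fun h0 => h ?_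
  have h1 : (s + τ.re * r) ^ 2 + τ.im ^ 2 * r ^ 2 = 0 := by
    rw [pairForm, eq_comm, div_eq_zero_iff] at h0
    exact h0.resolve_right hv.ne'
  have hr : r = 0 := by
    have : τ.im ^ 2 * r ^ 2 = 0 := by nlinarith [sq_nonneg (s + τ.re * r), sq_nonneg (τ.im * r)]
    simpa [hv.ne'] using this
  exact ⟨hr, by simpa [hr] using h1⟩

/-- The three quadratic forms that occur before, between and after the Poisson summations all get
their lower bounds from here; only continuity, homogeneity and definiteness have to be checked for
each. -/
theorem exists_latNorm_le {X : Type*} [TopologicalSpace X] {s : Set X} (hs : IsCompact s)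
    (f : X → ℝ → ℝ → (Fin 4 → ℝ) → (Fin 4 → ℝ) → ℝ)
    (hf : Continuous fun p : X × (Ix → ℝ) =>
      f p.1 (p.2 ixA) (p.2 ixC) (fun i => p.2 (ixX i)) (fun i => p.2 (ixY i)))
    (hom : ∀ p r a c x z, f p (r * a) (r * c) (r • x) (r • z) = r ^ 2 * f p a c x z)
    (hpos : ∀ p a c x z, 0 ≤ f p a c x z ∧ (f p a c x z = 0 → a = 0 ∧ c = 0 ∧ x = 0 ∧ z = 0)) :
    ∃ k : ℝ, 0 < k ∧ ∀ p ∈ s, ∀ l : IntVec, k * latNorm l ≤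
      f p l.1.1 l.1.2 (toReal l.2.1) (toReal l.2.2) := by
  obtain ⟨k, hk, h⟩ := exists_quadratic_lower_bound_pi hs
    (fun p v => f p (v ixA) (v ixC) (fun i => v (ixX i)) (fun i => v (ixY i))) hf
    (fun p r v => hom p r _ _ _ _) (fun p _ v hv => by
      obtain ⟨h1, h2⟩ := hpos p (v ixA) (v ixC) (fun i => v (ixX i)) (fun i => v (ixY i))
      refine lt_of_le_of_ne h1 fun h0 => hv ?_
      obtain ⟨ha, hc, hx, hz⟩ := h2 h0.symm
      funext j
      rcases j with j | (j | j) | j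
      · exact ha
      · exact congrFun hx j
      · exact congrFun hz j
      · exact hc)
  refine ⟨k, hk, fun p hp l => ?_⟩
  have := h p hp (fun j => (latEquiv l j : ℝ))
  rw [← latNorm_eq] at this
  exact this

theorem pairForm_smul (τ : ℍ) (k r s : ℝ) : pairForm τ (k * r) (k * s) = k ^ 2 * pairForm τ r s := by
  unfold pairForm; ring

theorem shiftX_zero (x : Fin 4 → ℝ) : shiftX q 0 x = x := by
  funext i; simp [shiftX]

theorem shiftY_zero (x : Fin 4 → ℝ) : shiftY q 0 x = x := by
  funext i; simp [shiftY]

theorem shiftX_smul (k a : ℝ) (x : Fin 4 → ℝ) : shiftX q (k * a) (k • x) = k • shiftX q a x := by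
  funext i; simp [shiftX]; ring

theorem shiftY_smul (k a : ℝ) (x : Fin 4 → ℝ) : shiftY q (k * a) (k • x) = k • shiftY q a x := by
  funext i; simp [shiftY]; ring

theorem narainForm_smul (k : ℝ) (X Y : Fin 4 → ℝ) :
    narainForm e B (k • X) (k • Y) = k ^ 2 * narainForm e B X Y := by
  unfold narainForm
  rw [Matrix.smul_vecMul, Matrix.smul_vecMul, ← smul_add, Matrix.smul_vecMul, sqNorm_smul,
    sqNorm_smul]
  ring

theorem radPairing_smul (k a : ℝ) (x z : Fin 4 → ℝ) :
    radPairing q (k * a) (k • x) (k • z) = k * radPairing q a x z := by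
  unfold radPairing
  rw [Finset.mul_sum]
  exact Finset.sum_congr rfl fun i _ => by simp; ring

/-- Definiteness is triangular: vanishing of the form first forces `a = 0`, which removes the shifts
and forces `x = z = 0`, which removes the pairing and forces `c = 0`. -/
theorem exists_hamForm_ge (hy : 0 < y) (he : e.det ≠ 0) {s : Set (Fin 4 ⊕ Fin 4 → ℝ)}
    (hs : IsCompact s) :
    ∃ k : ℝ, 0 < k ∧ ∀ q ∈ s, ∀ l : IntVec, k * latNorm l ≤
      hamForm y e B q l.1.1 l.1.2 (toReal l.2.1) (toReal l.2.2) := by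
  refine exists_latNorm_le hs (fun q => hamForm y e B q) ?_ ?_ ?_
  · unfold hamForm narainForm radPairing shiftX shiftY
    have := continuous_sqNorm (ι := Fin 4)
    fun_prop
  · intro q r a c x z
    unfold hamForm
    rw [shiftX_smul, shiftY_smul, narainForm_smul, radPairing_smul]
    ring
  · intro q a c x z
    have h1 : 0 ≤ a ^ 2 / y := by positivity
    have h2 := narainForm_nonneg (e := e) B (shiftX q a x) (shiftY q a z)
    have h3 : 0 ≤ y * (c - radPairing q a x z) ^ 2 := by positivity
    refine ⟨by unfold hamForm; positivity, fun h => ?_⟩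
    unfold hamForm at h
    have ha : a = 0 := by
      have : a ^ 2 / y = 0 := by linarith
      simpa [hy.ne'] using this
    subst ha
    have hn : shiftX q 0 x = 0 ∧ shiftY q 0 z = 0 := by
      by_contra hn
      have := narainForm_pos B he hn
      linarith
    have hx : x = 0 := (shiftX_zero q x).symm.trans hn.1
    have hz : z = 0 := (shiftY_zero q z).symm.trans hn.2
    refine ⟨rfl, ?_, hx, hz⟩
    have : y * (c - radPairing q 0 x z) ^ 2 = 0 := by linarith
    simpa [hy.ne', hx, hz, radPairing] using this

theorem exists_midForm_ge (hy : 0 < y) (he : e.det ≠ 0) (τ : ℍ) {s : Set (Fin 4 ⊕ Fin 4 → ℝ)}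
    (hs : IsCompact s) :
    ∃ k : ℝ, 0 < k ∧ ∀ q ∈ s, ∀ l : IntVec, k * latNorm l ≤
      midForm y e B q τ l.1.1 l.1.2 (toReal l.2.1) (toReal l.2.2) := by
  have hv := τ.im_pos
  refine exists_latNorm_le hs (fun q => midForm y e B q τ) ?_ ?_ ?_
  · unfold midForm narainForm pairForm shiftX shiftY
    have := continuous_sqNorm (ι := Fin 4)
    fun_prop
  · intro q r a c x z
    unfold midForm
    rw [shiftX_smul, shiftY_smul, narainForm_smul, pairForm_smul]
    ring
  · intro q a c x z
    have h1 : 0 ≤ pairForm τ a c / y := div_nonneg (pairForm_nonneg _ _ _) hy.le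
    have h2 : 0 ≤ τ.im * narainForm e B (shiftX q a x) (shiftY q a z) :=
      mul_nonneg hv.le (narainForm_nonneg _ _ _)
    refine ⟨add_nonneg h1 h2, fun h => ?_⟩
    unfold midForm at h
    have hac : a = 0 ∧ c = 0 := by
      by_contra hn
      have := div_pos (pairForm_pos τ hn) hy
      linarith
    have hn : shiftX q a x = 0 ∧ shiftY q a z = 0 := by
      by_contra hn
      have := mul_pos hv (narainForm_pos B he hn)
      linarith
    obtain ⟨rfl, rfl⟩ := hac
    exact ⟨rfl, rfl, (shiftX_zero q x).symm.trans hn.1, (shiftY_zero q z).symm.trans hn.2⟩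

theorem exists_lagForm_ge (hy : 0 < y) (he : e.det ≠ 0) (τ : ℍ) :
    ∃ k : ℝ, 0 < k ∧ ∀ l : IntVec, k * latNorm l ≤
      lagForm y e q τ l.1.1 l.1.2 (toReal l.2.1) (toReal l.2.2) := by
  have hv := τ.im_pos
  suffices h : ∃ k : ℝ, 0 < k ∧ ∀ p ∈ ({()} : Set Unit), ∀ l : IntVec, k * latNorm l ≤
      (fun _ : Unit => lagForm y e q τ) p l.1.1 l.1.2 (toReal l.2.1) (toReal l.2.2) by
    obtain ⟨k, hk, h⟩ := h
    exact ⟨k, hk, h () rfl⟩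
  refine exists_latNorm_le (isCompact_singleton (x := ())) (fun _ => lagForm y e q τ) ?_ ?_ ?_
  · unfold lagForm pairForm shiftX Matrix.vecMul dotProduct
    fun_prop
  · intro _ r a c x z
    unfold lagForm
    rw [shiftX_smul, shiftX_smul, Matrix.smul_vecMul, Matrix.smul_vecMul, pairForm_smul]
    simp only [Pi.smul_apply, smul_eq_mul, pairForm_smul]
    rw [← Finset.mul_sum]
    ring
  · intro _ a c x z
    have h1 : 0 ≤ pairForm τ a c / y := div_nonneg (pairForm_nonneg _ _ _) hy.le
    have h2 : ∀ i, 0 ≤ pairForm τ ((shiftX q a x ᵥ* e) i) ((shiftX q c z ᵥ* e) i) :=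
      fun i => pairForm_nonneg _ _ _
    have h3 := Finset.sum_nonneg fun i (_ : i ∈ Finset.univ) => h2 i
    refine ⟨add_nonneg h1 h3, fun h => ?_⟩
    unfold lagForm at h
    have hac : a = 0 ∧ c = 0 := by
      by_contra hn
      have := div_pos (pairForm_pos τ hn) hy
      linarith
    have hxz : ∀ i, (shiftX q a x ᵥ* e) i = 0 ∧ (shiftX q c z ᵥ* e) i = 0 := by
      intro i
      by_contra hn
      have h4 := pairForm_pos τ hn
      have h5 := Finset.single_le_sum (fun i _ => h2 i) (Finset.mem_univ i)
      linarith
    have hX := vecMul_eq_zero_of_det_ne_zero he (funext fun i => (hxz i).1)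
    have hZ := vecMul_eq_zero_of_det_ne_zero he (funext fun i => (hxz i).2)
    obtain ⟨rfl, rfl⟩ := hac
    exact ⟨rfl, rfl, (shiftX_zero q x).symm.trans hX, (shiftX_zero q z).symm.trans hZ⟩

end Forms

/-! ### The lattice sums: Poisson summation -/

theorem mul_cexp_mul_cexp (c a b : ℂ) :
    c * Complex.exp a * Complex.exp b = c * Complex.exp (a + b) := by
  rw [mul_assoc, Complex.exp_add]

section Terms

variable (y : ℝ) (e B : Matrix (Fin 4) (Fin 4) ℝ) (q : Fin 4 ⊕ Fin 4 → ℝ) (τ : ℍ)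

/-- The summand of the Siegel–Narain theta function in the Hamiltonian form. -/
noncomputable def hamTerm (l : IntVec) : ℂ :=
  ((τ.im ^ 2 * √τ.im : ℝ) : ℂ) * Complex.exp
    (((-Real.pi * τ.im * hamForm y e B q l.1.1 l.1.2 (toReal l.2.1) (toReal l.2.2) : ℝ) : ℂ) +
      2 * Real.pi * Complex.I *
        ((-(τ.re * (l.1.1 * l.1.2 + ∑ i, (l.2.1 i : ℝ) * l.2.2 i)) : ℝ) : ℂ))

/-- The summand after Poisson summation in the last coordinate. -/
noncomputable def midTerm (l : IntVec) : ℂ :=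
  (((√y)⁻¹ * τ.im ^ 2 : ℝ) : ℂ) * Complex.exp
    (((-Real.pi * midForm y e B q τ l.1.1 l.1.2 (toReal l.2.1) (toReal l.2.2) : ℝ) : ℂ) +
      2 * Real.pi * Complex.I *
        ((-(τ.re * ∑ i, (l.2.1 i : ℝ) * l.2.2 i) -
          (l.1.2 + τ.re * l.1.1) * radPairing q l.1.1 (toReal l.2.1) (toReal l.2.2) : ℝ) : ℂ))

/-- The phase of the Lagrangian form. -/
noncomputable def lagPhase (a b : ℝ) (x z : Fin 4 → ℝ) : ℝ :=
  ∑ i, ((shiftX q a x ᵥ* B) i * shiftX q b z i + q (Sum.inr i) * (a * z i - b * x i))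

/-- The summand after Poisson summation in five coordinates. -/
noncomputable def lagTerm (l : IntVec) : ℂ :=
  ((|e.det| * (√y)⁻¹ : ℝ) : ℂ) * Complex.exp
    (((-Real.pi * lagForm y e q τ l.1.1 l.1.2 (toReal l.2.1) (toReal l.2.2) : ℝ) : ℂ) +
      2 * Real.pi * Complex.I *
        ((lagPhase B q l.1.1 l.1.2 (toReal l.2.1) (toReal l.2.2) : ℝ) : ℂ))

theorem norm_hamTerm (l : IntVec) : ‖hamTerm y e B q τ l‖ = τ.im ^ 2 * √τ.im *
    Real.exp (-Real.pi * τ.im * hamForm y e B q l.1.1 l.1.2 (toReal l.2.1) (toReal l.2.2)) := by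
  rw [hamTerm, norm_mul, norm_cexp_add_two_pi_I, Complex.norm_real, Real.norm_of_nonneg (by positivity)]

theorem norm_midTerm (l : IntVec) : ‖midTerm y e B q τ l‖ = (√y)⁻¹ * τ.im ^ 2 *
    Real.exp (-Real.pi * midForm y e B q τ l.1.1 l.1.2 (toReal l.2.1) (toReal l.2.2)) := by
  rw [midTerm, norm_mul, norm_cexp_add_two_pi_I, Complex.norm_real, Real.norm_of_nonneg (by positivity)]

theorem norm_lagTerm (l : IntVec) : ‖lagTerm y e B q τ l‖ = |e.det| * (√y)⁻¹ *
    Real.exp (-Real.pi * lagForm y e q τ l.1.1 l.1.2 (toReal l.2.1) (toReal l.2.2)) := by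
  rw [lagTerm, norm_mul, norm_cexp_add_two_pi_I, Complex.norm_real, Real.norm_of_nonneg (by positivity)]

variable {y e}

theorem summable_hamTerm (hy : 0 < y) (he : e.det ≠ 0) : Summable (hamTerm y e B q τ) := by
  obtain ⟨k, hk, h⟩ := exists_hamForm_ge B hy he (isCompact_singleton (x := q))
  have hv := τ.im_pos
  refine .of_norm_bounded ((summable_exp_latNorm (c := Real.pi * τ.im * k)
    (by have := Real.pi_pos; positivity)).mul_left (τ.im ^ 2 * √τ.im)) fun l => ?_
  rw [norm_hamTerm]
  have h1 := mul_le_mul_of_nonneg_left (h q rfl l) (mul_pos Real.pi_pos hv).le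
  refine mul_le_mul_of_nonneg_left (Real.exp_le_exp.2 ?_) (by positivity)
  linarith

theorem exists_norm_midTerm_le (hy : 0 < y) (he : e.det ≠ 0) {s : Set (Fin 4 ⊕ Fin 4 → ℝ)}
    (hs : IsCompact s) : ∃ u : IntVec → ℝ, Summable u ∧
      ∀ q ∈ s, ∀ l, ‖midTerm y e B q τ l‖ ≤ u l := by
  obtain ⟨k, hk, h⟩ := exists_midForm_ge B hy he τ hs
  refine ⟨_, (summable_exp_latNorm (c := Real.pi * k)
    (by have := Real.pi_pos; positivity)).mul_left ((√y)⁻¹ * τ.im ^ 2), fun q hq l => ?_⟩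
  rw [norm_midTerm]
  have h1 := mul_le_mul_of_nonneg_left (h q hq l) Real.pi_pos.le
  refine mul_le_mul_of_nonneg_left (Real.exp_le_exp.2 ?_) (by positivity)
  linarith

theorem summable_midTerm (hy : 0 < y) (he : e.det ≠ 0) : Summable (midTerm y e B q τ) := by
  obtain ⟨u, hu, h⟩ := exists_norm_midTerm_le B τ hy he (isCompact_singleton (x := q))
  exact .of_norm_bounded hu fun l => h q rfl l

theorem summable_lagTerm (hy : 0 < y) (he : e.det ≠ 0) : Summable (lagTerm y e B q τ) := by
  obtain ⟨k, hk, h⟩ := exists_lagForm_ge q hy he τ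
  refine .of_norm_bounded ((summable_exp_latNorm (c := Real.pi * k)
    (by have := Real.pi_pos; positivity)).mul_left (|e.det| * (√y)⁻¹)) fun l => ?_
  rw [norm_lagTerm]
  have h1 := mul_le_mul_of_nonneg_left (h l) Real.pi_pos.le
  refine mul_le_mul_of_nonneg_left (Real.exp_le_exp.2 ?_) (by positivity)
  linarith

/-- The phase `e^{-2πi τ₁ a c}` shifts the dual variable from `b` to `b + τ₁ a`. With the term `a² /
y` already present this completes `|a τ + b|² / (τ₂ y)`. The prefactor `τ₂^{5/2}` loses `√(τ₂ y)`.
-/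
theorem tsum_hamTerm_last (hy : 0 < y) (a : ℤ) (w : (Fin 4 → ℤ) × (Fin 4 → ℤ)) :
    ∑' c : ℤ, hamTerm y e B q τ ((a, c), w) = ∑' b : ℤ, midTerm y e B q τ ((a, b), w) := by
  have hv := τ.im_pos
  set P := radPairing q a (toReal w.1) (toReal w.2) with hP
  set n := narainForm e B (shiftX q a (toReal w.1)) (shiftY q a (toReal w.2)) with hn
  set C : ℂ := ((τ.im ^ 2 * √τ.im : ℝ) : ℂ) * Complex.exp
    (((-Real.pi * τ.im * ((a : ℝ) ^ 2 / y + n) : ℝ) : ℂ) +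
      2 * Real.pi * Complex.I * ((-(τ.re * ∑ i, (w.1 i : ℝ) * w.2 i) : ℝ) : ℂ)) with hC
  have h := tsum_int_gaussian_poisson (mul_pos hv hy) (-P) (-(τ.re * a))
  have h1 : ∀ c : ℤ, hamTerm y e B q τ ((a, c), w) = C * Complex.exp
      (((-Real.pi * (τ.im * y) * ((c : ℝ) + -P) ^ 2 : ℝ) : ℂ) +
        2 * Real.pi * Complex.I * (((c : ℝ) * -(τ.re * a) : ℝ) : ℂ)) := fun c => by
    rw [hamTerm, hC, mul_cexp_mul_cexp, hamForm]
    congr 2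
    simp only [← hP, ← hn]
    push_cast
    ring
  have h2 : ∀ b : ℤ, midTerm y e B q τ ((a, b), w) = C * (((√(τ.im * y))⁻¹ : ℝ) : ℂ) * Complex.exp
      (((-Real.pi / (τ.im * y) * ((b : ℝ) - -(τ.re * a)) ^ 2 : ℝ) : ℂ) +
        2 * Real.pi * Complex.I * ((((b : ℝ) - -(τ.re * a)) * -P : ℝ) : ℂ)) := fun b => by
    have hsq : √τ.im * √τ.im = τ.im := Real.mul_self_sqrt hv.le
    have hs : √τ.im ≠ 0 := (Real.sqrt_pos.2 hv).ne'
    have hc : (√y)⁻¹ * τ.im ^ 2 = τ.im ^ 2 * √τ.im * (√(τ.im * y))⁻¹ := by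
      rw [Real.sqrt_mul hv.le, mul_inv]
      field_simp
    rw [midTerm, hC, hc, mul_right_comm _ (Complex.exp _), ← Complex.ofReal_mul,
      mul_cexp_mul_cexp, midForm]
    congr 2
    simp only [← hP, ← hn, pairForm]
    have hre : -Real.pi * (((b : ℝ) + τ.re * a) ^ 2 + τ.im ^ 2 * a ^ 2) / τ.im / y =
      -Real.pi * τ.im * (a ^ 2 / y) + -Real.pi / (τ.im * y) * (b - -(τ.re * a)) ^ 2 := by
      field_simp
      ring
    have : -Real.pi * ((((b : ℝ) + τ.re * a) ^ 2 + τ.im ^ 2 * a ^ 2) / τ.im / y + τ.im * n) =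
      -Real.pi * τ.im * (a ^ 2 / y + n) + -Real.pi / (τ.im * y) * (b - -(τ.re * a)) ^ 2 := by
      linear_combination hre
    rw [this]
    push_cast
    ring
  rw [tsum_congr h1, tsum_congr h2, tsum_mul_left, tsum_mul_left, h, ← mul_assoc C]

/-- Reordering of the coordinates which isolates the last one. -/
def lastEquiv : (ℤ × ((Fin 4 → ℤ) × (Fin 4 → ℤ))) × ℤ ≃ IntVec where
  toFun p := ((p.1.1, p.2), p.1.2)
  invFun l := ((l.1.1, l.2), l.1.2)
  left_inv _ := rfl
  right_inv _ := rfl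

theorem tsum_hamTerm_eq (hy : 0 < y) (he : e.det ≠ 0) :
    ∑' l, hamTerm y e B q τ l = ∑' l, midTerm y e B q τ l := by
  have h1 := (lastEquiv.summable_iff.2 (summable_hamTerm B q τ hy he)).tsum_prod
  have h2 := (lastEquiv.summable_iff.2 (summable_midTerm B q τ hy he)).tsum_prod
  simp only [Function.comp_apply] at h1 h2
  rw [← lastEquiv.tsum_eq, ← lastEquiv.tsum_eq (midTerm y e B q τ), h1, h2]
  exact tsum_congr fun p => tsum_hamTerm_last B q τ hy p.1 p.2

theorem sum_vecMul_antisymm {B : Matrix (Fin 4) (Fin 4) ℝ} (hB : Bᵀ = -B) (X Z : Fin 4 → ℝ) :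
    ∑ i, (X ᵥ* B) i * Z i = -∑ i, (Z ᵥ* B) i * X i := by
  have h : ∀ i j, B i j = -B j i := fun i j => by
    have := congrFun (congrFun hB j) i
    simpa [Matrix.transpose_apply] using this
  simp only [Matrix.vecMul, dotProduct, Finset.sum_mul]
  rw [Finset.sum_comm, ← Finset.sum_neg_distrib]
  refine Finset.sum_congr rfl fun i _ => ?_
  rw [← Finset.sum_neg_distrib]
  refine Finset.sum_congr rfl fun j _ => ?_
  rw [h i j]; ring

theorem sum_vecMul_self {B : Matrix (Fin 4) (Fin 4) ℝ} (hB : Bᵀ = -B) (X : Fin 4 → ℝ) :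
    ∑ i, (X ᵥ* B) i * X i = 0 := by
  have := sum_vecMul_antisymm hB X X
  linarith

variable {B}

/-- Poisson summation in the four remaining dual coordinates uses up the prefactor `τ₂²`. The new
variable enters as `Z + τ₁ X`, with `X` and `Z` the shifted vectors, so `τ` survives only through
the forms `|X τ + Z|² / τ₂`, and the phase no longer contains it. -/
theorem tsum_midTerm_last (hB : Bᵀ = -B) (he : e.det ≠ 0) (a b : ℤ) (x : Fin 4 → ℤ) :
    ∑' z, midTerm y e B q τ ((a, b), (x, z)) = ∑' z, lagTerm y e B q τ ((a, b), (x, z)) := by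
  have hv := τ.im_pos
  set X := shiftX q a (toReal x) with hX
  set u : Fin 4 → ℝ := fun i => (X ᵥ* B) i + a * q (Sum.inr i) with hu
  set v : Fin 4 → ℝ := fun i => -(τ.re * x i) - (b + τ.re * a) * q (Sum.inl i) with hvdef
  set C : ℂ := (((√y)⁻¹ * τ.im ^ 2 : ℝ) : ℂ) * Complex.exp
    (((-Real.pi * (pairForm τ a b / y + τ.im * sqNorm (X ᵥ* e)) : ℝ) : ℂ) +
      2 * Real.pi * Complex.I * ((-((b + τ.re * a) * ∑ i, X i * q (Sum.inr i)) : ℝ) : ℂ)) with hC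
  have h := tsum_gaussian_poisson he hv u v
  have hXi : ∀ i, X i = x i + a * q (Sum.inl i) := fun i => rfl
  have h1 : ∀ z : Fin 4 → ℤ, midTerm y e B q τ ((a, b), (x, z)) = C * Complex.exp
      (((-Real.pi * τ.im * sqNorm ((fun i => u i + z i) ᵥ* (eᵀ)⁻¹) : ℝ) : ℂ) +
        2 * Real.pi * Complex.I * ((∑ i, z i * v i : ℝ) : ℂ)) := fun z => by
    have hz : (X ᵥ* B + shiftY q a (toReal z)) = fun i => u i + z i := by
      funext i; simp [hu, shiftY]; ring
    have hph : -(τ.re * ∑ i, (x i : ℝ) * z i) -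
        (b + τ.re * a) * radPairing q a (toReal x) (toReal z) =
        -((b + τ.re * a) * ∑ i, X i * q (Sum.inr i)) + ∑ i, z i * v i := by
      simp only [radPairing, Finset.mul_sum, ← Finset.sum_neg_distrib, ← Finset.sum_sub_distrib,
        ← Finset.sum_add_distrib, hXi, hvdef]
      exact Finset.sum_congr rfl fun i _ => by ring
    rw [midTerm, hC, mul_cexp_mul_cexp, midForm, narainForm]
    simp only [← hX]
    rw [hph, hz]
    congr 2
    push_cast
    ring
  have h2 : ∀ z : Fin 4 → ℤ, lagTerm y e B q τ ((a, b), (x, z)) =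
      C * (|e.det| * ((τ.im⁻¹ : ℝ) : ℂ) ^ (2 : ℕ)) * Complex.exp
      (((-Real.pi / τ.im * sqNorm ((fun i => z i - v i) ᵥ* e) : ℝ) : ℂ) +
        2 * Real.pi * Complex.I * ((∑ i, (z i - v i) * u i : ℝ) : ℂ)) := fun z => by
    have hzv : (fun i => (z i : ℝ) - v i) = shiftX q b (toReal z) + τ.re • X := by
      funext i
      simp [hvdef, shiftX, hX]
      ring
    have hform : lagForm y e q τ a b (toReal x) (toReal z) = pairForm τ a b / y +
        τ.im * sqNorm (X ᵥ* e) + sqNorm ((fun i => z i - v i) ᵥ* e) / τ.im := by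
      rw [hzv, Matrix.add_vecMul, Matrix.smul_vecMul]
      simp only [lagForm, sqNorm, pairForm, ← hX, Finset.mul_sum, Finset.sum_div, add_assoc,
        ← Finset.sum_add_distrib, Pi.add_apply, Pi.smul_apply, smul_eq_mul]
      congr 1
      refine Finset.sum_congr rfl fun i _ => ?_
      field_simp
      ring
    have hph : lagPhase B q a b (toReal x) (toReal z) =
        -((b + τ.re * a) * ∑ i, X i * q (Sum.inr i)) + ∑ i, (z i - v i) * u i := by
      -- Antisymmetry of `B` kills the term `τ₁ X B X`, the one part of the new phase that would
      -- still depend on `τ`.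
      have h0 := sum_vecMul_self hB X
      have : ∑ i, ((z i : ℝ) - v i) * u i = ∑ i, (X ᵥ* B) i * shiftX q b (toReal z) i +
          τ.re * ∑ i, (X ᵥ* B) i * X i +
          ∑ i, (shiftX q b (toReal z) i + τ.re * X i) * (a * q (Sum.inr i)) := by
        simp only [Finset.mul_sum, ← Finset.sum_add_distrib]
        refine Finset.sum_congr rfl fun i _ => ?_
        have := congrFun hzv i
        simp only [Pi.add_apply, Pi.smul_apply, smul_eq_mul] at this
        rw [this, hu]
        ring
      rw [this, h0]
      rw [mul_zero, add_zero, Finset.mul_sum, ← Finset.sum_neg_distrib, ← Finset.sum_add_distrib,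
        ← Finset.sum_add_distrib]
      refine Finset.sum_congr rfl fun i _ => ?_
      simp only [← hX]
      simp only [hXi, shiftX]
      ring
    have hc : ((|e.det| * (√y)⁻¹ : ℝ) : ℂ) =
        (((√y)⁻¹ * τ.im ^ 2 : ℝ) : ℂ) * (|e.det| * ((τ.im⁻¹ : ℝ) : ℂ) ^ (2 : ℕ)) := by
      rw [← Complex.ofReal_pow, ← Complex.ofReal_mul, ← Complex.ofReal_mul]
      congr 1
      field_simp
    rw [lagTerm, hC, hc]
    simp only []
    rw [hform, hph, mul_right_comm (((√y)⁻¹ * τ.im ^ 2 : ℝ) : ℂ) (Complex.exp _),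
      mul_cexp_mul_cexp]
    congr 2
    push_cast
    ring
  have h4 : ((Fintype.card (Fin 4) : ℂ) / 2) = ((2 : ℕ) : ℂ) := by
    rw [Fintype.card_fin]; norm_num
  rw [h4, Complex.cpow_natCast] at h
  rw [tsum_congr h1, tsum_congr h2, tsum_mul_left, tsum_mul_left, h]
  ring

theorem summable_midTerm_fiber (hy : 0 < y) (he : e.det ≠ 0) (p : ℤ × ℤ) :
    Summable fun w => midTerm y e B q τ (p, w) :=
  (summable_midTerm B q τ hy he).comp_injective (Prod.mk_right_injective p)

theorem summable_lagTerm_fiber (hy : 0 < y) (he : e.det ≠ 0) (p : ℤ × ℤ) :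
    Summable fun w => lagTerm y e B q τ (p, w) :=
  (summable_lagTerm B q τ hy he).comp_injective (Prod.mk_right_injective p)

/-- The second Poisson summation leaves the winding pair alone, so the two sums agree for each pair
separately. This is what lets the modular group act on the individual winding sectors. -/
theorem tsum_midTerm_fiber (hy : 0 < y) (hB : Bᵀ = -B) (he : e.det ≠ 0) (p : ℤ × ℤ) :
    ∑' w, midTerm y e B q τ (p, w) = ∑' w, lagTerm y e B q τ (p, w) := by
  rw [(summable_midTerm_fiber q τ hy he p).tsum_prod, (summable_lagTerm_fiber q τ hy he p).tsum_prod]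
  exact tsum_congr fun x => tsum_midTerm_last q τ hB he p.1 p.2 x

theorem tsum_midTerm_eq (hy : 0 < y) (hB : Bᵀ = -B) (he : e.det ≠ 0) :
    ∑' l, midTerm y e B q τ l = ∑' l, lagTerm y e B q τ l := by
  rw [(summable_midTerm B q τ hy he).tsum_prod, (summable_lagTerm B q τ hy he).tsum_prod]
  exact tsum_congr fun p => tsum_midTerm_fiber q τ hy hB he p

end Terms

/-! ### The lattice sums: modular invariance -/

theorem pairForm_eq (τ : ℍ) (r s : ℝ) : pairForm τ r s = Complex.normSq (r * τ + s) / τ.im := by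
  rw [pairForm, Complex.normSq_apply]
  simp
  ring_nf

/-- The number `r (γτ) + s` is the transformed linear form in `τ` divided by the automorphy factor,
and the height of `γτ` carries the inverse square of the absolute value of that factor. -/
theorem pairForm_modular (γ : SL(2, ℤ)) (τ : ℍ) (r s : ℝ) :
    pairForm (γ • τ) r s = pairForm τ (γ 0 0 * r + γ 1 0 * s) (γ 0 1 * r + γ 1 1 * s) := by
  have hd := UpperHalfPlane.denom_ne_zero (γ : GL (Fin 2) ℝ) τ
  have hn : Complex.normSq (UpperHalfPlane.denom (γ : GL (Fin 2) ℝ) τ) ≠ 0 := by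
    rwa [Ne, Complex.normSq_eq_zero]
  have hv := τ.im_pos.ne'
  have hde : UpperHalfPlane.denom (γ : GL (Fin 2) ℝ) τ = γ 1 0 * τ + γ 1 1 := rfl
  have hc : ((γ • τ : ℍ) : ℂ) = (γ 0 0 * τ + γ 0 1) / UpperHalfPlane.denom (γ : GL (Fin 2) ℝ) τ := by
    rw [hde]
    have := UpperHalfPlane.coe_specialLinearGroup_apply γ τ
    simpa using this
  rw [pairForm_eq, pairForm_eq, ModularGroup.im_smul_eq_div_normSq, div_div_eq_mul_div,
    ← Complex.normSq_mul]
  congr 2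
  rw [hc]
  field_simp
  rw [hde]
  push_cast
  ring

/-- The action of a unimodular matrix on pairs, from the right. -/
def pairAct {A : Type*} [AddCommGroup A] (γ : SL(2, ℤ)) : A × A ≃ A × A where
  toFun p := (γ 0 0 • p.1 + γ 1 0 • p.2, γ 0 1 • p.1 + γ 1 1 • p.2)
  invFun p := (γ 1 1 • p.1 - γ 1 0 • p.2, γ 0 0 • p.2 - γ 0 1 • p.1)
  left_inv p := by
    have hd := γ.det_coe
    rw [Matrix.det_fin_two] at hd
    refine Prod.ext ?_ ?_
    · show _ = p.1
      conv_rhs => rw [← one_smul ℤ p.1, ← hd]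
      module
    · show _ = p.2
      conv_rhs => rw [← one_smul ℤ p.2, ← hd]
      module
  right_inv p := by
    have hd := γ.det_coe
    rw [Matrix.det_fin_two] at hd
    refine Prod.ext ?_ ?_
    · show _ = p.1
      conv_rhs => rw [← one_smul ℤ p.1, ← hd]
      module
    · show _ = p.2
      conv_rhs => rw [← one_smul ℤ p.2, ← hd]
      module

section

variable (y : ℝ) (e : Matrix (Fin 4) (Fin 4) ℝ) {B : Matrix (Fin 4) (Fin 4) ℝ}
  (q : Fin 4 ⊕ Fin 4 → ℝ) (τ : ℍ)

theorem shiftX_pair (γ : SL(2, ℤ)) (p : ℤ × ℤ) (w : (Fin 4 → ℤ) × (Fin 4 → ℤ)) :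
    shiftX q ((pairAct γ p).1 : ℤ) (toReal (pairAct γ w).1) =
      (γ 0 0 : ℝ) • shiftX q p.1 (toReal w.1) + (γ 1 0 : ℝ) • shiftX q p.2 (toReal w.2) ∧
    shiftX q ((pairAct γ p).2 : ℤ) (toReal (pairAct γ w).2) =
      (γ 0 1 : ℝ) • shiftX q p.1 (toReal w.1) + (γ 1 1 : ℝ) • shiftX q p.2 (toReal w.2) := by
  constructor <;>
  · funext i
    simp [shiftX, pairAct, toReal]
    ring

/-- The same matrix acts on `(a, b)` and on `(x, z)`, hence on the pair of shifted vectors. The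
exponent transforms through `pairForm_modular`; the phase is built from the alternating expressions
`X B Z` and `a z - b x`, which are multiplied by the determinant 1. -/
theorem lagTerm_modular (hB : Bᵀ = -B) (γ : SL(2, ℤ)) (l : IntVec) :
    lagTerm y e B q (γ • τ) l = lagTerm y e B q τ (pairAct γ l.1, pairAct γ l.2) := by
  obtain ⟨h1, h2⟩ := shiftX_pair q γ l.1 l.2
  have hd : ((γ 0 0 : ℝ)) * γ 1 1 - γ 0 1 * γ 1 0 = 1 := by
    have := γ.det_coe
    rw [Matrix.det_fin_two] at this
    exact_mod_cast this
  have hform : lagForm y e q (γ • τ) l.1.1 l.1.2 (toReal l.2.1) (toReal l.2.2) =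
      lagForm y e q τ ((pairAct γ l.1).1 : ℤ) ((pairAct γ l.1).2 : ℤ)
        (toReal (pairAct γ l.2).1) (toReal (pairAct γ l.2).2) := by
    rw [lagForm, lagForm, h1, h2]
    simp only [Matrix.add_vecMul, Matrix.smul_vecMul, Pi.add_apply, Pi.smul_apply, smul_eq_mul,
      pairForm_modular]
    congr 2
    simp [pairAct]
  have hph : lagPhase B q l.1.1 l.1.2 (toReal l.2.1) (toReal l.2.2) =
      lagPhase B q ((pairAct γ l.1).1 : ℤ) ((pairAct γ l.1).2 : ℤ)
        (toReal (pairAct γ l.2).1) (toReal (pairAct γ l.2).2) := by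
    rw [lagPhase, lagPhase, h1, h2]
    set X := shiftX q l.1.1 (toReal l.2.1)
    set Z := shiftX q l.1.2 (toReal l.2.2)
    simp only [Finset.sum_add_distrib]
    congr 1
    · have hX := sum_vecMul_self hB X
      have hZ := sum_vecMul_self hB Z
      have hXZ := sum_vecMul_antisymm hB Z X
      simp only [Matrix.add_vecMul, Matrix.smul_vecMul, Pi.add_apply, Pi.smul_apply, smul_eq_mul]
      have : ∀ i, ((γ 0 0 : ℝ) * (X ᵥ* B) i + γ 1 0 * (Z ᵥ* B) i) *
          (γ 0 1 * X i + γ 1 1 * Z i) = γ 0 0 * γ 0 1 * ((X ᵥ* B) i * X i) +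
            γ 0 0 * γ 1 1 * ((X ᵥ* B) i * Z i) + γ 1 0 * γ 0 1 * ((Z ᵥ* B) i * X i) +
            γ 1 0 * γ 1 1 * ((Z ᵥ* B) i * Z i) := fun i => by ring
      simp only [this, Finset.sum_add_distrib, ← Finset.mul_sum, hX, hZ, hXZ]
      linear_combination (-∑ i, (X ᵥ* B) i * Z i) * hd
    · refine Finset.sum_congr rfl fun i _ => ?_
      simp only [pairAct, toReal, Equiv.coe_fn_mk]
      simp only [Pi.add_apply, Pi.smul_apply, smul_eq_mul]
      push_cast
      linear_combination (-(q (Sum.inr i) * (l.1.1 * l.2.2 i - l.1.2 * l.2.1 i))) * hd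
  rw [lagTerm, lagTerm, hform, hph]

theorem tsum_lagTerm_modular (hB : Bᵀ = -B) (γ : SL(2, ℤ)) :
    ∑' l, lagTerm y e B q (γ • τ) l = ∑' l, lagTerm y e B q τ l := by
  rw [← ((pairAct γ).prodCongr (pairAct γ)).tsum_eq (lagTerm y e B q τ)]
  exact tsum_congr fun l => lagTerm_modular y e q τ hB γ l

theorem tsum_lagTerm_fiber_modular (hB : Bᵀ = -B) (γ : SL(2, ℤ)) (p : ℤ × ℤ) :
    ∑' w, lagTerm y e B q (γ • τ) (p, w) = ∑' w, lagTerm y e B q τ (pairAct γ p, w) := by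
  rw [← (pairAct γ).tsum_eq fun w => lagTerm y e B q τ (pairAct γ p, w)]
  exact tsum_congr fun w => lagTerm_modular y e q τ hB γ (p, w)

/-- The Siegel–Narain theta function of the split lattice of rank ten. -/
noncomputable def narainTheta (B : Matrix (Fin 4) (Fin 4) ℝ) : ℂ := ∑' l, hamTerm y e B q τ l

variable {y e}

theorem narainTheta_modular (hy : 0 < y) (hB : Bᵀ = -B) (he : e.det ≠ 0) (γ : SL(2, ℤ)) :
    narainTheta y e q (γ • τ) B = narainTheta y e q τ B := by
  simp only [narainTheta, tsum_hamTerm_eq B q _ hy he, tsum_midTerm_eq q _ hy hB he,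
    tsum_lagTerm_modular y e q τ hB γ]

end

/-! ### Fourier modes of the theta function -/

/-- The character `e^{-2πi (M ⬝ Q₁ + N ⬝ Q₂)}`. -/
noncomputable def modeChar (M N : Fin 4 → ℤ) (q : Fin 4 ⊕ Fin 4 → ℝ) : ℂ :=
  Complex.exp (-(2 * Real.pi * Complex.I) *
    ∑ i : Fin 4, ((M i : ℂ) * (q (Sum.inl i) : ℂ) + (N i : ℂ) * (q (Sum.inr i) : ℂ)))

theorem norm_modeChar (M N : Fin 4 → ℤ) (q : Fin 4 ⊕ Fin 4 → ℝ) : ‖modeChar M N q‖ = 1 := by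
  have : modeChar M N q = Complex.exp (((-(2 * Real.pi) *
      ∑ i : Fin 4, ((M i : ℝ) * q (Sum.inl i) + (N i : ℝ) * q (Sum.inr i)) : ℝ) : ℂ) *
        Complex.I) := by
    rw [modeChar]
    congr 1
    push_cast
    ring
  rw [this, Complex.norm_exp_ofReal_mul_I]

theorem continuous_modeChar (M N : Fin 4 → ℤ) : Continuous (modeChar M N) := by
  unfold modeChar
  fun_prop

theorem modeChar_eq_prod (M N : Fin 4 → ℤ) (q : Fin 4 ⊕ Fin 4 → ℝ) :
    modeChar M N q = ∏ j, Complex.exp (-(2 * Real.pi * Complex.I) *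
      ((Sum.elim M N j : ℤ) : ℂ) * (q j : ℂ)) := by
  rw [modeChar, ← Complex.exp_sum, Fintype.sum_sum_type, Finset.sum_add_distrib, mul_add,
    Finset.mul_sum, Finset.mul_sum]
  simp only [Sum.elim_inl, Sum.elim_inr, mul_assoc]

theorem integral_cexp_int (n : ℤ) :
    ∫ x in Set.Icc (0 : ℝ) 1, Complex.exp (-(2 * Real.pi * Complex.I) * (n : ℂ) * (x : ℂ)) =
      if n = 0 then 1 else 0 := by
  rw [integral_Icc_eq_integral_Ioc, ← intervalIntegral.integral_of_le zero_le_one]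
  split_ifs with h
  · simp [h]
  · have hn : (n : ℂ) ≠ 0 := by exact_mod_cast h
    have hc : -(2 * Real.pi * Complex.I) * (n : ℂ) ≠ 0 :=
      mul_ne_zero (neg_ne_zero.2 Complex.two_pi_I_ne_zero) hn
    rw [integral_exp_mul_complex hc]
    have : Complex.exp (-(2 * Real.pi * Complex.I) * (n : ℂ) * ((1 : ℝ) : ℂ)) = 1 := by
      rw [Complex.exp_eq_one_iff]
      exact ⟨-n, by push_cast; ring⟩
    rw [this]
    simp

theorem integral_modeChar (M N : Fin 4 → ℤ) :
    ∫ q in cube, modeChar M N q = if M = 0 ∧ N = 0 then 1 else 0 := by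
  have hcube : (cube : Set (Fin 4 ⊕ Fin 4 → ℝ)) = Set.univ.pi fun _ => Set.Icc 0 1 := by
    rw [Set.pi_univ_Icc]
    rfl
  simp only [modeChar_eq_prod]
  rw [hcube, volume_pi, Measure.restrict_pi_pi, integral_fintype_prod_eq_prod
    (f := fun j (x : ℝ) => Complex.exp (-(2 * Real.pi * Complex.I) *
      ((Sum.elim M N j : ℤ) : ℂ) * (x : ℂ)))]
  simp only [integral_cexp_int]
  rw [Finset.prod_ite_zero]
  simp [funext_iff]

section

variable {y : ℝ} {e B : Matrix (Fin 4) (Fin 4) ℝ} (M N : Fin 4 → ℤ) (τ : ℍ)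

variable (y e B) in
theorem continuous_midTerm (l : IntVec) : Continuous fun q => midTerm y e B q τ l := by
  unfold midTerm midForm narainForm radPairing shiftX shiftY
  have := continuous_sqNorm (ι := Fin 4)
  fun_prop

variable (y e B) in
/-- The mode of the part of the theta function with given winding numbers. -/
noncomputable def windingMode (p : ℤ × ℤ) : ℂ :=
  ∫ q in cube, (∑' w, midTerm y e B q τ (p, w)) * modeChar M N q

/-- A majorant uniform over the compact cube allows integration term by term, both for the whole
lattice and within each winding sector. -/
theorem hasSum_midTerm_mode (hy : 0 < y) (he : e.det ≠ 0) :
    HasSum (fun l => ∫ q in cube, midTerm y e B q τ l * modeChar M N q)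
      (∫ q in cube, (∑' l, midTerm y e B q τ l) * modeChar M N q) ∧
    ∀ p, HasSum (fun w => ∫ q in cube, midTerm y e B q τ (p, w) * modeChar M N q)
      (windingMode y e B M N τ p) := by
  obtain ⟨u, hu, hb⟩ := exists_norm_midTerm_le B τ hy he (isCompact_Icc (a := (0 : Fin 4 ⊕ Fin 4 → ℝ)) (b := 1))
  have hint : ∀ l, IntegrableOn (fun q => midTerm y e B q τ l * modeChar M N q) cube := fun l =>
    ((continuous_midTerm y e B τ l).mul (continuous_modeChar M N)).continuousOn.integrableOn_compact
      isCompact_Icc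
  have hvol : (volume : Measure (Fin 4 ⊕ Fin 4 → ℝ)).real cube = 1 := by
    rw [Measure.real, Real.volume_Icc_pi]
    simp
  have hle : ∀ l, ∫ q in cube, ‖midTerm y e B q τ l * modeChar M N q‖ ≤ u l := fun l => by
    calc _ ≤ ∫ q in (cube : Set (Fin 4 ⊕ Fin 4 → ℝ)), u l := by
          refine setIntegral_mono_on (hint l).norm ?_ measurableSet_Icc fun q hq => ?_
          · exact integrableOn_const (by simp [Real.volume_Icc_pi])
          · rw [norm_mul, norm_modeChar, mul_one]
            exact hb q hq l
      _ = u l := by rw [setIntegral_const, hvol, one_smul]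
  have hsum : Summable fun l => ∫ q in cube, ‖midTerm y e B q τ l * modeChar M N q‖ :=
    hu.of_nonneg_of_le (fun l => integral_nonneg fun q => norm_nonneg _) hle
  constructor
  · have := hasSum_integral_of_summable_integral_norm hint hsum
    simpa only [tsum_mul_right] using this
  · intro p
    have := hasSum_integral_of_summable_integral_norm (fun w => hint (p, w))
      (hsum.comp_injective (Prod.mk_right_injective p))
    simpa only [tsum_mul_right, windingMode] using this

theorem hasSum_windingMode (hy : 0 < y) (he : e.det ≠ 0) :
    HasSum (windingMode y e B M N τ) (∫ q in cube, narainTheta y e q τ B * modeChar M N q) := by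
  obtain ⟨h1, h2⟩ := hasSum_midTerm_mode (B := B) M N τ hy he
  simp only [narainTheta, tsum_hamTerm_eq B _ τ hy he]
  exact h1.prod_fiberwise h2

/-- The modular group permutes winding sectors, so it is enough to know one representative of each
orbit of pairs. -/
theorem windingMode_modular (hy : 0 < y) (hB : Bᵀ = -B) (he : e.det ≠ 0) (γ : SL(2, ℤ))
    (p : ℤ × ℤ) : windingMode y e B M N (γ • τ) p = windingMode y e B M N τ (pairAct γ p) := by
  simp only [windingMode, tsum_midTerm_fiber _ _ hy hB he,
    tsum_lagTerm_fiber_modular _ _ _ _ hB]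

/-- With `a = 0` the shifts disappear and the unipotent variable remains only in the phase `-k (z·Q₁
+ x·Q₂)`. It is linear and can be absorbed into the character. -/
theorem midTerm_zero_left (q : Fin 4 ⊕ Fin 4 → ℝ) (k : ℤ) (w : (Fin 4 → ℤ) × (Fin 4 → ℤ)) :
    midTerm y e B q τ ((0, k), w) * modeChar M N q =
      midTerm y e B 0 τ ((0, k), w) * modeChar (M + k • w.2) (N + k • w.1) q := by
  have hr : radPairing 0 0 (toReal w.1) (toReal w.2) = 0 := by simp [radPairing]
  simp only [midTerm, midForm, Int.cast_zero, shiftX_zero, shiftY_zero, hr, modeChar]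
  rw [mul_cexp_mul_cexp, mul_cexp_mul_cexp]
  congr 2
  have : radPairing q 0 (toReal w.1) (toReal w.2) =
      ∑ i, ((w.2 i : ℝ) * q (Sum.inl i) + w.1 i * q (Sum.inr i)) := by
    refine Finset.sum_congr rfl fun i _ => ?_
    simp only [toReal]
    ring
  rw [this]
  have h2 : ∑ i : Fin 4, ((((M + k • w.2) i : ℤ) : ℂ) * (q (Sum.inl i) : ℂ) +
      (((N + k • w.1) i : ℤ) : ℂ) * (q (Sum.inr i) : ℂ)) =
      ∑ i : Fin 4, ((M i : ℂ) * (q (Sum.inl i) : ℂ) + (N i : ℂ) * (q (Sum.inr i) : ℂ)) +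
      k * ((∑ i, ((w.2 i : ℝ) * q (Sum.inl i) + w.1 i * q (Sum.inr i)) : ℝ) : ℂ) := by
    push_cast [Finset.mul_sum]
    rw [← Finset.sum_add_distrib]
    refine Finset.sum_congr rfl fun i _ => ?_
    simp only [Pi.add_apply, Pi.smul_apply, smul_eq_mul]
    push_cast
    ring
  rw [h2]
  push_cast
  ring

theorem windingMode_zero_left (hy : 0 < y) (he : e.det ≠ 0) (k : ℤ) :
    windingMode y e B M N τ (0, k) = ∑' w : (Fin 4 → ℤ) × (Fin 4 → ℤ),
      midTerm y e B 0 τ ((0, k), w) * if M + k • w.2 = 0 ∧ N + k • w.1 = 0 then 1 else 0 := by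
  rw [← ((hasSum_midTerm_mode (B := B) M N τ hy he).2 (0, k)).tsum_eq]
  refine tsum_congr fun w => ?_
  simp only [midTerm_zero_left, integral_const_mul, integral_modeChar]

theorem dvd_gcdModes_iff (k : ℕ) :
    k ∣ gcdModes M N ↔ (∀ i, (k : ℤ) ∣ M i) ∧ ∀ i, (k : ℤ) ∣ N i := by
  simp only [gcdModes, Finset.dvd_gcd_iff, Finset.mem_univ, true_imp_iff, Sum.forall, Sum.elim_inl,
    Sum.elim_inr, Int.natCast_dvd]

theorem gcdModes_ne_zero {N : Fin 4 → ℤ} (hN : N ≠ 0) : gcdModes M N ≠ 0 := by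
  obtain ⟨i, hi⟩ := Function.ne_iff.1 hN
  intro h
  rw [gcdModes, Finset.gcd_eq_zero_iff] at h
  exact hi (by simpa using h (Sum.inr i) (Finset.mem_univ _))

theorem windingMode_zero_zero (hy : 0 < y) (he : e.det ≠ 0) {N : Fin 4 → ℤ} (hN : N ≠ 0) :
    windingMode y e B M N τ 0 = 0 := by
  have := windingMode_zero_left (B := B) M N τ hy he 0
  simp only [zero_smul, add_zero, hN, and_false, if_false, mul_zero, tsum_zero] at this
  exact this

theorem windingMode_of_not_dvd (hy : 0 < y) (he : e.det ≠ 0) {k : ℕ} (hk : ¬ k ∣ gcdModes M N) :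
    windingMode y e B M N τ (0, (k : ℤ)) = 0 := by
  rw [windingMode_zero_left M N τ hy he, dvd_gcdModes_iff] at *
  convert tsum_zero with w
  rw [if_neg, mul_zero]
  rintro ⟨h1, h2⟩
  refine hk ⟨fun i => ⟨-w.2 i, ?_⟩, fun i => ⟨-w.1 i, ?_⟩⟩
  · have := congrFun h1 i
    simp only [Pi.add_apply, Pi.smul_apply, smul_eq_mul, Pi.zero_apply] at this
    linarith
  · have := congrFun h2 i
    simp only [Pi.add_apply, Pi.smul_apply, smul_eq_mul, Pi.zero_apply] at this
    linarith

/-- With `U = (N B + M) (eᵀ)⁻¹` and `W = N e` the charges are `(U ∓ W) / √2`. Hence the sum of their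
squares is `U² + W²`, and the difference is `-2 U·W`. -/
theorem pL_eq (he : e.det ≠ 0) : pL e B M N = (√2)⁻¹ • ((toReal N ᵥ* B + toReal M) ᵥ* (eᵀ)⁻¹ - toReal N ᵥ* e) ∧
    pR e B M N = (√2)⁻¹ • ((toReal N ᵥ* B + toReal M) ᵥ* (eᵀ)⁻¹ + toReal N ᵥ* e) := by
  have h : (toReal N ᵥ* (e * eᵀ)) ᵥ* (eᵀ)⁻¹ = toReal N ᵥ* e := by
    rw [Matrix.vecMul_vecMul, Matrix.mul_assoc, Matrix.mul_nonsing_inv _ (by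
      rw [Matrix.det_transpose]; exact he.isUnit), Matrix.mul_one]
  constructor
  · rw [pL, Matrix.vecMul_sub, ← h, ← Matrix.sub_vecMul, add_comm (toReal N ᵥ* B), add_sub_assoc]
  · rw [pR, Matrix.vecMul_add, ← h, ← Matrix.add_vecMul, add_comm (toReal N ᵥ* B) (toReal M),
      add_assoc]

theorem sqrt_two_inv_mul_self : (√2)⁻¹ * (√2)⁻¹ = (1 / 2 : ℝ) := by
  rw [← mul_inv, Real.mul_self_sqrt zero_le_two, one_div]

theorem pL2_add_pR2 (he : e.det ≠ 0) :
    pL2 e B M N + pR2 e B M N = narainForm e B (toReal N) (toReal M) := by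
  rw [pL2, pR2, (pL_eq M N he).1, (pL_eq M N he).2, narainForm]
  set U := (toReal N ᵥ* B + toReal M) ᵥ* (eᵀ)⁻¹
  set W := toReal N ᵥ* e
  simp only [dotProduct, sqNorm, ← Finset.sum_add_distrib, Pi.smul_apply, Pi.sub_apply,
    Pi.add_apply, smul_eq_mul]
  refine Finset.sum_congr rfl fun i _ => ?_
  linear_combination ((U i - W i) ^ 2 + (U i + W i) ^ 2) * sqrt_two_inv_mul_self

/-- In `U·W` the frame `e` cancels and `N B N` vanishes by antisymmetry. The difference is thus an
integer independent of the moduli, the source of all integrality of phases below. -/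
theorem pL2_sub_pR2 (hB : Bᵀ = -B) (he : e.det ≠ 0) :
    pL2 e B M N - pR2 e B M N = -2 * ∑ i, (M i : ℝ) * N i := by
  have h1 : ((toReal N ᵥ* B + toReal M) ᵥ* (eᵀ)⁻¹) ⬝ᵥ (toReal N ᵥ* e) = ∑ i, (M i : ℝ) * N i := by
    rw [← Matrix.mulVec_transpose e, Matrix.dotProduct_mulVec, Matrix.vecMul_vecMul,
      Matrix.nonsing_inv_mul _ (by rw [Matrix.det_transpose]; exact he.isUnit), Matrix.vecMul_one,
      add_dotProduct]
    have := sum_vecMul_self hB (toReal N)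
    simp only [dotProduct, this, zero_add]
  rw [← h1, pL2, pR2, (pL_eq M N he).1, (pL_eq M N he).2]
  set U := (toReal N ᵥ* B + toReal M) ᵥ* (eᵀ)⁻¹
  set W := toReal N ᵥ* e
  simp only [dotProduct, ← Finset.sum_sub_distrib, Finset.mul_sum, Pi.smul_apply, Pi.sub_apply,
    Pi.add_apply, smul_eq_mul]
  refine Finset.sum_congr rfl fun i _ => ?_
  linear_combination ((U i - W i) ^ 2 - (U i + W i) ^ 2) * sqrt_two_inv_mul_self

variable (y e B) in
/-- The contribution of a divisor to the modes of the theta function. -/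
noncomputable def divisorMode (p : ℕ) (τ : ℍ) : ℂ :=
  (((√y)⁻¹ * τ.im ^ 2 : ℝ) : ℂ) * (gaussWeight y (pL2 e B M N + pR2 e B M N) p τ.im *
    Complex.exp (Complex.I * Real.pi * (τ.re : ℂ) *
      (((pL2 e B M N - pR2 e B M N) / (p : ℝ) ^ 2 : ℝ) : ℂ)))

/-- Orthogonality of characters leaves the single lattice vector `x = -N/k`, `z = -M/k`. Homogeneity
of the form then produces the division by `k²` in the weight and in the phase. -/
theorem windingMode_of_dvd (hy : 0 < y) (hB : Bᵀ = -B) (he : e.det ≠ 0) {k : ℕ} (hk0 : k ≠ 0)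
    (hk : k ∣ gcdModes M N) :
    windingMode y e B M N τ (0, (k : ℤ)) = divisorMode y e B M N k τ := by
  obtain ⟨h1, h2⟩ := (dvd_gcdModes_iff M N k).1 hk
  choose m hm using h1
  choose n hn using h2
  have hk1 : (k : ℤ) ≠ 0 := by exact_mod_cast hk0
  have hk2 : (k : ℝ) ≠ 0 := by exact_mod_cast hk0
  have hiff : ∀ w : (Fin 4 → ℤ) × (Fin 4 → ℤ),
      (M + (k : ℤ) • w.2 = 0 ∧ N + (k : ℤ) • w.1 = 0) ↔ w = (-n, -m) := by
    intro w
    rw [Prod.ext_iff, and_comm, funext_iff, funext_iff, funext_iff, funext_iff]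
    refine and_congr (forall_congr' fun i => ?_) (forall_congr' fun i => ?_)
    · simp only [Pi.add_apply, Pi.smul_apply, smul_eq_mul, Pi.zero_apply, hn, ← mul_add,
        mul_eq_zero, hk1, false_or, Pi.neg_apply]
      omega
    · simp only [Pi.add_apply, Pi.smul_apply, smul_eq_mul, Pi.zero_apply, hm, ← mul_add,
        mul_eq_zero, hk1, false_or, Pi.neg_apply]
      omega
  rw [windingMode_zero_left M N τ hy he]
  simp only [hiff]
  rw [tsum_eq_single (-n, -m) fun w hw => by rw [if_neg hw, mul_zero], if_pos rfl, mul_one]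
  have hv := τ.im_pos
  have hM : toReal M = (-(k : ℝ)) • toReal (-m) := by
    funext i
    simp only [toReal, hm, Pi.smul_apply, Pi.neg_apply, smul_eq_mul]
    push_cast
    ring
  have hN : toReal N = (-(k : ℝ)) • toReal (-n) := by
    funext i
    simp only [toReal, hn, Pi.smul_apply, Pi.neg_apply, smul_eq_mul]
    push_cast
    ring
  have hX : pL2 e B M N + pR2 e B M N = (k : ℝ) ^ 2 * narainForm e B (toReal (-n)) (toReal (-m)) := by
    rw [pL2_add_pR2 M N he, hM, hN, narainForm_smul, neg_sq]
  have hD : pL2 e B M N - pR2 e B M N =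
      -2 * ((k : ℝ) ^ 2 * ∑ i, (((-n) i : ℤ) : ℝ) * (((-m) i : ℤ) : ℝ)) := by
    rw [pL2_sub_pR2 M N hB he, Finset.mul_sum _ _ ((k : ℝ) ^ 2)]
    congr 1
    refine Finset.sum_congr rfl fun i _ => ?_
    simp only [hm, hn, Pi.neg_apply]
    push_cast
    ring
  rw [midTerm, divisorMode, gaussWeight, hX, hD, Complex.ofReal_exp, ← Complex.exp_add]
  refine congrArg _ (congrArg _ ?_)
  simp only [midForm, Int.cast_zero, shiftX_zero, shiftY_zero, pairForm]
  have hr : radPairing 0 0 (toReal (-n)) (toReal (-m)) = 0 := by simp [radPairing]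
  rw [hr]
  set nf := narainForm e B (toReal (-n)) (toReal (-m))
  set S := ∑ i, (((-n) i : ℤ) : ℝ) * (((-m) i : ℤ) : ℝ)
  have e1 : -Real.pi * ((((k : ℤ) : ℝ) + τ.re * 0) ^ 2 + τ.im ^ 2 * 0 ^ 2) / τ.im / y =
      -Real.pi * (k : ℝ) ^ 2 / (τ.im * y) := by
    rw [Int.cast_natCast]
    field_simp
    ring
  have e2 : -Real.pi * (((((k : ℤ) : ℝ) + τ.re * 0) ^ 2 + τ.im ^ 2 * 0 ^ 2) / τ.im / y + τ.im * nf) =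
      -Real.pi * (k : ℝ) ^ 2 / (τ.im * y) - Real.pi * (τ.im / (k : ℝ) ^ 2) * ((k : ℝ) ^ 2 * nf) := by
    rw [← e1]
    field_simp
    ring
  have e3 : -2 * ((k : ℝ) ^ 2 * S) / (k : ℝ) ^ 2 = -2 * S := by field_simp
  rw [e2, e3]
  push_cast
  ring

/-- The reversed multiples of coprime pairs are the nonzero pairs. -/
theorem pairAct_zero_left (k : ℕ+) (v : CoprimePair) :
    pairAct (stripRep τ v) (0, ((k : ℕ) : ℤ)) = (pairEquiv (k, v)).1.swap := by
  have h := bottomRow_stripRep τ v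
  have h1 : stripRep τ v 1 1 = v.1.1 := congrArg (fun v : CoprimePair => v.1.1) h
  have h0 : stripRep τ v 1 0 = v.1.2 := congrArg (fun v : CoprimePair => v.1.2) h
  rw [pairEquiv_apply]
  simp only [pairAct, Equiv.coe_fn_mk, h1, h0, smul_eq_mul, Prod.swap_prod_mk, mul_zero, zero_add]
  rw [mul_comm, mul_comm v.1.1]

/-- A nonzero winding pair is uniquely a positive multiple of a coprime one, hence the image of `(0,
k)` under the strip representative of that coprime pair. The pair `(0, 0)` contributes nothing
because `N ≠ 0`, and `(0, k)` contributes only when `k` divides the gcd. What is left is a Poincaré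
series for each divisor. -/
theorem narainTheta_mode_eq (hy : 0 < y) (hB : Bᵀ = -B) (he : e.det ≠ 0) {N : Fin 4 → ℤ}
    (hN : N ≠ 0) :
    (∀ p ∈ (gcdModes M N).divisors, Summable fun v => divisorMode y e B M N p (stripRep τ v • τ)) ∧
    ∫ q in cube, narainTheta y e q τ B * modeChar M N q =
      ∑ p ∈ (gcdModes M N).divisors, ∑' v, divisorMode y e B M N p (stripRep τ v • τ) := by
  have h := hasSum_windingMode (B := B) M N τ hy he
  have hs : Summable fun x : ℕ+ × CoprimePair => windingMode y e B M N τ (pairEquiv x).1.swap :=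
    h.summable.comp_injective (Prod.swap_injective.comp (Subtype.val_injective.comp pairEquiv.injective))
  have hterm : ∀ x : ℕ+ × CoprimePair, windingMode y e B M N τ (pairEquiv x).1.swap =
      windingMode y e B M N (stripRep τ x.2 • τ) (0, ((x.1 : ℕ) : ℤ)) := fun x => by
    rw [windingMode_modular M N τ hy hB he, pairAct_zero_left]
  have h1 : ∑' p, windingMode y e B M N τ p =
      ∑' k : ℕ+, ∑' v, windingMode y e B M N (stripRep τ v • τ) (0, ((k : ℕ) : ℤ)) := by
    rw [← (Equiv.prodComm ℤ ℤ).tsum_eq, ← tsum_subtype_eq_of_support_subset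
      (s := {p : ℤ × ℤ | p ≠ 0}) (fun p hp h0 => hp (by
        rw [h0]
        exact windingMode_zero_zero M τ hy he hN))]
    erw [← pairEquiv.tsum_eq]
    rw [← hs.tsum_prod.trans (tsum_congr fun k => tsum_congr fun v => hterm (k, v))]
    rfl
  have hsk : ∀ k : ℕ+, Summable fun v => windingMode y e B M N (stripRep τ v • τ) (0, ((k : ℕ) : ℤ)) :=
    fun k => (hs.comp_injective (Prod.mk_right_injective k)).congr fun v => hterm (k, v)
  have hdiv : ∀ p ∈ (gcdModes M N).divisors, ∃ k : ℕ+, (k : ℕ) = p ∧ ∀ τ' : ℍ,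
      windingMode y e B M N τ' (0, ((k : ℕ) : ℤ)) = divisorMode y e B M N p τ' := fun p hp => by
    have hp0 := Nat.pos_of_mem_divisors hp
    exact ⟨⟨p, hp0⟩, rfl, fun τ' => windingMode_of_dvd M N τ' hy hB he hp0.ne' (Nat.dvd_of_mem_divisors hp)⟩
  constructor
  · intro p hp
    obtain ⟨k, -, hk⟩ := hdiv p hp
    exact (hsk k).congr fun v => hk _
  · set F : ℕ → ℂ := fun k => ∑' v, windingMode y e B M N (stripRep τ v • τ) (0, (k : ℤ)) with hF
    have hF0 : F 0 = 0 := by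
      have : ∀ τ', windingMode y e B M N τ' (0, ((0 : ℕ) : ℤ)) = 0 := fun τ' =>
        windingMode_zero_zero M τ' hy he hN
      simp only [hF, this, tsum_zero]
    have h2 : ∑' k : ℕ+, F k = ∑' k : ℕ, F k :=
      tsum_subtype_eq_of_support_subset (s := {n : ℕ | 0 < n}) fun n hn =>
        Nat.pos_of_ne_zero fun h0 => hn (by rw [h0]; exact hF0)
    rw [← h.tsum_eq, h1, h2, tsum_eq_sum (s := (gcdModes M N).divisors)]
    · refine Finset.sum_congr rfl fun p hp => tsum_congr fun v => ?_
      obtain ⟨k, rfl, hk⟩ := hdiv p hp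
      exact hk _
    · intro p hp
      have hp' : ¬ p ∣ gcdModes M N := fun hd => hp (Nat.mem_divisors.2 ⟨hd, gcdModes_ne_zero M hN⟩)
      simp only [hF, windingMode_of_not_dvd M N _ hy he hp', tsum_zero]
end

/-! ### The Hecke operator and the removal of the constant term -/

/-- The map `τ ↦ 2 τ`. -/
noncomputable def scaleUp (τ : ℍ) : ℍ := ⟨2 * τ, by simpa using τ.im_pos⟩

/-- The map `τ ↦ (τ + b) / 2`. -/
noncomputable def scaleDown (b : ℝ) (τ : ℍ) : ℍ := ⟨(τ + b) / 2, by simpa using τ.im_pos⟩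

theorem scaleUp_re (τ : ℍ) : (scaleUp τ).re = 2 * τ.re := by rw [← UpperHalfPlane.coe_re, scaleUp]; simp
theorem scaleUp_im (τ : ℍ) : (scaleUp τ).im = 2 * τ.im := by rw [← UpperHalfPlane.coe_im, scaleUp]; simp
theorem scaleDown_re (b : ℝ) (τ : ℍ) : (scaleDown b τ).re = (τ.re + b) / 2 := by
  rw [← UpperHalfPlane.coe_re, scaleDown]; simp
theorem scaleDown_im (b : ℝ) (τ : ℍ) : (scaleDown b τ).im = τ.im / 2 := by
  rw [← UpperHalfPlane.coe_im, scaleDown]; simp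

/-- This and the next five lemmas say that, up to `SL(2,ℤ)`, the generators permute the points `2τ`,
`τ/2`, `(τ+1)/2`: `S` exchanges the first two and fixes the third, `T` fixes the first and exchanges
the others. Any invariant function summed over the three points is therefore again invariant. -/
theorem scaleUp_S (τ : ℍ) : scaleUp (ModularGroup.S • τ) = ModularGroup.S • scaleDown 0 τ := by
  ext
  have := UpperHalfPlane.ne_zero τ
  rw [UpperHalfPlane.modular_S_smul, UpperHalfPlane.modular_S_smul]
  simp [scaleUp, scaleDown]
  field_simp

theorem scaleDown_zero_S (τ : ℍ) :
    scaleDown 0 (ModularGroup.S • τ) = ModularGroup.S • scaleUp τ := by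
  ext
  have := UpperHalfPlane.ne_zero τ
  rw [UpperHalfPlane.modular_S_smul, UpperHalfPlane.modular_S_smul]
  simp [scaleUp, scaleDown]
  field_simp

/-- The matrix which relates the shifted half-scaling to the inversion. -/
def shiftedInversion : SL(2, ℤ) := ⟨!![1, -1; 2, -1], by simp [Matrix.det_fin_two]⟩

theorem scaleDown_one_S (τ : ℍ) :
    scaleDown 1 (ModularGroup.S • τ) = shiftedInversion • scaleDown 1 τ := by
  ext
  have := UpperHalfPlane.ne_zero τ
  rw [UpperHalfPlane.coe_specialLinearGroup_apply, UpperHalfPlane.modular_S_smul]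
  have h2 : (2 : ℂ) * ((τ + 1) / 2) + -1 = τ := by ring
  simp [scaleDown, shiftedInversion]
  rw [h2]
  field_simp
  ring

theorem scaleUp_T (τ : ℍ) :
    scaleUp (ModularGroup.T • τ) = ModularGroup.T • ModularGroup.T • scaleUp τ := by
  ext
  rw [UpperHalfPlane.modular_T_smul, UpperHalfPlane.modular_T_smul, UpperHalfPlane.modular_T_smul]
  simp [scaleUp]
  ring

theorem scaleDown_zero_T (τ : ℍ) : scaleDown 0 (ModularGroup.T • τ) = scaleDown 1 τ := by
  ext
  rw [UpperHalfPlane.modular_T_smul]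
  simp [scaleDown]
  ring

theorem scaleDown_one_T (τ : ℍ) :
    scaleDown 1 (ModularGroup.T • τ) = ModularGroup.T • scaleDown 0 τ := by
  ext
  rw [UpperHalfPlane.modular_T_smul, UpperHalfPlane.modular_T_smul]
  simp [scaleDown]
  ring

/-- The eigenvalue of the Hecke operator on the constant term of the theta function. -/
noncomputable def heckeConst : ℝ := 4 * √2 + √2 / 4

section

variable (y : ℝ) (e B : Matrix (Fin 4) (Fin 4) ℝ) (q : Fin 4 ⊕ Fin 4 → ℝ) (τ : ℍ)

/-- The theta function without its constant term. -/
noncomputable def thetaPrime : ℂ := ∑' l : {l : IntVec // l ≠ 0}, hamTerm y e B q τ l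

/-- The theta function after the Hecke operator which removes the constant term. -/
noncomputable def heckeTheta : ℂ :=
  thetaPrime y e B q (scaleUp τ) + thetaPrime y e B q (scaleDown 0 τ) +
    thetaPrime y e B q (scaleDown 1 τ) - heckeConst * thetaPrime y e B q τ

theorem hamTerm_zero : hamTerm y e B q τ 0 = ((τ.im ^ 2 * √τ.im : ℝ) : ℂ) := by
  have h0 : toReal 0 = 0 := by funext i; simp [toReal]
  have hr : radPairing q 0 0 0 = 0 := by simp [radPairing]
  have h : hamForm y e B q 0 0 0 0 = 0 := by
    simp [hamForm, shiftX_zero, shiftY_zero, hr, narainForm, sqNorm]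
  simp [hamTerm, h0, h]

variable {y e}

theorem narainTheta_eq (hy : 0 < y) (he : e.det ≠ 0) :
    narainTheta y e q τ B = ((τ.im ^ 2 * √τ.im : ℝ) : ℂ) + thetaPrime y e B q τ := by
  have hs := summable_hamTerm B q τ hy he
  rw [narainTheta, ← hs.tsum_subtype_add_tsum_subtype_compl {0}, ← hamTerm_zero y e B q τ]
  congr 1
  exact tsum_singleton 0 (hamTerm y e B q τ)

/-- The constant term `τ₂^{5/2}` is an eigenfunction with eigenvalue `2^{5/2} + 2 · 2^{-5/2}`, which
is `heckeConst`. Full theta functions may therefore replace the truncated ones, and only the full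
ones are invariant. -/
theorem heckeTheta_eq (hy : 0 < y) (he : e.det ≠ 0) : heckeTheta y e B q τ =
    narainTheta y e q (scaleUp τ) B + narainTheta y e q (scaleDown 0 τ) B +
      narainTheta y e q (scaleDown 1 τ) B - heckeConst * narainTheta y e q τ B := by
  have h2 : √2 * √2 = (2 : ℝ) := Real.mul_self_sqrt zero_le_two
  have h1 : √(2 * τ.im) = √2 * √τ.im := Real.sqrt_mul zero_le_two _
  have h3 : √(τ.im / 2) = √τ.im / √2 := Real.sqrt_div τ.im_pos.le _
  have h0 : √2 ≠ (0 : ℝ) := by positivity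
  have key : (2 * τ.im) ^ 2 * √(2 * τ.im) + (τ.im / 2) ^ 2 * √(τ.im / 2) +
      (τ.im / 2) ^ 2 * √(τ.im / 2) = heckeConst * (τ.im ^ 2 * √τ.im) := by
    rw [h1, h3, heckeConst]
    field_simp
    linear_combination (-(4 : ℝ)) * h2
  simp only [narainTheta_eq B q _ hy he, heckeTheta, scaleUp_im, scaleDown_im]
  have := congrArg (fun r : ℝ => (r : ℂ)) key
  simp only [Complex.ofReal_add, Complex.ofReal_mul (heckeConst)] at this
  linear_combination -this

variable {B}

/-- Invariance is checked on the generators `S` and `T`, where the three points are permuted up to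
unimodular matrices under which the theta function does not change. -/
theorem heckeTheta_modular (hy : 0 < y) (hB : Bᵀ = -B) (he : e.det ≠ 0) (γ : SL(2, ℤ)) :
    ∀ τ, heckeTheta y e B q (γ • τ) = heckeTheta y e B q τ := by
  have hγ : γ ∈ Subgroup.closure {ModularGroup.S, ModularGroup.T} := by
    rw [SpecialLinearGroup.SL2Z_generators]; trivial
  have hT := fun γ τ => narainTheta_modular q τ hy hB he γ
  induction hγ using Subgroup.closure_induction with
  | mem γ h =>
    intro τ
    simp only [heckeTheta_eq B q _ hy he]
    rcases h with rfl | rfl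
    · rw [scaleUp_S, scaleDown_zero_S, scaleDown_one_S, hT, hT, hT, hT]
      ring
    · rw [scaleUp_T, scaleDown_zero_T, scaleDown_one_T, hT, hT, hT, hT]
      ring
  | one => intro τ; rw [one_smul]
  | mul γ γ' _ _ h1 h2 => intro τ; rw [mul_smul, h1, h2]
  | inv γ _ h => intro τ; rw [← h (γ⁻¹ • τ), smul_inv_smul]

variable (B)

/-- Nonzero vectors have norm `n ≥ 1`, so at height `t ≥ 1/4` one has `t n ≥ t/2 + n/8`: one part
gives exponential decay in the height, the other makes the lattice sum converge. The threshold `1/4`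
is half of `1/2`, to leave room for `τ ↦ (τ + b) / 2` on `cuspStrip`. -/
theorem exists_norm_thetaPrime_le (hy : 0 < y) (he : e.det ≠ 0) {s : Set (Fin 4 ⊕ Fin 4 → ℝ)}
    (hs : IsCompact s) : ∃ C c : ℝ, 0 ≤ C ∧ 0 < c ∧ ∀ q ∈ s, ∀ τ : ℍ, 1 / 4 ≤ τ.im →
      ‖thetaPrime y e B q τ‖ ≤ C * τ.im ^ 3 * Real.exp (-c * τ.im) := by
  obtain ⟨k, hk, h⟩ := exists_hamForm_ge B hy he hs
  have hpi := Real.pi_pos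
  have hsum := (summable_exp_latNorm (c := Real.pi * k / 8) (by positivity)).subtype {l | l ≠ 0}
  refine ⟨2 * ∑' l : {l : IntVec // l ≠ 0}, Real.exp (-(Real.pi * k / 8) * latNorm l),
    Real.pi * k / 2, mul_nonneg zero_le_two (tsum_nonneg fun _ => (Real.exp_pos _).le),
    by positivity, fun q hq τ hτ => ?_⟩
  have hv := τ.im_pos
  have hb : ∀ l : {l : IntVec // l ≠ 0}, ‖hamTerm y e B q τ l‖ ≤
      2 * τ.im ^ 3 * Real.exp (-(Real.pi * k / 2) * τ.im) *
        Real.exp (-(Real.pi * k / 8) * latNorm l) := fun l => by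
    rw [norm_hamTerm, mul_assoc (2 * τ.im ^ 3), ← Real.exp_add]
    have h1 := h q hq l
    have h2 := one_le_latNorm l.2
    have hsq : √τ.im ≤ 2 * τ.im := by
      rw [Real.sqrt_le_left (by positivity)]
      nlinarith
    have hm : τ.im ^ 2 * √τ.im ≤ 2 * τ.im ^ 3 := by
      have := mul_le_mul_of_nonneg_left hsq (sq_nonneg τ.im)
      nlinarith
    refine mul_le_mul hm (Real.exp_le_exp.2 ?_) (Real.exp_pos _).le (by positivity)
    have h3 := mul_le_mul_of_nonneg_left h1 (mul_pos hpi hv).le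
    have h4 : τ.im / 2 + latNorm l / 8 ≤ τ.im * latNorm l := by nlinarith
    have h5 := mul_le_mul_of_nonneg_left h4 (mul_pos hpi hk).le
    nlinarith
  have hsum' := hsum.mul_left (2 * τ.im ^ 3 * Real.exp (-(Real.pi * k / 2) * τ.im))
  refine (tsum_of_norm_bounded hsum'.hasSum hb).trans (le_of_eq ?_)
  rw [tsum_mul_left]
  change _ * (∑' l : {l : IntVec // l ≠ 0}, Real.exp (-(Real.pi * k / 8) * latNorm l)) = _
  ring

theorem exists_norm_heckeTheta_le (hy : 0 < y) (he : e.det ≠ 0) {s : Set (Fin 4 ⊕ Fin 4 → ℝ)}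
    (hs : IsCompact s) : ∃ C c : ℝ, 0 ≤ C ∧ 0 < c ∧ ∀ q ∈ s, ∀ τ ∈ cuspStrip,
      ‖heckeTheta y e B q τ‖ ≤ C * (τ.im ^ 3 * Real.exp (-c * τ.im)) := by
  obtain ⟨C, c, hC, hc, h⟩ := exists_norm_thetaPrime_le B hy he hs
  have hh : 0 ≤ heckeConst := by unfold heckeConst; positivity
  refine ⟨C * 8 + C + C + heckeConst * C, c / 2, by positivity, by positivity, fun q hq τ hτ => ?_⟩
  have hτ2 : 1 / 2 < τ.im := hτ.2
  have hv := τ.im_pos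
  have hmono : ∀ a : ℝ, 1 / 2 ≤ a → Real.exp (-c * (a * τ.im)) ≤ Real.exp (-(c / 2) * τ.im) :=
    fun a ha => Real.exp_le_exp.2 (by nlinarith [mul_pos hc hv])
  set E := Real.exp (-(c / 2) * τ.im)
  have hE : 0 < E := Real.exp_pos _
  have b1 : ‖thetaPrime y e B q (scaleUp τ)‖ ≤ C * 8 * (τ.im ^ 3 * E) := by
    refine (h q hq (scaleUp τ) (by rw [scaleUp_im]; linarith)).trans ?_
    rw [scaleUp_im, mul_pow]
    have := mul_le_mul_of_nonneg_left (hmono 2 (by norm_num)) (by positivity : 0 ≤ C * 8 * τ.im ^ 3)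
    linarith
  have b2 : ∀ b, ‖thetaPrime y e B q (scaleDown b τ)‖ ≤ C * (τ.im ^ 3 * E) := fun b => by
    refine (h q hq (scaleDown b τ) (by rw [scaleDown_im]; linarith)).trans ?_
    rw [scaleDown_im, div_pow, div_eq_inv_mul τ.im]
    have h1 := mul_le_mul_of_nonneg_left (hmono 2⁻¹ (by norm_num)) (by positivity : 0 ≤ C * τ.im ^ 3)
    have h2 : C * (τ.im ^ 3 / 2 ^ 3) ≤ C * τ.im ^ 3 := by
      refine mul_le_mul_of_nonneg_left ?_ hC
      have : 0 ≤ τ.im ^ 3 := by positivity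
      linarith
    have h3 := mul_le_mul_of_nonneg_right h2 (Real.exp_pos (-c * (2⁻¹ * τ.im))).le
    linarith
  have b3 : ‖thetaPrime y e B q τ‖ ≤ C * (τ.im ^ 3 * E) := by
    refine (h q hq τ (by linarith)).trans ?_
    have := mul_le_mul_of_nonneg_left (hmono 1 (by norm_num)) (by positivity : 0 ≤ C * τ.im ^ 3)
    rw [one_mul] at this
    linarith
  have b4 : ‖(heckeConst : ℂ) * thetaPrime y e B q τ‖ ≤ heckeConst * (C * (τ.im ^ 3 * E)) := by
    rw [norm_mul, Complex.norm_real, Real.norm_of_nonneg hh]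
    exact mul_le_mul_of_nonneg_left b3 hh
  rw [heckeTheta]
  refine (norm_sub_le _ _).trans ?_
  have := norm_add₃_le (a := thetaPrime y e B q (scaleUp τ)) (b := thetaPrime y e B q (scaleDown 0 τ))
    (c := thetaPrime y e B q (scaleDown 1 τ))
  linarith [b2 0, b2 1]

theorem continuous_hamForm (a c : ℝ) (x z : Fin 4 → ℝ) :
    Continuous fun q => hamForm y e B q a c x z := by
  have := continuous_sqNorm (ι := Fin 4)
  unfold hamForm narainForm radPairing shiftX shiftY
  fun_prop

theorem measurable_thetaPrime (hy : 0 < y) (he : e.det ≠ 0) :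
    Measurable fun p : (Fin 4 ⊕ Fin 4 → ℝ) × ℍ => thetaPrime y e B p.1 p.2 := by
  have hs : ∀ p : (Fin 4 ⊕ Fin 4 → ℝ) × ℍ,
      Summable fun l : {l : IntVec // l ≠ 0} => hamTerm y e B p.1 p.2 l :=
    fun p => (summable_hamTerm B p.1 p.2 hy he).subtype {l | l ≠ 0}
  refine measurable_tsum_of_summable (ι := {l : IntVec // l ≠ 0})
    (f := fun l (p : (Fin 4 ⊕ Fin 4 → ℝ) × ℍ) => hamTerm y e B p.1 p.2 l) (fun l => ?_) hs
  have h1 := UpperHalfPlane.continuous_re.comp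
    (continuous_snd : Continuous fun p : (Fin 4 ⊕ Fin 4 → ℝ) × ℍ => p.2)
  have h2 := UpperHalfPlane.continuous_im.comp
    (continuous_snd : Continuous fun p : (Fin 4 ⊕ Fin 4 → ℝ) × ℍ => p.2)
  have h3 := (continuous_hamForm (y := y) (e := e) B l.1.1.1 l.1.1.2 (toReal l.1.2.1)
    (toReal l.1.2.2)).comp (continuous_fst : Continuous fun p : (Fin 4 ⊕ Fin 4 → ℝ) × ℍ => p.1)
  simp only [Function.comp_def] at h1 h2 h3
  unfold hamTerm
  refine Continuous.measurable (.mul (Complex.continuous_ofReal.comp ((h2.pow 2).mul h2.sqrt))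
    (Complex.continuous_exp.comp (.add (Complex.continuous_ofReal.comp ((continuous_const.mul h2).mul h3))
      (continuous_const.mul (Complex.continuous_ofReal.comp (h1.mul continuous_const).neg)))))

theorem continuous_scaleUp : Continuous scaleUp := by
  rw [UpperHalfPlane.isEmbedding_coe.continuous_iff]
  exact continuous_const.mul UpperHalfPlane.continuous_coe

theorem continuous_scaleDown (b : ℝ) : Continuous (scaleDown b) := by
  rw [UpperHalfPlane.isEmbedding_coe.continuous_iff]
  exact (UpperHalfPlane.continuous_coe.add continuous_const).div_const 2

theorem measurable_thetaPrime_comp (hy : 0 < y) (he : e.det ≠ 0) {f : ℍ → ℍ} (hf : Continuous f) :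
    Measurable fun p : (Fin 4 ⊕ Fin 4 → ℝ) × ℍ => thetaPrime y e B p.1 (f p.2) := by
  have hm := hf.measurable
  have h1 : Measurable fun p : (Fin 4 ⊕ Fin 4 → ℝ) × ℍ => (p.1, f p.2) := by fun_prop
  have h2 := (measurable_thetaPrime B hy he).comp h1
  simp only [Function.comp_def] at h2
  exact h2

theorem measurable_heckeTheta (hy : 0 < y) (he : e.det ≠ 0) :
    Measurable fun p : (Fin 4 ⊕ Fin 4 → ℝ) × ℍ => heckeTheta y e B p.1 p.2 := by
  have h1 := measurable_thetaPrime_comp B hy he continuous_scaleUp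
  have h2 := measurable_thetaPrime_comp B hy he (continuous_scaleDown 0)
  have h3 := measurable_thetaPrime_comp B hy he (continuous_scaleDown 1)
  have h4 := (measurable_thetaPrime B hy he).const_mul (heckeConst : ℂ)
  unfold heckeTheta
  exact ((h1.add h2).add h3).sub h4

end

/-! ### Mellin transforms of theta functions over the strip -/

/-- A Gaussian term, multiplied by a power of the imaginary part and a function of the real part. -/
noncomputable def stripTerm (s : ℂ) (χ : ℝ → ℂ) (r : ℝ) (τ : ℍ) : ℂ :=
  ((τ.im : ℝ) : ℂ) ^ (s - 3 / 2) *
    (χ τ.re * (((τ.im ^ 2 * √τ.im : ℝ) : ℂ) * ((Real.exp (-(r * τ.im)) : ℝ) : ℂ)))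

theorem norm_stripTerm (s : ℂ) (χ : ℝ → ℂ) (r : ℝ) (τ : ℍ) : ‖stripTerm s χ r τ‖ =
    τ.im ^ (s.re - 3 / 2) * (‖χ τ.re‖ * (τ.im ^ 2 * √τ.im * Real.exp (-(r * τ.im)))) := by
  have hv := τ.im_pos
  rw [stripTerm, norm_mul, norm_mul, norm_mul, Complex.norm_cpow_eq_rpow_re_of_pos hv,
    Complex.norm_real, Complex.norm_real, Real.norm_of_nonneg (by positivity),
    Real.norm_of_nonneg (Real.exp_pos _).le]
  congr 2
  simp

/-- Against the density `t⁻²` the powers combine as `t^{s-3/2} t^{5/2} t^{-2} = t^{s-1}`, which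
leaves a Gamma integral; this explains the exponent `s - 3/2`. -/
theorem integral_stripTerm {χ : ℝ → ℂ} (hχ : IntegrableOn χ (Set.Ioc (-(1 / 2)) (1 / 2))) {s : ℂ}
    (hs : 0 < s.re) {r : ℝ} (hr : 0 < r) :
    IntegrableOn (stripTerm s χ r) strip ∧ ∫ τ in strip, stripTerm s χ r τ =
      (∫ x in Set.Ioc (-(1 / 2)) (1 / 2), χ x) * ((1 / (r : ℂ)) ^ s * Complex.Gamma s) := by
  set g : ℝ → ℂ := fun t => (t : ℂ) ^ (s - 1) * Complex.exp (-(r * t)) with hg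
  set f : ℝ × ℝ → ℂ := fun p => ((p.2 : ℝ) : ℂ) ^ (s - 3 / 2) *
    (χ p.1 * (((p.2 ^ 2 * √p.2 : ℝ) : ℂ) * ((Real.exp (-(r * p.2)) : ℝ) : ℂ))) with hf
  have hfg : ∀ p ∈ (Set.Ioc (-(1 / 2)) (1 / 2) ×ˢ Set.Ioi 0 : Set (ℝ × ℝ)),
      χ p.1 * g p.2 = (1 / p.2 ^ 2) • f p := by
    rintro ⟨x, t⟩ ⟨-, ht⟩
    have ht : 0 < t := ht
    have htc : (t : ℂ) ≠ 0 := by exact_mod_cast ht.ne'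
    simp only [hg, hf]
    have h1 : (t : ℂ) ^ (s - 1) = (t : ℂ) ^ (s - 3 / 2) * ((√t : ℝ) : ℂ) := by
      rw [Real.sqrt_eq_rpow, Complex.ofReal_cpow ht.le, ← Complex.cpow_add _ _ htc]
      congr 1
      push_cast
      ring
    rw [h1, Complex.real_smul]
    push_cast
    field_simp
  have hgi : IntegrableOn g (Set.Ioi 0) := by
    have h0 := Complex.GammaIntegral_convergent hs
    have h1 := (integrableOn_Ioi_comp_mul_left_iff
      (fun x : ℝ => ((Real.exp (-x) : ℝ) : ℂ) * (x : ℂ) ^ (s - 1)) 0 hr).2 (by simpa using h0)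
    refine IntegrableOn.congr_fun (h1.const_mul ((r : ℂ) ^ (s - 1))⁻¹) (fun t ht => ?_) measurableSet_Ioi
    have ht : 0 < t := ht
    have hrc : (r : ℂ) ≠ 0 := by exact_mod_cast hr.ne'
    have : (r : ℂ) ^ (s - 1) ≠ 0 := by simp [Complex.cpow_eq_zero_iff, hrc]
    simp only [hg, Complex.ofReal_mul, Complex.ofReal_exp, Complex.ofReal_neg]
    rw [Complex.mul_cpow_ofReal_nonneg hr.le ht.le]
    field_simp
  have hms : MeasurableSet (Set.Ioc (-(1 / 2)) (1 / 2) ×ˢ Set.Ioi 0 : Set (ℝ × ℝ)) :=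
    measurableSet_Ioc.prod measurableSet_Ioi
  constructor
  · have h1 : IntegrableOn (fun p : ℝ × ℝ => χ p.1 * g p.2) (Set.Ioc (-(1 / 2)) (1 / 2) ×ˢ Set.Ioi 0) := by
      rw [IntegrableOn, Measure.volume_eq_prod, ← Measure.prod_restrict]
      exact Integrable.mul_prod hχ hgi
    exact (integrableOn_strip_iff f).2 (h1.congr_fun hfg hms)
  · have h1 := integral_strip_eq f
    rw [← setIntegral_congr_fun hms hfg, Measure.volume_eq_prod, setIntegral_prod_mul, hg,
      Complex.integral_cpow_mul_exp_neg_mul_Ioi hs hr] at h1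
    exact h1

/-- The norm of a strip term is again a strip term, with `‖χ‖` for `χ` and `Re s` for `s`, so the
previous evaluation applies. -/
theorem integral_norm_stripTerm {χ : ℝ → ℂ} (hχ : IntegrableOn χ (Set.Ioc (-(1 / 2)) (1 / 2))) {s : ℂ}
    (hs : 0 < s.re) {r : ℝ} (hr : 0 < r) :
    ∫ τ in strip, ‖stripTerm s χ r τ‖ =
      (∫ x in Set.Ioc (-(1 / 2)) (1 / 2), ‖χ x‖) * (r ^ (-s.re) * Real.Gamma s.re) := by
  have h := (integral_stripTerm (χ := fun x => (‖χ x‖ : ℂ)) hχ.norm.ofReal (s := (s.re : ℂ))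
    (by simpa using hs) hr).2
  have h1 : ∀ τ : ℍ, stripTerm (s.re : ℂ) (fun x => (‖χ x‖ : ℂ)) r τ =
      ((‖stripTerm s χ r τ‖ : ℝ) : ℂ) := fun τ => by
    rw [norm_stripTerm, stripTerm]
    push_cast
    congr 1
    rw [Complex.ofReal_cpow τ.im_pos.le]
    push_cast
    rfl
  simp only [h1] at h
  rw [integral_complex_ofReal, integral_complex_ofReal, Complex.Gamma_ofReal] at h
  have h2 : (1 / (r : ℂ)) ^ (s.re : ℂ) = ((r ^ (-s.re) : ℝ) : ℂ) := by
    rw [Real.rpow_neg hr.le, ← Real.inv_rpow hr.le, Complex.ofReal_cpow (by positivity), one_div]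
    push_cast
    rfl
  rw [h2] at h
  exact_mod_cast h

theorem integral_tsum_stripTerm {ι : Type*} [Countable ι] {χ : ι → ℝ → ℂ}
    (hχ : ∀ i, Continuous (χ i)) {C : ℝ} (hC : ∀ i x, ‖χ i x‖ ≤ C) {s : ℂ} (hs : 0 < s.re)
    {r : ι → ℝ} (hr : ∀ i, 0 < r i) (hsum : Summable fun i => r i ^ (-s.re))
    (hp : ∀ τ, Summable fun i => ‖stripTerm s (χ i) (r i) τ‖) :
    IntegrableOn (fun τ => ∑' i, ‖stripTerm s (χ i) (r i) τ‖) strip ∧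
      HasSum (fun i => (∫ x in Set.Ioc (-(1 / 2)) (1 / 2), χ i x) *
        ((1 / (r i : ℂ)) ^ s * Complex.Gamma s)) (∫ τ in strip, ∑' i, stripTerm s (χ i) (r i) τ) := by
  have hχi : ∀ i, IntegrableOn (χ i) (Set.Ioc (-(1 / 2)) (1 / 2)) := fun i =>
    ((hχ i).continuousOn.integrableOn_compact isCompact_Icc).mono_set Set.Ioc_subset_Icc_self
  have hint := fun i => (integral_stripTerm (hχi i) hs (hr i)).1
  have hle : ∀ i, ∫ τ in strip, ‖stripTerm s (χ i) (r i) τ‖ ≤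
      C * Real.Gamma s.re * r i ^ (-s.re) := fun i => by
    rw [integral_norm_stripTerm (hχi i) hs (hr i)]
    have h1 : ∫ x in Set.Ioc (-(1 / 2) : ℝ) (1 / 2), ‖χ i x‖ ≤ C := by
      calc _ ≤ ∫ x in Set.Ioc (-(1 / 2) : ℝ) (1 / 2), C :=
            setIntegral_mono_on (hχi i).norm (integrableOn_const (by simp)) measurableSet_Ioc
              fun x _ => hC i x
        _ = C := by
            rw [setIntegral_const]
            simp only [Measure.real, Real.volume_Ioc]
            norm_num
    have h2 : 0 ≤ r i ^ (-s.re) * Real.Gamma s.re :=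
      mul_nonneg (Real.rpow_nonneg (hr i).le _) (Real.Gamma_pos_of_pos hs).le
    have := mul_le_mul_of_nonneg_right h1 h2
    linarith
  have hsn : Summable fun i => ∫ τ in strip, ‖stripTerm s (χ i) (r i) τ‖ :=
    (hsum.mul_left (C * Real.Gamma s.re)).of_nonneg_of_le
      (fun i => integral_nonneg fun τ => norm_nonneg _) hle
  have hm : ∀ i, Measurable fun τ => stripTerm s (χ i) (r i) τ := fun i => by
    have h1 := UpperHalfPlane.continuous_re.measurable
    have h2 := UpperHalfPlane.continuous_im.measurable
    have h3 := (hχ i).measurable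
    unfold stripTerm
    fun_prop
  constructor
  · refine ⟨(measurable_tsum_of_summable (fun i => (hm i).norm) hp).aestronglyMeasurable, ?_⟩
    have h1 : ∫⁻ τ in strip, ∑' i, ‖stripTerm s (χ i) (r i) τ‖ₑ < ⊤ := by
      rw [lintegral_tsum fun i => (hm i).enorm.aemeasurable]
      have : ∀ i, ∫⁻ τ in strip, ‖stripTerm s (χ i) (r i) τ‖ₑ =
          ENNReal.ofReal (∫ τ in strip, ‖stripTerm s (χ i) (r i) τ‖) := fun i => by
        rw [ofReal_integral_norm_eq_lintegral_enorm (hint i)]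
      simp only [this]
      rw [← ENNReal.ofReal_tsum_of_nonneg (fun i => integral_nonneg fun τ => norm_nonneg _) hsn]
      exact ENNReal.ofReal_lt_top
    refine lt_of_le_of_lt (lintegral_mono fun τ => ?_) h1
    rw [Real.enorm_of_nonneg (tsum_nonneg fun i => norm_nonneg _),
      ENNReal.ofReal_tsum_of_nonneg (fun i => norm_nonneg _) (hp τ)]
    simp only [ofReal_norm]
    exact le_rfl
  · have := hasSum_integral_of_summable_integral_norm hint hsn
    simpa only [(integral_stripTerm (hχi _) hs (hr _)).2] using this

/-! ### The zeta function of the null vectors -/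

/-- The split quadratic form on integral vectors. -/
def latQ (l : IntVec) : ℤ := l.1.1 * l.1.2 + ∑ i, l.2.1 i * l.2.2 i

/-- The phase `e^{-2πi x n}`. -/
noncomputable def intPhase (n : ℤ) (x : ℝ) : ℂ :=
  Complex.exp (2 * Real.pi * Complex.I * ((-(x * n) : ℝ) : ℂ))

theorem norm_intPhase (n : ℤ) (x : ℝ) : ‖intPhase n x‖ = 1 := by
  have := norm_cexp_add_two_pi_I 0 (-(x * n))
  rwa [Complex.ofReal_zero, zero_add, Real.exp_zero] at this

theorem continuous_intPhase (n : ℤ) : Continuous (intPhase n) := by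
  unfold intPhase; fun_prop

theorem integral_intPhase (n : ℤ) :
    ∫ x in Set.Ioc (-(1 / 2)) (1 / 2), intPhase n x = if n = 0 then 1 else 0 := by
  have h : ∀ x : ℝ, intPhase n x = Complex.exp (-(2 * Real.pi * Complex.I) * n * x) := fun x => by
    unfold intPhase; congr 1; push_cast; ring
  rw [← intervalIntegral.integral_of_le (by norm_num)]
  split_ifs with h0
  · have h1 : ∀ x, intPhase n x = 1 := fun x => by rw [h, h0]; simp
    simp only [h1]
    norm_num
  · have hn : (n : ℂ) ≠ 0 := by exact_mod_cast h0
    have hc : -(2 * Real.pi * Complex.I) * (n : ℂ) ≠ 0 :=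
      mul_ne_zero (neg_ne_zero.2 Complex.two_pi_I_ne_zero) hn
    simp only [h]
    rw [integral_exp_mul_complex hc]
    have : Complex.exp (-(2 * Real.pi * Complex.I) * (n : ℂ) * ((1 / 2 : ℝ) : ℂ)) =
        Complex.exp (-(2 * Real.pi * Complex.I) * (n : ℂ) * ((-(1 / 2) : ℝ) : ℂ)) := by
      rw [Complex.exp_eq_exp_iff_exists_int]
      exact ⟨-n, by push_cast; ring⟩
    rw [this, sub_self, zero_div]

section

variable (y : ℝ) (e B : Matrix (Fin 4) (Fin 4) ℝ) (q : Fin 4 ⊕ Fin 4 → ℝ)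

/-- The squared norm of the image of an integral vector. -/
noncomputable abbrev latHam (l : IntVec) : ℝ :=
  hamForm y e B q l.1.1 l.1.2 (toReal l.2.1) (toReal l.2.2)

/-- The zeta function of the nonzero null vectors. -/
noncomputable def nullZeta (s : ℂ) : ℂ :=
  ∑' l : {l : IntVec // l ≠ 0}, if latQ l = 0 then (1 / (latHam y e B q l : ℂ)) ^ s else 0

theorem hamTerm_eq_intPhase (τ : ℍ) (l : IntVec) : hamTerm y e B q τ l =
    intPhase (latQ l) τ.re * (((τ.im ^ 2 * √τ.im : ℝ) : ℂ) *
      ((Real.exp (-(Real.pi * latHam y e B q l * τ.im)) : ℝ) : ℂ)) := by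
  rw [hamTerm, Complex.exp_add, intPhase, Complex.ofReal_exp, latQ]
  have h1 : -Real.pi * τ.im * hamForm y e B q l.1.1 l.1.2 (toReal l.2.1) (toReal l.2.2) =
      -(Real.pi * latHam y e B q l * τ.im) := by ring
  rw [h1]
  push_cast
  ring

variable {y e}

theorem latHam_pos (hy : 0 < y) (he : e.det ≠ 0) {l : IntVec} (hl : l ≠ 0) :
    0 < latHam y e B q l := by
  obtain ⟨k, hk, h⟩ := exists_hamForm_ge B hy he (isCompact_singleton (x := q))
  have := h q rfl l
  have := one_le_latNorm hl
  unfold latHam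
  nlinarith

theorem summable_latHam_rpow (hy : 0 < y) (he : e.det ≠ 0) {r : ℝ} (hr : 5 < r) :
    Summable fun l : {l : IntVec // l ≠ 0} => latHam y e B q l ^ (-r) := by
  obtain ⟨k, hk, h⟩ := exists_hamForm_ge B hy he (isCompact_singleton (x := q))
  refine ((summable_latNorm_rpow hr).mul_left (k ^ (-r))).of_nonneg_of_le
    (fun l => Real.rpow_nonneg (latHam_pos B q hy he l.2).le _) fun l => ?_
  have h1 := one_le_latNorm l.2
  rw [← Real.mul_rpow hk.le (latNorm_nonneg _)]
  exact Real.rpow_le_rpow_of_nonpos (by positivity) (h q rfl l) (by linarith)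

/-- One statement serves the theta function and its Hecke translates. The functions of the real part
only have to be bounded and have mean `c` over a period on null vectors and mean zero on all others;
the integral then projects onto the null vectors. -/
theorem integral_lattice_strip (hy : 0 < y) (he : e.det ≠ 0) {χ : IntVec → ℝ → ℂ}
    (hχ : ∀ i, Continuous (χ i)) {C : ℝ} (hC : ∀ i x, ‖χ i x‖ ≤ C) {s : ℂ} (hs : 5 < s.re)
    {t : ℝ} (ht : 0 < t) {c : ℂ}
    (hc : ∀ l, ∫ x in Set.Ioc (-(1 / 2)) (1 / 2), χ l x = if latQ l = 0 then c else 0) :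
    IntegrableOn (fun τ => ∑' l : {l : IntVec // l ≠ 0},
        stripTerm s (χ l) (t * latHam y e B q l) τ) strip ∧
      ∫ τ in strip, ∑' l : {l : IntVec // l ≠ 0}, stripTerm s (χ l) (t * latHam y e B q l) τ =
        c * ((1 / (t : ℂ)) ^ s * Complex.Gamma s) * nullZeta y e B q s := by
  obtain ⟨k, hk, h⟩ := exists_hamForm_ge B hy he (isCompact_singleton (x := q))
  have hp : ∀ τ, Summable fun l : {l : IntVec // l ≠ 0} =>
      ‖stripTerm s (χ l) (t * latHam y e B q l) τ‖ := fun τ => by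
    have hv := τ.im_pos
    refine (((summable_exp_latNorm (c := t * k * τ.im) (by positivity)).subtype {l | l ≠ 0}).mul_left
      (C * (τ.im ^ (s.re - 3 / 2) * (τ.im ^ 2 * √τ.im)))).of_nonneg_of_le
      (fun l => norm_nonneg _) fun l => ?_
    have h1 := mul_le_mul_of_nonneg_left (h q rfl l) (mul_pos ht hv).le
    have h2 : ‖stripTerm s (χ l) (t * latHam y e B q l) τ‖ = ‖χ l τ.re‖ *
        (τ.im ^ (s.re - 3 / 2) * (τ.im ^ 2 * √τ.im)) * Real.exp (-(t * latHam y e B q l * τ.im)) := by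
      rw [norm_stripTerm]; ring
    rw [h2]
    refine mul_le_mul (mul_le_mul_of_nonneg_right (hC _ _) (by positivity))
      (Real.exp_le_exp.2 ?_) (by positivity)
      (mul_nonneg ((norm_nonneg _).trans (hC 0 0)) (by positivity))
    unfold latHam
    linarith
  have hr : ∀ l : {l : IntVec // l ≠ 0}, 0 < t * latHam y e B q l := fun l =>
    mul_pos ht (latHam_pos B q hy he l.2)
  have hsum : Summable fun l : {l : IntVec // l ≠ 0} => (t * latHam y e B q l) ^ (-s.re) := by
    refine ((summable_latHam_rpow B q hy he hs).mul_left (t ^ (-s.re))).congr fun l => ?_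
    rw [← Real.mul_rpow ht.le (latHam_pos B q hy he l.2).le]
  obtain ⟨h1, h2⟩ := integral_tsum_stripTerm (χ := fun l : {l : IntVec // l ≠ 0} => χ l)
    (fun l => hχ l) (fun l => hC l) (by linarith) hr hsum hp
  constructor
  · refine Integrable.mono' h1 ?_ (.of_forall fun τ => norm_tsum_le_tsum_norm (hp τ))
    refine (measurable_tsum_of_summable (fun l => ?_) fun τ => (hp τ).of_norm).aestronglyMeasurable
    have h1 := UpperHalfPlane.continuous_re.measurable
    have h2 := UpperHalfPlane.continuous_im.measurable
    have h3 := (hχ l).measurable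
    unfold stripTerm
    fun_prop
  · rw [← h2.tsum_eq, nullZeta, ← tsum_mul_left]
    refine tsum_congr fun l => ?_
    have hl := latHam_pos B q hy he l.2
    rw [hc]
    split_ifs
    · have : (1 / ((t * latHam y e B q l : ℝ) : ℂ)) = ((1 / t : ℝ) : ℂ) * ((1 / latHam y e B q l : ℝ) : ℂ) := by
        push_cast
        field_simp
      rw [this, Complex.mul_cpow_ofReal_nonneg (by positivity) (by positivity)]
      push_cast
      ring
    · simp

theorem cpow_mul_thetaPrime (s : ℂ) (τ : ℍ) : ((τ.im : ℝ) : ℂ) ^ (s - 3 / 2) * thetaPrime y e B q τ =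
    ∑' l : {l : IntVec // l ≠ 0}, stripTerm s (intPhase (latQ l)) (Real.pi * latHam y e B q l) τ := by
  rw [thetaPrime, ← tsum_mul_left]
  exact tsum_congr fun l => by rw [hamTerm_eq_intPhase]; rfl

/-- The mean of `e^{-2πi x q(l)}` over a period is 1 for null vectors and 0 otherwise. -/
theorem integral_thetaPrime (hy : 0 < y) (he : e.det ≠ 0) {s : ℂ} (hs : 5 < s.re) :
    IntegrableOn (fun τ : ℍ => ((τ.im : ℝ) : ℂ) ^ (s - 3 / 2) * thetaPrime y e B q τ) strip ∧
    ∫ τ in strip, ((τ.im : ℝ) : ℂ) ^ (s - 3 / 2) * thetaPrime y e B q τ =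
      (1 / (Real.pi : ℂ)) ^ s * Complex.Gamma s * nullZeta y e B q s := by
  simp only [cpow_mul_thetaPrime]
  have := integral_lattice_strip B q hy he (χ := fun l => intPhase (latQ l))
    (fun l => continuous_intPhase _) (fun l x => (norm_intPhase _ x).le) hs Real.pi_pos
    (c := 1) (fun l => integral_intPhase _)
  simpa only [one_mul] using this

/-- Replacing the form by a multiple of the norm that works for all unipotent variables in a compact
set gives one integrable majorant, as required to exchange the integrals over the cube and the
strip. -/
theorem exists_thetaPrime_bound (hy : 0 < y) (he : e.det ≠ 0) {K : Set (Fin 4 ⊕ Fin 4 → ℝ)}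
    (hK : IsCompact K) {s : ℂ} (hs : 5 < s.re) : ∃ G : ℍ → ℝ, IntegrableOn G strip ∧
      ∀ q ∈ K, ∀ τ : ℍ, ‖((τ.im : ℝ) : ℂ) ^ (s - 3 / 2) * thetaPrime y e B q τ‖ ≤ G τ := by
  obtain ⟨k, hk, h⟩ := exists_hamForm_ge B hy he hK
  have hpi := Real.pi_pos
  have hform : ∀ (τ : ℍ) (l : {l : IntVec // l ≠ 0}),
      ‖stripTerm s (fun _ => 1) (Real.pi * (k * latNorm l)) τ‖ =
      τ.im ^ (s.re - 3 / 2) * (τ.im ^ 2 * √τ.im) * Real.exp (-(Real.pi * k * τ.im) * latNorm l) := by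
    intro τ l
    rw [norm_stripTerm, norm_one, one_mul]
    ring_nf
  have hp : ∀ τ, Summable fun l : {l : IntVec // l ≠ 0} =>
      ‖stripTerm s (fun _ => 1) (Real.pi * (k * latNorm l)) τ‖ := fun τ => by
    simp only [hform]
    have hv := τ.im_pos
    exact ((summable_exp_latNorm (c := Real.pi * k * τ.im) (by positivity)).subtype {l | l ≠ 0}).mul_left _
  refine ⟨_, (integral_tsum_stripTerm (χ := fun (_ : {l : IntVec // l ≠ 0}) _ => 1)
    (fun _ => continuous_const) (C := 1) (fun _ _ => by simp) (s := s) (by linarith)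
    (r := fun l => Real.pi * (k * latNorm l))
    (fun l => by have := one_le_latNorm l.2; positivity) ?_ hp).1, ?_⟩
  · refine ((summable_latNorm_rpow hs).mul_left ((Real.pi * k) ^ (-s.re))).congr fun l => ?_
    rw [← mul_assoc, Real.mul_rpow (by positivity) (latNorm_nonneg _)]
  · intro q hq τ
    have hv := τ.im_pos
    rw [cpow_mul_thetaPrime]
    refine tsum_of_norm_bounded (hp τ).hasSum fun l => ?_
    rw [hform, norm_stripTerm, norm_intPhase, one_mul, ← mul_assoc]
    refine mul_le_mul_of_nonneg_left (Real.exp_le_exp.2 ?_) (by positivity)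
    have h1 := mul_le_mul_of_nonneg_left (h q hq l) (mul_pos hpi hv).le
    unfold latHam
    linarith

/-- The factor by which the Hecke operator acts. -/
noncomputable def heckeFactor (s : ℂ) : ℂ :=
  4 * √2 * (1 / 2) ^ s + √2 / 4 * 2 ^ s - heckeConst

/-- Shifting the argument by `1/2` multiplies the phase by `(-1)^n`. Odd `n` cancel pointwise, and
an even `n = 2m` doubles to the phase of `m`. The factor `√2 / 8 = 2^{-5/2}` comes from the height
`τ₂ / 2`. -/
theorem integral_halfPhase (n : ℤ) : ∫ x in Set.Ioc (-(1 / 2)) (1 / 2),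
    (√2 / 8 : ℂ) * (intPhase n ((x + 0) / 2) + intPhase n ((x + 1) / 2)) =
      if n = 0 then (√2 / 4 : ℂ) else 0 := by
  have hsh : ∀ x, intPhase n ((x + 1) / 2) = (-1) ^ n * intPhase n ((x + 0) / 2) := fun x => by
    rw [← Complex.exp_pi_mul_I, ← Complex.exp_int_mul, intPhase, intPhase, ← Complex.exp_add,
      Complex.exp_eq_exp_iff_exists_int]
    exact ⟨-n, by push_cast; ring⟩
  rcases Int.even_or_odd' n with ⟨m, rfl | rfl⟩
  · have h1 : ∀ x : ℝ, (√2 / 8 : ℂ) * (intPhase (2 * m) ((x + 0) / 2) + intPhase (2 * m) ((x + 1) / 2)) =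
        (√2 / 4 : ℂ) * intPhase m x := fun x => by
      have h2 : intPhase (2 * m) ((x + 0) / 2) = intPhase m x := by
        unfold intPhase; congr 3; push_cast; ring
      rw [hsh, (even_two_mul m).neg_one_zpow, h2]
      ring
    simp only [h1, integral_const_mul, integral_intPhase]
    by_cases hm : m = 0 <;> simp [hm]
  · have h1 : ∀ x : ℝ, (√2 / 8 : ℂ) * (intPhase (2 * m + 1) ((x + 0) / 2) +
        intPhase (2 * m + 1) ((x + 1) / 2)) = 0 := fun x => by
      rw [hsh, (odd_two_mul_add_one m).neg_one_zpow]
      ring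
    have h0 : (2 * m + 1 : ℤ) ≠ 0 := by omega
    simp only [h1, h0, if_false, integral_zero]

theorem cpow_mul_thetaPrime_up (s : ℂ) (τ : ℍ) :
    ((τ.im : ℝ) : ℂ) ^ (s - 3 / 2) * thetaPrime y e B q (scaleUp τ) =
    ∑' l : {l : IntVec // l ≠ 0}, stripTerm s (fun x => (4 * √2 : ℂ) * intPhase (latQ l) (2 * x))
      (2 * Real.pi * latHam y e B q l) τ := by
  rw [thetaPrime, ← tsum_mul_left]
  refine tsum_congr fun l => ?_
  rw [hamTerm_eq_intPhase, stripTerm, scaleUp_re, scaleUp_im, Real.sqrt_mul zero_le_two]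
  have : Real.pi * latHam y e B q l * (2 * τ.im) = 2 * Real.pi * latHam y e B q l * τ.im := by ring
  rw [this]
  push_cast
  ring

theorem cpow_mul_thetaPrime_down (hy : 0 < y) (he : e.det ≠ 0) (s : ℂ) (τ : ℍ) :
    ((τ.im : ℝ) : ℂ) ^ (s - 3 / 2) *
      (thetaPrime y e B q (scaleDown 0 τ) + thetaPrime y e B q (scaleDown 1 τ)) =
    ∑' l : {l : IntVec // l ≠ 0}, stripTerm s (fun x => (√2 / 8 : ℂ) *
      (intPhase (latQ l) ((x + 0) / 2) + intPhase (latQ l) ((x + 1) / 2)))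
      (Real.pi / 2 * latHam y e B q l) τ := by
  have hs : ∀ b, Summable fun l : {l : IntVec // l ≠ 0} => hamTerm y e B q (scaleDown b τ) l :=
    fun b => (summable_hamTerm B q (scaleDown b τ) hy he).subtype {l | l ≠ 0}
  have hadd : thetaPrime y e B q (scaleDown 0 τ) + thetaPrime y e B q (scaleDown 1 τ) =
      ∑' l : {l : IntVec // l ≠ 0}, (hamTerm y e B q (scaleDown 0 τ) l + hamTerm y e B q (scaleDown 1 τ) l) :=
    ((hs 0).tsum_add (hs 1)).symm
  rw [hadd, ← tsum_mul_left]
  refine tsum_congr fun l => ?_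
  have h2 : √2 * √2 = (2 : ℝ) := Real.mul_self_sqrt zero_le_two
  have h0 : √2 ≠ (0 : ℝ) := by positivity
  have h3 : (τ.im / 2) ^ 2 * √(τ.im / 2) = √2 / 8 * (τ.im ^ 2 * √τ.im) := by
    rw [Real.sqrt_div τ.im_pos.le]
    field_simp
    linear_combination (-(4 : ℝ)) * h2
  rw [hamTerm_eq_intPhase, hamTerm_eq_intPhase, stripTerm, scaleDown_re, scaleDown_im, scaleDown_re,
    scaleDown_im, h3]
  have : Real.pi * latHam y e B q l * (τ.im / 2) = Real.pi / 2 * latHam y e B q l * τ.im := by ring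
  rw [this]
  push_cast
  ring

/-- Scaling `τ` by 2 or `1/2` scales the form by the same factor, so each Hecke translate reproduces
the null zeta function times a power of 2. The operator thus acts on the Mellin transform by a
scalar. -/
theorem integral_heckeTheta (hy : 0 < y) (he : e.det ≠ 0) {s : ℂ} (hs : 5 < s.re) :
    ∫ τ in strip, ((τ.im : ℝ) : ℂ) ^ (s - 3 / 2) * heckeTheta y e B q τ =
      (1 / (Real.pi : ℂ)) ^ s * Complex.Gamma s * heckeFactor s * nullZeta y e B q s := by
  have hpi := Real.pi_pos
  obtain ⟨i1, e1⟩ := integral_lattice_strip B q hy he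
    (χ := fun l x => (4 * √2 : ℂ) * intPhase (latQ l) (2 * x))
    (fun l => continuous_const.mul ((continuous_intPhase _).comp (continuous_const.mul continuous_id)))
    (C := 4 * √2) (fun l x => by
      rw [norm_mul, norm_intPhase, mul_one]
      simp [abs_of_nonneg (Real.sqrt_nonneg 2)]) hs (t := 2 * Real.pi) (by positivity) (c := 4 * √2) (fun l => by
      have h2 : ∀ x, intPhase (latQ l) (2 * x) = intPhase (2 * latQ l) x := fun x => by
        unfold intPhase; congr 3; push_cast; ring
      simp only [h2, integral_const_mul, integral_intPhase]
      by_cases h : latQ l = 0 <;> simp [h])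
  obtain ⟨i2, e2⟩ := integral_lattice_strip B q hy he
    (χ := fun l x => (√2 / 8 : ℂ) *
      (intPhase (latQ l) ((x + 0) / 2) + intPhase (latQ l) ((x + 1) / 2)))
    (fun l => by have := continuous_intPhase (latQ l); fun_prop)
    (C := √2 / 8 * 2) (fun l x => by
      rw [norm_mul]
      have := norm_add_le (intPhase (latQ l) ((x + 0) / 2)) (intPhase (latQ l) ((x + 1) / 2))
      rw [norm_intPhase, norm_intPhase] at this
      refine mul_le_mul (by simp [abs_of_nonneg (Real.sqrt_nonneg 2)]) (by linarith) (norm_nonneg _) (by positivity)) hs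
    (t := Real.pi / 2) (by positivity) (c := √2 / 4) (fun l => integral_halfPhase _)
  obtain ⟨i3, e3⟩ := integral_thetaPrime B q hy he hs
  simp only [← cpow_mul_thetaPrime_up B q] at i1 e1
  simp only [← cpow_mul_thetaPrime_down B q hy he] at i2 e2
  have hsplit : ∀ τ : ℍ, ((τ.im : ℝ) : ℂ) ^ (s - 3 / 2) * heckeTheta y e B q τ =
      ((τ.im : ℝ) : ℂ) ^ (s - 3 / 2) * thetaPrime y e B q (scaleUp τ) +
      ((τ.im : ℝ) : ℂ) ^ (s - 3 / 2) *
        (thetaPrime y e B q (scaleDown 0 τ) + thetaPrime y e B q (scaleDown 1 τ)) -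
      heckeConst * (((τ.im : ℝ) : ℂ) ^ (s - 3 / 2) * thetaPrime y e B q τ) := fun τ => by
    rw [heckeTheta]; ring
  simp only [hsplit]
  have i12 := i1.add i2
  simp only [Pi.add_def] at i12
  rw [integral_sub i12 (i3.const_mul _), integral_add i1 i2, integral_const_mul, e1, e2, e3]
  have p1 : (1 / ((2 * Real.pi : ℝ) : ℂ)) ^ s = (1 / 2) ^ s * (1 / (Real.pi : ℂ)) ^ s := by
    have := Complex.mul_cpow_ofReal_nonneg (a := 1 / 2) (b := 1 / Real.pi) (by norm_num)
      (by positivity) s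
    push_cast at this
    rw [← this]
    congr 1
    push_cast
    field_simp
  have p2 : (1 / ((Real.pi / 2 : ℝ) : ℂ)) ^ s = 2 ^ s * (1 / (Real.pi : ℂ)) ^ s := by
    have := Complex.mul_cpow_ofReal_nonneg (a := 2) (b := 1 / Real.pi) (by norm_num)
      (by positivity) s
    push_cast at this
    rw [← this]
    congr 1
    push_cast
    field_simp
  rw [p1, p2, heckeFactor]
  ring

theorem norm_two_cpow (s : ℂ) : ‖(2 : ℂ) ^ s‖ = 2 ^ s.re := by
  have := Complex.norm_cpow_eq_rpow_re_of_pos (x := 2) (by norm_num) s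
  simpa using this

theorem half_cpow (s : ℂ) : (1 / 2 : ℂ) ^ s = ((2 : ℂ) ^ s)⁻¹ := by
  rw [one_div, Complex.inv_cpow]
  rw [show (2 : ℂ) = ((2 : ℝ) : ℂ) by norm_num, Complex.arg_ofReal_of_nonneg zero_le_two]
  exact Real.pi_pos.ne

/-- For `Re s > 5` one has `|2^s| ≥ 32`, so the growing term has size at least `8√2`, while the
other two together are at most `4√2 + √2/4 + √2/8`. -/
theorem heckeFactor_ne_zero {s : ℂ} (hs : 5 < s.re) : heckeFactor s ≠ 0 := by
  intro h
  have h0 : (0 : ℝ) < √2 := by positivity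
  have h2 : (32 : ℝ) ≤ ‖(2 : ℂ) ^ s‖ := by
    rw [norm_two_cpow]
    calc (32 : ℝ) = 2 ^ (5 : ℝ) := by norm_num
      _ ≤ _ := Real.rpow_le_rpow_of_exponent_le (by norm_num) hs.le
  have h1 : (√2 / 4 : ℂ) * 2 ^ s = heckeConst - 4 * √2 * (1 / 2) ^ s := by
    rw [heckeFactor] at h
    linear_combination h
  have h3 := congrArg norm h1
  have h4 := norm_sub_le (heckeConst : ℂ) (4 * √2 * (1 / 2 : ℂ) ^ s)
  have h5 : ‖(√2 / 4 : ℂ) * 2 ^ s‖ = √2 / 4 * ‖(2 : ℂ) ^ s‖ := by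
    rw [norm_mul]; simp
  have h6 : ‖(4 * √2 * (1 / 2 : ℂ) ^ s : ℂ)‖ ≤ 4 * √2 * (1 / 32) := by
    rw [norm_mul, half_cpow, norm_inv]
    have : ‖(4 * √2 : ℂ)‖ = 4 * √2 := by simp
    rw [this, ← one_div]
    exact mul_le_mul_of_nonneg_left (one_div_le_one_div_of_le (by norm_num) h2) (by positivity)
  have h7 : ‖(heckeConst : ℂ)‖ = 4 * √2 + √2 / 4 := by
    rw [Complex.norm_real, heckeConst, Real.norm_of_nonneg (by positivity)]
  rw [h5] at h3
  have h8 := mul_le_mul_of_nonneg_left h2 (by positivity : 0 ≤ √2 / 4)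
  linarith

theorem two_cpow_three_halves : (2 : ℂ) ^ (3 / 2 : ℂ) = 2 * √2 := by
  have : (2 : ℂ) ^ (3 / 2 : ℂ) = (((2 : ℝ) ^ (3 / 2 : ℝ) : ℝ) : ℂ) := by
    rw [Complex.ofReal_cpow zero_le_two]; norm_num
  rw [this, show (3 / 2 : ℝ) = 1 + 1 / 2 by norm_num, Real.rpow_add (by norm_num), Real.rpow_one,
    ← Real.sqrt_eq_rpow]
  push_cast
  ring

theorem heckeFactor_three_halves_ne_zero : heckeFactor (3 / 2) ≠ 0 := by
  have h2 : √2 * √2 = (2 : ℝ) := Real.mul_self_sqrt zero_le_two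
  have h2c : (√2 : ℂ) * √2 = 2 := by exact_mod_cast h2
  have h0 : (√2 : ℂ) ≠ 0 := by
    have : √2 ≠ (0 : ℝ) := by positivity
    exact_mod_cast this
  -- At `s = 3/2` the two powers of 2 contribute `2` and `1`, and `heckeConst` exceeds their sum.
  have h : heckeFactor (3 / 2) = ((3 - heckeConst : ℝ) : ℂ) := by
    rw [heckeFactor, half_cpow, two_cpow_three_halves]
    push_cast
    field_simp
    linear_combination (4 : ℂ) * h2c
  rw [h]
  have h1 : (1 : ℝ) ≤ √2 := by rw [Real.one_le_sqrt]; norm_num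
  have : 3 - heckeConst ≠ 0 := by
    unfold heckeConst
    linarith
  exact_mod_cast this

theorem differentiable_heckeFactor : Differentiable ℂ heckeFactor := by
  have h : heckeFactor = fun s => 4 * √2 * ((2 : ℂ) ^ s)⁻¹ + √2 / 4 * 2 ^ s - heckeConst := by
    funext s; rw [heckeFactor, half_cpow]
  have h2 : Differentiable ℂ fun s : ℂ => (2 : ℂ) ^ s := fun s =>
    (differentiableAt_id).const_cpow (.inl two_ne_zero)
  rw [h]
  have h0 : ∀ s : ℂ, (2 : ℂ) ^ s ≠ 0 := fun s => by simp [Complex.cpow_eq_zero_iff]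
  exact (((h2.inv h0).const_mul _).add (h2.const_mul _)).sub_const _

end

/-! ### Integral elements of the spin group -/

/-- The involution of the coordinates which exchanges dual isotropic lines. -/
def ixDual : Ix → Ix
  | Sum.inl _ => ixC
  | Sum.inr (Sum.inl i) => Sum.inr (Sum.inl i.swap)
  | Sum.inr (Sum.inr _) => ixA

theorem ixDual_ixDual (j : Ix) : ixDual (ixDual j) = j := by
  rcases j with j | (j | j) | j <;> rfl

theorem polar_Q55 (v w : V10) : QuadraticMap.polar Q55 v w = ∑ j, v j * w (ixDual j) := by
  simp only [QuadraticMap.polar, Q55_apply, Pi.add_apply, Fintype.sum_sum_type, ixDual, Sum.swap_inl,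
    Sum.swap_inr, Finset.univ_unique, Finset.sum_singleton, Fin.sum_univ_four]
  simp
  ring

theorem polar_Q55_single (v : V10) (k : Ix) :
    QuadraticMap.polar Q55 v (Pi.single k 1) = v (ixDual k) := by
  rw [polar_Q55, Finset.sum_eq_single (ixDual k)]
  · simp [ixDual_ixDual]
  · intro j _ hj
    rw [Pi.single_eq_of_ne (fun h => hj (by rw [← h, ixDual_ixDual])), mul_zero]
  · simp

theorem Q55_vecAct (g : Spin55) (v : V10) : Q55 (vecAct g v) = Q55 v := by
  have h : algebraMap ℝ Cl55 (Q55 (vecAct g v)) = algebraMap ℝ Cl55 (Q55 v) := by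
    rw [← CliffordAlgebra.ι_sq_scalar, ← CliffordAlgebra.ι_sq_scalar]
    change cl (vecAct g v) * cl (vecAct g v) = _
    have h1 : ((g⁻¹ : Spin55) : Cl55) * (g : Cl55) = 1 := by
      rw [← Submonoid.coe_mul, inv_mul_cancel]; rfl
    have h2 : (g : Cl55) * ((g⁻¹ : Spin55) : Cl55) = 1 := by
      rw [← Submonoid.coe_mul, mul_inv_cancel]; rfl
    rw [cl_vecAct]
    calc (g : Cl55) * cl v * ((g⁻¹ : Spin55) : Cl55) * ((g : Cl55) * cl v * ((g⁻¹ : Spin55) : Cl55)) =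
        (g : Cl55) * cl v * (((g⁻¹ : Spin55) : Cl55) * (g : Cl55)) * cl v * ((g⁻¹ : Spin55) : Cl55) := by
          simp only [mul_assoc]
      _ = (g : Cl55) * (cl v * cl v) * ((g⁻¹ : Spin55) : Cl55) := by
          rw [h1, mul_one]; simp only [mul_assoc]
      _ = _ := by
          rw [CliffordAlgebra.ι_sq_scalar, ← Algebra.commutes, mul_assoc, h2, mul_one]
  exact (algebraMap ℝ Cl55).injective h

theorem polar_Q55_vecAct (g : Spin55) (v w : V10) :
    QuadraticMap.polar Q55 (vecAct g v) (vecAct g w) = QuadraticMap.polar Q55 v w := by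
  simp only [QuadraticMap.polar, ← map_add, Q55_vecAct]

theorem vecRep_mulVec (g : Spin55) (v : V10) : vecRep g *ᵥ v = vecAct g v :=
  LinearMap.toMatrix'_mulVec _ _

theorem vecAct_mul (g k : Spin55) (v : V10) : vecAct (g * k) v = vecAct g (vecAct k v) := by
  simp only [← vecRep_mulVec, map_mul, Matrix.mulVec_mulVec]

theorem vecAct_one (v : V10) : vecAct 1 v = v := by
  rw [← vecRep_mulVec, map_one, Matrix.one_mulVec]

theorem vecAct_inv_vecAct (g : Spin55) (v : V10) : vecAct g⁻¹ (vecAct g v) = v := by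
  rw [← vecAct_mul, inv_mul_cancel, vecAct_one]

theorem vecRep_apply (g : Spin55) (j k : Ix) : vecRep g j k = vecAct g (Pi.single k 1) j := by
  rw [← vecRep_mulVec, Matrix.mulVec_single_one]; rfl

/-- Invariance of the split form makes the inverse the adjoint, which is the transpose conjugated by
the involution of the coordinates. In particular the inverse of an integral matrix of this kind is
integral. -/
theorem vecRep_inv_apply (g : Spin55) (j k : Ix) :
    vecRep g⁻¹ j k = vecRep g (ixDual k) (ixDual j) := by
  have h := polar_Q55_vecAct g (vecAct g⁻¹ (Pi.single k 1)) (Pi.single (ixDual j) 1)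
  rw [polar_Q55_single, ixDual_ixDual, ← vecAct_mul, mul_inv_cancel, vecAct_one,
    QuadraticMap.polar_comm, polar_Q55_single, ← vecRep_apply, ← vecRep_apply] at h
  exact h.symm

theorem mem_spinInt_iff (g : Spin55) :
    g ∈ spinInt ↔ ∃ A : Matrix Ix Ix ℤ, vecRep g = A.map (fun n : ℤ => (n : ℝ)) := by
  constructor
  · rintro ⟨U, hU⟩
    exact ⟨U, (congrArg Units.val hU).symm⟩
  · rintro ⟨A, hA⟩
    have hinv : vecRep g⁻¹ =
        (Matrix.of fun j k => A (ixDual k) (ixDual j)).map (fun n : ℤ => (n : ℝ)) := by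
      ext j k
      rw [vecRep_inv_apply, hA]; rfl
    have hcast : Function.Injective fun C : Matrix Ix Ix ℤ => C.map (fun n : ℤ => (n : ℝ)) :=
      Matrix.map_injective Int.cast_injective
    have hmul : ∀ C D : Matrix Ix Ix ℤ, (C * D).map (fun n : ℤ => (n : ℝ)) =
        C.map (fun n : ℤ => (n : ℝ)) * D.map (fun n : ℤ => (n : ℝ)) := fun C D =>
      Matrix.map_mul (f := Int.castRingHom ℝ)
    have hone : (1 : Matrix Ix Ix ℤ).map (fun n : ℤ => (n : ℝ)) = 1 :=
      Matrix.map_one _ Int.cast_zero Int.cast_one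
    refine ⟨⟨A, Matrix.of fun j k => A (ixDual k) (ixDual j), hcast ?_, hcast ?_⟩, Units.ext hA.symm⟩
    · simp only [hmul, hone]
      rw [← hA, ← hinv, ← map_mul, mul_inv_cancel, map_one]
    · simp only [hmul, hone]
      rw [← hA, ← hinv, ← map_mul, inv_mul_cancel, map_one]

theorem exists_int_vecAct {g : Spin55} (hg : g ∈ spinInt) (w : Ix → ℤ) :
    ∃ w' : Ix → ℤ, vecAct g (fun j => (w j : ℝ)) = fun j => (w' j : ℝ) := by
  obtain ⟨A, hA⟩ := (mem_spinInt_iff g).1 hg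
  refine ⟨A *ᵥ w, ?_⟩
  funext j
  rw [← vecRep_mulVec, hA]
  simp [Matrix.mulVec, dotProduct]

theorem unip_mem_spinInt (q : Fin 4 ⊕ Fin 4 → ℤ) : unip (fun i => (q i : ℝ)) ∈ spinInt := by
  refine (mem_spinInt_iff _).2 ⟨Matrix.of fun j k => match j, k with
        | Sum.inl _, Sum.inl _ => 1
        | Sum.inl _, Sum.inr (Sum.inl i) => q i
        | Sum.inl _, Sum.inr (Sum.inr _) => -∑ i : Fin 4, q (Sum.inl i) * q (Sum.inr i)
        | Sum.inr (Sum.inl i), Sum.inr (Sum.inl l) => if i = l then 1 else 0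
        | Sum.inr (Sum.inl i), Sum.inr (Sum.inr _) => -q i.swap
        | Sum.inr (Sum.inr _), Sum.inr (Sum.inr _) => 1
        | _, _ => 0, ?_⟩
  rw [vecRep_unip]
  ext j k
  rcases j with j | j | j <;> rcases k with k | k | k <;> simp

/-- The isotropic plane reflection vector of the coordinates `a` and `c`. -/
def vecAC : V10 := Pi.single ixA 1 + Pi.single ixC 1

/-- The reflection vector of the first coordinates of `x` and `y`. -/
def vecXY : V10 := Pi.single (ixX 0) 1 + Pi.single (ixY 0) 1

theorem Q55_vecAC : Q55 vecAC = 1 := by simp [Q55_apply, vecAC]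

theorem Q55_vecXY : Q55 vecXY = 1 := by simp [Q55_apply, vecXY, Fin.sum_univ_four]

/-- The element of `Spin(5,5,ℤ)` which maps `(a, c)` to `(-c, -a)`. -/
def spinSwap : Spin55 :=
  ⟨cl vecAC * cl vecXY, cl_mul_cl_mem_spin _ _ (by rw [Q55_vecAC, Q55_vecXY, one_mul])⟩

/-- A product of two vectors of square 1 acts as the product of their reflections. The reflection
that matters is the one in `vecAC`; the orthogonal second one makes the product even, so that it
lies in the spin group. -/
theorem vecAct_spinSwap (v : V10) : vecAct spinSwap v =
    v - QuadraticMap.polar Q55 vecXY v • vecXY - QuadraticMap.polar Q55 vecAC v • vecAC := by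
  set m := cl vecXY with hm
  set n := cl vecAC with hn
  have hg : ((spinSwap : Spin55) : Cl55) = n * m := rfl
  have hginv : ((spinSwap⁻¹ : Spin55) : Cl55) = m * n := by
    have : ((spinSwap⁻¹ : Spin55) : Cl55) = star (n * m) := rfl
    rw [this, star_mul, hm, hn, CliffordAlgebra.star_ι, CliffordAlgebra.star_ι, neg_mul_neg]
  have hmm : m * m = 1 := by
    rw [hm, CliffordAlgebra.ι_sq_scalar, Q55_vecXY, map_one]
  have hnn : n * n = 1 := by
    rw [hn, CliffordAlgebra.ι_sq_scalar, Q55_vecAC, map_one]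
  have refl : ∀ u w : V10, cl u * cl u = 1 →
      cl u * cl w * cl u = cl (QuadraticMap.polar Q55 u w • u - w) := fun u w hu => by
    have h := CliffordAlgebra.ι_mul_ι_comm (Q := Q55) u w
    rw [map_sub, map_smul]
    change cl u * cl w = _ - cl w * cl u at h
    rw [h, sub_mul, mul_assoc, hu, mul_one, ← Algebra.smul_def]
  have h0 : QuadraticMap.polar Q55 vecAC vecXY = 0 := by
    rw [polar_Q55]
    simp [vecAC, vecXY, ixDual]
  have hfin : cl (vecAct spinSwap v) = cl (v - QuadraticMap.polar Q55 vecXY v • vecXY -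
      QuadraticMap.polar Q55 vecAC v • vecAC) := by
    rw [cl_vecAct, hg, hginv]
    have : n * m * cl v * (m * n) = n * (m * cl v * m) * n := by simp only [mul_assoc]
    rw [this, refl _ _ hmm, refl _ _ hnn, QuadraticMap.polar_sub_right, QuadraticMap.polar_smul_right,
      h0, smul_zero, zero_sub]
    congr 1
    module
  simpa [clInv_cl] using congrArg clInv hfin

theorem spinSwap_mem : spinSwap ∈ spinInt := by
  refine (mem_spinInt_iff _).2 ⟨Matrix.of fun j k =>
    (if j = k then 1 else 0) -
      (if k = ixX 0 ∨ k = ixY 0 then if j = ixX 0 ∨ j = ixY 0 then 1 else 0 else 0) -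
      (if k = ixA ∨ k = ixC then if j = ixA ∨ j = ixC then 1 else 0 else 0), ?_⟩
  ext j k
  rw [vecRep_apply, vecAct_spinSwap, polar_Q55_single, polar_Q55_single]
  rcases j with j | (j | j) | j <;> rcases k with k | (k | k) | k <;>
    simp [vecXY, vecAC, ixDual, Pi.single_apply] <;> split_ifs <;> simp_all

/-! ### The orbits of integral null vectors -/

theorem vecAct_spinSwap_ixC (v : V10) : vecAct spinSwap v ixC = -v ixA := by
  rw [vecAct_spinSwap, polar_Q55, polar_Q55]
  simp [vecAC, vecXY, ixDual]

theorem polar_radVec (q : Fin 4 ⊕ Fin 4 → ℝ) (v : V10) :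
    QuadraticMap.polar Q55 (radVec q) v = ∑ i, q i * v (Sum.inr (Sum.inl i)) := by
  rw [polar_Q55, sum_Ix, Fintype.sum_sum_type]
  simp [radVec, ixDual, add_comm]

theorem vecAct_unip_ixA (q : Fin 4 ⊕ Fin 4 → ℝ) (v : V10) : vecAct (unip q) v ixA =
    v ixA + (∑ i, q i * v (Sum.inr (Sum.inl i)) - v ixC * Q55 (radVec q)) := by
  rw [vecAct_unip, polar_radVec]
  simp [vecA, radVec]

theorem vecAct_unip_ixC (q : Fin 4 ⊕ Fin 4 → ℝ) (v : V10) : vecAct (unip q) v ixC = v ixC := by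
  rw [vecAct_unip]
  simp [vecA, radVec]

theorem vecAct_unip_inl (q : Fin 4 ⊕ Fin 4 → ℝ) (v : V10) (i : Fin 4 ⊕ Fin 4) :
    vecAct (unip q) v (Sum.inr (Sum.inl i)) = v (Sum.inr (Sum.inl i)) - v ixC * q i.swap := by
  rw [vecAct_unip]
  rcases i with i | i <;> simp [vecA, radVec]

theorem Q55_radVec_single (i : Fin 4 ⊕ Fin 4) (t : ℝ) : Q55 (radVec (Pi.single i t)) = 0 := by
  rw [Q55_apply]
  rcases i with i | i <;> simp [radVec]

/-- The vector lies on the `Spin(5,5,ℤ)`-orbit of a multiple of the isotropic basis vector. -/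
def IsOrbitMultiple (v : V10) : Prop := ∃ γ ∈ spinInt, ∃ r : ℝ, vecAct γ v = r • vecA

theorem IsOrbitMultiple.of_vecAct {γ : Spin55} (hγ : γ ∈ spinInt) {v : V10}
    (h : IsOrbitMultiple (vecAct γ v)) : IsOrbitMultiple v := by
  obtain ⟨δ, hδ, r, hr⟩ := h
  exact ⟨δ * γ, mul_mem hδ hγ, r, by rw [vecAct_mul, hr]⟩

theorem unip_single_mem (i : Fin 4 ⊕ Fin 4) (t : ℤ) : unip (Pi.single i (t : ℝ)) ∈ spinInt := by
  have : (Pi.single i (t : ℝ) : Fin 4 ⊕ Fin 4 → ℝ) = fun j => ((Pi.single i t : Fin 4 ⊕ Fin 4 → ℤ) j : ℝ) := by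
    funext j
    by_cases h : j = i
    · subst h; simp
    · simp [h]
  rw [this]
  exact unip_mem_spinInt _

/-- A Euclidean algorithm on the last coordinate `c`. If `c` divides all middle coordinates, a
unipotent element clears them, nullity forces `a = 0`, and the swap finishes. Otherwise some middle
coordinate is reduced to a remainder `0 < r < |c|`, then `a` is reduced modulo `r`, and the swap
moves it into the last place. -/
theorem isOrbitMultiple_of_ixC_ne_zero (n : ℕ) : ∀ w : Ix → ℤ, Q55 (fun j => (w j : ℝ)) = 0 →
    w ixC ≠ 0 → (w ixC).natAbs = n → IsOrbitMultiple fun j => (w j : ℝ) := by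
  induction n using Nat.strong_induction_on with
  | _ n ih =>
  intro w hQ hc hn
  by_cases hdvd : ∀ i, w ixC ∣ w (Sum.inr (Sum.inl i))
  · choose d hd using hdvd
    have hu := unip_mem_spinInt fun i => d i.swap
    refine .of_vecAct hu (.of_vecAct spinSwap_mem ⟨1, one_mem _, -w ixC, ?_⟩)
    set v' := vecAct (unip fun i => (d i.swap : ℝ)) fun j => (w j : ℝ) with hv'
    have hC : v' ixC = w ixC := vecAct_unip_ixC _ _
    have hX : ∀ i, v' (Sum.inr (Sum.inl i)) = 0 := fun i => by
      rw [hv', vecAct_unip_inl, Sum.swap_swap, hd]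
      push_cast
      ring
    have hA : v' ixA = 0 := by
      have h0 : Q55 v' = 0 := (Q55_vecAct _ _).trans hQ
      rw [Q55_apply] at h0
      simp only [hX, zero_mul, Finset.sum_const_zero, add_zero, hC] at h0
      exact (mul_eq_zero.1 h0).resolve_right (by exact_mod_cast hc)
    have hv : v' = (w ixC : ℝ) • (Pi.single ixC 1 : V10) := by
      funext j
      rcases j with j | j | j
      · simpa using hA
      · simpa using hX j
      · simpa using hC
    rw [vecAct_one, vecAct_spinSwap, hv, QuadraticMap.polar_smul_right, QuadraticMap.polar_smul_right,
      polar_Q55_single, polar_Q55_single]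
    simp [vecXY, vecAC, vecA, ixDual]
  · push Not at hdvd
    obtain ⟨i, hi⟩ := hdvd
    set m := w (Sum.inr (Sum.inl i)) with hm
    have hr0 : 0 < m % w ixC := lt_of_le_of_ne (Int.emod_nonneg _ hc)
      fun h => hi (Int.dvd_of_emod_eq_zero h.symm)
    have hr1 : m % w ixC < n := by rw [← hn]; exact Int.emod_lt _ hc
    have h1 := unip_single_mem i.swap (m / w ixC)
    obtain ⟨w1, hw1⟩ := exists_int_vecAct h1 w
    have hi1 : w1 (Sum.inr (Sum.inl i)) = m % w ixC := by
      have := vecAct_unip_inl (Pi.single i.swap ((m / w ixC : ℤ) : ℝ)) (fun j => (w j : ℝ)) i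
      rw [hw1, Pi.single_eq_same] at this
      have h2 := Int.emod_add_mul_ediv m (w ixC)
      have h3 : w1 (Sum.inr (Sum.inl i)) = w (Sum.inr (Sum.inl i)) - w ixC * (m / w ixC) := by
        beta_reduce at this
        exact_mod_cast this
      rw [h3]
      linarith
    set r := m % w ixC with hr
    -- The shift by one puts the new `a` into `[1, r]` and not `[0, r - 1]`: it must be nonzero to
    -- serve as the next last coordinate, and `r < |c|` still makes it smaller than before.
    set t : ℤ := -((w1 ixA - 1) / r) with ht
    have h2 := unip_single_mem i t
    obtain ⟨w2, hw2⟩ := exists_int_vecAct h2 w1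
    have ha2 : w2 ixA = (w1 ixA - 1) % r + 1 := by
      have := vecAct_unip_ixA (Pi.single i (t : ℝ)) (fun j => (w1 j : ℝ))
      rw [hw2, Q55_radVec_single, mul_zero, sub_zero, Finset.sum_eq_single i
        (fun j _ hj => by rw [Pi.single_eq_of_ne hj, zero_mul]) (by simp), Pi.single_eq_same,
        hi1] at this
      have h4 : w2 ixA = w1 ixA + t * r := by beta_reduce at this; exact_mod_cast this
      have h5 := Int.emod_add_mul_ediv (w1 ixA - 1) r
      rw [h4, ht]
      linarith
    obtain ⟨w3, hw3⟩ := exists_int_vecAct spinSwap_mem w2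
    have hc3 : w3 ixC = -w2 ixA := by
      have := vecAct_spinSwap_ixC fun j => (w2 j : ℝ)
      rw [hw3] at this
      beta_reduce at this
      exact_mod_cast this
    have hb1 := Int.emod_nonneg (w1 ixA - 1) hr0.ne'
    have hb2 := Int.emod_lt_of_pos (w1 ixA - 1) hr0
    have hQ3 : Q55 (fun j => (w3 j : ℝ)) = 0 := by
      rw [← hw3, Q55_vecAct, ← hw2, Q55_vecAct, ← hw1, Q55_vecAct, hQ]
    have := ih _ (by omega) w3 hQ3 (by omega) rfl
    rw [← hw3] at this
    have := this.of_vecAct spinSwap_mem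
    rw [← hw2] at this
    have := this.of_vecAct h2
    rw [← hw1] at this
    exact this.of_vecAct h1

/-- If the last coordinate vanishes, a nonzero `a` is swapped into its place; if `a` vanishes too, a
unipotent element first adds a nonzero middle coordinate to it. -/
theorem isOrbitMultiple_of_null (w : Ix → ℤ) (hQ : Q55 (fun j => (w j : ℝ)) = 0) (hw : w ≠ 0) :
    IsOrbitMultiple fun j => (w j : ℝ) := by
  have hA : ∀ w : Ix → ℤ, Q55 (fun j => (w j : ℝ)) = 0 → w ixA ≠ 0 →
      IsOrbitMultiple fun j => (w j : ℝ) := by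
    intro w hQ ha
    obtain ⟨w', hw'⟩ := exists_int_vecAct spinSwap_mem w
    refine .of_vecAct spinSwap_mem ?_
    rw [hw']
    have hc : w' ixC = -w ixA := by
      have := vecAct_spinSwap_ixC fun j => (w j : ℝ)
      rw [hw'] at this
      beta_reduce at this
      exact_mod_cast this
    exact isOrbitMultiple_of_ixC_ne_zero _ w' (by rw [← hw', Q55_vecAct, hQ]) (by omega) rfl
  by_cases hc : w ixC = 0
  · by_cases ha : w ixA = 0
    · have : ∃ i, w (Sum.inr (Sum.inl i)) ≠ 0 := by
        by_contra h
        push Not at h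
        exact hw (by funext j; rcases j with j | j | j; exacts [ha, h j, hc])
      obtain ⟨i, hi⟩ := this
      have h1 := unip_single_mem i 1
      obtain ⟨w', hw'⟩ := exists_int_vecAct h1 w
      refine .of_vecAct h1 ?_
      rw [hw']
      refine hA w' (by rw [← hw', Q55_vecAct, hQ]) ?_
      have := vecAct_unip_ixA (Pi.single i ((1 : ℤ) : ℝ)) (fun j => (w j : ℝ))
      rw [hw', Q55_radVec_single, mul_zero, sub_zero, Finset.sum_eq_single i
        (fun j _ hj => by rw [Pi.single_eq_of_ne hj, zero_mul]) (by simp), Pi.single_eq_same, ha] at this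
      have h4 : w' ixA = w (Sum.inr (Sum.inl i)) := by
        have h5 : ((w' ixA : ℤ) : ℝ) = ((w (Sum.inr (Sum.inl i)) : ℤ) : ℝ) := by
          beta_reduce at this; rw [this]; push_cast; ring
        exact_mod_cast h5
      rwa [h4]
    · exact hA w hQ ha
  · exact isOrbitMultiple_of_ixC_ne_zero _ w hQ hc rfl

/-! ### The Eisenstein series as a sum over null vectors -/

/-- Bottom rows are, up to the involution of coordinates, the vectors in the orbit of the isotropic
basis vector. This converts the orbit statement for columns into one for rows. -/
theorem vecRep_ixC (g : Spin55) (j : Ix) : vecRep g ixC j = vecAct g⁻¹ vecA (ixDual j) := by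
  have := vecRep_inv_apply g⁻¹ ixC j
  rw [inv_inv, vecRep_apply] at this
  exact this

theorem Q55_comp_ixDual (v : V10) : Q55 (fun j => v (ixDual j)) = Q55 v := by
  rw [Q55_apply, Q55_apply]
  simp only [ixDual, Sum.swap_inl, Sum.swap_inr]
  rw [mul_comm]
  congr 1
  exact Finset.sum_congr rfl fun i _ => mul_comm _ _

theorem latQ_eq (l : IntVec) : (latQ l : ℝ) = Q55 (fun j => (latEquiv l j : ℝ)) := by
  rw [Q55_apply, latQ]
  push_cast
  rfl

theorem vecRep_mul_ixC (g k : Spin55) (j : Ix) :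
    vecRep (g * k) ixC j = ∑ i, vecRep g ixC i * vecRep k i j := by
  rw [map_mul, Matrix.mul_apply]

theorem vecRep_parabolic_mul {p : Spin55} (hp : p ∈ parabolic) (k : Spin55) (j : Ix) :
    vecRep (p * k) ixC j = vecRep p ixC ixC * vecRep k ixC j := by
  rw [vecRep_mul_ixC, Finset.sum_eq_single ixC (fun i _ hi => by rw [hp i hi, zero_mul]) (by simp)]

theorem mul_inv_mem_parabolic {g k : Spin55} {r : ℝ}
    (h : ∀ j, vecRep g ixC j = r * vecRep k ixC j) : g * k⁻¹ ∈ parabolic := by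
  intro j hj
  have h1 := vecRep_mul_ixC k k⁻¹ j
  rw [mul_inv_cancel, map_one, Matrix.one_apply_ne hj.symm] at h1
  simp only [vecRep_mul_ixC, h, mul_assoc, ← Finset.mul_sum, ← h1, mul_zero]

theorem exists_row_eq {l : IntVec} (hl : l ≠ 0) (hQ : latQ l = 0) :
    ∃ γ ∈ spinInt, ∃ r : ℝ, ∀ j, (latEquiv l j : ℝ) = r * vecRep γ ixC j := by
  have hw : (fun j => latEquiv l (ixDual j)) ≠ 0 := fun h => hl <| latEquiv.injective <| by
    funext j
    have := congrFun h (ixDual j)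
    rw [ixDual_ixDual] at this
    rw [this]
    rcases j with j | (j | j) | j <;> rfl
  obtain ⟨γ, hγ, r, hr⟩ := isOrbitMultiple_of_null (fun j => latEquiv l (ixDual j)) (by
    rw [Q55_comp_ixDual fun j => (latEquiv l j : ℝ), ← latQ_eq, hQ, Int.cast_zero]) hw
  refine ⟨γ, hγ, r, fun j => ?_⟩
  have h1 := congrArg (vecAct γ⁻¹) hr
  rw [vecAct_inv_vecAct, map_smul] at h1
  have h2 := congrFun h1 (ixDual j)
  rw [ixDual_ixDual] at h2
  rw [h2, vecRep_ixC]
  rfl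

/-- The bottom row of an integral element. -/
noncomputable def bottomVec (γ : spinInt) : IntVec :=
  latEquiv.symm (((mem_spinInt_iff γ.1).1 γ.2).choose ixC)

theorem bottomVec_apply (γ : spinInt) (j : Ix) :
    (latEquiv (bottomVec γ) j : ℝ) = vecRep γ ixC j := by
  rw [bottomVec, Equiv.apply_symm_apply]
  exact (congrFun (congrFun ((mem_spinInt_iff γ.1).1 γ.2).choose_spec ixC) j).symm

theorem exists_vecRep_ixC_ne_zero (g : Spin55) : ∃ j, vecRep g ixC j ≠ 0 := by
  by_contra h
  push Not at h
  have h1 := vecRep_mul_ixC g g⁻¹ ixC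
  rw [mul_inv_cancel, map_one, Matrix.one_apply_eq] at h1
  simp [h] at h1

theorem latEquiv_zero : latEquiv 0 = 0 := by
  funext j
  rcases j with j | (j | j) | j <;> rfl

theorem latEquiv_smul (k : ℤ) (l : IntVec) (j : Ix) : latEquiv (k • l) j = k * latEquiv l j := by
  rcases j with j | (j | j) | j <;> rfl

/-- The multiples of the bottom rows of coset representatives. -/
noncomputable def cosetVec (p : {k : ℤ // k ≠ 0} × EisCosets) : {l : IntVec // l ≠ 0} :=
  ⟨p.1.1 • bottomVec p.2.out, fun h => by
    obtain ⟨j, hj⟩ := exists_vecRep_ixC_ne_zero (p.2.out : spinInt).1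
    have := latEquiv_smul p.1.1 (bottomVec p.2.out) j
    rw [h, latEquiv_zero] at this
    have h1 := (mul_eq_zero.1 this.symm).resolve_left p.1.2
    rw [← bottomVec_apply, h1] at hj
    simp at hj⟩

theorem cosetVec_apply (p : {k : ℤ // k ≠ 0} × EisCosets) (j : Ix) :
    (latEquiv (cosetVec p).1 j : ℝ) = p.1.1 * vecRep (p.2.out : spinInt).1 ixC j := by
  rw [← bottomVec_apply]
  exact_mod_cast latEquiv_smul p.1.1 (bottomVec p.2.out) j

/-- Proportional bottom rows belong to the same coset of the parabolic, and once the representative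
is fixed the integer factor is determined, sign included. -/
theorem cosetVec_injective : Function.Injective cosetVec := by
  intro p p' h
  have h1 : ∀ j, (p.1.1 : ℝ) * vecRep (p.2.out : spinInt).1 ixC j =
      p'.1.1 * vecRep (p'.2.out : spinInt).1 ixC j := fun j => by
    rw [← cosetVec_apply, ← cosetVec_apply, h]
  have hk : (p.1.1 : ℝ) ≠ 0 := by exact_mod_cast p.1.2
  have h2 : p.2 = p'.2 := by
    rw [← Quotient.out_eq p.2, ← Quotient.out_eq p'.2]
    refine (Quotient.sound ?_).symm
    refine QuotientGroup.rightRel_apply.2 ?_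
    refine Subgroup.mem_subgroupOf.2 ?_
    have h3 := mul_inv_mem_parabolic (g := (p.2.out : spinInt).1) (k := (p'.2.out : spinInt).1)
      (r := p'.1.1 / p.1.1) fun j => by
        rw [div_mul_eq_mul_div, ← h1]
        field_simp
    exact h3
  refine Prod.ext (Subtype.ext ?_) h2
  obtain ⟨j, hj⟩ := exists_vecRep_ixC_ne_zero (p.2.out : spinInt).1
  have h3 := h1 j
  rw [← h2] at h3
  exact_mod_cast mul_right_cancel₀ hj h3

theorem range_cosetVec : Set.range cosetVec = {l | latQ l.1 = 0} := by
  ext l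
  constructor
  · rintro ⟨p, rfl⟩
    have h1 : (latQ (cosetVec p).1 : ℝ) = 0 := by
      have h2 : (fun j => (latEquiv (cosetVec p).1 j : ℝ)) =
          fun j => ((p.1.1 : ℝ) • vecAct ((p.2.out : spinInt).1)⁻¹ vecA) (ixDual j) := by
        funext j
        rw [cosetVec_apply, vecRep_ixC]; rfl
      rw [latQ_eq, h2, Q55_comp_ixDual, QuadraticMap.map_smul, Q55_vecAct]
      simp [Q55_apply, vecA]
    exact_mod_cast h1
  · intro hQ
    obtain ⟨γ, hγ, r, hr⟩ := exists_row_eq l.2 hQ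
    set c : EisCosets := Quotient.mk'' ⟨γ, hγ⟩ with hc
    have hrel : γ * ((c.out : spinInt).1)⁻¹ ∈ parabolic := by
      have := Quotient.exact (Quotient.out_eq c)
      exact Subgroup.mem_subgroupOf.1 (QuotientGroup.rightRel_apply.1 this)
    have h1 : ∀ j, (latEquiv l.1 j : ℝ) =
        r * vecRep (γ * ((c.out : spinInt).1)⁻¹) ixC ixC * vecRep (c.out : spinInt).1 ixC j := by
      intro j
      rw [hr, mul_assoc, ← vecRep_parabolic_mul hrel, inv_mul_cancel_right]
    set t := r * vecRep (γ * ((c.out : spinInt).1)⁻¹) ixC ixC with ht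
    -- The proportionality factor `t` is a priori real. It is an integer because the
    -- representative's row is primitive: paired with the last column of the integral inverse it
    -- gives 1.
    obtain ⟨A, hA⟩ := (mem_spinInt_iff _).1 (inv_mem (c.out : spinInt).2)
    have h2 : t = ((∑ j, latEquiv l.1 j * A j ixC : ℤ) : ℝ) := by
      have h3 := vecRep_mul_ixC (c.out : spinInt).1 ((c.out : spinInt).1)⁻¹ ixC
      rw [mul_inv_cancel, map_one, Matrix.one_apply_eq, hA] at h3
      push_cast
      simp only [h1, mul_assoc, ← Finset.mul_sum]
      simp only [Matrix.map_apply] at h3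
      rw [← h3, mul_one]
    set k : ℤ := ∑ j, latEquiv l.1 j * A j ixC with hk
    have hk0 : k ≠ 0 := by
      intro h0
      refine l.2 (latEquiv.injective ?_)
      funext j
      have := h1 j
      rw [h2, h0, Int.cast_zero, zero_mul] at this
      rw [latEquiv_zero]
      exact_mod_cast this
    refine ⟨(⟨k, hk0⟩, c), Subtype.ext (latEquiv.injective ?_)⟩
    funext j
    have := cosetVec_apply (⟨k, hk0⟩, c) j
    rw [← h2] at this
    have h4 := h1 j
    rw [← this] at h4
    exact_mod_cast h4.symm

section

variable {y : ℝ} {e B : Matrix (Fin 4) (Fin 4) ℝ} {h : Spin55}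

theorem sqNorm_vecMul_unip_levi (hy : 0 < y) (q : Fin 4 ⊕ Fin 4 → ℝ) (v : Ix → ℝ) :
    ∑ j, (v ᵥ* (vecRep (unip q) * levi (√y)⁻¹ (so44 e B))) j ^ 2 =
      hamForm y e B q (v ixA) (v ixC) (fun i => v (ixX i)) (fun i => v (ixY i)) := by
  have hs : √y ^ 2 = y := Real.sq_sqrt hy.le
  have hu : v ᵥ* vecRep (unip q) = mkIx (v ixA)
      (v ixC - radPairing q (v ixA) (fun i => v (ixX i)) (fun i => v (ixY i)))
      (shiftX q (v ixA) fun i => v (ixX i)) (shiftY q (v ixA) fun i => v (ixY i)) := by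
    rw [vecRep_unip]
    funext j
    rw [Matrix.vecMul, dotProduct, sum_Ix]
    rcases j with j | (j | j) | j
    · simp [mkIx]
    · simp [mkIx, shiftX]; ring
    · simp [mkIx, shiftY]; ring
    · simp [mkIx, radPairing, Fin.sum_univ_four]; ring
  have hl : ∀ (a c : ℝ) (X Y : Fin 4 → ℝ), mkIx a c X Y ᵥ* levi (√y)⁻¹ (so44 e B) =
      mkIx (a * (√y)⁻¹) (c * √y) (X ᵥ* e) ((X ᵥ* B + Y) ᵥ* (eᵀ)⁻¹) := by
    intro a c X Y
    have h1 : Sum.elim X Y ᵥ* so44 e B = Sum.elim (X ᵥ* e) ((X ᵥ* B + Y) ᵥ* (eᵀ)⁻¹) := by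
      rw [so44, ← Matrix.vecMul_vecMul, Matrix.vecMul_fromBlocks, Matrix.vecMul_fromBlocks]
      simp
    rw [mkIx, levi, Matrix.vecMul_fromBlocks]
    funext j
    rcases j with j | j | j
    · simp [mkIx, Matrix.vecMul, dotProduct]
    · have h2 := congrFun h1 j
      simp only [Sum.elim_comp_inr, Matrix.vecMul_zero, Sum.elim_inr, Matrix.vecMul_fromBlocks,
        Sum.elim_inl, mkIx, add_zero, zero_add, Sum.elim_comp_inl, h2]
    · simp [mkIx, Matrix.vecMul, dotProduct]
  rw [← Matrix.vecMul_vecMul, hu, hl, sum_Ix, hamForm, narainForm]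
  simp only [mkIx, Sum.elim_inl, Sum.elim_inr, mul_pow, inv_pow, hs, sqNorm]
  field_simp
  ring

theorem bottomNorm_sq (hy : 0 < y) (hh : vecRep h = levi (√y)⁻¹ (so44 e B))
    (q : Fin 4 ⊕ Fin 4 → ℝ) (γ : spinInt) :
    bottomNorm (vecRep (γ * (unip q * h))) ^ 2 = latHam y e B q (bottomVec γ) := by
  rw [bottomNorm, Real.sq_sqrt (Finset.sum_nonneg fun _ _ => sq_nonneg _)]
  have h1 := sqNorm_vecMul_unip_levi (e := e) (B := B) hy q (fun j => (latEquiv (bottomVec γ) j : ℝ))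
  rw [← hh] at h1
  rw [map_mul, map_mul]
  refine Eq.trans ?_ h1
  refine Finset.sum_congr rfl fun j _ => ?_
  simp only [bottomVec_apply]
  rfl

end

theorem one_div_sq_cpow {x : ℝ} (hx : 0 < x) (s : ℂ) :
    ((x⁻¹ : ℝ) : ℂ) ^ (2 * s) = (1 / ((x ^ 2 : ℝ) : ℂ)) ^ s := by
  have h0 : ((x⁻¹ : ℝ) : ℂ) ≠ 0 := by exact_mod_cast (inv_pos.2 hx).ne'
  have h1 : (1 / ((x ^ 2 : ℝ) : ℂ)) = (((x ^ 2)⁻¹ : ℝ) : ℂ) := by push_cast; rw [one_div]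
  have h2 : (((x ^ 2)⁻¹ : ℝ) : ℂ) ≠ 0 := by exact_mod_cast (inv_pos.2 (pow_pos hx 2)).ne'
  rw [h1, Complex.cpow_def_of_ne_zero h0, Complex.cpow_def_of_ne_zero h2,
    ← Complex.ofReal_log (inv_pos.2 hx).le, ← Complex.ofReal_log (by positivity), Real.log_inv,
    Real.log_inv, Real.log_pow]
  congr 1
  push_cast
  ring

theorem hasSum_int_sq_cpow {s : ℂ} (hs : 1 / 2 < s.re) :
    HasSum (fun k : {k : ℤ // k ≠ 0} => (1 / (((k.1 : ℝ) ^ 2 : ℝ) : ℂ)) ^ s) (2 * riemannZeta (2 * s)) := by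
  have h2s : 1 < (2 * s).re := by simp; linarith
  have hs0 : s ≠ 0 := by rintro rfl; simp at hs; linarith
  have hnat : HasSum (fun n : ℕ => (1 / (((n : ℝ) ^ 2 : ℝ) : ℂ)) ^ s) (riemannZeta (2 * s)) := by
    have h1 : (fun n : ℕ => (1 / (((n : ℝ) ^ 2 : ℝ) : ℂ)) ^ s) = fun n : ℕ => 1 / (n : ℂ) ^ (2 * s) := by
      funext n
      rcases n.eq_zero_or_pos with rfl | hn
      · simp [hs0]
      · have hn' : (0 : ℝ) < n := by exact_mod_cast hn
        rw [← one_div_sq_cpow hn', Complex.ofReal_inv, Complex.inv_cpow, one_div]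
        · simp
        · simp only [Complex.ofReal_natCast, Complex.natCast_arg]; exact Real.pi_pos.ne
    rw [h1, zeta_eq_tsum_one_div_nat_cpow h2s]
    exact (Complex.summable_one_div_nat_cpow.2 h2s).hasSum
  have hint := HasSum.of_nat_of_neg (f := fun k : ℤ => (1 / (((k : ℝ) ^ 2 : ℝ) : ℂ)) ^ s)
    (by simpa using hnat) (by simpa using hnat)
  have h0 : (1 / ((((0 : ℤ) : ℝ) ^ 2 : ℝ) : ℂ)) ^ s = 0 := by simp [hs0]
  rw [h0, sub_zero, ← two_mul] at hint
  refine (hasSum_subtype_iff_of_support_subset (s := {k : ℤ | k ≠ 0}) ?_).2 hint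
  intro k hk hk0
  exact hk (by simp only [hk0]; exact h0)

section

variable {y : ℝ} {e B : Matrix (Fin 4) (Fin 4) ℝ} {h : Spin55}

theorem latHam_smul (q : Fin 4 ⊕ Fin 4 → ℝ) (k : ℤ) (l : IntVec) :
    latHam y e B q (k • l) = (k : ℝ) ^ 2 * latHam y e B q l := by
  have hx : ∀ x : Fin 4 → ℤ, toReal (k • x) = (k : ℝ) • toReal x := fun x => by
    funext i; simp [toReal]
  have h1 : (((k • l).1.1 : ℤ) : ℝ) = k * (l.1.1 : ℝ) := by simp
  have h2 : (((k • l).1.2 : ℤ) : ℝ) = k * (l.1.2 : ℝ) := by simp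
  have h3 : toReal (k • l).2.1 = (k : ℝ) • toReal l.2.1 := hx _
  have h4 : toReal (k • l).2.2 = (k : ℝ) • toReal l.2.2 := hx _
  simp only [latHam, h1, h2, h3, h4, hamForm, shiftX_smul, shiftY_smul, narainForm_smul, radPairing_smul]
  ring

theorem latHam_bottomVec_pos (hy : 0 < y) (he : e.det ≠ 0) (q : Fin 4 ⊕ Fin 4 → ℝ) (c : EisCosets) :
    0 < latHam y e B q (bottomVec c.out) := by
  refine latHam_pos B q hy he ?_
  have := (cosetVec (⟨1, one_ne_zero⟩, c)).2
  simpa [cosetVec] using this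

theorem eisTerm_eq (hy : 0 < y) (he : e.det ≠ 0) (hh : vecRep h = levi (√y)⁻¹ (so44 e B))
    (q : Fin 4 ⊕ Fin 4 → ℝ) (s : ℂ) (c : EisCosets) :
    eisTerm s (unip q * h) c = (1 / (latHam y e B q (bottomVec c.out) : ℂ)) ^ s := by
  have h1 := bottomNorm_sq hy hh q c.out
  have h2 := latHam_bottomVec_pos (B := B) hy he q c
  rw [← h1] at h2
  have h3 : 0 < bottomNorm (vecRep ((c.out : spinInt) * (unip q * h))) :=
    lt_of_le_of_ne (Real.sqrt_nonneg _) fun h0 => by rw [← h0] at h2; simp at h2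
  rw [eisTerm, height, one_div_sq_cpow h3, h1]

theorem cosetVec_term (hy : 0 < y) (he : e.det ≠ 0) (hh : vecRep h = levi (√y)⁻¹ (so44 e B))
    (q : Fin 4 ⊕ Fin 4 → ℝ) (s : ℂ) (p : {k : ℤ // k ≠ 0} × EisCosets) :
    (if latQ (cosetVec p).1 = 0 then (1 / (latHam y e B q (cosetVec p).1 : ℂ)) ^ s else 0) =
      (1 / (((p.1.1 : ℝ) ^ 2 : ℝ) : ℂ)) ^ s * eisTerm s (unip q * h) p.2 := by
  have h0 : latQ (cosetVec p).1 = 0 := by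
    have : cosetVec p ∈ Set.range cosetVec := ⟨p, rfl⟩
    rwa [range_cosetVec] at this
  have h1 := latHam_bottomVec_pos (B := B) hy he q p.2
  rw [if_pos h0, eisTerm_eq hy he hh, cosetVec, latHam_smul]
  have : (1 / (((p.1.1 : ℝ) ^ 2 * latHam y e B q (bottomVec p.2.out) : ℝ) : ℂ)) =
      ((1 / (p.1.1 : ℝ) ^ 2 : ℝ) : ℂ) * ((1 / latHam y e B q (bottomVec p.2.out) : ℝ) : ℂ) := by
    push_cast
    rw [one_div_mul_one_div]
  rw [this, Complex.mul_cpow_ofReal_nonneg (by positivity) (by positivity)]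
  push_cast
  rfl

/-- Writing the nonzero null vectors uniquely as multiples of coset rows factors their zeta function
into the sum of `|k|^{-2s}` over nonzero integers and the Eisenstein series. Convergence of the
series is read off from the multiples with `k = 1`. -/
theorem summable_eisTerm (hy : 0 < y) (he : e.det ≠ 0) (hh : vecRep h = levi (√y)⁻¹ (so44 e B))
    (q : Fin 4 ⊕ Fin 4 → ℝ) {s : ℂ} (hs : 5 < s.re) :
    Summable (eisTerm s (unip q * h)) ∧
    2 * riemannZeta (2 * s) * ∑' c, eisTerm s (unip q * h) c = nullZeta y e B q s := by
  set f : {l : IntVec // l ≠ 0} → ℂ := fun l =>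
    if latQ l = 0 then (1 / (latHam y e B q l : ℂ)) ^ s else 0 with hf
  have hfs : Summable f := by
    refine .of_norm_bounded (summable_latHam_rpow B q hy he hs) fun l => ?_
    have hl := latHam_pos B q hy he l.2
    rw [hf]
    dsimp only
    split_ifs
    · have : (1 / (latHam y e B q l : ℂ)) = ((latHam y e B q l)⁻¹ : ℝ) := by push_cast; rw [one_div]
      rw [this, Complex.norm_cpow_eq_rpow_re_of_pos (by positivity), Real.inv_rpow hl.le,
        Real.rpow_neg hl.le]
    · rw [norm_zero]; positivity
  have hsupp : Function.support f ⊆ Set.range cosetVec := by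
    rw [range_cosetVec]
    intro l hl
    by_contra h0
    exact hl (if_neg h0)
  have h1 := (cosetVec_injective.summable_iff fun l hl => by
    by_contra h0; exact hl (hsupp h0)).2 hfs
  have h2 := cosetVec_injective.tsum_eq hsupp
  have hcomp : (f ∘ cosetVec) = fun p => (1 / (((p.1.1 : ℝ) ^ 2 : ℝ) : ℂ)) ^ s *
      eisTerm s (unip q * h) p.2 := funext fun p => cosetVec_term hy he hh q s p
  have hc2 : ∀ p, f (cosetVec p) = (1 / (((p.1.1 : ℝ) ^ 2 : ℝ) : ℂ)) ^ s *
      eisTerm s (unip q * h) p.2 := fun p => cosetVec_term hy he hh q s p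
  rw [hcomp] at h1
  have hsum : Summable (eisTerm s (unip q * h)) := by
    have := h1.comp_injective (i := fun c => ((⟨1, one_ne_zero⟩ : {k : ℤ // k ≠ 0}), c))
      fun c c' hcc => (Prod.ext_iff.1 hcc).2
    refine this.congr fun c => ?_
    simp
  refine ⟨hsum, ?_⟩
  have hz := hasSum_int_sq_cpow (s := s) (by linarith)
  rw [← hz.tsum_eq, nullZeta]
  simp only [hc2] at h2
  refine Eq.trans ?_ h2
  exact hz.summable.tsum_mul_tsum hsum h1

end

/-! ### Meromorphic continuation of the Eisenstein series -/

theorem epsteinMin_inv_le {τ : ℍ} (hτ : τ ∈ cuspStrip) : (epsteinMin τ)⁻¹ ≤ 8 * τ.im := by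
  obtain ⟨⟨h1, h2⟩, h3⟩ := hτ
  have h3' : 1 / 2 < τ.im := h3
  have hv := τ.im_pos
  rw [epsteinMin, inv_div, div_le_iff₀ hv]
  nlinarith

section

variable {y : ℝ} {e B : Matrix (Fin 4) (Fin 4) ℝ}

/-- The integrand over the cuspidal strip. -/
noncomputable def cuspIntegrand (y : ℝ) (e B : Matrix (Fin 4) (Fin 4) ℝ)
    (q : Fin 4 ⊕ Fin 4 → ℝ) (w : ℂ) (τ : ℍ) : ℂ :=
  eisNum w τ * (heckeTheta y e B q τ / cuspWeight τ)

/-- The numerator of the Eisenstein series. -/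
noncomputable def eisSpinNum (y : ℝ) (e B : Matrix (Fin 4) (Fin 4) ℝ)
    (q : Fin 4 ⊕ Fin 4 → ℝ) (s : ℂ) : ℂ :=
  2 * s * (2 * s - 1) * ∫ τ in cuspStrip, cuspIntegrand y e B q (s - 3 / 2) τ

/-- The denominator of the Eisenstein series. -/
noncomputable def eisSpinDen (s : ℂ) : ℂ :=
  xiEntire (2 * s) * heckeFactor s * eisDen (s - 3 / 2)

theorem differentiable_eisSpinDen : Differentiable ℂ eisSpinDen :=
  ((differentiable_xiEntire.comp (differentiable_id.const_mul 2)).mul differentiable_heckeFactor).mul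
    (differentiable_eisDen.comp (differentiable_id.sub_const _))

theorem eisSpinDen_ne_zero {s : ℂ} (hs : 5 < s.re) : eisSpinDen s ≠ 0 := by
  have h1 : 1 < (2 * s).re := by simp; linarith
  have h2 : 1 < (s - 3 / 2).re := by
    have : (3 / 2 : ℂ).re = 3 / 2 := by norm_num
    rw [Complex.sub_re, this]; linarith
  exact mul_ne_zero (mul_ne_zero (xiEntire_ne_zero_of_one_lt_re h1) (heckeFactor_ne_zero hs))
    (eisDen_ne_zero_of_one_lt_re h2)

theorem measurable_cuspIntegrand (hy : 0 < y) (he : e.det ≠ 0) (w : ℂ) :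
    Measurable fun p : (Fin 4 ⊕ Fin 4 → ℝ) × ℍ => cuspIntegrand y e B p.1 w p.2 := by
  have h1 := measurable_heckeTheta B hy he
  have h2 := (measurable_eisNum w).comp
    (measurable_snd : Measurable fun p : (Fin 4 ⊕ Fin 4 → ℝ) × ℍ => p.2)
  have h3 := Complex.measurable_ofReal.comp (measurable_cuspWeight.comp
    (measurable_snd : Measurable fun p : (Fin 4 ⊕ Fin 4 → ℝ) × ℍ => p.2))
  exact h2.mul (h1.div h3)

theorem norm_heckeTheta_div_le (q : Fin 4 ⊕ Fin 4 → ℝ) (τ : ℍ) :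
    ‖heckeTheta y e B q τ / cuspWeight τ‖ ≤ ‖heckeTheta y e B q τ‖ := by
  rw [norm_div, Complex.norm_real, Real.norm_of_nonneg (cuspWeight_pos τ).le]
  exact div_le_self (norm_nonneg _) (one_le_cuspWeight τ)

/-- The `SL(2)` numerator grows at most polynomially up the cusp, the Hecke-modified theta function
decays exponentially, and the weight is at least one. Uniformity in `q` and `w` gives both
holomorphy in `w` and boundedness over the cube. -/
theorem exists_cuspIntegrand_bound (hy : 0 < y) (he : e.det ≠ 0) {K : Set (Fin 4 ⊕ Fin 4 → ℝ)}
    (hK : IsCompact K) (r : ℝ) : ∃ G : ℍ → ℝ, IntegrableOn G cuspStrip ∧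
      ∀ q ∈ K, ∀ w, ‖w‖ ≤ r → ∀ τ ∈ cuspStrip, ‖cuspIntegrand y e B q w τ‖ ≤ G τ := by
  obtain ⟨k, C, hC, h1⟩ := exists_norm_eisNum_le r
  obtain ⟨C', c, hC', hc, h2⟩ := exists_norm_heckeTheta_le B hy he hK
  have i1 := integrableOn_cuspStrip_exp hc 3
  have i2 : IntegrableOn (fun τ : ℍ => 8 ^ k * (τ.im ^ (k + 3) * Real.exp (-c * τ.im))) cuspStrip :=
    (integrableOn_cuspStrip_exp hc (k + 3)).const_mul _
  have i3 : IntegrableOn (fun τ : ℍ => τ.im ^ 3 * Real.exp (-c * τ.im) +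
      8 ^ k * (τ.im ^ (k + 3) * Real.exp (-c * τ.im))) cuspStrip := i1.add i2
  refine ⟨fun τ => C * C' * (τ.im ^ 3 * Real.exp (-c * τ.im) +
    8 ^ k * (τ.im ^ (k + 3) * Real.exp (-c * τ.im))), i3.const_mul _, fun q hq w hw τ hτ => ?_⟩
  have hv := τ.im_pos
  have h3 := pow_le_pow_left₀ (inv_nonneg.2 (epsteinMin_pos τ).le) (epsteinMin_inv_le hτ) k
  calc ‖cuspIntegrand y e B q w τ‖ = ‖eisNum w τ‖ * ‖heckeTheta y e B q τ / cuspWeight τ‖ :=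
        norm_mul _ _
    _ ≤ (C * (1 + (8 * τ.im) ^ k)) * (C' * (τ.im ^ 3 * Real.exp (-c * τ.im))) := by
        refine mul_le_mul ((h1 τ w hw).trans ?_) ((norm_heckeTheta_div_le q τ).trans (h2 q hq τ hτ))
          (norm_nonneg _) (by positivity)
        exact mul_le_mul_of_nonneg_left (by linarith) hC
    _ = _ := by rw [mul_pow]; ring

theorem differentiable_eisSpinNum (hy : 0 < y) (he : e.det ≠ 0) (q : Fin 4 ⊕ Fin 4 → ℝ) :
    Differentiable ℂ (eisSpinNum y e B q) := by
  have h1 : Differentiable ℂ fun w => ∫ τ in cuspStrip, cuspIntegrand y e B q w τ := by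
    refine differentiable_integral_of_locally_bounded
      (fun w => ((measurable_cuspIntegrand hy he w).comp measurable_prodMk_left).aestronglyMeasurable)
      (.of_forall fun τ => (differentiable_eisNum τ).mul_const _) fun r => ?_
    obtain ⟨G, hG, hb⟩ := exists_cuspIntegrand_bound (B := B) hy he (isCompact_singleton (x := q)) r
    refine ⟨G, hG, ?_⟩
    filter_upwards [ae_restrict_mem measurableSet_cuspStrip] with τ hτ w hw
    exact hb q rfl w hw τ hτ
  have h2 := h1.comp ((differentiable_id (𝕜 := ℂ)).sub_const (3 / 2 : ℂ))
  unfold eisSpinNum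
  exact (((differentiable_id.const_mul 2).mul ((differentiable_id.const_mul 2).sub_const 1))).mul h2

/-- The invariant function is written as a sum of translates of its weighted restriction to
`cuspStrip`, and unfolding turns the power of the height into twice the Eisenstein series. The
right-hand integral converges for every `w`, the left one need not. -/
theorem integral_heckeTheta_eq_cusp (hy : 0 < y) (hB : Bᵀ = -B) (he : e.det ≠ 0)
    (q : Fin 4 ⊕ Fin 4 → ℝ) {w : ℂ} (hw : 1 < w.re) :
    ∫ τ in strip, ((τ.im : ℝ) : ℂ) ^ w * heckeTheta y e B q τ =
      2 / eisDen w * ∫ τ in cuspStrip, cuspIntegrand y e B q w τ := by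
  set F : ℍ → ℂ := cuspStrip.indicator fun τ => heckeTheta y e B q τ / cuspWeight τ with hF
  have hmq : Measurable fun τ => heckeTheta y e B q τ / (cuspWeight τ : ℂ) :=
    ((measurable_heckeTheta B hy he).comp measurable_prodMk_left).div
      (Complex.measurable_ofReal.comp measurable_cuspWeight)
  have hFm : Measurable F := hmq.indicator measurableSet_cuspStrip
  have hsum : ∀ τ, ∑' γ : SL(2, ℤ), F (γ • τ) = heckeTheta y e B q τ :=
    tsum_cuspStrip_indicator_div (heckeTheta_modular q hy hB he)
  obtain ⟨C', c, hC', hc, h2⟩ := exists_norm_heckeTheta_le B hy he (isCompact_singleton (x := q))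
  have hint : Integrable fun τ => epsteinMin τ ^ (-w.re) * ‖F τ‖ := by
    have hform : (fun τ => epsteinMin τ ^ (-w.re) * ‖F τ‖) = cuspStrip.indicator fun τ =>
        epsteinMin τ ^ (-w.re) * ‖heckeTheta y e B q τ / cuspWeight τ‖ := by
      funext τ
      rw [hF]
      by_cases h : τ ∈ cuspStrip
      · rw [Set.indicator_of_mem h, Set.indicator_of_mem h]
      · rw [Set.indicator_of_notMem h, Set.indicator_of_notMem h, norm_zero, mul_zero]
    rw [hform, integrable_indicator_iff measurableSet_cuspStrip]
    refine Integrable.mono' ((integrableOn_cuspStrip_exp hc (⌈w.re⌉₊ + 3)).const_mul (8 ^ ⌈w.re⌉₊ * C'))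
      ?_ ?_
    · refine Measurable.aestronglyMeasurable (Measurable.mul ?_ hmq.norm)
      have h3 := UpperHalfPlane.continuous_re.measurable
      have h4 := UpperHalfPlane.continuous_im.measurable
      unfold epsteinMin
      fun_prop
    · filter_upwards [ae_restrict_mem measurableSet_cuspStrip] with τ hτ
      have hv := τ.im_pos
      have hm := epsteinMin_pos τ
      have h12 : 1 / 2 < τ.im := hτ.2
      rw [Real.norm_of_nonneg (by positivity)]
      calc epsteinMin τ ^ (-w.re) * ‖heckeTheta y e B q τ / cuspWeight τ‖ ≤
          (8 * τ.im) ^ ⌈w.re⌉₊ * (C' * (τ.im ^ 3 * Real.exp (-c * τ.im))) := by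
            refine mul_le_mul ?_ ((norm_heckeTheta_div_le q τ).trans (h2 q rfl τ hτ))
              (norm_nonneg _) (by positivity)
            rw [Real.rpow_neg hm.le, ← Real.inv_rpow hm.le, ← Real.rpow_natCast]
            exact (Real.rpow_le_rpow (inv_nonneg.2 hm.le) (epsteinMin_inv_le hτ) (by linarith)).trans
              (Real.rpow_le_rpow_of_exponent_le (by linarith) (Nat.le_ceil _))
        _ = _ := by rw [mul_pow]; ring
  have h := integral_strip_tsum_smul hFm hw hint
  simp only [hsum] at h
  rw [h, ← integral_const_mul, ← integral_indicator measurableSet_cuspStrip]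
  refine integral_congr_ae (.of_forall fun τ => ?_)
  dsimp only
  rw [hF]
  by_cases hτ : τ ∈ cuspStrip
  · rw [Set.indicator_of_mem hτ, Set.indicator_of_mem hτ, cuspIntegrand]
    ring
  · rw [Set.indicator_of_notMem hτ, Set.indicator_of_notMem hτ, mul_zero]

theorem completedRiemannZeta_two_mul {s : ℂ} (hs : 1 < (2 * s).re) : completedRiemannZeta (2 * s) =
    (1 / (Real.pi : ℂ)) ^ s * Complex.Gamma s * riemannZeta (2 * s) := by
  have h0 : 2 * s ≠ 0 := fun h => by rw [h] at hs; simp at hs; linarith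
  have hG : Complex.Gammaℝ (2 * s) ≠ 0 := Complex.Gammaℝ_ne_zero_of_re_pos (by linarith)
  rw [riemannZeta_def_of_ne_zero h0, Complex.Gammaℝ_def]
  rw [Complex.Gammaℝ_def] at hG
  have h1 : -(2 * s) / 2 = -s := by ring
  have h2 : 2 * s / 2 = s := by ring
  rw [h1, h2] at hG ⊢
  have h3 : (1 / (Real.pi : ℂ)) ^ s = (Real.pi : ℂ) ^ (-s) := by
    rw [one_div, Complex.inv_cpow, Complex.cpow_neg]
    rw [Complex.arg_ofReal_of_nonneg Real.pi_pos.le]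
    exact Real.pi_pos.ne
  rw [h3, mul_div_cancel₀ _ hG]

/-- The same strip integral has been evaluated twice: as `2 ξ(2s) heckeFactor(s)` times the series,
and by unfolding to the cusp. Multiplying by `2s (2s - 1)` makes the completed zeta function entire.
-/
theorem tsum_eisTerm_eq {h : Spin55} (hy : 0 < y) (hB : Bᵀ = -B) (he : e.det ≠ 0)
    (hh : vecRep h = levi (√y)⁻¹ (so44 e B)) (q : Fin 4 ⊕ Fin 4 → ℝ) {s : ℂ} (hs : 5 < s.re) :
    ∑' c, eisTerm s (unip q * h) c = eisSpinNum y e B q s / eisSpinDen s := by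
  have h1 : 1 < (2 * s).re := by simp; linarith
  have h2 : 1 < (s - 3 / 2).re := by
    have : (3 / 2 : ℂ).re = 3 / 2 := by norm_num
    rw [Complex.sub_re, this]; linarith
  have h20 : 2 * s ≠ 0 := fun h => by rw [h] at h1; simp at h1; linarith
  have h21 : 2 * s ≠ 1 := fun h => by rw [h] at h1; simp at h1
  have e1 := (summable_eisTerm (B := B) hy he hh q hs).2
  have e2 := integral_heckeTheta B q hy he hs
  rw [integral_heckeTheta_eq_cusp hy hB he q h2, ← e1] at e2
  have e3 := completedRiemannZeta_two_mul h1
  have hd := eisDen_ne_zero_of_one_lt_re h2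
  rw [eq_div_iff (eisSpinDen_ne_zero hs), eisSpinNum, eisSpinDen, xiEntire_eq h20 h21, e3]
  have e4 : ∫ τ in cuspStrip, cuspIntegrand y e B q (s - 3 / 2) τ =
      eisDen (s - 3 / 2) / 2 * (2 / eisDen (s - 3 / 2) *
        ∫ τ in cuspStrip, cuspIntegrand y e B q (s - 3 / 2) τ) := by
    have h5 : ∀ D : ℂ, D ≠ 0 → D / 2 * (2 / D) = 1 := fun D hD => by field_simp
    rw [← mul_assoc, h5 _ hd, one_mul]
  rw [e4, e2]
  ring

/-- The continuation of the Eisenstein series as a quotient of entire functions. -/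
theorem isMeroCont_eisSpin {h : Spin55} (hy : 0 < y) (hB : Bᵀ = -B) (he : e.det ≠ 0)
    (hh : vecRep h = levi (√y)⁻¹ (so44 e B)) (q : Fin 4 ⊕ Fin 4 → ℝ) :
    IsMeroCont (fun s => ∑' c, eisTerm s (unip q * h) c) 5 (fun s => eisSpin s (unip q * h)) ∧
      ∀ s, eisSpinDen s ≠ 0 → AnalyticAt ℂ (fun w => eisSpin w (unip q * h)) s ∧
        eisSpin s (unip q * h) = eisSpinNum y e B q s / eisSpinDen s :=
  meroCont_quotient (differentiable_eisSpinNum hy he q) differentiable_eisSpinDen fun _ hs =>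
    ⟨eisSpinDen_ne_zero hs, tsum_eisTerm_eq hy hB he hh q hs⟩

end

/-! ### The integrals of the modes over the strip -/

theorem epsteinMin_inv_le_of_mem_strip {τ : ℍ} (hτ : τ ∈ strip) :
    (epsteinMin τ)⁻¹ ≤ 2 * τ.im + 2 / τ.im := by
  obtain ⟨h1, h2⟩ := hτ
  have hv := τ.im_pos
  have h3 : 2 * τ.im + 2 / τ.im = (2 * τ.im ^ 2 + 2) / τ.im := by field_simp
  rw [epsteinMin, inv_div, h3]
  refine div_le_div_of_nonneg_right ?_ hv.le
  have h5 : τ.re ^ 2 ≤ 1 / 2 := by nlinarith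
  linarith

/-- The power is bounded by a multiple of `exp (c (2t + 2/t))`. The choice `c = min a b / 4` makes
this cost at most half of `a/t` and half of `b t`. -/
theorem one_add_pow_mul_exp_le {a b : ℝ} (ha : 0 < a) (hb : 0 < b) (k : ℕ) : ∃ C : ℝ, 0 ≤ C ∧
    ∀ t : ℝ, 0 < t → (1 + (2 * t + 2 / t) ^ k) * Real.exp (-a / t - b * t) ≤
      C * Real.exp (-(b / 2) * t) := by
  set c := min a b / 4 with hc
  have hc0 : 0 < c := by positivity
  refine ⟨1 + k.factorial / c ^ k, by positivity, fun t ht => ?_⟩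
  have hu : 0 < 2 * t + 2 / t := by positivity
  have h1 : (2 * t + 2 / t) ^ k ≤ k.factorial / c ^ k * Real.exp (c * (2 * t + 2 / t)) := by
    have := Real.pow_div_factorial_le_exp _ (mul_pos hc0 hu).le k
    rw [mul_pow, div_le_iff₀ (by positivity)] at this
    rw [div_mul_eq_mul_div, le_div_iff₀ (by positivity)]
    linarith
  have h2 : c * (2 * t + 2 / t) ≤ a / t / 2 + b * t / 2 := by
    have e1 : c * (2 * t + 2 / t) = min a b * t / 2 + min a b / t / 2 := by rw [hc]; ring
    rw [e1]
    have := mul_le_mul_of_nonneg_right (min_le_right a b) ht.le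
    have := div_le_div_of_nonneg_right (min_le_left a b) ht.le
    linarith
  have h3 : 0 < a / t := by positivity
  have h4 : 0 < b * t := by positivity
  have h5 : 1 ≤ Real.exp (c * (2 * t + 2 / t)) := Real.one_le_exp (by positivity)
  calc _ ≤ ((1 + k.factorial / c ^ k) * Real.exp (c * (2 * t + 2 / t))) *
        Real.exp (-a / t - b * t) := by
        refine mul_le_mul_of_nonneg_right ?_ (Real.exp_pos _).le
        linarith
    _ = (1 + k.factorial / c ^ k) * Real.exp (c * (2 * t + 2 / t) + (-a / t - b * t)) := by
        rw [Real.exp_add]; ring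
    _ ≤ _ := by
        refine mul_le_mul_of_nonneg_left (Real.exp_le_exp.2 ?_) (by positivity)
        rw [neg_div]
        linarith

theorem integrableOn_strip_gauss {a b : ℝ} (ha : 0 < a) (hb : 0 < b) (k : ℕ) :
    IntegrableOn (fun τ : ℍ => τ.im ^ 2 * ((1 + (2 * τ.im + 2 / τ.im) ^ k) *
      Real.exp (-a / τ.im - b * τ.im))) strip := by
  refine integrableOn_strip_of_im (g := fun t => t ^ 2 * ((1 + (2 * t + 2 / t) ^ k) *
      Real.exp (-a / t - b * t))) ?_
  obtain ⟨C, hC, h⟩ := one_add_pow_mul_exp_le ha hb k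
  refine Integrable.mono' ((exp_neg_integrableOn_Ioi 0 (half_pos hb)).const_mul C) ?_ ?_
  · exact Measurable.aestronglyMeasurable (by fun_prop)
  · filter_upwards [ae_restrict_mem measurableSet_Ioi] with t (ht : 0 < t)
    have h0 : 1 / t ^ 2 * (t ^ 2 * ((1 + (2 * t + 2 / t) ^ k) * Real.exp (-a / t - b * t))) =
        (1 + (2 * t + 2 / t) ^ k) * Real.exp (-a / t - b * t) := by field_simp
    rw [h0, Real.norm_of_nonneg (by positivity)]
    exact h t ht

section

variable {y : ℝ} {e B : Matrix (Fin 4) (Fin 4) ℝ} (M : Fin 4 → ℤ) {N : Fin 4 → ℤ}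

theorem pL2_add_pR2_pos (he : e.det ≠ 0) (hN : N ≠ 0) : 0 < pL2 e B M N + pR2 e B M N := by
  rw [pL2_add_pR2 M N he]
  refine narainForm_pos B he fun h => hN ?_
  funext i
  have h2 : (N i : ℝ) = 0 := congrFun h.1 i
  exact_mod_cast h2

theorem norm_divisorMode (p : ℕ) (τ : ℍ) : ‖divisorMode y e B M N p τ‖ =
    (√y)⁻¹ * (τ.im ^ 2 * Real.exp (-(Real.pi * p ^ 2 / y) / τ.im -
      Real.pi / p ^ 2 * (pL2 e B M N + pR2 e B M N) * τ.im)) := by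
  have h1 : Complex.I * Real.pi * (τ.re : ℂ) * (((pL2 e B M N - pR2 e B M N) / (p : ℝ) ^ 2 : ℝ) : ℂ) =
      ((Real.pi * τ.re * ((pL2 e B M N - pR2 e B M N) / (p : ℝ) ^ 2) : ℝ) : ℂ) * Complex.I := by
    push_cast; ring
  rw [divisorMode, norm_mul, norm_mul, h1, Complex.norm_exp_ofReal_mul_I, mul_one, gaussWeight,
    Complex.norm_real, Complex.norm_real, Real.norm_of_nonneg (Real.exp_pos _).le,
    Real.norm_of_nonneg (by positivity), mul_assoc]
  congr 4
  · rw [neg_div, div_div, mul_comm τ.im y, neg_mul, neg_div]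
  · ring

theorem measurable_divisorMode (p : ℕ) : Measurable (divisorMode y e B M N p) := by
  have h1 := UpperHalfPlane.continuous_re.measurable
  have h2 := UpperHalfPlane.continuous_im.measurable
  unfold divisorMode gaussWeight
  fun_prop

/-- A mode contains `exp (-a/t - b t)` with `a, b > 0`, so it beats any polynomial growth at the
cusp and at the real axis alike. For this reason integrals of modes over the whole strip exist for
every `w`, with no Hecke operator. -/
theorem exists_strip_bound_pow (hy : 0 < y) (he : e.det ≠ 0) (hN : N ≠ 0) {p : ℕ} (hp : p ≠ 0)
    {f : ℂ → ℍ → ℂ} {r : ℝ} {C : ℝ} {k : ℕ} (hC : 0 ≤ C)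
    (hf : ∀ τ w, ‖w‖ ≤ r → ‖f w τ‖ ≤ C * (1 + (epsteinMin τ)⁻¹ ^ k)) :
    ∃ G : ℍ → ℝ, IntegrableOn G strip ∧ ∀ w, ‖w‖ ≤ r → ∀ τ ∈ strip,
      ‖f w τ * divisorMode y e B M N p τ‖ ≤ G τ := by
  have hX := pL2_add_pR2_pos (B := B) M he hN
  have hp' : (0 : ℝ) < p := by exact_mod_cast hp.bot_lt
  have hpi := Real.pi_pos
  refine ⟨_, (integrableOn_strip_gauss (a := Real.pi * p ^ 2 / y)
    (b := Real.pi / p ^ 2 * (pL2 e B M N + pR2 e B M N)) (by positivity) (by positivity) k).const_mul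
    (C * (√y)⁻¹), fun w hw τ hτ => ?_⟩
  have hm := epsteinMin_pos τ
  have hv := τ.im_pos
  have h1 := pow_le_pow_left₀ (inv_nonneg.2 hm.le) (epsteinMin_inv_le_of_mem_strip hτ) k
  rw [norm_mul, norm_divisorMode]
  calc _ ≤ (C * (1 + (2 * τ.im + 2 / τ.im) ^ k)) * _ :=
        mul_le_mul_of_nonneg_right ((hf τ w hw).trans
          (mul_le_mul_of_nonneg_left (by linarith) hC)) (by positivity)
    _ = _ := by ring

/-- The integral of the `SL(2)` Eisenstein series against a mode, before normalization. -/
noncomputable def modeNum (y : ℝ) (e B : Matrix (Fin 4) (Fin 4) ℝ) (M N : Fin 4 → ℤ) (p : ℕ)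
    (w : ℂ) : ℂ := ∫ τ in strip, eisNum w τ * divisorMode y e B M N p τ

theorem integrableOn_eisNum_mul (hy : 0 < y) (he : e.det ≠ 0) (hN : N ≠ 0) {p : ℕ} (hp : p ≠ 0)
    (w : ℂ) : IntegrableOn (fun τ => eisNum w τ * divisorMode y e B M N p τ) strip := by
  obtain ⟨k, C, hC, hf⟩ := exists_norm_eisNum_le ‖w‖
  obtain ⟨G, hG, h⟩ := exists_strip_bound_pow (B := B) M hy he hN hp hC hf
  refine Integrable.mono' hG
    ((measurable_eisNum w).mul (measurable_divisorMode M p)).aestronglyMeasurable ?_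
  filter_upwards [ae_restrict_mem measurableSet_strip] with τ hτ
  exact h w le_rfl τ hτ

theorem differentiable_modeNum (hy : 0 < y) (he : e.det ≠ 0) (hN : N ≠ 0) {p : ℕ} (hp : p ≠ 0) :
    Differentiable ℂ (modeNum y e B M N p) := by
  refine differentiable_integral_of_locally_bounded
    (fun w => ((measurable_eisNum w).mul (measurable_divisorMode M p)).aestronglyMeasurable)
    (.of_forall fun τ => (differentiable_eisNum τ).mul_const _) fun r => ?_
  obtain ⟨k, C, hC, hf⟩ := exists_norm_eisNum_le r
  obtain ⟨G, hG, h⟩ := exists_strip_bound_pow (B := B) M hy he hN hp hC hf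
  refine ⟨G, hG, ?_⟩
  filter_upwards [ae_restrict_mem measurableSet_strip] with τ hτ w hw
  exact h w hw τ hτ

/-- The mode integrals in the coordinates of the statement. -/
theorem integral_sl2Weight (hy : 0 < y) (he : e.det ≠ 0) (hN : N ≠ 0) {p : ℕ} (hp : p ≠ 0)
    {w : ℂ} (hw : eisDen w ≠ 0) :
    IntegrableOn (fun τ : ℝ × ℝ => gaussWeight y (pL2 e B M N + pR2 e B M N) p τ.2 *
      sl2Weight w (pL2 e B M N - pR2 e B M N) p τ.2 τ.1)
      (Set.Ioc (-(1 / 2)) (1 / 2) ×ˢ Set.Ioi 0) ∧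
    (((√y)⁻¹ : ℝ) : ℂ) * ∫ τ₂ in Set.Ioi (0 : ℝ), gaussWeight y (pL2 e B M N + pR2 e B M N) p τ₂ *
      ∫ τ₁ in (-(1 / 2) : ℝ)..(1 / 2), sl2Weight w (pL2 e B M N - pR2 e B M N) p τ₂ τ₁ =
      modeNum y e B M N p w / eisDen w := by
  set g : ℝ × ℝ → ℂ := fun τ => gaussWeight y (pL2 e B M N + pR2 e B M N) p τ.2 *
      sl2Weight w (pL2 e B M N - pR2 e B M N) p τ.2 τ.1 with hg
  set f : ℝ × ℝ → ℂ := fun τ => (((√y)⁻¹ * τ.2 ^ 2 : ℝ) : ℂ) * g τ with hf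
  have hfτ : ∀ τ : ℍ, f (τ.re, τ.im) = (eisDen w)⁻¹ * (eisNum w τ * divisorMode y e B M N p τ) := by
    intro τ
    have h1 : ((τ.re : ℂ) + (τ.im : ℂ) * Complex.I) = (τ : ℂ) := by
      exact Complex.ext (by simp) (by simp)
    have h2 : eisSL2 w (τ : ℂ) = eisNum w τ / eisDen w := (isMeroCont_eisSL2 τ.im_pos).2 w hw |>.2
    simp only [hf, hg, sl2Weight, divisorMode, h1, h2]
    ring
  have hs : ∀ τ ∈ (Set.Ioc (-(1 / 2)) (1 / 2) ×ˢ Set.Ioi 0 : Set (ℝ × ℝ)),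
      (1 / τ.2 ^ 2) • f τ = (((√y)⁻¹ : ℝ) : ℂ) * g τ := by
    rintro ⟨t1, t2⟩ ⟨-, ht⟩
    have ht0 : (t2 : ℂ) ≠ 0 := by
      have : (0 : ℝ) < t2 := ht
      exact_mod_cast this.ne'
    simp only [hf, Complex.real_smul]
    push_cast
    field_simp
  have hms : MeasurableSet (Set.Ioc (-(1 / 2)) (1 / 2) ×ˢ Set.Ioi 0 : Set (ℝ × ℝ)) :=
    measurableSet_Ioc.prod measurableSet_Ioi
  have hint := (integrableOn_eisNum_mul (B := B) M hy he hN hp w).const_mul (eisDen w)⁻¹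
  simp only [← hfτ] at hint
  have hint2 := (integrableOn_congr_fun hs hms).1 ((integrableOn_strip_iff f).1 hint)
  have hy0 : (((√y)⁻¹ : ℝ) : ℂ) ≠ 0 := by
    have : 0 < (√y)⁻¹ := by positivity
    exact_mod_cast this.ne'
  have hgi : IntegrableOn g (Set.Ioc (-(1 / 2)) (1 / 2) ×ˢ Set.Ioi 0) := by
    refine (hint2.const_mul (((√y)⁻¹ : ℝ) : ℂ)⁻¹).congr (.of_forall fun τ => ?_)
    dsimp only
    rw [inv_mul_cancel_left₀ hy0]
  refine ⟨hgi, ?_⟩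
  have h1 : modeNum y e B M N p w / eisDen w = ∫ τ in strip, f (τ.re, τ.im) := by
    simp only [hfτ, integral_const_mul, modeNum]
    rw [div_eq_inv_mul]
  rw [h1, integral_strip_eq, setIntegral_congr_fun hms hs, integral_const_mul]
  congr 1
  rw [Measure.volume_eq_prod, ← Measure.prod_restrict]
  rw [IntegrableOn, Measure.volume_eq_prod, ← Measure.prod_restrict] at hgi
  rw [integral_prod_symm _ hgi]
  refine integral_congr_ae (.of_forall fun t => ?_)
  simp only [hg, integral_const_mul]
  rw [intervalIntegral.integral_of_le (by norm_num)]

end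

/-! ### The Fourier coefficients in the region of absolute convergence. -/

instance isFiniteMeasure_restrict_cube : IsFiniteMeasure (volume.restrict cube) :=
  isFiniteMeasure_restrict.2 isCompact_Icc.measure_ne_top

section

variable {y : ℝ} {e B : Matrix (Fin 4) (Fin 4) ℝ} (M : Fin 4 → ℤ) {N : Fin 4 → ℤ}

/-- The constant term of the theta function does not depend on `q` and has no mode with `N ≠ 0`, so
truncation is harmless here. -/
theorem integral_thetaPrime_modeChar (hy : 0 < y) (hB : Bᵀ = -B) (he : e.det ≠ 0) (hN : N ≠ 0)
    (τ : ℍ) : ∫ q in cube, thetaPrime y e B q τ * modeChar M N q =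
      ∑ p ∈ (gcdModes M N).divisors, ∑' v, divisorMode y e B M N p (stripRep τ v • τ) := by
  rw [← (narainTheta_mode_eq M τ hy hB he hN).2]
  -- Any `s` with `Re s > 5` would do: the majorant is used only at the fixed point `τ`, to bound
  -- the truncated theta function over the cube.
  obtain ⟨G, -, hG⟩ := exists_thetaPrime_bound (e := e) B hy he (isCompact_Icc (a := (0 : Fin 4 ⊕ Fin 4 → ℝ)) (b := 1))
    (s := 6) (by norm_num)
  have hv0 : ((τ.im : ℝ) : ℂ) ^ (6 - 3 / 2 : ℂ) ≠ 0 := by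
    have : (τ.im : ℂ) ≠ 0 := by exact_mod_cast τ.im_pos.ne'
    simp [Complex.cpow_eq_zero_iff, this]
  have hint : IntegrableOn (fun q => thetaPrime y e B q τ * modeChar M N q) cube := by
    refine Integrable.mono' (g := fun _ => G τ / ‖((τ.im : ℝ) : ℂ) ^ (6 - 3 / 2 : ℂ)‖)
      (integrable_const _) ?_ ?_
    · exact (((measurable_thetaPrime B hy he).comp measurable_prodMk_right).mul
        (continuous_modeChar M N).measurable).aestronglyMeasurable
    · filter_upwards [ae_restrict_mem measurableSet_Icc] with q hq
      have := hG q hq τ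
      rw [norm_mul] at this
      rw [norm_mul, norm_modeChar, mul_one, le_div_iff₀ (norm_pos_iff.2 hv0)]
      linarith
  have hconst : ∫ q in cube, ((τ.im ^ 2 * √τ.im : ℝ) : ℂ) * modeChar M N q = 0 := by
    rw [integral_const_mul, integral_modeChar, if_neg fun h => hN h.2, mul_zero]
  have hint2 : IntegrableOn (fun q => ((τ.im ^ 2 * √τ.im : ℝ) : ℂ) * modeChar M N q) cube :=
    ((continuous_modeChar M N).integrableOn_Icc).const_mul _
  have : ∀ q, narainTheta y e q τ B * modeChar M N q =
      ((τ.im ^ 2 * √τ.im : ℝ) : ℂ) * modeChar M N q + thetaPrime y e B q τ * modeChar M N q := fun q => by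
    rw [narainTheta_eq B q τ hy he, add_mul]
  simp only [this]
  rw [integral_add hint2 hint, hconst, zero_add]

theorem integral_cube_integral_thetaPrime (hy : 0 < y) (he : e.det ≠ 0) (N : Fin 4 → ℤ) {s : ℂ}
    (hs : 5 < s.re) :
    ∫ q in cube, (∫ τ in strip, ((τ.im : ℝ) : ℂ) ^ (s - 3 / 2) * thetaPrime y e B q τ) *
        modeChar M N q =
      ∫ τ in strip, ((τ.im : ℝ) : ℂ) ^ (s - 3 / 2) *
        ∫ q in cube, thetaPrime y e B q τ * modeChar M N q := by
  obtain ⟨G, hG, hb⟩ := exists_thetaPrime_bound (e := e) B hy he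
    (isCompact_Icc (a := (0 : Fin 4 ⊕ Fin 4 → ℝ)) (b := 1)) hs
  simp only [← integral_mul_const, ← integral_const_mul]
  rw [integral_integral_swap]
  · simp only [mul_assoc]
  · have hm : Measurable fun p : (Fin 4 ⊕ Fin 4 → ℝ) × ℍ =>
        ((p.2.im : ℝ) : ℂ) ^ (s - 3 / 2) * thetaPrime y e B p.1 p.2 * modeChar M N p.1 := by
      have h1 := measurable_thetaPrime B hy he
      have h2 := (continuous_modeChar M N).measurable
      have h3 := UpperHalfPlane.continuous_im.measurable
      fun_prop
    refine Integrable.mono' (g := fun p : (Fin 4 ⊕ Fin 4 → ℝ) × ℍ => G p.2)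
      ((integrable_const (1 : ℝ)).mul_prod hG |>.congr (.of_forall fun p => one_mul _))
      hm.aestronglyMeasurable ?_
    rw [Measure.prod_restrict]
    filter_upwards [ae_restrict_mem (measurableSet_Icc.prod measurableSet_strip)] with p hp
    simp only [Function.uncurry]
    rw [norm_mul, norm_modeChar, mul_one]
    exact hb _ hp.1 _

/-- The Poincaré series is the full group sum of the modes cut off to the strip. Unfolding exchanges
the roles: the group sum moves onto the power of the height and becomes twice the Eisenstein series,
while the mode is integrated over a single strip. -/
theorem integral_strip_divisorMode (hy : 0 < y) (hB : Bᵀ = -B) (he : e.det ≠ 0) (hN : N ≠ 0)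
    {w : ℂ} (hw : 1 < w.re) :
    ∫ τ in strip, ((τ.im : ℝ) : ℂ) ^ w *
      ∑ p ∈ (gcdModes M N).divisors, ∑' v, divisorMode y e B M N p (stripRep τ v • τ) =
    2 * ∑ p ∈ (gcdModes M N).divisors, modeNum y e B M N p w / eisDen w := by
  set D := (gcdModes M N).divisors with hD
  have hDp : ∀ p ∈ D, p ≠ 0 := fun p hp => (Nat.pos_of_mem_divisors hp).ne'
  set F : ℍ → ℂ := fun τ => ∑ p ∈ D, strip.indicator (divisorMode y e B M N p) τ with hF
  have hFm : Measurable F :=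
    Finset.measurable_sum _ fun p _ => (measurable_divisorMode M p).indicator measurableSet_strip
  have hsum : ∀ τ, ∑' γ : SL(2, ℤ), F (γ • τ) =
      ∑ p ∈ D, ∑' v, divisorMode y e B M N p (stripRep τ v • τ) := fun τ => by
    have h1 := (narainTheta_mode_eq M τ hy hB he hN).1
    rw [hF]
    dsimp only
    rw [Summable.tsum_finsetSum fun p hp => (summable_strip_indicator_iff _ τ).2 (h1 p hp)]
    exact Finset.sum_congr rfl fun p _ => tsum_strip_indicator _ τ
  set k := ⌈w.re⌉₊
  have hint1 : ∀ p ∈ D, IntegrableOn (fun τ => epsteinMin τ ^ (-w.re) *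
      ‖divisorMode y e B M N p τ‖) strip := fun p hp => by
    obtain ⟨G, hG, hb⟩ := exists_strip_bound_pow (B := B) M hy he hN (hDp p hp) (r := 0) (C := 1)
      (k := k) (f := fun _ τ => (((epsteinMin τ)⁻¹ ^ k : ℝ) : ℂ)) zero_le_one fun τ w hw => by
        have := epsteinMin_pos τ
        rw [Complex.norm_real, Real.norm_of_nonneg (by positivity)]
        linarith
    have hm0 : Measurable epsteinMin := by
      have h3 := UpperHalfPlane.continuous_re.measurable
      have h4 := UpperHalfPlane.continuous_im.measurable
      unfold epsteinMin
      fun_prop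
    refine Integrable.mono' hG ((hm0.pow_const _).mul (measurable_divisorMode M p).norm).aestronglyMeasurable ?_
    filter_upwards [ae_restrict_mem measurableSet_strip] with τ hτ
    have hm := epsteinMin_pos τ
    have h1 := hb 0 (by simp) τ hτ
    rw [norm_mul, Complex.norm_real, Real.norm_of_nonneg (by positivity)] at h1
    rw [Real.norm_of_nonneg (by positivity)]
    refine le_trans (mul_le_mul_of_nonneg_right ?_ (norm_nonneg _)) h1
    rw [Real.rpow_neg hm.le, ← Real.inv_rpow hm.le, ← Real.rpow_natCast]
    refine Real.rpow_le_rpow_of_exponent_le ?_ (Nat.le_ceil _)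
    have hv := τ.im_pos
    rw [epsteinMin, inv_div, le_div_iff₀ hv]
    nlinarith [sq_nonneg (τ.im - 1 / 2), sq_nonneg τ.re]
  have hint : Integrable fun τ => epsteinMin τ ^ (-w.re) * ‖F τ‖ := by
    have h1 : Integrable fun τ => ∑ p ∈ D, strip.indicator (fun τ => epsteinMin τ ^ (-w.re) *
        ‖divisorMode y e B M N p τ‖) τ := integrable_finsetSum _ fun p hp =>
      (integrable_indicator_iff measurableSet_strip).2 (hint1 p hp)
    refine Integrable.mono' h1 ?_ (.of_forall fun τ => ?_)
    · have hm0 : Measurable epsteinMin := by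
        have h3 := UpperHalfPlane.continuous_re.measurable
        have h4 := UpperHalfPlane.continuous_im.measurable
        unfold epsteinMin
        fun_prop
      exact ((hm0.pow_const _).mul hFm.norm).aestronglyMeasurable
    · have hm := epsteinMin_pos τ
      rw [Real.norm_of_nonneg (by positivity)]
      refine (mul_le_mul_of_nonneg_left (norm_sum_le _ _) (by positivity)).trans_eq ?_
      rw [Finset.mul_sum]
      refine Finset.sum_congr rfl fun p _ => ?_
      by_cases h : τ ∈ strip
      · rw [Set.indicator_of_mem h, Set.indicator_of_mem h]
      · rw [Set.indicator_of_notMem h, Set.indicator_of_notMem h, norm_zero, mul_zero]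
  have h := integral_strip_tsum_smul hFm hw hint
  simp only [hsum] at h
  rw [h]
  have h2 : ∀ τ, 2 * (eisNum w τ / eisDen w) * F τ = ∑ p ∈ D, strip.indicator
      (fun τ => 2 / eisDen w * (eisNum w τ * divisorMode y e B M N p τ)) τ := fun τ => by
    rw [hF]
    dsimp only
    rw [Finset.mul_sum]
    refine Finset.sum_congr rfl fun p _ => ?_
    by_cases h : τ ∈ strip
    · rw [Set.indicator_of_mem h, Set.indicator_of_mem h]; ring
    · rw [Set.indicator_of_notMem h, Set.indicator_of_notMem h, mul_zero]
  simp only [h2]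
  rw [integral_finsetSum _ fun p hp => (integrable_indicator_iff measurableSet_strip).2
    ((integrableOn_eisNum_mul (B := B) M hy he hN (hDp p hp) w).const_mul _), Finset.mul_sum]
  refine Finset.sum_congr rfl fun p _ => ?_
  rw [integral_indicator measurableSet_strip, integral_const_mul, modeNum]
  ring

theorem modeIntegrand_eq (s : ℂ) (h : Spin55) (q : Fin 4 ⊕ Fin 4 → ℝ) :
    modeIntegrand s h M N q = eisSpin s (unip q * h) * modeChar M N q := rfl

variable {h : Spin55}

/-- The Eisenstein series is the Mellin transform of the truncated theta function divided by `2
ξ(2s)`. Fubini moves the mode inside, and unfolding gives back the factor 2. -/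
theorem fourierMode_eq_of_re (hy : 0 < y) (hB : Bᵀ = -B) (he : e.det ≠ 0)
    (hh : vecRep h = levi (√y)⁻¹ (so44 e B)) (hN : N ≠ 0) {s : ℂ} (hs : 5 < s.re) :
    fourierMode s h M N = (completedRiemannZeta (2 * s))⁻¹ *
      ∑ p ∈ (gcdModes M N).divisors, modeNum y e B M N p (s - 3 / 2) / eisDen (s - 3 / 2) := by
  have h1 : 1 < (2 * s).re := by simp; linarith
  have h2 : 1 < (s - 3 / 2).re := by
    have : (3 / 2 : ℂ).re = 3 / 2 := by norm_num
    rw [Complex.sub_re, this]; linarith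
  have hxi := completedRiemannZeta_ne_zero_of_one_lt_re h1
  have hq : ∀ q, modeIntegrand s h M N q = (2 * completedRiemannZeta (2 * s))⁻¹ *
      ((∫ τ in strip, ((τ.im : ℝ) : ℂ) ^ (s - 3 / 2) * thetaPrime y e B q τ) * modeChar M N q) := by
    intro q
    have h3 := (isMeroCont_eisSpin hy hB he hh q).1.2 s hs
    beta_reduce at h3
    rw [modeIntegrand_eq, h3, (integral_thetaPrime B q hy he hs).2,
      ← (summable_eisTerm (B := B) hy he hh q hs).2]
    have h4 : (1 / (Real.pi : ℂ)) ^ s * Complex.Gamma s * (2 * riemannZeta (2 * s) *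
        ∑' c, eisTerm s (unip q * h) c) = 2 * completedRiemannZeta (2 * s) *
          ∑' c, eisTerm s (unip q * h) c := by
      rw [completedRiemannZeta_two_mul h1]; ring
    rw [h4, mul_assoc (2 * completedRiemannZeta (2 * s)), inv_mul_cancel_left₀ (by simpa using hxi)]
  rw [fourierMode]
  simp only [hq]
  rw [integral_const_mul, integral_cube_integral_thetaPrime M hy he N hs]
  simp only [integral_thetaPrime_modeChar M hy hB he hN]
  rw [integral_strip_divisorMode M hy hB he hN h2, mul_inv, mul_comm (2 : ℂ)⁻¹, mul_assoc,
    inv_mul_cancel_left₀ two_ne_zero]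

/-! ### Continuation of the Fourier coefficients -/

theorem measurable_eisSpinNum (hy : 0 < y) (he : e.det ≠ 0) (s : ℂ) :
    Measurable fun q => eisSpinNum y e B q s := by
  have h1 : StronglyMeasurable fun q => ∫ τ in cuspStrip, cuspIntegrand y e B q (s - 3 / 2) τ :=
    StronglyMeasurable.integral_prod_right
      (f := fun q τ => cuspIntegrand y e B q (s - 3 / 2) τ)
      (measurable_cuspIntegrand hy he _).stronglyMeasurable
  exact h1.measurable.const_mul _

theorem exists_eisSpinNum_bound (hy : 0 < y) (he : e.det ≠ 0) (r : ℝ) : ∃ C : ℝ,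
    ∀ q ∈ cube, ∀ s, ‖s‖ ≤ r → ‖eisSpinNum y e B q s‖ ≤ C := by
  obtain ⟨G, hG, hb⟩ := exists_cuspIntegrand_bound (e := e) (B := B) hy he
    (isCompact_Icc (a := (0 : Fin 4 ⊕ Fin 4 → ℝ)) (b := 1)) (r + 3 / 2)
  refine ⟨2 * r * (2 * r + 1) * ∫ τ in cuspStrip, G τ, fun q hq s hs => ?_⟩
  have hr : 0 ≤ r := (norm_nonneg _).trans hs
  have h1 : ‖(2 * s * (2 * s - 1) : ℂ)‖ ≤ 2 * r * (2 * r + 1) := by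
    have h2 : ‖(2 * s : ℂ)‖ = 2 * ‖s‖ := by simp
    rw [norm_mul, h2]
    refine mul_le_mul (by linarith) ((norm_sub_le _ _).trans ?_) (norm_nonneg _) (by positivity)
    rw [h2, norm_one]; linarith
  rw [eisSpinNum, norm_mul]
  refine mul_le_mul h1 (norm_integral_le_of_norm_le hG ?_) (norm_nonneg _) (by positivity)
  filter_upwards [ae_restrict_mem measurableSet_cuspStrip] with τ hτ
  refine hb q hq _ ((norm_sub_le _ _).trans ?_) τ hτ
  have : ‖(3 / 2 : ℂ)‖ = 3 / 2 := by norm_num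
  rw [this]; linarith

theorem integrableOn_eisSpinNum_mul (hy : 0 < y) (he : e.det ≠ 0) (N : Fin 4 → ℤ) (s : ℂ) :
    IntegrableOn (fun q => eisSpinNum y e B q s * modeChar M N q) cube := by
  obtain ⟨C, hC⟩ := exists_eisSpinNum_bound (e := e) (B := B) hy he ‖s‖
  refine Integrable.mono' (g := fun _ => C) (integrable_const _)
    ((measurable_eisSpinNum hy he s).mul (continuous_modeChar M N).measurable).aestronglyMeasurable ?_
  filter_upwards [ae_restrict_mem measurableSet_Icc] with q hq
  rw [norm_mul, norm_modeChar, mul_one]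
  exact hC q hq s le_rfl

theorem differentiable_integral_eisSpinNum (hy : 0 < y) (he : e.det ≠ 0) (N : Fin 4 → ℤ) :
    Differentiable ℂ fun s => ∫ q in cube, eisSpinNum y e B q s * modeChar M N q := by
  refine differentiable_integral_of_locally_bounded
    (fun s => ((measurable_eisSpinNum hy he s).mul
      (continuous_modeChar M N).measurable).aestronglyMeasurable)
    (.of_forall fun q => (differentiable_eisSpinNum hy he q).mul_const _) fun r => ?_
  obtain ⟨C, hC⟩ := exists_eisSpinNum_bound (e := e) (B := B) hy he r
  refine ⟨fun _ => C, integrable_const _, ?_⟩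
  filter_upwards [ae_restrict_mem measurableSet_Icc] with q hq s hs
  rw [norm_mul, norm_modeChar, mul_one]
  exact hC q hq s hs

theorem modeIntegrand_eq_div (hy : 0 < y) (hB : Bᵀ = -B) (he : e.det ≠ 0)
    (hh : vecRep h = levi (√y)⁻¹ (so44 e B)) (N : Fin 4 → ℤ) {s : ℂ} (hs : eisSpinDen s ≠ 0)
    (q : Fin 4 ⊕ Fin 4 → ℝ) :
    modeIntegrand s h M N q = (eisSpinDen s)⁻¹ * (eisSpinNum y e B q s * modeChar M N q) := by
  rw [modeIntegrand_eq, ((isMeroCont_eisSpin hy hB he hh q).2 s hs).2]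
  ring

/-- The entire function outside whose zeros the identities hold. -/
noncomputable def exceptional (s : ℂ) : ℂ := eisSpinDen s * (s * (2 * s - 1))

theorem differentiable_exceptional : Differentiable ℂ exceptional :=
  differentiable_eisSpinDen.mul (differentiable_id.mul ((differentiable_id.const_mul 2).sub_const 1))

theorem exceptional_ne_zero {s : ℂ} (hs : 5 < s.re) : exceptional s ≠ 0 := by
  refine mul_ne_zero (eisSpinDen_ne_zero hs) (mul_ne_zero ?_ ?_)
  · rintro rfl
    simp at hs
    linarith
  · intro h
    have := congrArg Complex.re h
    simp at this
    linarith

theorem exceptional_three_halves : exceptional (3 / 2) ≠ 0 := by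
  refine mul_ne_zero (mul_ne_zero (mul_ne_zero ?_ heckeFactor_three_halves_ne_zero) ?_) (by norm_num)
  · exact xiEntire_ne_zero_of_one_lt_re (by norm_num)
  · rw [sub_self, eisDen_zero]; exact one_ne_zero

/-- Both sides are holomorphic away from the zeros of `exceptional` and agree for `Re s > 5`. The
factor `s (2s - 1)` in `exceptional` avoids the poles of `ξ(2s)`, and the rest avoids the zeros of
the denominators. -/
theorem fourierMode_eq (hy : 0 < y) (hB : Bᵀ = -B) (he : e.det ≠ 0)
    (hh : vecRep h = levi (√y)⁻¹ (so44 e B)) (hN : N ≠ 0) {s : ℂ} (hs : exceptional s ≠ 0) :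
    fourierMode s h M N = (completedRiemannZeta (2 * s))⁻¹ *
      ∑ p ∈ (gcdModes M N).divisors, modeNum y e B M N p (s - 3 / 2) / eisDen (s - 3 / 2) := by
  refine eq_of_differentiableOn_compl_zeros differentiable_exceptional
    (f := fun s => fourierMode s h M N) (g := fun s => (completedRiemannZeta (2 * s))⁻¹ *
      ∑ p ∈ (gcdModes M N).divisors, modeNum y e B M N p (s - 3 / 2) / eisDen (s - 3 / 2))
    ?_ ?_ (fun s hs => exceptional_ne_zero hs)
    (fun s hs => fourierMode_eq_of_re M hy hB he hh hN hs) s hs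
  · intro s hs
    have hd : ∀ᶠ t in 𝓝 s, eisSpinDen t ≠ 0 :=
      differentiable_eisSpinDen.continuous.continuousAt.eventually_ne (left_ne_zero_of_mul hs)
    have h1 : (fun s => fourierMode s h M N) =ᶠ[𝓝 s] fun s => (eisSpinDen s)⁻¹ *
        ∫ q in cube, eisSpinNum y e B q s * modeChar M N q := by
      filter_upwards [hd] with t ht
      rw [← integral_const_mul, fourierMode]
      exact integral_congr_ae (.of_forall fun q => modeIntegrand_eq_div M hy hB he hh N ht q)
    refine DifferentiableAt.congr_of_eventuallyEq ?_ h1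
    exact ((differentiable_eisSpinDen s).inv (left_ne_zero_of_mul hs)).mul
      (differentiable_integral_eisSpinNum M hy he N s)
  · intro s hs
    have hd := right_ne_zero_of_mul (left_ne_zero_of_mul hs)
    have hxd := left_ne_zero_of_mul (left_ne_zero_of_mul (left_ne_zero_of_mul hs))
    have h0 := right_ne_zero_of_mul hs
    have h20 : 2 * s ≠ 0 := mul_ne_zero two_ne_zero (left_ne_zero_of_mul h0)
    have h21 : 2 * s ≠ 1 := sub_ne_zero.1 (right_ne_zero_of_mul h0)
    have hxi : completedRiemannZeta (2 * s) ≠ 0 := by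
      rw [xiEntire_eq h20 h21] at hxd
      exact right_ne_zero_of_mul hxd
    have e1 : DifferentiableAt ℂ (fun s : ℂ => completedRiemannZeta (2 * s)) s :=
      (differentiableAt_completedZeta h20 h21).comp s (differentiableAt_id.const_mul 2)
    refine (e1.inv hxi).mul (DifferentiableAt.fun_sum fun p hp => DifferentiableAt.div ?_ ?_ hd)
    · exact ((differentiable_modeNum M hy he hN (Nat.pos_of_mem_divisors hp).ne').comp
        (differentiable_id.sub_const _)) s
    · exact (differentiable_eisDen.comp (differentiable_id.sub_const _)) s

end

/-! ### Bessel functions and special values -/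

theorem image_mul_exp {c : ℝ} (hc : 0 < c) :
    (fun u => c * Real.exp u) '' Set.univ = Set.Ioi 0 := by
  ext t
  constructor
  · rintro ⟨u, -, rfl⟩
    exact mul_pos hc (Real.exp_pos _)
  · intro (ht : 0 < t)
    exact ⟨Real.log (t / c), trivial, by
      simp only [Real.exp_log (div_pos ht hc)]; field_simp⟩

theorem integrableOn_exp_neg_div {a b : ℝ} (ha : 0 < a) (hb : 0 < b) :
    IntegrableOn (fun t => Real.exp (-a / t - b * t)) (Set.Ioi 0) := by
  refine Integrable.mono' (exp_neg_integrableOn_Ioi 0 hb)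
    (Measurable.aestronglyMeasurable (by fun_prop)) ?_
  filter_upwards [ae_restrict_mem measurableSet_Ioi] with t (ht : 0 < t)
  rw [Real.norm_of_nonneg (Real.exp_pos _).le]
  refine Real.exp_le_exp.2 ?_
  have : 0 < a / t := by positivity
  rw [neg_div]
  linarith

/-- Substituting `t = √(a/b) e^u` turns the exponent into `-2√(ab) cosh u` and the measure into `e^u
du`; folding `u` with `-u` replaces `e^u` by `2 cosh u`. -/
theorem integral_exp_neg_div {a b : ℝ} (ha : 0 < a) (hb : 0 < b) :
    ∫ t in Set.Ioi 0, Real.exp (-a / t - b * t) = 2 * √(a / b) * besselK 1 (2 * √(a * b)) := by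
  set c := √(a / b) with hc
  set x := 2 * √(a * b) with hx
  have hc0 : 0 < c := Real.sqrt_pos.2 (by positivity)
  have hac : a / c = √(a * b) := by
    rw [div_eq_iff hc0.ne', hc, ← Real.sqrt_mul (by positivity)]
    rw [show a * b * (a / b) = a ^ 2 by field_simp, Real.sqrt_sq ha.le]
  have hbc : b * c = √(a * b) := by
    rw [hc, show a * b = b ^ 2 * (a / b) by field_simp, Real.sqrt_mul (by positivity),
      Real.sqrt_sq hb.le]
  have hexp : ∀ u, Real.exp (-a / (c * Real.exp u) - b * (c * Real.exp u)) =
      Real.exp (-x * Real.cosh u) := fun u => by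
    congr 1
    have : -a / (c * Real.exp u) = -(a / c) * Real.exp (-u) := by
      rw [Real.exp_neg]; field_simp
    rw [this, ← mul_assoc, hac, hbc, Real.cosh_eq, hx]
    ring
  have hder : ∀ u ∈ Set.univ, HasDerivWithinAt (fun u => c * Real.exp u) (c * Real.exp u) Set.univ u :=
    fun u _ => ((Real.hasDerivAt_exp u).const_mul c).hasDerivWithinAt
  have hinj : Set.InjOn (fun u => c * Real.exp u) Set.univ := fun u _ v _ h =>
    Real.exp_injective (mul_left_cancel₀ hc0.ne' h)
  have habs : ∀ u, |c * Real.exp u| = c * Real.exp u := fun u => abs_of_pos (by positivity)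
  have hint := (integrableOn_image_iff_integrableOn_abs_deriv_smul MeasurableSet.univ hder hinj
    (fun t => Real.exp (-a / t - b * t))).1 (by
      rw [image_mul_exp hc0]; exact integrableOn_exp_neg_div ha hb)
  have hval := integral_image_eq_integral_abs_deriv_smul MeasurableSet.univ hder hinj
    (fun t => Real.exp (-a / t - b * t))
  simp only [habs, hexp, smul_eq_mul, Measure.restrict_univ, integrableOn_univ] at hint hval
  rw [image_mul_exp hc0] at hval
  have hneg := hint.comp_neg
  have h1 : ∫ u in Set.Iic (0 : ℝ), c * Real.exp u * Real.exp (-x * Real.cosh u) =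
      ∫ u in Set.Ioi (0 : ℝ), c * Real.exp (-u) * Real.exp (-x * Real.cosh (-u)) := by
    have := integral_comp_neg_Ioi (0 : ℝ) fun u => c * Real.exp u * Real.exp (-x * Real.cosh u)
    rw [neg_zero] at this
    exact this.symm
  rw [hval, ← intervalIntegral.integral_Iic_add_Ioi (b := 0) hint.integrableOn hint.integrableOn, h1,
    ← integral_add hneg.integrableOn hint.integrableOn, besselK, ← integral_const_mul]
  refine integral_congr_ae (.of_forall fun u => ?_)
  dsimp only
  rw [Real.cosh_neg, one_mul, Real.cosh_eq u]
  ring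

theorem integral_gaussWeight {y X : ℝ} (hy : 0 < y) (hX : 0 < X) {p : ℕ} (hp : p ≠ 0) :
    IntegrableOn (fun t => Real.exp (-Real.pi * (p : ℝ) ^ 2 / (t * y) -
      Real.pi * (t / (p : ℝ) ^ 2) * X)) (Set.Ioi 0) ∧
    ∫ t in Set.Ioi 0, Real.exp (-Real.pi * (p : ℝ) ^ 2 / (t * y) -
      Real.pi * (t / (p : ℝ) ^ 2) * X) =
      2 * ((p : ℝ) ^ 2 / (√y * √X)) * besselK 1 (2 * Real.pi * (√y)⁻¹ * √X) := by
  have hp' : (0 : ℝ) < p := by exact_mod_cast hp.bot_lt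
  have hpi := Real.pi_pos
  have h1 : ∀ t, -Real.pi * (p : ℝ) ^ 2 / (t * y) - Real.pi * (t / (p : ℝ) ^ 2) * X =
      -(Real.pi * p ^ 2 / y) / t - (Real.pi * X / p ^ 2) * t := fun t => by
    rw [neg_div (t : ℝ), div_div, mul_comm t y, neg_mul, neg_div]
    ring
  simp only [h1]
  refine ⟨integrableOn_exp_neg_div (by positivity) (by positivity), ?_⟩
  rw [integral_exp_neg_div (by positivity) (by positivity)]
  have h2 : √(Real.pi * p ^ 2 / y / (Real.pi * X / p ^ 2)) = (p : ℝ) ^ 2 / (√y * √X) := by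
    rw [show Real.pi * p ^ 2 / y / (Real.pi * X / p ^ 2) = ((p : ℝ) ^ 2) ^ 2 / (y * X) by field_simp,
      Real.sqrt_div (by positivity), Real.sqrt_sq (by positivity), Real.sqrt_mul hy.le]
  have h3 : √(Real.pi * p ^ 2 / y * (Real.pi * X / p ^ 2)) = Real.pi * ((√y)⁻¹ * √X) := by
    rw [show Real.pi * p ^ 2 / y * (Real.pi * X / p ^ 2) = Real.pi ^ 2 * (y⁻¹ * X) by field_simp,
      Real.sqrt_mul (by positivity), Real.sqrt_sq hpi.le, Real.sqrt_mul (by positivity), Real.sqrt_inv]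
  rw [h2, h3]
  ring_nf

/-- The preceding formula with `a = b = x/2` expresses twice the Bessel function as the integral of
a positive function. -/
theorem besselK_one_pos {x : ℝ} (hx : 0 < x) : 0 < besselK 1 x := by
  have h := integral_exp_neg_div (half_pos hx) (half_pos hx)
  have : NeZero (volume.restrict (Set.Ioi (0 : ℝ))) := ⟨by simp [Measure.restrict_eq_zero]⟩
  have h1 : 0 < ∫ t in Set.Ioi 0, Real.exp (-(x / 2) / t - x / 2 * t) :=
    integral_exp_pos (integrableOn_exp_neg_div (half_pos hx) (half_pos hx))
  rw [div_self (half_pos hx).ne', Real.sqrt_one, Real.sqrt_mul_self (half_pos hx).le, mul_div_cancel₀ _ two_ne_zero] at h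
  rw [h] at h1
  linarith

theorem Gammaℝ_three : Complex.Gammaℝ 3 = 1 / (2 * Real.pi) := by
  have := Complex.Gammaℝ_add_two (s := 1) one_ne_zero
  rw [Complex.Gammaℝ_one, show (1 : ℂ) + 2 = 3 by norm_num] at this
  rw [this, one_mul, div_div]

theorem Gammaℝ_five : Complex.Gammaℝ 5 = 3 / (4 * Real.pi ^ 2) := by
  have := Complex.Gammaℝ_add_two (s := 3) three_ne_zero
  rw [Gammaℝ_three, show (3 : ℂ) + 2 = 5 by norm_num] at this
  rw [this]
  ring

theorem riemannZeta_three : riemannZeta 3 = 2 * Real.pi * completedRiemannZeta 3 := by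
  rw [riemannZeta_def_of_ne_zero three_ne_zero, Gammaℝ_three]
  field_simp

theorem riemannZeta_five : riemannZeta 5 = 4 * Real.pi ^ 2 / 3 * completedRiemannZeta 5 := by
  rw [riemannZeta_def_of_ne_zero (by norm_num), Gammaℝ_five]
  field_simp

section

variable {y : ℝ} {e B : Matrix (Fin 4) (Fin 4) ℝ} (M : Fin 4 → ℤ) {N : Fin 4 → ℤ}

/-- For `M = p a` and `N = p b` the difference of squared charges is `-2 p² a·b`. The phase in the
mode is therefore a character of period one. -/
theorem exists_phase (hB : Bᵀ = -B) (he : e.det ≠ 0) {p : ℕ} (hp : p ≠ 0) (hd : p ∣ gcdModes M N) :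
    ∃ k : ℤ, (pL2 e B M N - pR2 e B M N) / (p : ℝ) ^ 2 = -2 * k := by
  obtain ⟨h1, h2⟩ := (dvd_gcdModes_iff M N p).1 hd
  choose a ha using h1
  choose b hb using h2
  refine ⟨∑ i, a i * b i, ?_⟩
  have hp' : (p : ℝ) ≠ 0 := by exact_mod_cast hp
  rw [pL2_sub_pR2 M N hB he]
  simp only [ha, hb]
  push_cast
  have hs : ∑ i, (p : ℝ) * a i * (p * b i) = (p : ℝ) ^ 2 * ∑ i, (a i : ℝ) * b i := by
    rw [Finset.mul_sum]
    exact Finset.sum_congr rfl fun i _ => by ring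
  rw [div_eq_iff (by positivity), hs]
  ring

theorem divisorMode_eq {p : ℕ} {k : ℤ}
    (hk : (pL2 e B M N - pR2 e B M N) / (p : ℝ) ^ 2 = -2 * k) (τ : ℍ) :
    divisorMode y e B M N p τ = (((√y)⁻¹ * τ.im ^ 2 : ℝ) : ℂ) *
      (gaussWeight y (pL2 e B M N + pR2 e B M N) p τ.im * intPhase k τ.re) := by
  rw [divisorMode, hk, intPhase]
  congr 3
  push_cast
  ring

theorem integral_strip_im_sq (g : ℝ × ℝ → ℂ) (y : ℝ) :
    ∫ τ in strip, (((√y)⁻¹ * τ.im ^ 2 : ℝ) : ℂ) * g (τ.re, τ.im) =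
      (((√y)⁻¹ : ℝ) : ℂ) * ∫ p in Set.Ioc (-(1 / 2)) (1 / 2) ×ˢ Set.Ioi 0, g p := by
  rw [integral_strip_eq fun p => (((√y)⁻¹ * p.2 ^ 2 : ℝ) : ℂ) * g p, ← integral_const_mul]
  refine setIntegral_congr_fun (measurableSet_Ioc.prod measurableSet_Ioi) ?_
  rintro ⟨t1, t2⟩ ⟨-, ht⟩
  have ht0 : (t2 : ℂ) ≠ 0 := by
    have : (0 : ℝ) < t2 := ht
    exact_mod_cast this.ne'
  simp only [Complex.real_smul]
  push_cast
  field_simp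

/-- The integral of a mode. -/
theorem integral_divisorMode (hy : 0 < y) (he : e.det ≠ 0) (hN : N ≠ 0) {p : ℕ} (hp : p ≠ 0) {k : ℤ}
    (hk : (pL2 e B M N - pR2 e B M N) / (p : ℝ) ^ 2 = -2 * k) :
    ∫ τ in strip, divisorMode y e B M N p τ = if k = 0 then
      (((√y)⁻¹ * (2 * ((p : ℝ) ^ 2 / (√y * √(pL2 e B M N + pR2 e B M N))) *
        besselK 1 (2 * Real.pi * (√y)⁻¹ * √(pL2 e B M N + pR2 e B M N))) : ℝ) : ℂ) else 0 := by
  simp only [divisorMode_eq M hk]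
  rw [integral_strip_im_sq fun q => gaussWeight y (pL2 e B M N + pR2 e B M N) p q.2 * intPhase k q.1]
  have h1 := setIntegral_prod_mul (μ := volume) (ν := volume) (fun x => intPhase k x)
    (fun t => gaussWeight y (pL2 e B M N + pR2 e B M N) p t) (Set.Ioc (-(1 / 2)) (1 / 2)) (Set.Ioi 0)
  rw [integral_intPhase] at h1
  simp only [mul_comm (gaussWeight _ _ _ _)]
  rw [Measure.volume_eq_prod, h1]
  split_ifs
  · rw [one_mul]
    simp only [gaussWeight]
    rw [integral_complex_ofReal, (integral_gaussWeight hy (pL2_add_pR2_pos M he hN) hp).2]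
    push_cast
    ring
  · simp

variable {h : Spin55}

/-- At `w = 0` the `SL(2)` series is identically 1. The `τ₁` integral then vanishes unless `p_L² =
p_R²`, and the `τ₂` integral gives the same Bessel function for every divisor, weighted by `p²`,
whence `σ₂`. The constant comes from `ζ(3) = 2π ξ(3)`. -/
theorem fourierMode_three_halves (hy : 0 < y) (hB : Bᵀ = -B) (he : e.det ≠ 0)
    (hh : vecRep h = levi (√y)⁻¹ (so44 e B)) (hN : N ≠ 0) :
    2 * riemannZeta 3 * fourierMode (3 / 2) h M N =
      (if pL2 e B M N = pR2 e B M N then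
        4 * √2 * Real.pi * divisorSum 2 (gcdModes M N) / (y * √(pL2 e B M N)) *
          besselK 1 (2 * Real.pi * (√y)⁻¹ * √(2 * pL2 e B M N))
      else 0 : ℝ) := by
  have h3 : (2 * (3 / 2) : ℂ) = 3 := by norm_num
  have hxi : completedRiemannZeta 3 ≠ 0 := completedRiemannZeta_ne_zero_of_one_lt_re (by norm_num)
  have hsum : ∀ p ∈ (gcdModes M N).divisors, modeNum y e B M N p 0 =
      if pL2 e B M N = pR2 e B M N then
        (((√y)⁻¹ * (2 * ((p : ℝ) ^ 2 / (√y * √(pL2 e B M N + pR2 e B M N))) *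
        besselK 1 (2 * Real.pi * (√y)⁻¹ * √(pL2 e B M N + pR2 e B M N))) : ℝ) : ℂ) else 0 := by
    intro p hp
    have hp0 : p ≠ 0 := (Nat.pos_of_mem_divisors hp).ne'
    have hp' : (p : ℝ) ≠ 0 := by exact_mod_cast hp0
    obtain ⟨k, hk⟩ := exists_phase M hB he hp0 (Nat.dvd_of_mem_divisors hp)
    have hk0 : k = 0 ↔ pL2 e B M N = pR2 e B M N := by
      rw [div_eq_iff (pow_ne_zero 2 hp')] at hk
      rw [← sub_eq_zero (a := pL2 e B M N), hk]
      simp [hp0]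
    simp only [modeNum, eisNum_zero, one_mul]
    rw [integral_divisorMode M hy he hN hp0 hk]
    simp only [hk0]
  rw [fourierMode_eq M hy hB he hh hN exceptional_three_halves, h3, riemannZeta_three, sub_self,
    eisDen_zero]
  simp only [div_one]
  rw [Finset.sum_congr rfl hsum]
  split_ifs with hpp
  · have hX := pL2_add_pR2_pos (B := B) M he hN
    have h2 : pL2 e B M N + pR2 e B M N = 2 * pL2 e B M N := by rw [← hpp]; ring
    rw [h2] at hX ⊢
    have hpL : 0 < pL2 e B M N := by linarith
    have hr : ∀ p : ℕ, (√y)⁻¹ * (2 * ((p : ℝ) ^ 2 / (√y * √(2 * pL2 e B M N))) *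
        besselK 1 (2 * Real.pi * (√y)⁻¹ * √(2 * pL2 e B M N))) =
        (p : ℝ) ^ 2 * (√2 / (y * √(pL2 e B M N)) *
          besselK 1 (2 * Real.pi * (√y)⁻¹ * √(2 * pL2 e B M N))) := fun p => by
      have e1 : √(2 * pL2 e B M N) = √2 * √(pL2 e B M N) := Real.sqrt_mul zero_le_two _
      have e4 : ∀ a b c P Y : ℝ, a ≠ 0 → b ≠ 0 → c ≠ 0 → a * a = Y → b * b = 2 →
          a⁻¹ * (2 * (P / (a * (b * c)))) = P * (b / (Y * c)) := by
        rintro a b c P Y ha hb hc rfl h2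
        rw [← h2]
        field_simp
      rw [← mul_assoc, e1, e4 _ _ _ _ _ (by positivity) (by positivity) (by positivity)
        (Real.mul_self_sqrt hy.le) (Real.mul_self_sqrt zero_le_two)]
      ring
    simp only [hr]
    rw [← Complex.ofReal_sum, ← Finset.sum_mul, divisorSum]
    have hz : ∀ p : ℕ, (p : ℝ) ^ (2 : ℤ) = (p : ℝ) ^ 2 := fun p => by norm_cast
    simp only [hz]
    have e5 : ∀ c : ℂ, 2 * (2 * Real.pi * completedRiemannZeta 3) * ((completedRiemannZeta 3)⁻¹ * c) =
        4 * Real.pi * c := fun c => by field_simp; ring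
    rw [e5]
    push_cast
    ring
  · simp

theorem fourierMode_three_halves_ne_zero_iff (hy : 0 < y) (hB : Bᵀ = -B) (he : e.det ≠ 0)
    (hh : vecRep h = levi (√y)⁻¹ (so44 e B)) (hN : N ≠ 0) :
    fourierMode (3 / 2) h M N ≠ 0 ↔ pL2 e B M N = pR2 e B M N := by
  have hv := fourierMode_three_halves M hy hB he hh hN
  have hz : (2 * riemannZeta 3 : ℂ) ≠ 0 :=
    mul_ne_zero two_ne_zero (riemannZeta_ne_zero_of_one_le_re (by norm_num))
  rw [← mul_ne_zero_iff_left hz, hv]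
  split_ifs with hpp
  · refine ⟨fun _ => hpp, fun _ => ?_⟩
    have hX := pL2_add_pR2_pos (B := B) M he hN
    have hpL : 0 < pL2 e B M N := by linarith
    have hK : 0 < besselK 1 (2 * Real.pi * (√y)⁻¹ * √(2 * pL2 e B M N)) :=
      besselK_one_pos (by have := Real.pi_pos; positivity)
    have hs : 0 < divisorSum 2 (gcdModes M N) := by
      refine Finset.sum_pos (fun d hd => ?_) ⟨1, Nat.one_mem_divisors.2 (gcdModes_ne_zero M hN)⟩
      have : (0 : ℝ) < d := by exact_mod_cast Nat.pos_of_mem_divisors hd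
      positivity
    have hpi := Real.pi_pos
    exact_mod_cast (by positivity : (4 * √2 * Real.pi * divisorSum 2 (gcdModes M N) /
      (y * √(pL2 e B M N)) * besselK 1 (2 * Real.pi * (√y)⁻¹ * √(2 * pL2 e B M N))) ≠ 0)
  · simp [hpp]

end

/-- By the symmetry `u ↦ -u` the factor `e^{u/2}` may be replaced by `cosh (u/2)`, and since `cosh u
= 1 + 2 sinh² (u/2)` the substitution `v = sinh (u/2)` leaves a Gaussian integral. -/
theorem integral_exp_neg_cosh {z : ℝ} (hz : 0 < z) :
    Integrable (fun u => Real.exp (-z * Real.cosh u) * Real.exp (u / 2)) ∧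
    ∫ u, Real.exp (-z * Real.cosh u) * Real.exp (u / 2) =
      2 * Real.exp (-z) * √(Real.pi / (2 * z)) := by
  have hder : ∀ u ∈ Set.univ, HasDerivWithinAt (fun u => Real.sinh (u / 2)) (Real.cosh (u / 2) * (1 / 2))
      Set.univ u := fun u _ => by
    have := (Real.hasDerivAt_sinh (u / 2)).comp u ((hasDerivAt_id u).div_const 2)
    exact this.hasDerivWithinAt
  have hinj : Set.InjOn (fun u : ℝ => Real.sinh (u / 2)) Set.univ := fun u _ v _ h => by
    have := Real.sinh_injective h
    linarith
  have himg : (fun u : ℝ => Real.sinh (u / 2)) '' Set.univ = Set.univ := by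
    rw [Set.image_univ, Set.range_eq_univ]
    intro v
    exact ⟨2 * Real.arsinh v, by simp [Real.sinh_arsinh]⟩
  have hgauss : Integrable fun v : ℝ => 2 * Real.exp (-z) * Real.exp (-(2 * z) * v ^ 2) :=
    (integrable_exp_neg_mul_sq (by positivity)).const_mul _
  have hcosh : ∀ u, |Real.cosh (u / 2) * (1 / 2)| • (2 * Real.exp (-z) *
      Real.exp (-(2 * z) * Real.sinh (u / 2) ^ 2)) = Real.exp (-z * Real.cosh u) * Real.cosh (u / 2) := by
    intro u
    have h1 : Real.cosh u = 1 + 2 * Real.sinh (u / 2) ^ 2 := by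
      have := Real.cosh_two_mul (u / 2)
      rw [mul_div_cancel₀ _ two_ne_zero, Real.cosh_sq] at this
      linarith
    have h2 := Real.cosh_pos (u / 2)
    rw [abs_of_pos (by positivity), h1, smul_eq_mul,
      show -z * (1 + 2 * Real.sinh (u / 2) ^ 2) = -z + -(2 * z) * Real.sinh (u / 2) ^ 2 by ring, Real.exp_add]
    ring
  have hint := (integrableOn_image_iff_integrableOn_abs_deriv_smul MeasurableSet.univ hder hinj
    (fun v => 2 * Real.exp (-z) * Real.exp (-(2 * z) * v ^ 2))).1 (by rw [himg]; exact hgauss.integrableOn)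
  have hval := integral_image_eq_integral_abs_deriv_smul MeasurableSet.univ hder hinj
    (fun v => 2 * Real.exp (-z) * Real.exp (-(2 * z) * v ^ 2))
  simp only [hcosh, himg, Measure.restrict_univ, integrableOn_univ] at hint hval
  have hf : Integrable fun u => Real.exp (-z * Real.cosh u) * Real.exp (u / 2) := by
    refine Integrable.mono' (hint.const_mul 2) (Continuous.aestronglyMeasurable (by fun_prop))
      (.of_forall fun u => ?_)
    rw [Real.norm_of_nonneg (by positivity), Real.cosh_eq (u / 2)]
    have := mul_pos (Real.exp_pos (-z * Real.cosh u)) (Real.exp_pos (-(u / 2)))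
    nlinarith
  refine ⟨hf, ?_⟩
  have h1 : ∫ u, Real.exp (-z * Real.cosh u) * Real.exp (u / 2) =
      ∫ u, Real.exp (-z * Real.cosh u) * Real.exp (-(u / 2)) := by
    have := integral_neg_eq_self (fun u : ℝ => Real.exp (-z * Real.cosh u) * Real.exp (u / 2)) volume
    rw [← this]
    refine integral_congr_ae (.of_forall fun u => ?_)
    simp only [Real.cosh_neg, neg_div]
  have h2 : Integrable fun u => Real.exp (-z * Real.cosh u) * Real.exp (-(u / 2)) := by
    refine hf.comp_neg.congr (.of_forall fun u => ?_)
    simp only [Real.cosh_neg, neg_div]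
  have h3 : ∫ u, Real.exp (-z * Real.cosh u) * Real.cosh (u / 2) =
      ∫ u, Real.exp (-z * Real.cosh u) * Real.exp (u / 2) := by
    have : ∀ u, Real.exp (-z * Real.cosh u) * Real.cosh (u / 2) =
        1 / 2 * (Real.exp (-z * Real.cosh u) * Real.exp (u / 2) +
          Real.exp (-z * Real.cosh u) * Real.exp (-(u / 2))) := fun u => by
      rw [Real.cosh_eq (u / 2)]; ring
    simp only [this]
    rw [integral_const_mul, integral_add hf h2, ← h1]
    ring
  rw [← h3, ← hval, integral_const_mul, integral_gaussian]

/-- The substitution `x = √(a/b) e^u` applies once more. The factor `x^{-1/2}` leaves `e^{u/2}` in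
place of `e^u`, and the integral becomes elementary. -/
theorem integral_rsqrt_mul_exp {a b : ℝ} (ha : 0 < a) (hb : 0 < b) :
    IntegrableOn (fun x => √(1 / x) * Real.exp (-a / x - b * x)) (Set.Ioi 0) ∧
    ∫ x in Set.Ioi 0, √(1 / x) * Real.exp (-a / x - b * x) =
      √(Real.pi / b) * Real.exp (-(2 * √(a * b))) := by
  set c := √(a / b) with hc
  set z := 2 * √(a * b) with hz
  have hc0 : 0 < c := Real.sqrt_pos.2 (by positivity)
  have hab : 0 < √(a * b) := Real.sqrt_pos.2 (by positivity)
  have hz0 : 0 < z := by positivity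
  have hac : a / c = √(a * b) := by
    rw [div_eq_iff hc0.ne', hc, ← Real.sqrt_mul (by positivity)]
    rw [show a * b * (a / b) = a ^ 2 by field_simp, Real.sqrt_sq ha.le]
  have hbc : b * c = √(a * b) := by
    rw [hc, show a * b = b ^ 2 * (a / b) by field_simp, Real.sqrt_mul (by positivity),
      Real.sqrt_sq hb.le]
  have hder : ∀ u ∈ Set.univ, HasDerivWithinAt (fun u => c * Real.exp u) (c * Real.exp u) Set.univ u :=
    fun u _ => ((Real.hasDerivAt_exp u).const_mul c).hasDerivWithinAt
  have hinj : Set.InjOn (fun u => c * Real.exp u) Set.univ := fun u _ v _ h =>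
    Real.exp_injective (mul_left_cancel₀ hc0.ne' h)
  have hform : ∀ u, |c * Real.exp u| • (√(1 / (c * Real.exp u)) *
      Real.exp (-a / (c * Real.exp u) - b * (c * Real.exp u))) =
      √c * (Real.exp (-z * Real.cosh u) * Real.exp (u / 2)) := fun u => by
    have h1 : -a / (c * Real.exp u) - b * (c * Real.exp u) = -z * Real.cosh u := by
      have : -a / (c * Real.exp u) = -(a / c) * Real.exp (-u) := by
        rw [Real.exp_neg]; field_simp
      rw [this, ← mul_assoc, hac, hbc, Real.cosh_eq, hz]
      ring
    have h2 : c * Real.exp u * √(1 / (c * Real.exp u)) = √c * Real.exp (u / 2) := by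
      have h3 : 0 < c * Real.exp u := by positivity
      rw [one_div, Real.sqrt_inv]
      have h4 : √(c * Real.exp u) = √c * Real.exp (u / 2) := by
        rw [Real.sqrt_mul hc0.le, Real.exp_half]
      rw [← h4]
      nth_rewrite 1 [← Real.mul_self_sqrt h3.le]
      field_simp
    rw [h1, abs_of_pos (by positivity), smul_eq_mul, ← mul_assoc, h2]
    ring
  obtain ⟨i1, e1⟩ := integral_exp_neg_cosh hz0
  have hint := integrableOn_image_iff_integrableOn_abs_deriv_smul MeasurableSet.univ hder hinj
    (fun x => √(1 / x) * Real.exp (-a / x - b * x))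
  have hval := integral_image_eq_integral_abs_deriv_smul MeasurableSet.univ hder hinj
    (fun x => √(1 / x) * Real.exp (-a / x - b * x))
  simp only [hform, image_mul_exp hc0, Measure.restrict_univ, integrableOn_univ] at hint hval
  refine ⟨hint.2 (i1.const_mul _), ?_⟩
  rw [hval, integral_const_mul, e1]
  have h5 : √c * (2 * √(Real.pi / (2 * z))) = √(Real.pi / b) := by
    have h6 : (2 : ℝ) = √4 := by rw [show (4 : ℝ) = 2 ^ 2 by norm_num, Real.sqrt_sq zero_le_two]
    nth_rewrite 1 [h6]
    rw [← Real.sqrt_mul (by norm_num), ← Real.sqrt_mul hc0.le]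
    congr 1
    rw [hz, ← hbc]
    field_simp
    norm_num
  rw [← h5]
  ring

/-- The factorizations of `k` are `(u d, u (k/d))` with `u = ±1` and `d` a positive divisor of
`|k|`. The summand sees only `d`, so the two signs give the factor 2. -/
theorem tsum_mul_eq_int {k : ℤ} (hk : k ≠ 0) (f : ℝ → ℂ) :
    HasSum (fun l : ℤ × ℤ => if l.1 * l.2 = k then f |(l.1 : ℝ)| else 0)
      (2 * ∑ d ∈ k.natAbs.divisors, f d) := by
  set φ : ℕ × ℤˣ → ℤ × ℤ := fun p => ((p.2 : ℤ) * p.1, (p.2 : ℤ) * (k / p.1)) with hφ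
  have hinj : Set.InjOn φ (k.natAbs.divisors ×ˢ (Finset.univ : Finset ℤˣ) : Finset (ℕ × ℤˣ)) := by
    rintro ⟨d, u⟩ hd ⟨d', u'⟩ hd' h
    simp only [Finset.coe_product, Set.mem_prod, Finset.mem_coe] at hd hd'
    have h1 : (u : ℤ) * d = u' * d' := (Prod.ext_iff.1 h).1
    have h2 := congrArg Int.natAbs h1
    rw [Int.natAbs_mul, Int.natAbs_mul, Int.units_natAbs, Int.units_natAbs, one_mul, one_mul,
      Int.natAbs_natCast, Int.natAbs_natCast] at h2
    subst h2
    have hd0 : (d : ℤ) ≠ 0 := by exact_mod_cast (Nat.pos_of_mem_divisors hd.1).ne'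
    rw [Units.ext (mul_right_cancel₀ hd0 h1)]
  have hsum : HasSum (fun l : ℤ × ℤ => if l.1 * l.2 = k then f |(l.1 : ℝ)| else 0)
      (∑ l ∈ (k.natAbs.divisors ×ˢ (Finset.univ : Finset ℤˣ)).image φ,
        if l.1 * l.2 = k then f |(l.1 : ℝ)| else 0) := by
    refine hasSum_sum_of_ne_finset_zero fun l hl => if_neg fun h => hl ?_
    have h1 : l.1 ≠ 0 := fun h0 => hk (by rw [← h, h0, zero_mul])
    have hsign : IsUnit l.1.sign := Int.isUnit_iff.2 <| by
      rcases lt_or_gt_of_ne h1 with h0 | h0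
      · exact .inr (Int.sign_eq_neg_one_of_neg h0)
      · exact .inl (Int.sign_eq_one_of_pos h0)
    obtain ⟨u, hu⟩ := hsign
    have h2 : (u : ℤ) * l.1.natAbs = l.1 := by rw [hu, Int.sign_mul_natAbs]
    refine Finset.mem_image.2 ⟨(l.1.natAbs, u), ?_, ?_⟩
    · refine Finset.mem_product.2 ⟨Nat.mem_divisors.2 ⟨?_, Int.natAbs_ne_zero.2 hk⟩, Finset.mem_univ _⟩
      rw [← h, Int.natAbs_mul]
      exact dvd_mul_right _ _
    · refine Prod.ext h2 ?_
      have h3 : k = l.1.natAbs * (u * l.2) := by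
        rw [← h]
        nth_rewrite 1 [← h2]
        ring
      have h4 : (l.1.natAbs : ℤ) ≠ 0 := by simpa using h1
      have h5 : (u : ℤ) * u = 1 := Int.units_coe_mul_self u
      change (u : ℤ) * (k / l.1.natAbs) = l.2
      rw [h3, Int.mul_ediv_cancel_left _ h4, ← mul_assoc, h5, one_mul]
  convert hsum using 1
  rw [Finset.sum_image hinj, Finset.sum_product, Finset.mul_sum]
  refine Finset.sum_congr rfl fun d hd => ?_
  have hterm : ∀ u : ℤˣ, (if (φ (d, u)).1 * (φ (d, u)).2 = k then f |((φ (d, u)).1 : ℝ)| else 0) = f d := by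
    intro u
    have h5 : (u : ℤ) * u = 1 := Int.units_coe_mul_self u
    have hdk : (d : ℤ) ∣ k := Int.natCast_dvd.2 (Nat.dvd_of_mem_divisors hd)
    have h6 : (φ (d, u)).1 * (φ (d, u)).2 = k := by
      change (u : ℤ) * d * (u * (k / d)) = k
      rw [mul_mul_mul_comm, h5, one_mul, Int.mul_ediv_cancel' hdk]
    have h7 : |((φ (d, u)).1 : ℝ)| = d := by
      change |(((u : ℤ) * d : ℤ) : ℝ)| = d
      rw [← Int.cast_abs, abs_mul, Int.abs_eq_natAbs, Int.units_natAbs, Int.abs_eq_natAbs,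
        Int.natAbs_natCast]
      simp
    rw [if_pos h6, h7]
  rw [Finset.sum_congr rfl fun u _ => hterm u, Finset.sum_const, Finset.card_univ, Fintype.card_units_int,
    nsmul_eq_mul]
  norm_num

/-! ### The Fourier modes of the Epstein zeta function at `w = 1` -/

/-- The point `x + i t`. -/
noncomputable def ptIm (t : ℝ) (ht : 0 < t) (x : ℝ) : ℍ := ⟨(x : ℂ) + t * Complex.I, by simpa using ht⟩

theorem ptIm_re {t : ℝ} (ht : 0 < t) (x : ℝ) : (ptIm t ht x).re = x := by
  change ((x : ℂ) + t * Complex.I).re = x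
  simp

theorem ptIm_im {t : ℝ} (ht : 0 < t) (x : ℝ) : (ptIm t ht x).im = t := by
  change ((x : ℂ) + t * Complex.I).im = t
  simp

theorem measurable_ptIm {t : ℝ} (ht : 0 < t) : Measurable (ptIm t ht) := by
  refine Continuous.measurable ?_
  rw [UpperHalfPlane.isEmbedding_coe.continuous_iff]
  change Continuous fun x : ℝ => (x : ℂ) + t * Complex.I
  fun_prop

theorem ptIm_self (τ : ℍ) : ptIm τ.im τ.im_pos τ.re = τ := by
  ext
  exact Complex.ext (by simp [ptIm]) (by simp [ptIm])

theorem summable_exp_pair {t x : ℝ} (ht : 0 < t) (hx : 0 < x) :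
    Summable fun l : ℤ × ℤ => Real.exp (-Real.pi * t * (x * l.1 ^ 2 + l.2 ^ 2 / x)) := by
  have h := summable_exp_neg_epstein (ptIm x hx 0) ht
  refine ((Equiv.prodComm ℤ ℤ).summable_iff.2 h).congr fun l => ?_
  simp only [Function.comp, Equiv.prodComm_apply, epsteinQ_eq, ptIm_re, ptIm_im, Prod.fst_swap,
    Prod.snd_swap, mul_zero, add_zero]
  congr 1
  field_simp
  ring

/-- In the Poisson-transformed theta function the real part of `τ` occurs only in `e^{2πi l₁ l₂ x}`,
so the mode `k` selects the pairs with `l₁ l₂ = k`. -/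
theorem integral_epsteinTheta_mode {k : ℤ} {t x : ℝ} (ht : 0 < t) (hx : 0 < x) :
    IntegrableOn (fun r => (epsteinTheta (ptIm t ht r) x : ℂ) * intPhase k r)
      (Set.Ioc (-(1 / 2)) (1 / 2)) ∧
    ∫ r in Set.Ioc (-(1 / 2)) (1 / 2), (epsteinTheta (ptIm t ht r) x : ℂ) * intPhase k r =
      (√(t / x) : ℝ) * ∑' l : ℤ × ℤ, if l.1 * l.2 = k then
        ((Real.exp (-Real.pi * t * (x * l.1 ^ 2 + l.2 ^ 2 / x)) : ℝ) : ℂ) else 0 := by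
  set E : ℤ × ℤ → ℝ := fun l => Real.exp (-Real.pi * t * (x * l.1 ^ 2 + l.2 ^ 2 / x)) with hE
  have hsE : Summable E := summable_exp_pair ht hx
  have hform : ∀ r, (epsteinTheta (ptIm t ht r) x : ℂ) * intPhase k r =
      (√(t / x) : ℝ) * ∑' l : ℤ × ℤ, (E l : ℂ) * intPhase (k - l.1 * l.2) r := fun r => by
    rw [epsteinTheta_eq_poisson _ hx, ptIm_re, ptIm_im, mul_assoc, ← tsum_mul_right]
    congr 1
    refine tsum_congr fun l => ?_
    rw [Complex.exp_add, ← Complex.ofReal_exp, mul_assoc]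
    congr 1
    rw [intPhase, intPhase, ← Complex.exp_add]
    congr 1
    push_cast
    ring
  have hnorm : ∀ l r, ‖(E l : ℂ) * intPhase (k - l.1 * l.2) r‖ = E l := fun l r => by
    rw [norm_mul, norm_intPhase, mul_one, Complex.norm_real, Real.norm_of_nonneg (Real.exp_pos _).le]
  have hint : ∀ l : ℤ × ℤ, IntegrableOn (fun r => (E l : ℂ) * intPhase (k - l.1 * l.2) r)
      (Set.Ioc (-(1 / 2)) (1 / 2)) := fun l =>
    ((continuous_const.mul (continuous_intPhase _)).integrableOn_Icc).mono_set Set.Ioc_subset_Icc_self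
  have hvol : volume.real (Set.Ioc (-(1 / 2) : ℝ) (1 / 2)) = 1 := by
    rw [Real.volume_real_Ioc]; norm_num
  have hsum := hasSum_integral_of_summable_integral_norm (μ := volume.restrict (Set.Ioc (-(1 / 2)) (1 / 2)))
    hint (by simp only [hnorm, setIntegral_const, hvol, one_smul]; exact hsE)
  have hsn : ∀ r, Summable fun l : ℤ × ℤ => (E l : ℂ) * intPhase (k - l.1 * l.2) r := fun r =>
    .of_norm (by simp only [hnorm]; exact hsE)
  have hbound : ∀ r, ‖∑' l : ℤ × ℤ, (E l : ℂ) * intPhase (k - l.1 * l.2) r‖ ≤ ∑' l, E l := fun r =>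
    tsum_of_norm_bounded hsE.hasSum fun l => (hnorm l r).le
  have hmeas : Measurable fun r => ∑' l : ℤ × ℤ, (E l : ℂ) * intPhase (k - l.1 * l.2) r :=
    measurable_tsum_of_summable
      (fun l => (continuous_const.mul (continuous_intPhase (k - l.1 * l.2))).measurable) hsn
  constructor
  · simp only [hform]
    exact Integrable.const_mul (Integrable.mono' (integrable_const (∑' l, E l))
      hmeas.aestronglyMeasurable (.of_forall hbound)) _
  · simp only [hform]
    rw [integral_const_mul, ← hsum.tsum_eq]
    congr 1
    refine tsum_congr fun l => ?_
    rw [integral_const_mul, integral_intPhase]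
    by_cases h : l.1 * l.2 = k
    · rw [if_pos (by rw [h, sub_self]), if_pos h, mul_one]
    · rw [if_neg fun h0 => h (sub_eq_zero.1 h0).symm, if_neg h, mul_zero]

/-- What the kernel subtracts from the theta function does not depend on `τ` and has no nonzero
mode. The point `x = 1` is excluded because the kernel is set to zero there. -/
theorem integral_epsteinKernel_mode {k : ℤ} (hk : k ≠ 0) {t x : ℝ} (ht : 0 < t) (hx : 0 < x)
    (hx1 : x ≠ 1) :
    ∫ r in Set.Ioc (-(1 / 2)) (1 / 2), epsteinKernel (ptIm t ht r) x * intPhase k r =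
      (√(t / x) : ℝ) * ∑' l : ℤ × ℤ, if l.1 * l.2 = k then
        ((Real.exp (-Real.pi * t * (x * l.1 ^ 2 + l.2 ^ 2 / x)) : ℝ) : ℂ) else 0 := by
  obtain ⟨i1, e1⟩ := integral_epsteinTheta_mode (k := k) ht hx
  have hc : ∃ c : ℂ, ∀ τ, epsteinKernel τ x = epsteinTheta τ x - c := by
    rcases lt_or_gt_of_ne hx1 with h | h
    · exact ⟨(x : ℂ)⁻¹, fun τ => by simp [epsteinKernel, h, hx, h.le]⟩
    · exact ⟨1, fun τ => by simp [epsteinKernel, h, h.le]⟩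
  obtain ⟨c, hc⟩ := hc
  have i2 : IntegrableOn (fun r => c * intPhase k r) (Set.Ioc (-(1 / 2)) (1 / 2)) :=
    ((continuous_const.mul (continuous_intPhase _)).integrableOn_Icc).mono_set Set.Ioc_subset_Icc_self
  simp only [hc, sub_mul]
  rw [integral_sub i1 i2, e1, integral_const_mul, integral_intPhase, if_neg hk, mul_zero, sub_zero]

theorem integral_rsqrt_divisors {k : ℤ} {t : ℝ} (ht : 0 < t) {d : ℝ} (hd : 0 < d)
    {m : ℝ} (hm : 0 < m) (hdm : d * m = |(k : ℝ)|) :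
    IntegrableOn (fun x => √(t / x) * Real.exp (-Real.pi * t * (x * d ^ 2 + m ^ 2 / x))) (Set.Ioi 0) ∧
    ∫ x in Set.Ioi 0, √(t / x) * Real.exp (-Real.pi * t * (x * d ^ 2 + m ^ 2 / x)) =
      d⁻¹ * Real.exp (-(2 * Real.pi * |(k : ℝ)| * t)) := by
  have hpi := Real.pi_pos
  have h : ∀ x, √(t / x) * Real.exp (-Real.pi * t * (x * d ^ 2 + m ^ 2 / x)) =
      √t * (√(1 / x) * Real.exp (-(Real.pi * t * m ^ 2) / x - Real.pi * t * d ^ 2 * x)) := fun x => by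
    rw [← mul_assoc, ← Real.sqrt_mul ht.le, mul_one_div]
    congr 2
    ring
  obtain ⟨i1, e1⟩ := integral_rsqrt_mul_exp (a := Real.pi * t * m ^ 2) (b := Real.pi * t * d ^ 2)
    (by positivity) (by positivity)
  simp only [h]
  refine ⟨i1.const_mul _, ?_⟩
  rw [integral_const_mul, e1, ← mul_assoc, ← Real.sqrt_mul ht.le]
  congr 1
  · rw [show t * (Real.pi / (Real.pi * t * d ^ 2)) = (d⁻¹) ^ 2 by field_simp, Real.sqrt_sq (by positivity)]
  · rw [show Real.pi * t * m ^ 2 * (Real.pi * t * d ^ 2) = (Real.pi * t * (d * m)) ^ 2 by ring,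
      Real.sqrt_sq (by positivity), hdm]
    congr 1
    ring

/-- At `w = 1` the Mellin weight `x^{w-1}` disappears. Each factorization `|k| = d m` then
contributes the elementary integral `d⁻¹ e^{-2π|k|t}`, and summing over divisors and the two signs
gives `2 σ₋₁(|k|)`. -/
theorem integral_epsteinEntire_mode {k : ℤ} (hk : k ≠ 0) {t : ℝ} (ht : 0 < t) :
    ∫ r in Set.Ioc (-(1 / 2)) (1 / 2), epsteinEntire 1 (ptIm t ht r) * intPhase k r =
      ((2 * divisorSum (-1) k.natAbs * Real.exp (-(2 * Real.pi * |(k : ℝ)| * t)) : ℝ) : ℂ) := by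
  set I : Set ℝ := Set.Ioc (-(1 / 2)) (1 / 2) with hI
  have hswap : ∫ r in I, epsteinEntire 1 (ptIm t ht r) * intPhase k r =
      ∫ x in Set.Ioi (0 : ℝ), ∫ r in I, epsteinKernel (ptIm t ht r) x * intPhase k r := by
    have h1 : ∀ τ, epsteinEntire 1 τ = ∫ x in Set.Ioi (0 : ℝ), epsteinKernel τ x := fun τ => by
      rw [epsteinEntire_eq]; simp
    simp only [h1, ← integral_mul_const]
    rw [integral_integral_swap]
    obtain ⟨n, b, hb, hb0, hbd⟩ := exists_norm_cpow_mul_epsteinKernel_le 1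
    have hm : Measurable fun p : ℝ × ℝ => epsteinKernel (ptIm t ht p.1) p.2 * intPhase k p.1 := by
      have h2 := measurable_epsteinKernel.comp (((measurable_ptIm ht).comp measurable_fst).prodMk
        (measurable_snd : Measurable fun p : ℝ × ℝ => p.2))
      exact h2.mul ((continuous_intPhase k).measurable.comp measurable_fst)
    refine Integrable.mono' (g := fun p : ℝ × ℝ => (2 * t + 2 / t) ^ n * b p.2)
      ((integrable_const ((2 * t + 2 / t) ^ n)).mul_prod hb) hm.aestronglyMeasurable ?_
    rw [Measure.prod_restrict]
    filter_upwards [ae_restrict_mem (measurableSet_Ioc.prod measurableSet_Ioi)] with p hp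
    have h3 := hbd (ptIm t ht p.1) 1 p.2 (by simp) hp.2
    simp only [sub_self, Complex.cpow_zero, one_mul] at h3
    simp only [Function.uncurry]
    rw [norm_mul, norm_intPhase, mul_one]
    refine h3.trans (mul_le_mul_of_nonneg_right ?_ (hb0 _ hp.2))
    have h4 : ptIm t ht p.1 ∈ strip := by
      change (ptIm t ht p.1).re ∈ Set.Ioc (-(1 / 2) : ℝ) (1 / 2)
      rw [ptIm_re]; exact hp.1
    have h5 := epsteinMin_inv_le_of_mem_strip h4
    rw [ptIm_im] at h5
    exact pow_le_pow_left₀ (inv_nonneg.2 (epsteinMin_pos _).le) h5 n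
  have hk' : 0 < |(k : ℝ)| := abs_pos.2 (by exact_mod_cast hk)
  have hinner : ∀ᵐ x ∂volume.restrict (Set.Ioi (0 : ℝ)),
      ∫ r in I, epsteinKernel (ptIm t ht r) x * intPhase k r =
      ((2 * ∑ d ∈ k.natAbs.divisors, √(t / x) *
        Real.exp (-Real.pi * t * (x * d ^ 2 + (|(k : ℝ)| / d) ^ 2 / x)) : ℝ) : ℂ) := by
    have hne : ∀ᵐ x ∂volume.restrict (Set.Ioi (0 : ℝ)), x ≠ 1 := by
      refine ae_restrict_of_ae ?_
      simp [ae_iff]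
    filter_upwards [ae_restrict_mem measurableSet_Ioi, hne] with x (hx : 0 < x) hx1
    rw [integral_epsteinKernel_mode hk ht hx hx1]
    have h1 := tsum_mul_eq_int hk fun c =>
      ((Real.exp (-Real.pi * t * (x * c ^ 2 + (|(k : ℝ)| / c) ^ 2 / x)) : ℝ) : ℂ)
    have h2 : ∀ l : ℤ × ℤ, (if l.1 * l.2 = k then
        ((Real.exp (-Real.pi * t * (x * l.1 ^ 2 + l.2 ^ 2 / x)) : ℝ) : ℂ) else 0) =
        if l.1 * l.2 = k then ((Real.exp (-Real.pi * t * (x * |(l.1 : ℝ)| ^ 2 +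
          (|(k : ℝ)| / |(l.1 : ℝ)|) ^ 2 / x)) : ℝ) : ℂ) else 0 := fun l => by
      split_ifs with h
      · have h0 : (l.1 : ℝ) ≠ 0 := fun h0 => hk (by
          rw [← h]; have : l.1 = 0 := by exact_mod_cast h0
          rw [this, zero_mul])
        have h3 : |(k : ℝ)| / |(l.1 : ℝ)| = |(l.2 : ℝ)| := by
          rw [← h, div_eq_iff (abs_pos.2 h0).ne', ← abs_mul]
          push_cast
          rw [mul_comm]
        rw [h3, sq_abs, sq_abs]
      · rfl
    simp only [h2]
    rw [h1.tsum_eq]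
    push_cast
    rw [← mul_assoc, mul_comm ((√(t / x) : ℝ) : ℂ), mul_assoc, Finset.mul_sum]
  rw [hswap, integral_congr_ae hinner, integral_complex_ofReal, integral_const_mul]
  congr 1
  have hterm : ∀ d ∈ k.natAbs.divisors, IntegrableOn (fun x => √(t / x) *
      Real.exp (-Real.pi * t * (x * (d : ℝ) ^ 2 + (|(k : ℝ)| / d) ^ 2 / x))) (Set.Ioi 0) ∧
      ∫ x in Set.Ioi 0, √(t / x) *
      Real.exp (-Real.pi * t * (x * (d : ℝ) ^ 2 + (|(k : ℝ)| / d) ^ 2 / x)) =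
      (d : ℝ)⁻¹ * Real.exp (-(2 * Real.pi * |(k : ℝ)| * t)) := fun d hd => by
    have hd0 : (0 : ℝ) < d := by exact_mod_cast Nat.pos_of_mem_divisors hd
    exact integral_rsqrt_divisors ht hd0 (by positivity) (by field_simp)
  rw [integral_finsetSum _ fun d hd => (hterm d hd).1, Finset.sum_congr rfl fun d hd => (hterm d hd).2,
    ← Finset.sum_mul, divisorSum]
  simp only [zpow_neg_one]
  ring

/-! ### The limit at `s = 5/2` -/

section

variable {y : ℝ} {e B : Matrix (Fin 4) (Fin 4) ℝ} (M : Fin 4 → ℤ) {N : Fin 4 → ℤ}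

theorem exists_epsteinEntire_mul_bound (hy : 0 < y) (he : e.det ≠ 0) (hN : N ≠ 0) {p : ℕ}
    (hp : p ≠ 0) (r : ℝ) : ∃ G : ℍ → ℝ, IntegrableOn G strip ∧ ∀ w, ‖w‖ ≤ r → ∀ τ ∈ strip,
      ‖epsteinEntire w τ * divisorMode y e B M N p τ‖ ≤ G τ := by
  obtain ⟨k, C, hC, hf⟩ := exists_norm_epsteinEntire_le r
  exact exists_strip_bound_pow (B := B) M hy he hN hp hC fun τ w hw => (hf τ w hw).trans
    (mul_le_mul_of_nonneg_left (le_add_of_nonneg_left zero_le_one) hC)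

/-- The integral of the entire part of the Epstein zeta function against a mode. -/
noncomputable def epsteinMode (y : ℝ) (e B : Matrix (Fin 4) (Fin 4) ℝ) (M N : Fin 4 → ℤ) (p : ℕ)
    (w : ℂ) : ℂ := ∫ τ in strip, epsteinEntire w τ * divisorMode y e B M N p τ

theorem integrableOn_epsteinEntire_mul (hy : 0 < y) (he : e.det ≠ 0) (hN : N ≠ 0) {p : ℕ}
    (hp : p ≠ 0) (w : ℂ) :
    IntegrableOn (fun τ => epsteinEntire w τ * divisorMode y e B M N p τ) strip := by
  obtain ⟨G, hG, h⟩ := exists_epsteinEntire_mul_bound (B := B) M hy he hN hp ‖w‖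
  refine Integrable.mono' hG
    ((measurable_epsteinEntire w).mul (measurable_divisorMode M p)).aestronglyMeasurable ?_
  filter_upwards [ae_restrict_mem measurableSet_strip] with τ hτ
  exact h w le_rfl τ hτ

theorem differentiable_epsteinMode (hy : 0 < y) (he : e.det ≠ 0) (hN : N ≠ 0) {p : ℕ}
    (hp : p ≠ 0) : Differentiable ℂ (epsteinMode y e B M N p) := by
  refine differentiable_integral_of_locally_bounded
    (fun w => ((measurable_epsteinEntire w).mul (measurable_divisorMode M p)).aestronglyMeasurable)
    (.of_forall fun τ => (differentiable_epsteinEntire τ).mul_const _) fun r => ?_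
  obtain ⟨G, hG, h⟩ := exists_epsteinEntire_mul_bound (B := B) M hy he hN hp r
  refine ⟨G, hG, ?_⟩
  filter_upwards [ae_restrict_mem measurableSet_strip] with τ hτ w hw
  exact h w hw τ hτ

theorem integrableOn_divisorMode (hy : 0 < y) (he : e.det ≠ 0) (hN : N ≠ 0) {p : ℕ} (hp : p ≠ 0) :
    IntegrableOn (divisorMode y e B M N p) strip := by
  have := integrableOn_eisNum_mul (B := B) M hy he hN hp 0
  simpa only [eisNum_zero, one_mul] using this

/-- The polar terms of the completed Epstein zeta function are constant in `τ` and have no mode with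
`k ≠ 0`. The numerator thus keeps a factor `1 - w`, which will cancel the zero of `eisDen` at `w =
1`. -/
theorem modeNum_eq_epsteinMode (hy : 0 < y) (he : e.det ≠ 0) (hN : N ≠ 0) {p : ℕ} (hp : p ≠ 0)
    {k : ℤ} (hk : (pL2 e B M N - pR2 e B M N) / (p : ℝ) ^ 2 = -2 * k) (hk0 : k ≠ 0) (w : ℂ) :
    modeNum y e B M N p w = (1 - w) * (w * (2 * w - 1)) * epsteinMode y e B M N p w := by
  have h : ∀ τ, eisNum w τ * divisorMode y e B M N p τ =
      (1 - w) * (w * (2 * w - 1)) * (epsteinEntire w τ * divisorMode y e B M N p τ) +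
      (-(1 - w) * (2 * w - 1) - w * (2 * w - 1)) * divisorMode y e B M N p τ := fun τ => by
    rw [eisNum]; ring
  rw [modeNum]
  simp only [h]
  rw [integral_add ((integrableOn_epsteinEntire_mul M hy he hN hp w).const_mul _)
    ((integrableOn_divisorMode M hy he hN hp).const_mul _), integral_const_mul, integral_const_mul,
    integral_divisorMode M hy he hN hp hk, if_neg hk0, mul_zero, add_zero, epsteinMode]

/-- Since `|p_L² - p_R²| = 2 |k| p²`, the exponential `e^{-2π|k|t}` merges with the Gaussian weight
and only replaces `p_L² + p_R²` by `Y`. The remaining integral is the one which defines `K₁`. -/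
theorem epsteinMode_one (hy : 0 < y) (he : e.det ≠ 0) (hN : N ≠ 0) {p : ℕ} (hp : p ≠ 0)
    {k : ℤ} (hk : (pL2 e B M N - pR2 e B M N) / (p : ℝ) ^ 2 = -2 * k) (hk0 : k ≠ 0) {Y : ℝ}
    (hY : Y = pL2 e B M N + pR2 e B M N + |pL2 e B M N - pR2 e B M N|) :
    epsteinMode y e B M N p 1 = ((4 / y * ((p : ℝ) ^ 2 * divisorSum (-1) k.natAbs *
      (besselK 1 (2 * Real.pi * (√y)⁻¹ * √Y) / √Y)) : ℝ) : ℂ) := by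
  have hpi := Real.pi_pos
  have hX := pL2_add_pR2_pos (B := B) M he hN
  set X := pL2 e B M N + pR2 e B M N with hXdef
  have hp' : (0 : ℝ) < p := by exact_mod_cast hp.bot_lt
  have habs : |pL2 e B M N - pR2 e B M N| = 2 * |(k : ℝ)| * p ^ 2 := by
    rw [(div_eq_iff (by positivity)).1 hk, abs_mul, abs_mul, abs_neg, abs_of_pos (zero_lt_two (α := ℝ)),
      abs_of_nonneg (sq_nonneg (p : ℝ))]
  have hY0 : 0 < Y := by rw [hY]; positivity
  -- A point `x + i t` exists only for `t > 0`; the value 0 elsewhere is irrelevant, since all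
  -- integrals run over `t > 0`.
  open Classical in
  set g : ℝ × ℝ → ℂ := fun q => if ht : 0 < q.2 then
    gaussWeight y X p q.2 * (epsteinEntire 1 (ptIm q.2 ht q.1) * intPhase k q.1) else 0 with hg
  have hgτ : ∀ τ : ℍ, epsteinEntire 1 τ * divisorMode y e B M N p τ =
      (((√y)⁻¹ * τ.im ^ 2 : ℝ) : ℂ) * g (τ.re, τ.im) := fun τ => by
    rw [divisorMode_eq M hk, hg]
    dsimp only
    rw [dif_pos τ.im_pos, ptIm_self]
    ring
  have hgi : IntegrableOn g (Set.Ioc (-(1 / 2)) (1 / 2) ×ˢ Set.Ioi 0) := by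
    have h1 := integrableOn_epsteinEntire_mul (B := B) M hy he hN hp 1
    simp only [hgτ] at h1
    have h2 := (integrableOn_strip_iff fun q => (((√y)⁻¹ * q.2 ^ 2 : ℝ) : ℂ) * g q).1 h1
    have hy0 : (√y : ℂ) ≠ 0 := by
      have : √y ≠ 0 := by positivity
      exact_mod_cast this
    refine (integrableOn_congr_fun ?_ (measurableSet_Ioc.prod measurableSet_Ioi)).1
      (h2.const_mul (√y : ℂ))
    rintro ⟨t1, t2⟩ ⟨-, ht⟩
    have ht0 : (t2 : ℂ) ≠ 0 := by
      have : (0 : ℝ) < t2 := ht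
      exact_mod_cast this.ne'
    simp only [Complex.real_smul]
    push_cast
    field_simp
  rw [epsteinMode]
  simp only [hgτ]
  rw [integral_strip_im_sq, Measure.volume_eq_prod, ← Measure.prod_restrict]
  rw [IntegrableOn, Measure.volume_eq_prod, ← Measure.prod_restrict] at hgi
  rw [integral_prod_symm _ hgi]
  have hinner : ∀ᵐ t ∂volume.restrict (Set.Ioi (0 : ℝ)),
      ∫ r in Set.Ioc (-(1 / 2)) (1 / 2), g (r, t) =
        ((2 * divisorSum (-1) k.natAbs * Real.exp (-Real.pi * (p : ℝ) ^ 2 / (t * y) -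
      Real.pi * (t / (p : ℝ) ^ 2) * Y) : ℝ) : ℂ) := by
    filter_upwards [ae_restrict_mem measurableSet_Ioi] with t (ht : 0 < t)
    simp only [hg, dif_pos ht]
    rw [integral_const_mul, integral_epsteinEntire_mode hk0 ht, gaussWeight, ← Complex.ofReal_mul]
    congr 1
    have : Real.exp (-Real.pi * (p : ℝ) ^ 2 / (t * y) - Real.pi * (t / (p : ℝ) ^ 2) * Y) =
        Real.exp (-Real.pi * (p : ℝ) ^ 2 / (t * y) - Real.pi * (t / (p : ℝ) ^ 2) * X) *
          Real.exp (-(2 * Real.pi * |(k : ℝ)| * t)) := by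
      rw [← Real.exp_add, hY, habs]
      congr 1
      field_simp
      ring
    rw [this]
    ring
  rw [integral_congr_ae hinner, integral_complex_ofReal, integral_const_mul,
    (integral_gaussWeight hy hY0 hp).2, ← Complex.ofReal_mul]
  congr 1
  have h2 : √y * √y = y := Real.mul_self_sqrt hy.le
  have h3 : 0 < √y := by positivity
  have h4 : 0 < √Y := by positivity
  nth_rewrite 4 [← h2]
  field_simp
  ring

variable {h : Spin55}

/-- Away from `s = 5/2` the factor `1 - w` cancels between numerator and denominator. The quotient
that remains is continuous at `5/2`, so the limit is its value there. -/
theorem tendsto_fourierMode (hy : 0 < y) (hB : Bᵀ = -B) (he : e.det ≠ 0)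
    (hh : vecRep h = levi (√y)⁻¹ (so44 e B)) (hN : N ≠ 0) (hne : pL2 e B M N ≠ pR2 e B M N) :
    Tendsto (fun s => riemannZeta 5 * fourierMode s h M N) (𝓝[≠] (5 / 2))
        (𝓝 ((16 * Real.pi / y *
          ∑ p ∈ (gcdModes M N).divisors,
            (p : ℝ) ^ 2 * divisorSum (-1) ⌊|pL2 e B M N - pR2 e B M N| / (2 * (p : ℝ) ^ 2)⌋₊ *
              (besselK 1 (2 * Real.pi * (√y)⁻¹ *
                  √(pL2 e B M N + pR2 e B M N + |pL2 e B M N - pR2 e B M N|)) /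
                √(pL2 e B M N + pR2 e B M N + |pL2 e B M N - pR2 e B M N|)) : ℝ) : ℂ)) := by
  set Y := pL2 e B M N + pR2 e B M N + |pL2 e B M N - pR2 e B M N| with hY
  set D := (gcdModes M N).divisors with hD
  have hphase : ∀ p ∈ D, ∃ k : ℤ, (pL2 e B M N - pR2 e B M N) / (p : ℝ) ^ 2 = -2 * k ∧ k ≠ 0 ∧
      ⌊|pL2 e B M N - pR2 e B M N| / (2 * (p : ℝ) ^ 2)⌋₊ = k.natAbs := by
    intro p hp
    have hp0 : p ≠ 0 := (Nat.pos_of_mem_divisors hp).ne'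
    have hp' : (0 : ℝ) < p := by exact_mod_cast hp0.bot_lt
    obtain ⟨k, hk⟩ := exists_phase M hB he hp0 (Nat.dvd_of_mem_divisors hp)
    have hk' := (div_eq_iff (by positivity)).1 hk
    refine ⟨k, hk, fun h0 => hne ?_, ?_⟩
    · rw [h0] at hk'
      simp only [Int.cast_zero, mul_zero, zero_mul] at hk'
      exact sub_eq_zero.1 hk'
    -- The floor in the statement loses nothing: the quotient is the natural number `|k|`.
    · have : |pL2 e B M N - pR2 e B M N| / (2 * (p : ℝ) ^ 2) = (k.natAbs : ℝ) := by
        rw [hk', abs_mul, abs_mul, abs_neg, abs_of_pos (zero_lt_two (α := ℝ)),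
          abs_of_nonneg (sq_nonneg (p : ℝ)), Nat.cast_natAbs, Int.cast_abs]
        field_simp
      rw [this, Nat.floor_natCast]
  set f : ℂ → ℂ := fun s => riemannZeta 5 * ((completedRiemannZeta (2 * s))⁻¹ *
    ∑ p ∈ D, (s - 3 / 2) * (2 * (s - 3 / 2) - 1) / xiEntire (2 * (s - 3 / 2)) *
      epsteinMode y e B M N p (s - 3 / 2)) with hf
  have hev : ∀ᶠ s in 𝓝[≠] (5 / 2 : ℂ), f s = riemannZeta 5 * fourierMode s h M N := by
    have h1 : ∀ᶠ s in 𝓝[≠] (5 / 2 : ℂ), exceptional s ≠ 0 := by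
      have := mem_codiscrete.1 (compl_zeros_mem_codiscrete differentiable_exceptional
        exceptional_three_halves) (5 / 2)
      rw [disjoint_principal_right, compl_compl] at this
      exact this
    filter_upwards [h1, self_mem_nhdsWithin] with s hs (hs1 : s ≠ 5 / 2)
    rw [fourierMode_eq M hy hB he hh hN hs, hf]
    dsimp only
    congr 2
    refine Finset.sum_congr rfl fun p hp => ?_
    obtain ⟨k, hk, hk0, -⟩ := hphase p hp
    rw [modeNum_eq_epsteinMode M hy he hN (Nat.pos_of_mem_divisors hp).ne' hk hk0, eisDen]
    have h2 : 1 - (s - 3 / 2) ≠ 0 := fun h0 => hs1 (by linear_combination -h0)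
    rw [mul_assoc, mul_div_mul_left _ _ h2]
    ring
  refine Tendsto.congr' hev ?_
  have h5 : (2 * (5 / 2) : ℂ) = 5 := by norm_num
  have h1 : (5 / 2 - 3 / 2 : ℂ) = 1 := by norm_num
  have hxi5 : completedRiemannZeta 5 ≠ 0 := completedRiemannZeta_ne_zero_of_one_lt_re (by norm_num)
  have hx2 : xiEntire 2 = Real.pi / 3 := by
    rw [xiEntire_eq two_ne_zero (by norm_num)]
    have h2 := riemannZeta_def_of_ne_zero (two_ne_zero (α := ℂ))
    rw [riemannZeta_two, Complex.Gammaℝ_def] at h2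
    have h3 : (-2 / 2 : ℂ) = -1 := by norm_num
    have hpi : (Real.pi : ℂ) ≠ 0 := by exact_mod_cast Real.pi_ne_zero
    rw [h3, div_self two_ne_zero, Complex.Gamma_one, mul_one, Complex.cpow_neg_one, div_inv_eq_mul] at h2
    have h4 : completedRiemannZeta 2 = Real.pi / 6 := by
      apply mul_right_cancel₀ hpi
      rw [← h2]
      ring
    rw [h4]
    ring
  have hcont : ContinuousAt f (5 / 2) := by
    have c1 : ContinuousAt (fun s : ℂ => completedRiemannZeta (2 * s)) (5 / 2) :=
      ((differentiableAt_completedZeta (by norm_num) (by norm_num)).comp _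
        (differentiableAt_id.const_mul 2)).continuousAt
    have c2 : Continuous fun s : ℂ => xiEntire (2 * (s - 3 / 2)) :=
      differentiable_xiEntire.continuous.comp (by fun_prop)
    refine continuousAt_const.mul ((c1.inv₀ (by rw [h5]; exact hxi5)).mul
      (tendsto_finsetSum _ fun p hp => ContinuousAt.mul (ContinuousAt.div (by fun_prop) c2.continuousAt ?_) ?_))
    · rw [h1, mul_one, hx2]
      have := Real.pi_ne_zero
      exact div_ne_zero (by exact_mod_cast this) three_ne_zero
    · exact ((differentiable_epsteinMode M hy he hN (Nat.pos_of_mem_divisors hp).ne').continuous.comp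
        (continuous_id.sub continuous_const)).continuousAt
  have hval : f (5 / 2) = ((16 * Real.pi / y * ∑ p ∈ D, (p : ℝ) ^ 2 *
      divisorSum (-1) ⌊|pL2 e B M N - pR2 e B M N| / (2 * (p : ℝ) ^ 2)⌋₊ *
      (besselK 1 (2 * Real.pi * (√y)⁻¹ * √Y) / √Y) : ℝ) : ℂ) := by
    have hpi : (Real.pi : ℂ) ≠ 0 := by exact_mod_cast Real.pi_ne_zero
    have hterm : ∀ p ∈ D, epsteinMode y e B M N p 1 = ((4 / y * ((p : ℝ) ^ 2 *
        divisorSum (-1) ⌊|pL2 e B M N - pR2 e B M N| / (2 * (p : ℝ) ^ 2)⌋₊ *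
        (besselK 1 (2 * Real.pi * (√y)⁻¹ * √Y) / √Y)) : ℝ) : ℂ) := fun p hp => by
      obtain ⟨k, hk, hk0, hfl⟩ := hphase p hp
      rw [epsteinMode_one M hy he hN (Nat.pos_of_mem_divisors hp).ne' hk hk0 hY, hfl]
    have hconst : (1 * (2 * 1 - 1) / (Real.pi / 3) : ℂ) = 3 / Real.pi := by field_simp; norm_num
    simp only [hf, h5, h1]
    rw [riemannZeta_five, mul_one, hx2, ← Finset.mul_sum, Finset.sum_congr rfl hterm,
      ← Complex.ofReal_sum, ← Finset.mul_sum]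
    -- The factor `ζ(5)/ξ(5) = 4π²/3` times `w (2w - 1) / xiEntire (2w) = 3/π` at `w = 1` is `4π`;
    -- with the `4/y` of each mode this becomes `16π/y`.
    have h6 : ∀ S : ℂ, 4 * Real.pi ^ 2 / 3 * completedRiemannZeta 5 * ((completedRiemannZeta 5)⁻¹ *
        ((1 * (2 - 1) / (Real.pi / 3)) * S)) = 4 * Real.pi * S := fun S => by
      field_simp
      norm_num
    rw [h6]
    push_cast
    ring
  rw [← hval]
  exact hcont.tendsto.mono_left nhdsWithin_le_nhds

end

end

theorem mainTheorem10 (y : ℝ) (hy : 0 < y) (e B : Matrix (Fin 4) (Fin 4) ℝ) (he : 0 < e.det)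
    (hB : Bᵀ = -B) (h : Spin55) (hh : vecRep h = levi (√y)⁻¹ (so44 e B))
    (M N : Fin 4 → ℤ) (hN : N ≠ 0) :
    -- the series converge absolutely and continue meromorphically to all of `ℂ`
    (∀ q : Fin 4 ⊕ Fin 4 → ℝ,
      (∀ s : ℂ, 5 < s.re → Summable (eisTerm s (unip q * h))) ∧
      IsMeroCont (fun s => ∑' c, eisTerm s (unip q * h) c) 5
        (fun s => eisSpin s (unip q * h))) ∧
    (∀ z : ℂ, 0 < z.im → IsMeroCont (fun s => eisSL2Series s z) 1 (fun s => eisSL2 s z)) ∧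
    -- the general formula, outside a closed discrete set of exceptional `s`
    (∃ S : Set ℂ, Sᶜ ∈ Filter.codiscrete ℂ ∧ (3 / 2 : ℂ) ∉ S ∧ (∀ s : ℂ, 5 < s.re → s ∉ S) ∧
      ∀ s : ℂ, s ∉ S →
        (∀ q : Fin 4 ⊕ Fin 4 → ℝ, AnalyticAt ℂ (fun w => eisSpin w (unip q * h)) s) ∧
        (∀ z : ℂ, 0 < z.im → AnalyticAt ℂ (fun w => eisSL2 w z) (s - 3 / 2)) ∧
        MeasureTheory.IntegrableOn (modeIntegrand s h M N) cube ∧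
        (∀ p ∈ (gcdModes M N).divisors,
          MeasureTheory.IntegrableOn
            (fun τ : ℝ × ℝ => gaussWeight y (pL2 e B M N + pR2 e B M N) p τ.2 *
              sl2Weight (s - 3 / 2) (pL2 e B M N - pR2 e B M N) p τ.2 τ.1)
            (Set.Ioc (-(1 / 2)) (1 / 2) ×ˢ Set.Ioi 0)) ∧
        fourierMode s h M N =
          (completedRiemannZeta (2 * s) * (√y : ℝ))⁻¹ *
            ∑ p ∈ (gcdModes M N).divisors,
              ∫ τ₂ in Set.Ioi (0 : ℝ), gaussWeight y (pL2 e B M N + pR2 e B M N) p τ₂ *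
                ∫ τ₁ in (-(1 / 2) : ℝ)..(1 / 2),
                  sl2Weight (s - 3 / 2) (pL2 e B M N - pR2 e B M N) p τ₂ τ₁) ∧
    -- `s = 3/2`: support exactly on `p_L² = p_R²`, and the value there
    (fourierMode (3 / 2) h M N ≠ 0 ↔ pL2 e B M N = pR2 e B M N) ∧
    2 * riemannZeta 3 * fourierMode (3 / 2) h M N =
      (if pL2 e B M N = pR2 e B M N then
        4 * √2 * Real.pi * divisorSum 2 (gcdModes M N) / (y * √(pL2 e B M N)) *
          besselK 1 (2 * Real.pi * (√y)⁻¹ * √(2 * pL2 e B M N))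
      else 0 : ℝ) ∧
    -- `s = 5/2`: the limit of the modes with `p_L² ≠ p_R²`
    (pL2 e B M N ≠ pR2 e B M N →
      Filter.Tendsto (fun s => riemannZeta 5 * fourierMode s h M N) (nhdsWithin (5 / 2) {5 / 2}ᶜ)
        (nhds ((16 * Real.pi / y *
          ∑ p ∈ (gcdModes M N).divisors,
            (p : ℝ) ^ 2 * divisorSum (-1) ⌊|pL2 e B M N - pR2 e B M N| / (2 * (p : ℝ) ^ 2)⌋₊ *
              (besselK 1 (2 * Real.pi * (√y)⁻¹ *
                  √(pL2 e B M N + pR2 e B M N + |pL2 e B M N - pR2 e B M N|)) /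
                √(pL2 e B M N + pR2 e B M N + |pL2 e B M N - pR2 e B M N|)) : ℝ) : ℂ))) := by
  have he0 : e.det ≠ 0 := he.ne'
  have hq := isMeroCont_eisSpin hy hB he0 hh
  refine ⟨fun q => ⟨fun s hs => (summable_eisTerm (B := B) hy he0 hh q hs).1, (hq q).1⟩,
    fun z hz => (isMeroCont_eisSL2 hz).1,
    -- A single entire function, independent of `q`, of `z` and of the moduli, controls all
    -- denominators, so its zeros can serve as the exceptional set. The point `5/2` is one of them,
    -- because `eisDen` vanishes at 1; this is why the last claim is a limit.
    ⟨{s | exceptional s = 0}, compl_zeros_mem_codiscrete differentiable_exceptional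
      exceptional_three_halves, exceptional_three_halves, fun s hs => exceptional_ne_zero hs,
      fun s hs => ?_⟩,
    fourierMode_three_halves_ne_zero_iff M hy hB he0 hh hN,
    fourierMode_three_halves M hy hB he0 hh hN, tendsto_fourierMode M hy hB he0 hh hN⟩
  have hs' : exceptional s ≠ 0 := hs
  have hsd : eisSpinDen s ≠ 0 := left_ne_zero_of_mul hs'
  have hwd : eisDen (s - 3 / 2) ≠ 0 := right_ne_zero_of_mul hsd
  have hp : ∀ p ∈ (gcdModes M N).divisors, p ≠ 0 := fun p hp => (Nat.pos_of_mem_divisors hp).ne'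
  refine ⟨fun q => ((hq q).2 s hsd).1, fun z hz => ((isMeroCont_eisSL2 hz).2 _ hwd).1, ?_,
    fun p hpd => (integral_sl2Weight M hy he0 hN (hp p hpd) hwd).1, ?_⟩
  · exact MeasureTheory.IntegrableOn.congr_fun ((integrableOn_eisSpinNum_mul M hy he0 N s).const_mul (eisSpinDen s)⁻¹)
      (fun q _ => (modeIntegrand_eq_div M hy hB he0 hh N hsd q).symm) measurableSet_Icc
  · rw [fourierMode_eq M hy hB he0 hh hN hs', mul_inv, mul_assoc, Finset.mul_sum _ _ (((√y : ℝ) : ℂ)⁻¹)]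
    congr 1
    refine Finset.sum_congr rfl fun p hpd => ?_
    rw [← (integral_sl2Weight M hy he0 hN (hp p hpd) hwd).2, Complex.ofReal_inv]
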